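/- Let $\rho\ge 0$, $r\ge 0$ with $\frac{\rho}{2}+r\ge 1$, and let $L$ and $B$ be the pseudodifferential operators on $\mathbb{R}$ with symbols $l(\xi)$ and $b(\xi)$, i.e. $\widehat{Lv}=l\,\widehat v$ and $\widehat{Bv}=b\,\widehat v$, where $l,b:\mathbb{R}\to\mathbb{R}$ are measurable and even and, for some constants $c_1,c_2,c_3>0$ and all $\xi\in\mathbb{R}$, $$c_1^2(1+\xi^2)^{\rho/2}\le l(\xi)\le c_2^2(1+\xi^2)^{\rho/2},\qquad 0<b(\xi)\le c_3^2(1+\xi^2)^{-r/2}.$$ Write $K=L^{1/2}$ (symbol $\sqrt{l(\xi)}$), $B^{-1/2}$ (symbol $b(\xi)^{-1/2}$) and $\Lambda^{-1}$ (symbol $|\xi|^{-1}$). Let $s>\frac12$, $g\in C^{[s]+1}(\mathbb{R})$ real-valued, $G(p)=\int_0^p g(q)\,dq$, and let $\varphi\in H^s(\mathbb{R})$ be real-valued and $\psi\in H^{s-1-\rho/2}(\mathbb{R})$. Consider the Cauchy problem $$u_{tt}-Lu_{xx}=B(g(u))_{xx},\quad x\in\mathbb{R},\ t>0,\qquad u(x,0)=\varphi(x),\quad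 u_t(x,0)=\psi(x).$$ A solution on $[0,T)$, $0<T\le\infty$, is a real-valued $u\in C([0,T),H^s)\cap C^1([0,T),H^{s-1-\rho/2})$ with these initial data that satisfies the equation in the sense of tempered distributions in $x$ for each $t\in[0,T)$. It is maximal if it does not extend to a solution on $[0,T')$ for any $T'>T$. Assume that $B^{-1/2}K\varphi$, $B^{-1/2}\Lambda^{-1}\psi$ and $B^{-1/2}\Lambda^{-1}\varphi$ belong to $L^2(\mathbb{R})$ and $G(\varphi)\in L^1(\mathbb{R})$. Suppose that there is some $\nu>0$ such that $$p\,g(p)\le 2(1+2\nu)\,G(p)\quad\text{for all }p\in\mathbb{R},$$ and that $$E(0)=\|B^{-1/2}\Lambda^{-1}\psi\|_{L^2}^2+\|B^{-1/2}K\varphi\|_{L^2}^2+2\int_{\mathbb{R}}G(\varphi(x))\,dx<0.$$ Then the solution of the Cauchy problem blows up in finite time: if $u$ is a maximal solution, defined on $[0,T_{\max})$, then $T_{\max}<\infty$ and $$\limsup_{t\to T_{\max}^-}\left(\|u(t)\|_{H^s}+\|u_t(t)\|_{H^{s-1-\rho/2}}\right)=\infty.$$ -/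

import Mathlib

open MeasureTheory Filter Topology TemperedDistribution
open scoped SchwartzMap FourierTransform ENNReal

noncomputable section

namespace BEquation

/-- Real `L²(ℝ)`. -/
abbrev L2 : Type := Lp ℝ 2 (volume : Measure ℝ)

/-- Complex `L²(ℝ)`. -/
abbrev L2C : Type := Lp ℂ 2 (volume : Measure ℝ)

/-- A real `L²` function, viewed as a tempered distribution. -/
def toDist (f : L2) : 𝓢'(ℝ, ℂ) :=
  ((Complex.ofRealCLM.compLp f : L2C) : 𝓢'(ℝ, ℂ))

/-- The tempered distribution `S` is (integration against) the function `f`. -/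
def IsFunction (S : 𝓢'(ℝ, ℂ)) (f : ℝ → ℂ) : Prop :=
  AEStronglyMeasurable f volume ∧
    ∀ w : 𝓢(ℝ, ℂ), Integrable (fun ξ => w ξ * f ξ) volume ∧ S w = ∫ ξ, w ξ * f ξ

/-- `S = m(D) R`, where `m(D)` is the pseudodifferential operator with symbol `m`:
the Fourier transform of `R` is a function, and multiplying it by the symbol gives the Fourier
transform of `S`. The symbol is a function of the angular frequency (so that `d/dx` has symbol
`i ξ`); Mathlib's Fourier transform has kernel `exp (-2 π i x ξ)`, hence the factor `2 π`. -/
def IsMultiplierImage (m : ℝ → ℝ) (R S : 𝓢'(ℝ, ℂ)) : Prop :=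
  ∃ f : ℝ → ℂ, IsFunction (𝓕 R) f ∧
    IsFunction (𝓕 S) (fun ξ => (m (2 * Real.pi * ξ) : ℂ) * f ξ)

/-- The symbol of `B^{-1/2} K`, where `K = L^{1/2}`. -/
def symbolBK (l b : ℝ → ℝ) (ξ : ℝ) : ℝ := (√(b ξ))⁻¹ * √(l ξ)

/-- The symbol of `B^{-1/2} Λ^{-1}`, where `Λ^{-1}` has symbol `|ξ|⁻¹`. -/
def symbolBΛ (b : ℝ → ℝ) (ξ : ℝ) : ℝ := (√(b ξ))⁻¹ * |ξ|⁻¹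

/-- The primitive `G(p) = ∫₀ᵖ g`. -/
def primitive (g : ℝ → ℝ) (p : ℝ) : ℝ := ∫ q in (0 : ℝ)..p, g q

/-- The norm of the Sobolev space `H^σ(ℝ)`, equal to `∞` outside `H^σ(ℝ)`. There is at most one
`W` with `besselPotential ℝ ℂ σ S = W`. -/
def sobolevNorm (σ : ℝ) (S : 𝓢'(ℝ, ℂ)) : ℝ≥0∞ :=
  ⨅ (W : L2C) (_ : besselPotential ℝ ℂ σ S = (W : 𝓢'(ℝ, ℂ))), ‖W‖ₑ

/-- `w ∈ C(I, H^σ)`. -/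
def ContinuousInSobolev (σ : ℝ) (I : Set ℝ) (w : ℝ → 𝓢'(ℝ, ℂ)) : Prop :=
  ∃ W : ℝ → L2C, ContinuousOn W I ∧
    ∀ t ∈ I, besselPotential ℝ ℂ σ (w t) = (W t : 𝓢'(ℝ, ℂ))

/-- `w` is differentiable on `I` as a function with values in `H^σ`, with derivative `w'`. -/
def HasDerivInSobolev (σ : ℝ) (I : Set ℝ) (w w' : ℝ → 𝓢'(ℝ, ℂ)) : Prop :=
  ∃ W W' : ℝ → L2C, ∀ t ∈ I,
    besselPotential ℝ ℂ σ (w t) = (W t : 𝓢'(ℝ, ℂ)) ∧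
    besselPotential ℝ ℂ σ (w' t) = (W' t : 𝓢'(ℝ, ℂ)) ∧
    HasDerivWithinAt W (W' t) I t

/-- The time interval `[0, T)`, where `T = ⊤` is allowed. -/
def timeInterval (T : EReal) : Set ℝ := {t | 0 ≤ t ∧ (t : EReal) < T}

/-- The equation `u_tt = (L u)_xx + (B (g (u)))_xx` at time `t`, as an identity of tempered
distributions in `x`. Here `v` stands for `u_t`, and the time derivative is taken within `I`. -/
def EquationAt (l b g : ℝ → ℝ) (I : Set ℝ) (u : ℝ → L2) (v : ℝ → 𝓢'(ℝ, ℂ)) (t : ℝ) : Prop :=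
  ∃ (N : L2) (Lu BN : 𝓢'(ℝ, ℂ)),
    (∀ᵐ x ∂(volume : Measure ℝ), N x = g (u t x)) ∧
    IsMultiplierImage l (toDist (u t)) Lu ∧
    IsMultiplierImage b (toDist N) BN ∧
    ∀ w : 𝓢(ℝ, ℂ), HasDerivWithinAt (fun τ => v τ w)
      ((derivCLM ℂ (derivCLM ℂ Lu) + derivCLM ℂ (derivCLM ℂ BN)) w) I t

/-- `u` is a real-valued solution in `C([0,T), H^s) ∩ C¹([0,T), H^{s-1-ρ/2})` of the Cauchy problem
`u_tt - L u_xx = B(g(u))_xx`, `u(0) = φ`, `u_t(0) = ψ`, and `v = u_t` on `[0,T)`. -/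
structure IsSolution (l b g : ℝ → ℝ) (ρ s : ℝ) (φ : L2) (ψ : 𝓢'(ℝ, ℂ)) (T : EReal)
    (u : ℝ → L2) (v : ℝ → 𝓢'(ℝ, ℂ)) : Prop where
  pos : 0 < T
  continuous_u : ContinuousInSobolev s (timeInterval T) (fun t => toDist (u t))
  deriv_u : HasDerivInSobolev (s - 1 - ρ / 2) (timeInterval T) (fun t => toDist (u t)) v
  continuous_v : ContinuousInSobolev (s - 1 - ρ / 2) (timeInterval T) v
  equation : ∀ t ∈ timeInterval T, EquationAt l b g (timeInterval T) u v t
  initial_u : u 0 = φ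
  initial_v : v 0 = ψ

/-- A solution on `[0,T)` that is not the restriction of a solution on a longer interval. -/
def IsMaximalSolution (l b g : ℝ → ℝ) (ρ s : ℝ) (φ : L2) (ψ : 𝓢'(ℝ, ℂ)) (T : EReal)
    (u : ℝ → L2) (v : ℝ → 𝓢'(ℝ, ℂ)) : Prop :=
  IsSolution l b g ρ s φ ψ T u v ∧
    ∀ (T' : EReal) (u' : ℝ → L2) (v' : ℝ → 𝓢'(ℝ, ℂ)), T < T' →
      IsSolution l b g ρ s φ ψ T' u' v' → ¬ ∀ t ∈ timeInterval T, u' t = u t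

end BEquation

end

/-!
The argument has two halves: a solution that does not extend must become unbounded in `H^s` if its
existence time is finite, and the existence time cannot be infinite if the energy is negative.

*Blow-up alternative.* On the Fourier side a solution `u` in the sense of distributions is a pair of
curves in weighted `L²` spaces that satisfies an ordinary differential equation frequency by
frequency (`IsFourierSolution`), and equivalently a solution of Duhamel's formula (`IsMild`), built
from the bounded propagators `cos (tω)` and `sin (tω) / ω` with `ω = |ξ| l(ξ)^{1/2}`. The forcing
`sin (tω) ω⁻¹ ξ² b` has order `1 - r - ρ/2 ≤ 0`, so no derivatives are lost. For `s > 1/2` the map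
`u ↦ g(u)` sends bounded subsets of `H^s` to bounded subsets of `H^s` (`exists_hsq_nem_le`) and is
Lipschitz on them in `L²`. Banach's fixed point theorem, on a ball of `H^s` with the metric of `L²`,
solves Duhamel's formula on a short time interval (`exists_local_mild`). If a solution stays bounded
in `H^s` up to a finite time `T`, the integrals in Duhamel's formula converge at `T` and it can be
restarted there, so the solution extends beyond `T` (`IsSolution.exists_extension`); along a maximal
solution the norm is therefore unbounded (`IsMaximalSolution.limsup_eq_top`). The bound on `g(u)` in
`H^s` is proved by differences (the Gagliardo seminorm) for `s ≤ 1`, and by the chain rule and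
induction for larger `s`.

*No global solutions.* Initial data with `B^{-1/2} K φ` and `B^{-1/2} Λ⁻¹ ψ` in `L²` belong to a
space that need not contain `H^s`. That the regularity persists is seen from finite differences
in `x`: the propagators commute with them, `g` is Lipschitz on the range of `u`, and Grönwall's
inequality bounds each difference of `u(t)` by the same difference of the data
(`IsMild.exists_norm_dsRoot_le`). Hence `B^{1/2} Λ g(u)` stays in `L²`
(`IsMild.exists_wsq_be_nem_le`), and the transforms `P`, `Y`, `D` of `B^{-1/2} Λ⁻¹ u`,
`B^{-1/2} K u`, `B^{-1/2} Λ⁻¹ u_t` are curves in `L²` (`IsEnergyCurve`) with `P' = D`, `Y' = ω D` and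
`D' = -ω Y - B^{1/2} Λ g(u)`; the last two hold after a cutoff to bounded frequencies, which is
removed in the limit. They give the conservation of
`‖Y‖² + ‖D‖² + 2 ∫ G(u)` (`IsEnergyCurve.energy_eq`) and the virial identity
`⟪P, D⟫' = ‖D‖² - ‖Y‖² - ∫ u g(u)` (`IsEnergyCurve.hasDerivWithinAt_inner`). With
`p g(p) ≤ 2 (1 + 2 ν) G(p)` and negative energy, `y = ‖P‖²` satisfies
`y y'' ≥ (1 + ν) y'² + c y` for some `c > 0`, and Levine's concavity argument (`false_of_concavity`)
shows that no such function exists on `[0, ∞)`.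

The hypothesis on `g` also yields `g(0) = 0` (`eq_zero_of_le_primitive`), without which `g(u)` would
not be square integrable.
-/

noncomputable section

namespace BEquation

/-- The complexification of a real `L²` function, as a continuous real-linear map. -/
def cplx : L2 →L[ℝ] L2C := Complex.ofRealCLM.compLpL 2 volume

/-- The pointwise real part, as a continuous real-linear map. -/
def rePart : L2C →L[ℝ] L2 := Complex.reCLM.compLpL 2 volume

theorem cplx_ae (f : L2) : cplx f =ᵐ[volume] fun x => (f x : ℂ) :=
  ContinuousLinearMap.coeFn_compLp Complex.ofRealCLM f

theorem rePart_ae (f : L2C) : rePart f =ᵐ[volume] fun x => (f x).re :=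
  ContinuousLinearMap.coeFn_compLp Complex.reCLM f

theorem norm_cplx (f : L2) : ‖cplx f‖ = ‖f‖ := by
  apply le_antisymm
  · rw [← one_mul ‖f‖]
    apply Lp.norm_le_mul_norm_of_ae_le_mul
    filter_upwards [cplx_ae f] with x hx
    simp [hx]
  · rw [← one_mul ‖cplx f‖]
    apply Lp.norm_le_mul_norm_of_ae_le_mul
    filter_upwards [cplx_ae f] with x hx
    simp [hx]

theorem norm_rePart_le (f : L2C) : ‖rePart f‖ ≤ ‖f‖ := by
  rw [← one_mul ‖f‖]
  apply Lp.norm_le_mul_norm_of_ae_le_mul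
  filter_upwards [rePart_ae f] with x hx
  simpa [hx] using Complex.abs_re_le_norm (f x)

theorem rePart_cplx (f : L2) : rePart (cplx f) = f := by
  apply Lp.ext
  filter_upwards [rePart_ae (cplx f), cplx_ae f] with x h1 h2
  simp [h1, h2]

/-! ### Tempered distributions given by functions -/

theorem IsFunction.locallyIntegrable {S : 𝓢'(ℝ, ℂ)} {f : ℝ → ℂ} (h : IsFunction S f) :
    LocallyIntegrable f volume := by
  rw [locallyIntegrable_iff]
  intro k hk
  obtain ⟨R, hR⟩ := hk.isBounded.subset_closedBall (0 : ℝ)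
  let c : ContDiffBump (0 : ℝ) := ⟨max R 1, max R 1 + 1, by positivity, by linarith⟩
  have hc1 : HasCompactSupport (Complex.ofRealCLM ∘ c) := c.hasCompactSupport.comp_left rfl
  have hc2 : ContDiff ℝ ((⊤ : ℕ∞) : WithTop ℕ∞) (Complex.ofRealCLM ∘ c) := by
    have := c.contDiff (n := ((⊤ : ℕ∞)))
    fun_prop
  have hi := (h.2 (hc1.toSchwartzMap hc2)).1
  refine IntegrableOn.congr_fun (hi.integrableOn (s := k)) ?_ hk.measurableSet
  intro x hx
  have : c x = 1 := c.one_of_mem_closedBall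
    (Metric.closedBall_subset_closedBall (le_max_left _ _) (hR hx))
  simp [this]

theorem IsFunction.ae_eq {S : 𝓢'(ℝ, ℂ)} {f f' : ℝ → ℂ} (h : IsFunction S f)
    (h' : IsFunction S f') : f =ᵐ[volume] f' := by
  apply ae_eq_of_integral_contDiff_smul_eq h.locallyIntegrable h'.locallyIntegrable
  intro g hg hgc
  have hc1 : HasCompactSupport (Complex.ofRealCLM ∘ g) := hgc.comp_left rfl
  have hc2 : ContDiff ℝ ((⊤ : ℕ∞) : WithTop ℕ∞) (Complex.ofRealCLM ∘ g) := by fun_prop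
  have h1 := (h.2 (hc1.toSchwartzMap hc2)).2
  have h2 := (h'.2 (hc1.toSchwartzMap hc2)).2
  simpa using h1.symm.trans h2

theorem IsFunction.congr {S : 𝓢'(ℝ, ℂ)} {f f' : ℝ → ℂ} (h : IsFunction S f)
    (hf : f =ᵐ[volume] f') : IsFunction S f' := by
  refine ⟨h.1.congr hf, fun w => ?_⟩
  have : (fun ξ => w ξ * f ξ) =ᵐ[volume] fun ξ => w ξ * f' ξ := by
    filter_upwards [hf] with x hx
    rw [hx]
  exact ⟨(h.2 w).1.congr this, by rw [(h.2 w).2, integral_congr_ae this]⟩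

theorem IsFunction.dist_eq {S S' : 𝓢'(ℝ, ℂ)} {f : ℝ → ℂ} (h : IsFunction S f)
    (h' : IsFunction S' f) : S = S' := by
  ext w
  rw [(h.2 w).2, (h'.2 w).2]

theorem isFunction_coe (F : L2C) : IsFunction (F : 𝓢'(ℝ, ℂ)) F := by
  refine ⟨Lp.aestronglyMeasurable F, fun w => ⟨?_, ?_⟩⟩
  · exact ((w.memLp 2 volume).integrable_mul (Lp.memLp F))
  · simp [Lp.toTemperedDistribution_apply]

theorem isFunction_fourier_coe (f : L2C) : IsFunction (𝓕 (f : 𝓢'(ℝ, ℂ))) (𝓕 f : L2C) := by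
  rw [Lp.fourier_toTemperedDistribution_eq]
  exact isFunction_coe _

theorem coe_injective {F F' : L2C} (h : (F : 𝓢'(ℝ, ℂ)) = (F' : 𝓢'(ℝ, ℂ))) : F = F' := by
  have h1 := isFunction_coe F
  rw [h] at h1
  exact Lp.ext (h1.ae_eq (isFunction_coe F'))

theorem IsFunction.smulLeft {S : 𝓢'(ℝ, ℂ)} {f : ℝ → ℂ} (h : IsFunction S f) {m : ℝ → ℂ}
    (hm : m.HasTemperateGrowth) : IsFunction (smulLeftCLM ℂ m S) (fun ξ => m ξ * f ξ) := by
  refine ⟨hm.1.continuous.aestronglyMeasurable.mul h.1, fun w => ?_⟩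
  have key := h.2 (SchwartzMap.smulLeftCLM ℂ m w)
  have : (fun ξ => (SchwartzMap.smulLeftCLM ℂ m w) ξ * f ξ) = fun ξ => w ξ * (m ξ * f ξ) := by
    ext ξ
    rw [SchwartzMap.smulLeftCLM_apply_apply hm]
    simp only [smul_eq_mul]
    ring
  rw [this] at key
  exact ⟨key.1, by rw [smulLeftCLM_apply_apply, key.2]⟩

/-- The weight `(1 + ξ²)^{σ/2}` defining `H^σ`. -/
def wt (σ ξ : ℝ) : ℝ := (1 + ξ ^ 2) ^ (σ / 2)

theorem wt_pos (σ ξ : ℝ) : 0 < wt σ ξ := by unfold wt; positivity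

theorem wt_add (σ τ ξ : ℝ) : wt (σ + τ) ξ = wt σ ξ * wt τ ξ := by
  unfold wt
  rw [← Real.rpow_add (by positivity)]
  ring_nf

theorem wt_neg (σ ξ : ℝ) : wt (-σ) ξ = (wt σ ξ)⁻¹ := by
  unfold wt
  rw [← Real.rpow_neg (by positivity)]
  ring_nf

theorem wt_zero (ξ : ℝ) : wt 0 ξ = 1 := by simp [wt]

theorem wt_two (ξ : ℝ) : wt 2 ξ = 1 + ξ ^ 2 := by simp [wt]

theorem wt_mono {σ τ : ℝ} (h : σ ≤ τ) (ξ : ℝ) : wt σ ξ ≤ wt τ ξ := by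
  unfold wt
  exact Real.rpow_le_rpow_of_exponent_le (by nlinarith [sq_nonneg ξ]) (by linarith)

theorem one_le_wt {σ : ℝ} (h : 0 ≤ σ) (ξ : ℝ) : 1 ≤ wt σ ξ := by
  simpa [wt_zero] using wt_mono h ξ

theorem wt_le_one {σ : ℝ} (h : σ ≤ 0) (ξ : ℝ) : wt σ ξ ≤ 1 := by
  simpa [wt_zero] using wt_mono h ξ

theorem wt_even (σ ξ : ℝ) : wt σ (-ξ) = wt σ ξ := by simp [wt]

theorem continuous_wt (σ : ℝ) : Continuous (wt σ) := by
  unfold wt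
  refine Continuous.rpow_const (by fun_prop) fun ξ => Or.inl (by positivity)

theorem wt_hasTemperateGrowth (σ : ℝ) :
    (fun ξ : ℝ => ((wt σ ξ : ℝ) : ℂ)).HasTemperateGrowth := by
  have : (fun ξ : ℝ => (((1 + ‖ξ‖ ^ 2) ^ (σ / 2) : ℝ) : ℂ)).HasTemperateGrowth := by fun_prop
  simpa [wt] using this

theorem isFunction_fourier_bessel {S : 𝓢'(ℝ, ℂ)} {f : ℝ → ℂ} (h : IsFunction (𝓕 S) f) (σ : ℝ) :
    IsFunction (𝓕 (besselPotential ℝ ℂ σ S)) (fun ξ => (wt σ ξ : ℂ) * f ξ) := by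
  rw [fourier_besselPotential_eq_smulLeftCLM_fourier_apply]
  simpa [wt] using h.smulLeft (wt_hasTemperateGrowth σ)

theorem fourier_dist_injective {S S' : 𝓢'(ℝ, ℂ)} (h : 𝓕 S = 𝓕 S') : S = S' := by
  have := congrArg (fun R : 𝓢'(ℝ, ℂ) => 𝓕⁻ R) h
  simpa using this

theorem bessel_eq_iff {S : 𝓢'(ℝ, ℂ)} {W : L2C} (σ : ℝ) :
    besselPotential ℝ ℂ σ S = (W : 𝓢'(ℝ, ℂ)) ↔
      IsFunction (𝓕 S) (fun ξ => (wt (-σ) ξ : ℂ) * (𝓕 W : L2C) ξ) := by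
  constructor
  · intro h
    have h1 := isFunction_fourier_bessel (isFunction_fourier_coe W) (-σ)
    rw [← h, besselPotential_besselPotential_apply] at h1
    simpa using h1
  · intro h
    apply fourier_dist_injective
    have h1 := isFunction_fourier_bessel h σ
    refine h1.dist_eq ((isFunction_fourier_coe W).congr (Filter.Eventually.of_forall fun ξ => ?_))
    simp only
    rw [← mul_assoc, ← Complex.ofReal_mul, ← wt_add]
    simp [wt_zero]

/-! ### Multiplication operators on `L²` -/

/-- A measurable bounded real symbol. -/
def IsBdd (m : ℝ → ℝ) : Prop := Measurable m ∧ ∃ C, ∀ ξ, |m ξ| ≤ C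

theorem IsBdd.memLp {m : ℝ → ℝ} (h : IsBdd m) (F : L2C) :
    MemLp (fun ξ => (m ξ : ℂ) * F ξ) 2 volume := by
  obtain ⟨C, hC⟩ := h.2
  refine (Lp.memLp F).of_le_mul (c := C)
    ((Complex.measurable_ofReal.comp h.1).aestronglyMeasurable.mul (Lp.aestronglyMeasurable F)) ?_
  filter_upwards with ξ
  rw [norm_mul, Complex.norm_real, Real.norm_eq_abs]
  gcongr
  exact hC ξ

open Classical in
/-- Multiplication by a bounded measurable real symbol on complex `L²` (zero for other symbols). -/
def mulOp (m : ℝ → ℝ) : L2C →L[ℝ] L2C :=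
  if h : IsBdd m then
    LinearMap.mkContinuous
      { toFun := fun F => (h.memLp F).toLp _
        map_add' := fun F G => by
          apply Lp.ext
          filter_upwards [(h.memLp (F + G)).coeFn_toLp, (h.memLp F).coeFn_toLp,
            (h.memLp G).coeFn_toLp, Lp.coeFn_add F G,
            Lp.coeFn_add ((h.memLp F).toLp _) ((h.memLp G).toLp _)] with x h1 h2 h3 h4 h5
          simp only [h1, h5, Pi.add_apply, h2, h3, h4]
          ring
        map_smul' := fun c F => by
          apply Lp.ext
          filter_upwards [(h.memLp (c • F)).coeFn_toLp, (h.memLp F).coeFn_toLp,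
            Lp.coeFn_smul c F, Lp.coeFn_smul c ((h.memLp F).toLp _)] with x h1 h2 h3 h4
          simp only [RingHom.id_apply]
          rw [h1, h4, Pi.smul_apply, h2, h3, Pi.smul_apply]
          simp only [Complex.real_smul]
          ring } h.2.choose (fun F => by
      apply Lp.norm_le_mul_norm_of_ae_le_mul
      filter_upwards [(h.memLp F).coeFn_toLp] with x h1
      simp only [LinearMap.coe_mk, AddHom.coe_mk]
      rw [h1, norm_mul, Complex.norm_real, Real.norm_eq_abs]
      gcongr
      exact h.2.choose_spec x)
  else 0

theorem mulOp_ae {m : ℝ → ℝ} (h : IsBdd m) (F : L2C) :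
    mulOp m F =ᵐ[volume] fun ξ => (m ξ : ℂ) * F ξ := by
  rw [mulOp, dif_pos h]
  exact (h.memLp F).coeFn_toLp

theorem norm_mulOp_apply_le {m : ℝ → ℝ} (h : Measurable m) {C : ℝ} (hC : ∀ ξ, |m ξ| ≤ C)
    (F : L2C) : ‖mulOp m F‖ ≤ C * ‖F‖ := by
  apply Lp.norm_le_mul_norm_of_ae_le_mul
  filter_upwards [mulOp_ae ⟨h, C, hC⟩ F] with x h1
  rw [h1, norm_mul, Complex.norm_real, Real.norm_eq_abs]
  gcongr
  exact hC x

theorem norm_mulOp_le {m : ℝ → ℝ} (h : Measurable m) {C : ℝ} (hC : ∀ ξ, |m ξ| ≤ C) :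
    ‖mulOp m‖ ≤ C :=
  ContinuousLinearMap.opNorm_le_bound _ ((abs_nonneg _).trans (hC 0)) (norm_mulOp_apply_le h hC)

theorem IsBdd.mul {m n : ℝ → ℝ} (hm : IsBdd m) (hn : IsBdd n) : IsBdd (fun ξ => m ξ * n ξ) := by
  obtain ⟨hm, C, hC⟩ := hm
  obtain ⟨hn, D, hD⟩ := hn
  refine ⟨hm.mul hn, C * D, fun ξ => ?_⟩
  rw [abs_mul]
  exact mul_le_mul (hC ξ) (hD ξ) (abs_nonneg _) ((abs_nonneg _).trans (hC ξ))

theorem IsBdd.add {m n : ℝ → ℝ} (hm : IsBdd m) (hn : IsBdd n) : IsBdd (fun ξ => m ξ + n ξ) := by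
  obtain ⟨hm, C, hC⟩ := hm
  obtain ⟨hn, D, hD⟩ := hn
  exact ⟨hm.add hn, C + D, fun ξ => (abs_add_le _ _).trans (add_le_add (hC ξ) (hD ξ))⟩

theorem IsBdd.neg {m : ℝ → ℝ} (hm : IsBdd m) : IsBdd (fun ξ => -m ξ) := by
  obtain ⟨hm, C, hC⟩ := hm
  exact ⟨hm.neg, C, fun ξ => by rw [abs_neg]; exact hC ξ⟩

theorem IsBdd.sub {m n : ℝ → ℝ} (hm : IsBdd m) (hn : IsBdd n) : IsBdd (fun ξ => m ξ - n ξ) := by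
  simpa [sub_eq_add_neg] using hm.add hn.neg

theorem isBdd_const (c : ℝ) : IsBdd (fun _ => c) := ⟨measurable_const, |c|, fun _ => le_rfl⟩

theorem IsBdd.of_le {m n : ℝ → ℝ} (hn : IsBdd n) (hm : Measurable m) {c : ℝ}
    (h : ∀ ξ, |m ξ| ≤ c * |n ξ|) : IsBdd m := by
  obtain ⟨_, D, hD⟩ := hn
  refine ⟨hm, |c| * D, fun ξ => (h ξ).trans ?_⟩
  exact mul_le_mul (le_abs_self c) (hD ξ) (abs_nonneg _) (abs_nonneg _)

theorem mulOp_mulOp {m n : ℝ → ℝ} (hm : IsBdd m) (hn : IsBdd n) (F : L2C) :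
    mulOp m (mulOp n F) = mulOp (fun ξ => m ξ * n ξ) F := by
  apply Lp.ext
  filter_upwards [mulOp_ae hm (mulOp n F), mulOp_ae hn F, mulOp_ae (hm.mul hn) F] with x h1 h2 h3
  rw [h1, h2, h3]
  push_cast
  ring

theorem mulOp_add {m n : ℝ → ℝ} (hm : IsBdd m) (hn : IsBdd n) :
    mulOp (fun ξ => m ξ + n ξ) = mulOp m + mulOp n := by
  ext F : 1
  apply Lp.ext
  filter_upwards [mulOp_ae hm F, mulOp_ae hn F, mulOp_ae (hm.add hn) F,
    Lp.coeFn_add (mulOp m F) (mulOp n F)] with x h1 h2 h3 h4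
  rw [h3, add_apply, h4, Pi.add_apply, h1, h2]
  push_cast
  ring

theorem mulOp_neg {m : ℝ → ℝ} (hm : IsBdd m) : mulOp (fun ξ => -m ξ) = -mulOp m := by
  ext F : 1
  apply Lp.ext
  filter_upwards [mulOp_ae hm F, mulOp_ae hm.neg F, Lp.coeFn_neg (mulOp m F)] with x h1 h3 h4
  rw [h3, neg_apply, h4, Pi.neg_apply, h1]
  push_cast
  ring

theorem mulOp_const_mul {m : ℝ → ℝ} (hm : IsBdd m) (c : ℝ) :
    mulOp (fun ξ => c * m ξ) = c • mulOp m := by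
  ext F : 1
  apply Lp.ext
  filter_upwards [mulOp_ae hm F, mulOp_ae ((isBdd_const c).mul hm) F,
    Lp.coeFn_smul c (mulOp m F)] with x h1 h3 h4
  rw [h3, smul_apply, h4, Pi.smul_apply, h1, Complex.real_smul]
  push_cast
  ring

theorem mulOp_sub {m n : ℝ → ℝ} (hm : IsBdd m) (hn : IsBdd n) :
    mulOp (fun ξ => m ξ - n ξ) = mulOp m - mulOp n := by
  rw [sub_eq_add_neg, ← mulOp_neg hn, ← mulOp_add hm hn.neg]
  simp only [sub_eq_add_neg]

theorem mulOp_one (F : L2C) : mulOp (fun _ => 1) F = F := by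
  apply Lp.ext
  filter_upwards [mulOp_ae (isBdd_const 1) F] with x h1
  simp [h1]

theorem mulOp_injective {m : ℝ → ℝ} (hm : IsBdd m) (h0 : ∀ ξ, m ξ ≠ 0) {F G : L2C}
    (h : mulOp m F = mulOp m G) : F = G := by
  apply Lp.ext
  have h1 := mulOp_ae hm F
  rw [h] at h1
  filter_upwards [h1, mulOp_ae hm G] with x h2 h3
  rw [h2] at h3
  exact mul_left_cancel₀ (by exact_mod_cast h0 x) h3

/-- A family of symbols with a uniform second order Taylor bound gives a family of multiplication
operators that is differentiable in operator norm. -/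
theorem hasDerivAt_mulOp {m m' : ℝ → ℝ → ℝ} {C : ℝ} (hm : ∀ t, IsBdd (m t))
    (hm' : ∀ t, IsBdd (m' t)) (t : ℝ)
    (h : ∀ τ ξ, |m τ ξ - m t ξ - (τ - t) * m' t ξ| ≤ C * (τ - t) ^ 2) :
    HasDerivAt (fun t => mulOp (m t)) (mulOp (m' t)) t := by
  rw [hasDerivAt_iff_isLittleO]
  have : (fun τ => mulOp (m τ) - mulOp (m t) - (τ - t) • mulOp (m' t)) =O[𝓝 t]
      fun τ => (τ - t) ^ 2 := by
    refine Asymptotics.IsBigO.of_bound C (Filter.Eventually.of_forall fun τ => ?_)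
    rw [← mulOp_const_mul (hm' t), ← mulOp_sub (hm τ) (hm t),
      ← mulOp_sub ((hm τ).sub (hm t)) ((isBdd_const _).mul (hm' t)), Real.norm_of_nonneg (sq_nonneg _)]
    exact norm_mulOp_le (((hm τ).sub (hm t)).sub ((isBdd_const _).mul (hm' t))).1 (h τ)
  refine this.trans_isLittleO ?_
  have h2 : (fun τ : ℝ => (τ - t) ^ 2) = fun τ => (τ - t) * (τ - t) := by ext; ring
  rw [h2]
  have h3 : (fun τ : ℝ => τ - t) =o[𝓝 t] fun _ => (1 : ℝ) := by
    rw [Asymptotics.isLittleO_one_iff]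
    have : Tendsto (fun τ : ℝ => τ - t) (𝓝 t) (𝓝 (t - t)) :=
      (continuous_id.sub continuous_const).tendsto t
    simpa using this
  simpa using h3.mul_isBigO (Asymptotics.isBigO_refl (fun τ : ℝ => τ - t) (𝓝 t))

/-! ### Integrable Fourier transforms, translations and conjugation -/

theorem continuous_fourierInv {F : ℝ → ℂ} (hF : Integrable F) : Continuous (𝓕⁻ F : ℝ → ℂ) := by
  have : (𝓕⁻ F : ℝ → ℂ) = fun x => 𝓕 F (-x) := by
    ext x; exact Real.fourierInv_eq_fourier_neg F x
  rw [this]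
  have h : Continuous (𝓕 F : ℝ → ℂ) :=
    VectorFourier.fourierIntegral_continuous Real.continuous_fourierChar
      (by exact continuous_inner) hF
  exact h.comp continuous_neg

theorem norm_fourierInv_le (F : ℝ → ℂ) (x : ℝ) : ‖(𝓕⁻ F : ℝ → ℂ) x‖ ≤ ∫ ξ, ‖F ξ‖ := by
  rw [Real.fourierInv_eq']
  refine (norm_integral_le_integral_norm _).trans (le_of_eq ?_)
  congr 1
  ext ξ
  rw [norm_smul, Complex.norm_exp_ofReal_mul_I, one_mul]

theorem integrable_schwartz_mul_bounded (w : 𝓢(ℝ, ℂ)) {f : ℝ → ℂ}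
    (hf : AEStronglyMeasurable f volume) {C : ℝ} (hC : ∀ x, ‖f x‖ ≤ C) :
    Integrable (fun x => w x * f x) volume := by
  have := w.integrable (μ := volume)
  exact this.mul_bdd hf (Filter.Eventually.of_forall hC)

/-- On `L¹ ∩ L²` the inverse Fourier transform of `L²` is given by the Fourier integral. -/
theorem fourierInv_ae (F : L2C) (hF : Integrable F volume) :
    (𝓕⁻ F : L2C) =ᵐ[volume] (𝓕⁻ (F : ℝ → ℂ) : ℝ → ℂ) := by
  refine (isFunction_coe (𝓕⁻ F : L2C)).ae_eq
    ⟨(continuous_fourierInv hF).aestronglyMeasurable, fun w => ⟨?_, ?_⟩⟩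
  · exact integrable_schwartz_mul_bounded w (continuous_fourierInv hF).aestronglyMeasurable
      (norm_fourierInv_le F)
  · rw [← Lp.fourierInv_toTemperedDistribution_eq, fourierInv_apply,
      ((isFunction_coe F).2 _).2]
    have h1 := VectorFourier.integral_fourierIntegral_smul_eq_flip (𝕜 := ℝ) (V := ℝ) (W := ℝ)
      (e := Real.fourierChar) (μ := volume) (ν := volume) (L := -innerₗ ℝ) (f := fun x => w x)
      (g := (F : ℝ → ℂ)) Real.continuous_fourierChar
      (by
        have : Continuous fun p : ℝ × ℝ => -(inner ℝ p.1 p.2) := by fun_prop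
        simpa using this) w.integrable hF
    have h2 : (-innerₗ ℝ : ℝ →ₗ[ℝ] ℝ →ₗ[ℝ] ℝ).flip = -innerₗ ℝ := by
      ext; simp
    rw [h2] at h1
    have h3 : ∀ f : ℝ → ℂ, VectorFourier.fourierIntegral Real.fourierChar volume (-innerₗ ℝ) f
        = (𝓕⁻ f : ℝ → ℂ) := by
      intro f
      ext x
      rw [Real.fourierInv_eq]
      simp [VectorFourier.fourierIntegral]
    rw [h3, h3] at h1
    simpa [SchwartzMap.fourierInv_coe] using h1

/-- Translation `f ↦ f (· + h)` on complex `L²`. -/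
def shift (h : ℝ) : L2C →ₗᵢ[ℂ] L2C :=
  Lp.compMeasurePreservingₗᵢ ℂ (fun x : ℝ => x + h) (measurePreserving_add_right volume h)

theorem shift_ae (h : ℝ) (f : L2C) : shift h f =ᵐ[volume] fun x => f (x + h) :=
  Lp.coeFn_compMeasurePreserving f (measurePreserving_add_right volume h)

/-- The character `exp (2 π i h ξ)`. -/
def chr (h ξ : ℝ) : ℂ := Complex.exp ((2 * Real.pi * (h * ξ) : ℝ) * Complex.I)

theorem norm_chr (h ξ : ℝ) : ‖chr h ξ‖ = 1 := Complex.norm_exp_ofReal_mul_I _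

/-- Translation by `h` becomes multiplication by the character `chr h` under the Fourier transform. -/
theorem fourier_shift_ae (h : ℝ) (f : L2C) :
    (𝓕 (shift h f) : L2C) =ᵐ[volume] fun ξ => chr h ξ * (𝓕 f : L2C) ξ := by
  have hm : Continuous (chr h) := by unfold chr; fun_prop
  refine (isFunction_fourier_coe (shift h f)).ae_eq
    ⟨hm.aestronglyMeasurable.mul (Lp.aestronglyMeasurable _), fun w => ?_⟩
  set w1 : 𝓢(ℝ, ℂ) := 𝓕⁻ (SchwartzMap.compSubConstCLM ℂ h (𝓕 w)) with hw1
  have hw1' : ∀ ξ, w1 ξ = w ξ * chr h ξ := by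
    intro ξ
    rw [hw1, SchwartzMap.fourierInv_coe, Real.fourierInv_eq']
    rw [← integral_add_right_eq_self _ h]
    have h3 : w ξ = (𝓕⁻ (𝓕 w) : 𝓢(ℝ, ℂ)) ξ := by simp
    rw [h3, SchwartzMap.fourierInv_coe, Real.fourierInv_eq', ← integral_mul_const]
    congr 1
    ext x
    simp only [SchwartzMap.compSubConstCLM_apply, smul_eq_mul, add_sub_cancel_right, chr]
    rw [mul_right_comm (Complex.exp _), ← Complex.exp_add, ← add_mul, ← Complex.ofReal_add]
    congr 4
    have hin : ∀ y z : ℝ, inner ℝ y z = z * y := fun y z => by simp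
    rw [hin, hin]
    ring
  have key := (isFunction_fourier_coe f).2 w1
  have he : (fun ξ => w1 ξ * (𝓕 f : L2C) ξ) = fun ξ => w ξ * (chr h ξ * (𝓕 f : L2C) ξ) := by
    ext ξ
    rw [hw1']
    ring
  rw [he] at key
  refine ⟨key.1, ?_⟩
  rw [← key.2, TemperedDistribution.fourier_apply, TemperedDistribution.fourier_apply, ((isFunction_coe _).2 _).2, ((isFunction_coe _).2 _).2]
  have h4 : ∫ x, (𝓕 w1) x * f x = ∫ x, (𝓕 w1) (x + h) * f (x + h) :=
    (integral_add_right_eq_self (fun x => (𝓕 w1) x * f x) h).symm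
  rw [h4]
  apply integral_congr_ae
  filter_upwards [shift_ae h f] with x hx
  rw [hx, hw1]
  simp

/-- Complex conjugation on complex `L²`. -/
def conjL2 : L2C →L[ℝ] L2C := (Complex.conjCLE : ℂ →L[ℝ] ℂ).compLpL 2 volume

theorem conjL2_ae (f : L2C) : conjL2 f =ᵐ[volume] fun x => (starRingEnd ℂ) (f x) :=
  ContinuousLinearMap.coeFn_compLp (Complex.conjCLE : ℂ →L[ℝ] ℂ) f

/-- Conjugation turns into reflection and conjugation of the transform. -/
theorem fourier_conj_ae (f : L2C) :
    (𝓕 (conjL2 f) : L2C) =ᵐ[volume] fun ξ => (starRingEnd ℂ) ((𝓕 f : L2C) (-ξ)) := by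
  have hq : Measure.QuasiMeasurePreserving (fun x : ℝ => -x) volume volume :=
    (Measure.measurePreserving_neg volume).quasiMeasurePreserving
  refine (isFunction_fourier_coe (conjL2 f)).ae_eq
    ⟨?_, fun w => ?_⟩
  · exact Complex.continuous_conj.comp_aestronglyMeasurable
      ((Lp.aestronglyMeasurable (𝓕 f : L2C)).comp_quasiMeasurePreserving hq)
  set w1 : 𝓢(ℝ, ℂ) := SchwartzMap.postcompCLM (𝕜 := ℝ) (Complex.conjCLE : ℂ →L[ℝ] ℂ)
    (SchwartzMap.compCLMOfContinuousLinearEquiv ℝ (ContinuousLinearEquiv.neg ℝ) w) with hw1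
  have hw1' : ∀ ξ, w1 ξ = (starRingEnd ℂ) (w (-ξ)) := by
    intro ξ
    simp [hw1]
  have hF : ∀ x, (𝓕 w1 : 𝓢(ℝ, ℂ)) x = (starRingEnd ℂ) ((𝓕 w : 𝓢(ℝ, ℂ)) x) := by
    intro x
    rw [SchwartzMap.fourier_coe, SchwartzMap.fourier_coe, Real.fourier_eq', Real.fourier_eq',
      ← integral_conj, ← integral_neg_eq_self]
    congr 1
    ext ξ
    rw [hw1', smul_eq_mul, smul_eq_mul, map_mul, ← Complex.exp_conj, map_mul,
      Complex.conj_ofReal, Complex.conj_I]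
    simp
  have key := (isFunction_fourier_coe f).2 w1
  have h5 : ∀ ξ, w ξ * (starRingEnd ℂ) ((𝓕 f : L2C) (-ξ)) =
      (starRingEnd ℂ) (w1 (-ξ) * (𝓕 f : L2C) (-ξ)) := by
    intro ξ
    simp [hw1']
  simp_rw [h5]
  constructor
  · have := (key.1.comp_neg)
    exact (LinearIsometryEquiv.integrable_comp_iff Complex.conjLIE).2 this
  · rw [integral_conj, integral_neg_eq_self (fun ξ => w1 ξ * (𝓕 f : L2C) ξ), ← key.2,
      TemperedDistribution.fourier_apply, TemperedDistribution.fourier_apply, ((isFunction_coe _).2 _).2, ((isFunction_coe _).2 _).2,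
      ← integral_conj]
    apply integral_congr_ae
    filter_upwards [conjL2_ae f] with x hx
    rw [hx, hF]
    simp

theorem conjL2_eq_self_iff (f : L2C) : conjL2 f = f ↔ cplx (rePart f) = f := by
  constructor
  · intro h
    apply Lp.ext
    have h1 := conjL2_ae f
    rw [h] at h1
    filter_upwards [h1, cplx_ae (rePart f), rePart_ae f] with x h2 h3 h4
    rw [h3, h4]
    exact Complex.conj_eq_iff_re.1 h2.symm
  · intro h
    apply Lp.ext
    filter_upwards [conjL2_ae f, cplx_ae (rePart f)] with x h2 h3
    rw [h] at h3
    rw [h2, h3]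
    simp

/-- An `L²` function on the Fourier side that is the transform of a real function. -/
def IsHerm (F : L2C) : Prop := cplx (rePart (𝓕⁻ F : L2C)) = 𝓕⁻ F

theorem isHerm_iff (F : L2C) :
    IsHerm F ↔ ∀ᵐ ξ ∂(volume : Measure ℝ), (starRingEnd ℂ) (F (-ξ)) = F ξ := by
  rw [IsHerm, ← conjL2_eq_self_iff]
  have h1 := fourier_conj_ae (𝓕⁻ F : L2C)
  have h2 : (𝓕 (𝓕⁻ F : L2C) : L2C) = F := by simp
  rw [h2] at h1
  constructor
  · intro h
    rw [h, h2] at h1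
    filter_upwards [h1] with ξ h3 using h3.symm
  · intro h
    have : (𝓕 (conjL2 (𝓕⁻ F : L2C)) : L2C) = F := by
      apply Lp.ext
      filter_upwards [h1, h] with ξ h3 h4
      rw [h3, h4]
    have h3 := congrArg (fun G : L2C => (𝓕⁻ G : L2C)) this
    simpa using h3

theorem isHerm_fourier (f : L2) : IsHerm (𝓕 (cplx f) : L2C) := by
  simp [IsHerm, rePart_cplx]

theorem IsHerm.mulOp {F : L2C} (hF : IsHerm F) {m : ℝ → ℝ} (hm : IsBdd m)
    (he : ∀ ξ, m (-ξ) = m ξ) : IsHerm (mulOp m F) := by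
  rw [isHerm_iff] at *
  have hq : Measure.QuasiMeasurePreserving (fun x : ℝ => -x) volume volume :=
    (Measure.measurePreserving_neg volume).quasiMeasurePreserving
  filter_upwards [hF, mulOp_ae hm F, hq.ae (mulOp_ae hm F)] with ξ h1 h2 h3
  rw [h2, h3, map_mul, h1, Complex.conj_ofReal, he]

/-- The real subspace of Hermitian functions. -/
def herm : Submodule ℝ L2C where
  carrier := {F | IsHerm F}
  add_mem' := fun {F G} hF hG => by
    have : (𝓕⁻ (F + G) : L2C) = 𝓕⁻ F + 𝓕⁻ G := (Lp.fourierTransformₗᵢ ℝ ℂ).symm.map_add F G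
    simp only [Set.mem_ofPred_eq, IsHerm] at *
    rw [this, map_add, map_add, hF, hG]
  zero_mem' := by
    have : (𝓕⁻ (0 : L2C) : L2C) = 0 := (Lp.fourierTransformₗᵢ ℝ ℂ).symm.map_zero
    simp only [Set.mem_ofPred_eq, IsHerm]
    rw [this, map_zero, map_zero]
  smul_mem' := fun c F hF => by
    have : (𝓕⁻ (c • F) : L2C) = c • (𝓕⁻ F : L2C) :=
      (Lp.fourierTransformₗᵢ ℝ ℂ).symm.toLinearEquiv.toLinearMap.map_smul_of_tower c F
    simp only [Set.mem_ofPred_eq, IsHerm] at *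
    rw [this, map_smul, map_smul, hF]

theorem mem_herm (F : L2C) : F ∈ herm ↔ IsHerm F := Iff.rfl

theorem isClosed_herm : IsClosed (herm : Set L2C) := by
  have : (herm : Set L2C) = {F : L2C | cplx (rePart (𝓕⁻ F : L2C)) = 𝓕⁻ F} := by
    ext F; exact mem_herm F
  rw [this]
  have hc : Continuous fun F : L2C => (𝓕⁻ F : L2C) := (Lp.fourierTransformₗᵢ ℝ ℂ).symm.continuous
  exact isClosed_eq ((cplx.continuous.comp rePart.continuous).comp hc) hc

/-! ### Sobolev norms through finite differences -/

/-- The symbol `|exp (2 π i h ξ) - 1|²` of the squared difference operator with step `h`. -/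
def ds (h ξ : ℝ) : ℝ := (2 * Real.sin (Real.pi * (h * ξ))) ^ 2

theorem norm_chr_sub_one_sq (h ξ : ℝ) : ‖chr h ξ - 1‖ ^ 2 = ds h ξ := by
  have := Complex.norm_exp_I_mul_ofReal_sub_one (2 * Real.pi * (h * ξ))
  rw [mul_comm] at this
  rw [chr, this, ds, Real.norm_eq_abs, sq_abs]
  ring_nf

theorem ds_le_four (h ξ : ℝ) : ds h ξ ≤ 4 := by
  unfold ds
  nlinarith [Real.sin_sq_le_one (Real.pi * (h * ξ))]

theorem ds_le_sq (h ξ : ℝ) : ds h ξ ≤ (2 * Real.pi * (h * ξ)) ^ 2 := by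
  unfold ds
  rw [mul_pow, mul_assoc, mul_pow 2]
  gcongr ?_ * ?_
  rw [← sq_abs, ← sq_abs (Real.pi * (h * ξ))]
  have := Real.abs_sin_le_abs (x := Real.pi * (h * ξ))
  gcongr

theorem ds_abs (h ξ : ℝ) : ds h ξ = ds (|ξ| * h) 1 := by
  unfold ds
  rcases abs_cases ξ with ⟨h1, _⟩ | ⟨h1, _⟩ <;> rw [h1]
  · ring_nf
  · rw [show Real.pi * (-ξ * h * 1) = -(Real.pi * (h * ξ)) by ring, Real.sin_neg]
    ring

theorem continuous_ds : Continuous fun p : ℝ × ℝ => ds p.1 p.2 := by unfold ds; fun_prop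

theorem measurable_ds (h : ℝ) : Measurable (ds h) := by unfold ds; fun_prop

/-- The square of the `L²` norm of `m^{1/2} F`. -/
def wsq (m : ℝ → ℝ) (F : ℝ → ℂ) : ℝ≥0∞ := ∫⁻ ξ, ENNReal.ofReal (m ξ) * ‖F ξ‖ₑ ^ 2

/-- The square of the `H^σ` norm, in terms of the Fourier transform `F`. -/
def hsq (σ : ℝ) (F : ℝ → ℂ) : ℝ≥0∞ := wsq (wt (2 * σ)) F

theorem wsq_congr {m : ℝ → ℝ} {F G : ℝ → ℂ} (h : F =ᵐ[volume] G) : wsq m F = wsq m G := by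
  apply lintegral_congr_ae
  filter_upwards [h] with x hx
  rw [hx]

theorem wsq_mono {m n : ℝ → ℝ} (h : ∀ ξ, m ξ ≤ n ξ) (F : ℝ → ℂ) : wsq m F ≤ wsq n F := by
  unfold wsq
  gcongr
  exact h _

theorem wsq_const_mul {m : ℝ → ℝ} {c : ℝ} (hc : 0 ≤ c) (F : ℝ → ℂ) :
    wsq (fun ξ => c * m ξ) F = ENNReal.ofReal c * wsq m F := by
  unfold wsq
  rw [← lintegral_const_mul' _ _ ENNReal.ofReal_ne_top]
  congr 1
  ext ξ
  rw [ENNReal.ofReal_mul hc, mul_assoc]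

theorem wsq_add {m n : ℝ → ℝ} (hm : Measurable m) (h0 : ∀ ξ, 0 ≤ m ξ) (h1 : ∀ ξ, 0 ≤ n ξ)
    {F : ℝ → ℂ} (hF : AEStronglyMeasurable F volume) :
    wsq (fun ξ => m ξ + n ξ) F = wsq m F + wsq n F := by
  unfold wsq
  rw [← lintegral_add_left']
  · congr 1
    ext ξ
    rw [ENNReal.ofReal_add (h0 ξ) (h1 ξ), add_mul]
  · exact hm.ennreal_ofReal.aemeasurable.mul (hF.enorm.pow_const 2)

theorem wsq_mul {m : ℝ → ℝ} {n : ℝ → ℝ} (F : ℝ → ℂ) (hm : ∀ ξ, 0 ≤ m ξ) :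
    wsq m (fun ξ => (n ξ : ℂ) * F ξ) = wsq (fun ξ => m ξ * n ξ ^ 2) F := by
  unfold wsq
  congr 1
  ext ξ
  rw [enorm_mul, mul_pow, ← mul_assoc, ENNReal.ofReal_mul (hm ξ)]
  congr 2
  rw [← ofReal_norm, Complex.norm_real, ← ENNReal.ofReal_pow (norm_nonneg _)]
  simp

theorem enorm_sq_eq_wsq (F : L2C) : ‖F‖ₑ ^ 2 = wsq (fun _ => 1) F := by
  rw [Lp.enorm_def, eLpNorm_eq_lintegral_rpow_enorm_toReal (by norm_num) (by norm_num)]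
  simp only [ENNReal.toReal_ofNat, ENNReal.rpow_ofNat, wsq, ENNReal.ofReal_one, one_mul]
  rw [← ENNReal.rpow_natCast, ← ENNReal.rpow_mul]
  norm_num

theorem hsq_zero (F : L2C) : hsq 0 F = ‖F‖ₑ ^ 2 := by
  rw [enorm_sq_eq_wsq, hsq]
  congr 1
  ext ξ
  simp [wt_zero]

theorem hsq_mono {σ τ : ℝ} (h : σ ≤ τ) (F : ℝ → ℂ) : hsq σ F ≤ hsq τ F :=
  wsq_mono (fun ξ => wt_mono (by linarith) ξ) F

theorem wsq_mulOp {m n : ℝ → ℝ} (hm : ∀ ξ, 0 ≤ m ξ) (hn : IsBdd n) (F : L2C) :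
    wsq m (mulOp n F) = wsq (fun ξ => m ξ * n ξ ^ 2) F := by
  rw [wsq_congr (mulOp_ae hn F), wsq_mul _ hm]

theorem enorm_mulOp_sq {n : ℝ → ℝ} (hn : IsBdd n) (F : L2C) :
    ‖mulOp n F‖ₑ ^ 2 = wsq (fun ξ => n ξ ^ 2) F := by
  rw [enorm_sq_eq_wsq, wsq_mulOp (fun _ => zero_le_one) hn]
  simp

theorem enorm_fourier (f : L2C) : ‖(𝓕 f : L2C)‖ₑ = ‖f‖ₑ := by
  rw [← ofReal_norm, ← ofReal_norm, Lp.norm_fourier_eq]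

theorem enorm_shift_sub_sq (h : ℝ) (f : L2C) :
    ‖shift h f - f‖ₑ ^ 2 = wsq (ds h) (𝓕 f : L2C) := by
  rw [← enorm_fourier, enorm_sq_eq_wsq]
  have h0 : (𝓕 (shift h f - f) : L2C) = 𝓕 (shift h f) - 𝓕 f :=
    (Lp.fourierTransformₗᵢ ℝ ℂ).map_sub _ _
  rw [h0]
  unfold wsq
  apply lintegral_congr_ae
  filter_upwards [fourier_shift_ae h f, Lp.coeFn_sub (𝓕 (shift h f) : L2C) (𝓕 f)] with ξ h1 h2
  rw [h2, Pi.sub_apply, h1, ← norm_chr_sub_one_sq, ENNReal.ofReal_one, one_mul,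
    ← sub_one_mul, enorm_mul, mul_pow, ENNReal.ofReal_pow (norm_nonneg _), ofReal_norm]

theorem lintegral_comp_mul_left {c : ℝ} (hc : 0 < c) {f : ℝ → ℝ≥0∞} (hf : Measurable f) :
    ∫⁻ h, f (c * h) = ENNReal.ofReal c⁻¹ * ∫⁻ h, f h := by
  rw [← lintegral_map hf (measurable_const_mul c), Real.map_volume_mul_left hc.ne',
    lintegral_smul_measure, abs_of_pos (inv_pos.2 hc), smul_eq_mul]

/-- The weight `h^{-1-2σ}` on `(0, ∞)` of the Gagliardo seminorm. -/
def gker (σ h : ℝ) : ℝ≥0∞ :=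
  (Set.Ioi (0 : ℝ)).indicator (fun h => ENNReal.ofReal (h ^ (-1 - 2 * σ))) h

theorem measurable_gker (σ : ℝ) : Measurable (gker σ) :=
  Measurable.indicator (by fun_prop) measurableSet_Ioi

/-- The constant relating the Gagliardo seminorm to the Fourier side. -/
def gconst (σ : ℝ) : ℝ≥0∞ := ∫⁻ h, gker σ h * ENNReal.ofReal (ds h 1)

/-- By the substitution `h ↦ h / |ξ|` the Gagliardo kernel turns the symbols of the squared
differences into a multiple of `|ξ| ^ (2 σ)`. -/
theorem lintegral_gker_ds {σ : ℝ} (hσ : 0 < σ) (ξ : ℝ) :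
    ∫⁻ h, gker σ h * ENNReal.ofReal (ds h ξ) = gconst σ * ENNReal.ofReal (|ξ| ^ (2 * σ)) := by
  rcases eq_or_ne ξ 0 with rfl | hξ
  · rw [abs_zero, Real.zero_rpow (by positivity)]
    simp [ds]
  have hc : 0 < |ξ| := abs_pos.2 hξ
  have hm : Measurable fun h => gker σ h * ENNReal.ofReal (ds h 1) := by
    refine (measurable_gker σ).mul (Measurable.ennreal_ofReal ?_)
    unfold ds; fun_prop
  have h1 := lintegral_comp_mul_left hc hm
  have h2 : ∀ h, gker σ (|ξ| * h) =
      ENNReal.ofReal (|ξ| ^ (-1 - 2 * σ)) * gker σ h := by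
    intro h
    unfold gker
    by_cases hh : h ∈ Set.Ioi (0 : ℝ)
    · have hh' : |ξ| * h ∈ Set.Ioi (0 : ℝ) := mul_pos hc hh
      rw [Set.indicator_of_mem hh, Set.indicator_of_mem hh',
        Real.mul_rpow hc.le (le_of_lt hh), ENNReal.ofReal_mul (by positivity)]
    · have hh' : |ξ| * h ∉ Set.Ioi (0 : ℝ) := by
        simp only [Set.mem_Ioi, not_lt] at hh ⊢
        exact mul_nonpos_of_nonneg_of_nonpos hc.le hh
      rw [Set.indicator_of_notMem hh, Set.indicator_of_notMem hh', mul_zero]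
  simp_rw [h2, mul_assoc, ← ds_abs] at h1
  rw [lintegral_const_mul' _ _ ENNReal.ofReal_ne_top] at h1
  have h3 : ENNReal.ofReal (|ξ| ^ (1 + 2 * σ)) * ENNReal.ofReal (|ξ| ^ (-1 - 2 * σ)) = 1 := by
    rw [← ENNReal.ofReal_mul (by positivity), ← Real.rpow_add hc]
    ring_nf
    simp
  have h4 : ENNReal.ofReal (|ξ| ^ (1 + 2 * σ)) * ENNReal.ofReal |ξ|⁻¹ =
      ENNReal.ofReal (|ξ| ^ (2 * σ)) := by
    rw [← ENNReal.ofReal_mul (by positivity), ← Real.rpow_neg_one, ← Real.rpow_add hc]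
    ring_nf
  rw [← one_mul (∫⁻ _, _), ← h3, mul_assoc, h1, ← mul_assoc, h4, mul_comm]
  rfl

/-- The integral converges at `0` because `σ < α`, and at infinity because `0 < σ`. -/
theorem lintegral_gker_min_lt_top {α σ : ℝ} (hσ : 0 < σ) (hα : σ < α) {A B : ℝ} :
    ∫⁻ h, gker σ h * ENNReal.ofReal (min A (B * h ^ (2 * α))) < ⊤ := by
  have h0 : ∀ h, gker σ h * ENNReal.ofReal (min A (B * h ^ (2 * α))) =
      (Set.Ioi (0 : ℝ)).indicator (fun h => ENNReal.ofReal (h ^ (-1 - 2 * σ)) *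
        ENNReal.ofReal (min A (B * h ^ (2 * α)))) h := by
    intro h
    unfold gker
    rw [Set.indicator_mul_left]
  simp_rw [h0]
  rw [lintegral_indicator measurableSet_Ioi, ← Set.Ioc_union_Ioi_eq_Ioi zero_le_one,
    lintegral_union measurableSet_Ioi (Set.Ioc_disjoint_Ioi le_rfl)]
  refine ENNReal.add_lt_top.2 ⟨?_, ?_⟩
  · have hi : IntegrableOn (fun h : ℝ => |B| * h ^ (2 * (α - σ) - 1)) (Set.Ioc 0 1) volume := by
      have := intervalIntegral.intervalIntegrable_rpow' (a := 0) (b := 1)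
        (r := 2 * (α - σ) - 1) (by linarith)
      rw [intervalIntegrable_iff_integrableOn_Ioc_of_le zero_le_one] at this
      exact this.const_mul _
    refine lt_of_le_of_lt (setLIntegral_mono' measurableSet_Ioc fun h hh => ?_) hi.lintegral_lt_top
    rw [← ENNReal.ofReal_mul (Real.rpow_nonneg hh.1.le _)]
    apply ENNReal.ofReal_le_ofReal
    calc h ^ (-1 - 2 * σ) * min A (B * h ^ (2 * α))
        ≤ h ^ (-1 - 2 * σ) * (|B| * h ^ (2 * α)) := by
          gcongr
          · exact Real.rpow_nonneg hh.1.le _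
          · refine (min_le_right _ _).trans ?_
            gcongr
            · exact Real.rpow_nonneg hh.1.le _
            · exact le_abs_self B
      _ = |B| * (h ^ (-1 - 2 * σ) * h ^ (2 * α)) := by ring
      _ = _ := by
          rw [← Real.rpow_add hh.1]
          ring_nf
  · have hi : IntegrableOn (fun h : ℝ => A * h ^ (-1 - 2 * σ)) (Set.Ioi 1) volume :=
      (integrableOn_Ioi_rpow_of_lt (by linarith) zero_lt_one).const_mul _
    refine lt_of_le_of_lt (setLIntegral_mono' measurableSet_Ioi fun h hh => ?_) hi.lintegral_lt_top
    have hh0 : 0 < h := zero_lt_one.trans hh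
    rw [← ENNReal.ofReal_mul (Real.rpow_nonneg hh0.le _)]
    apply ENNReal.ofReal_le_ofReal
    rw [mul_comm]
    gcongr
    exact min_le_left _ _

theorem gconst_lt_top {σ : ℝ} (hσ : 0 < σ) (hσ1 : σ < 1) : gconst σ < ⊤ := by
  refine lt_of_le_of_lt ?_ (lintegral_gker_min_lt_top (α := 1) (A := 4) (B := (2 * Real.pi) ^ 2)
    hσ hσ1)
  unfold gconst
  gcongr with h
  refine le_min (ds_le_four h 1) ((ds_le_sq h 1).trans (le_of_eq ?_))
  simp
  ring

theorem gconst_ne_zero (σ : ℝ) : gconst σ ≠ 0 := by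
  have hm : Measurable fun h => gker σ h * ENNReal.ofReal (ds h 1) := by
    refine (measurable_gker σ).mul (Measurable.ennreal_ofReal ?_)
    unfold ds; fun_prop
  refine ((lintegral_pos_iff_support hm).2 ?_).ne'
  refine lt_of_lt_of_le (b := volume (Set.Ioo (0 : ℝ) 1)) (by simp) (measure_mono fun h hh => ?_)
  rw [Function.mem_support]
  refine mul_ne_zero ?_ ?_
  · unfold gker
    rw [Set.indicator_of_mem (Set.mem_Ioi.2 hh.1)]
    exact (ENNReal.ofReal_pos.2 (Real.rpow_pos_of_pos hh.1 _)).ne'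
  · refine (ENNReal.ofReal_pos.2 ?_).ne'
    unfold ds
    have : 0 < Real.sin (Real.pi * (h * 1)) :=
      Real.sin_pos_of_pos_of_lt_pi (by have := Real.pi_pos; have := hh.1; positivity)
        (by nlinarith [Real.pi_pos, hh.2])
    positivity

/-- The Gagliardo seminorm on the Fourier side. -/
theorem lintegral_gker_wsq {σ : ℝ} (hσ : 0 < σ) {F : ℝ → ℂ} (hF : AEStronglyMeasurable F volume) :
    ∫⁻ h, gker σ h * wsq (ds h) F = gconst σ * wsq (fun ξ => |ξ| ^ (2 * σ)) F := by
  have h1 : ∀ h, gker σ h * wsq (ds h) F =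
      ∫⁻ ξ, gker σ h * (ENNReal.ofReal (ds h ξ) * ‖F ξ‖ₑ ^ 2) := by
    intro h
    rw [wsq, lintegral_const_mul'']
    exact (measurable_ds h).ennreal_ofReal.aemeasurable.mul (hF.enorm.pow_const 2)
  simp_rw [h1]
  rw [lintegral_lintegral_swap]
  · have h2 : ∀ ξ, ∫⁻ h, gker σ h * (ENNReal.ofReal (ds h ξ) * ‖F ξ‖ₑ ^ 2) =
        gconst σ * (ENNReal.ofReal (|ξ| ^ (2 * σ)) * ‖F ξ‖ₑ ^ 2) := by
      intro ξ
      simp_rw [← mul_assoc]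
      rw [lintegral_mul_const', lintegral_gker_ds hσ]
      exact ENNReal.pow_ne_top enorm_ne_top
    simp_rw [h2]
    rw [lintegral_const_mul'', wsq]
    refine AEMeasurable.mul ?_ (hF.enorm.pow_const 2)
    exact Measurable.aemeasurable (by fun_prop)
  · have a1 : AEMeasurable (fun p : ℝ × ℝ => gker σ p.1) (volume.prod volume) :=
      ((measurable_gker σ).comp measurable_fst).aemeasurable
    have a2 : AEMeasurable (fun p : ℝ × ℝ => ENNReal.ofReal (ds p.1 p.2)) (volume.prod volume) :=
      continuous_ds.measurable.ennreal_ofReal.aemeasurable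
    have a3 : AEMeasurable (fun p : ℝ × ℝ => ‖F p.2‖ₑ ^ 2) (volume.prod volume) :=
      (hF.comp_snd.enorm.pow_const 2)
    exact a1.mul (a2.mul a3)

/-- The endpoint `σ = 1`, where the Gagliardo integral diverges: Fatou's lemma along the steps
`1 / (n + 1)`, whose difference quotients have symbols converging to `2 π |ξ|` in modulus. -/
theorem wsq_abs_sq_le {F : ℝ → ℂ} (hF : AEStronglyMeasurable F volume) {C : ℝ≥0∞}
    (h : ∀ h : ℝ, 0 < h → wsq (ds h) F ≤ ENNReal.ofReal (h ^ 2) * C) :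
    ENNReal.ofReal ((2 * Real.pi) ^ 2) * wsq (fun ξ => |ξ| ^ (2 * (1 : ℝ))) F ≤ C := by
  set f : ℕ → ℝ → ℝ≥0∞ := fun n ξ =>
    ENNReal.ofReal (((n : ℝ) + 1) ^ 2 * ds (1 / ((n : ℝ) + 1)) ξ) * ‖F ξ‖ₑ ^ 2 with hf
  have hfm : ∀ n, AEMeasurable (f n) volume := fun n =>
    ((measurable_ds _).const_mul _).ennreal_ofReal.aemeasurable.mul (hF.enorm.pow_const 2)
  have h1 := lintegral_liminf_le' (u := atTop) hfm
  have h2 : ∀ ξ, liminf (fun n => f n ξ) atTop =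
      ENNReal.ofReal ((2 * Real.pi) ^ 2 * |ξ| ^ (2 * (1 : ℝ))) * ‖F ξ‖ₑ ^ 2 := by
    intro ξ
    apply Tendsto.liminf_eq
    refine ENNReal.Tendsto.mul_const ?_ (Or.inr (ENNReal.pow_ne_top enorm_ne_top))
    refine ENNReal.tendsto_ofReal ?_
    have hd : HasDerivAt (fun t => 2 * Real.sin (Real.pi * (t * ξ))) (2 * (Real.pi * ξ)) 0 := by
      have h3 : HasDerivAt (fun t : ℝ => Real.pi * (t * ξ)) (Real.pi * ξ) 0 := by
        simpa using ((hasDerivAt_id (0 : ℝ)).mul_const ξ).const_mul Real.pi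
      have := (h3.sin).const_mul 2
      simpa using this
    have h4 := hd.tendsto_slope_zero_right
    have h5 : Tendsto (fun n : ℕ => 1 / ((n : ℝ) + 1)) atTop (𝓝[>] 0) :=
      tendsto_nhdsWithin_iff.2 ⟨tendsto_one_div_add_atTop_nhds_zero_nat,
        Filter.Eventually.of_forall fun n => by simp only [Set.mem_Ioi]; positivity⟩
    have h6 := (h4.comp h5).pow 2
    refine (h6.congr fun n => ?_).trans (le_of_eq ?_)
    · simp [ds]
      ring
    · congr 1
      rw [mul_one, Real.rpow_two, sq_abs]
      ring
  simp_rw [h2] at h1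
  have h7 : wsq (fun ξ => (2 * Real.pi) ^ 2 * |ξ| ^ (2 * (1 : ℝ))) F ≤ C := by
    refine h1.trans (liminf_le_of_le (by isBoundedDefault) fun b hb => ?_)
    obtain ⟨n, hn⟩ := hb.exists
    refine hn.trans ?_
    have h8 := h (1 / ((n : ℝ) + 1)) (by positivity)
    have h9 : ∫⁻ ξ, f n ξ = wsq (fun ξ => ((n : ℝ) + 1) ^ 2 * ds (1 / ((n : ℝ) + 1)) ξ) F := rfl
    rw [h9, wsq_const_mul (by positivity)]
    calc _ ≤ ENNReal.ofReal (((n : ℝ) + 1) ^ 2) *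
          (ENNReal.ofReal ((1 / ((n : ℝ) + 1)) ^ 2) * C) := by gcongr
      _ = C := by
        rw [← mul_assoc, ← ENNReal.ofReal_mul (by positivity), ← mul_pow]
        have : ((n : ℝ) + 1) * (1 / ((n : ℝ) + 1)) = 1 := by field_simp
        rw [this]
        simp
  rwa [wsq_const_mul (by positivity)] at h7

/-- If all differences of one function are controlled by those of another function, then so is
its homogeneous Sobolev norm of order `σ ∈ (0, 1]`. -/
theorem wsq_abs_le_of_ds {σ : ℝ} (hσ : 0 < σ) (hσ1 : σ ≤ 1) {F K : ℝ → ℂ}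
    (hF : AEStronglyMeasurable F volume) (hK : AEStronglyMeasurable K volume) {C : ℝ≥0∞}
    (hC : C ≠ ⊤) (h : ∀ h : ℝ, wsq (ds h) F ≤ C * wsq (ds h) K) :
    wsq (fun ξ => |ξ| ^ (2 * σ)) F ≤ C * wsq (fun ξ => |ξ| ^ (2 * σ)) K := by
  rcases lt_or_eq_of_le hσ1 with h1 | rfl
  · have h2 : gconst σ * wsq (fun ξ => |ξ| ^ (2 * σ)) F ≤
        gconst σ * (C * wsq (fun ξ => |ξ| ^ (2 * σ)) K) := by
      rw [← lintegral_gker_wsq hσ hF, mul_left_comm, ← lintegral_gker_wsq hσ hK,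
        ← lintegral_const_mul' _ _ hC]
      apply lintegral_mono
      intro t
      simp only
      rw [mul_left_comm]
      gcongr
      exact h t
    exact (ENNReal.mul_le_mul_iff_right (gconst_ne_zero σ) (gconst_lt_top hσ h1).ne).1 h2
  · have h2 := wsq_abs_sq_le hF
      (C := ENNReal.ofReal ((2 * Real.pi) ^ 2) * (C * wsq (fun ξ => |ξ| ^ (2 * (1 : ℝ))) K)) ?_
    · refine (ENNReal.mul_le_mul_iff_right ?_ ENNReal.ofReal_ne_top).1 h2
      exact (ENNReal.ofReal_pos.2 (by positivity)).ne'
    · intro t ht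
      refine (h t).trans ?_
      rw [← mul_assoc, ← ENNReal.ofReal_mul (by positivity), mul_left_comm,
        ← wsq_const_mul (by positivity)]
      gcongr
      refine wsq_mono (fun ξ => (ds_le_sq t ξ).trans (le_of_eq ?_)) K
      rw [mul_one, Real.rpow_two, sq_abs]
      ring

theorem hsq_le_add_abs {σ : ℝ} (hσ : 0 ≤ σ) (hσ1 : σ ≤ 1) (F : L2C) :
    hsq σ F ≤ ‖F‖ₑ ^ 2 + wsq (fun ξ => |ξ| ^ (2 * σ)) F := by
  rw [enorm_sq_eq_wsq, ← wsq_add measurable_const (fun _ => zero_le_one) (fun ξ => by positivity)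
    (Lp.aestronglyMeasurable F)]
  refine wsq_mono (fun ξ => ?_) F
  have := Real.rpow_add_le_add_rpow zero_le_one (sq_nonneg ξ) hσ hσ1
  unfold wt
  rw [Real.one_rpow, ← sq_abs ξ, ← Real.rpow_natCast, ← Real.rpow_mul (abs_nonneg ξ)] at this
  rw [← sq_abs ξ, ← Real.rpow_natCast]
  push_cast at this ⊢
  convert this using 2
  ring

theorem wsq_abs_le_hsq {σ : ℝ} (hσ : 0 ≤ σ) (F : ℝ → ℂ) :
    wsq (fun ξ => |ξ| ^ (2 * σ)) F ≤ hsq σ F := by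
  refine wsq_mono (fun ξ => ?_) F
  unfold wt
  rw [Real.rpow_mul (abs_nonneg ξ), Real.rpow_two, sq_abs]
  have : 2 * σ / 2 = σ := by ring
  rw [this]
  gcongr
  linarith

/-! ### Sobolev embedding -/

/-- The Sobolev embedding on the Fourier side, by the Cauchy–Schwarz inequality. -/
theorem lintegral_wt_le {α s : ℝ} (h : 1 / 2 < s - α) : ∃ C : ℝ≥0∞, C < ⊤ ∧ ∀ F : L2C,
    ∫⁻ ξ, ENNReal.ofReal (wt α ξ) * ‖F ξ‖ₑ ≤ C * hsq s F ^ (1 / 2 : ℝ) := by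
  refine ⟨(∫⁻ ξ, ENNReal.ofReal (wt (2 * (α - s)) ξ)) ^ (1 / 2 : ℝ), ?_, fun F => ?_⟩
  · have h1 : Integrable (fun ξ : ℝ => (1 + ‖ξ‖ ^ 2) ^ (-(2 * (s - α)) / 2)) volume :=
      integrable_rpow_neg_one_add_norm_sq (by simp; linarith)
    have h2 : Integrable (wt (2 * (α - s))) volume := by
      refine h1.congr (Filter.Eventually.of_forall fun ξ => ?_)
      simp only [wt, Real.norm_eq_abs, sq_abs]
      congr 1
      ring
    exact ENNReal.rpow_lt_top_of_nonneg (by norm_num) h2.lintegral_lt_top.ne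
  · have h3 := ENNReal.lintegral_mul_le_Lp_mul_Lq (volume : Measure ℝ)
      (p := 2) (q := 2) Real.HolderConjugate.two_two
      (f := fun ξ => ENNReal.ofReal (wt (α - s) ξ))
      (g := fun ξ => ENNReal.ofReal (wt s ξ) * ‖F ξ‖ₑ)
      (continuous_wt _).measurable.ennreal_ofReal.aemeasurable
      ((continuous_wt _).measurable.ennreal_ofReal.aemeasurable.mul
        (Lp.aestronglyMeasurable F).enorm)
    have sq : ∀ σ ξ : ℝ, ENNReal.ofReal (wt σ ξ) ^ (2 : ℝ) = ENNReal.ofReal (wt (2 * σ) ξ) := by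
      intro σ ξ
      rw [ENNReal.rpow_two, ← ENNReal.ofReal_pow (wt_pos _ _).le, two_mul, wt_add, sq]
    refine (le_of_eq ?_).trans (h3.trans (le_of_eq ?_))
    · congr 1
      ext ξ
      simp only [Pi.mul_apply]
      rw [← mul_assoc, ← ENNReal.ofReal_mul (wt_pos _ _).le, ← wt_add]
      congr 3
      ring
    · congr 2
      · congr 1
        ext ξ
        rw [sq]
      · rw [hsq, wsq]
        congr 1
        ext ξ
        rw [ENNReal.mul_rpow_of_nonneg _ _ (by norm_num), sq, ENNReal.rpow_two]

theorem integrable_of_hsq {s : ℝ} (hs : 1 / 2 < s) {F : L2C} (h : hsq s F < ⊤) :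
    Integrable F volume := by
  obtain ⟨C, hC, hF⟩ := lintegral_wt_le (α := 0) (s := s) (by linarith)
  refine ⟨Lp.aestronglyMeasurable F, ?_⟩
  have := hF F
  simp only [wt_zero, ENNReal.ofReal_one, one_mul] at this
  exact this.trans_lt (ENNReal.mul_lt_top hC (ENNReal.rpow_lt_top_of_nonneg (by norm_num) h.ne))

theorem ae_eq_fourierInv_fourier {f : L2C} (hf : Integrable (𝓕 f : L2C) volume) :
    f =ᵐ[volume] (𝓕⁻ ((𝓕 f : L2C) : ℝ → ℂ) : ℝ → ℂ) := by
  have := fourierInv_ae (𝓕 f : L2C) hf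
  simpa using this

/-- `H^s` embeds into `L^∞` for `s > 1/2`. -/
theorem exists_sup_bound {s : ℝ} (hs : 1 / 2 < s) (M : NNReal) : ∃ R : ℝ, 0 ≤ R ∧
    ∀ f : L2C, hsq s (𝓕 f : L2C) ≤ M → ∀ᵐ x ∂(volume : Measure ℝ), ‖f x‖ ≤ R := by
  obtain ⟨C, hC, hF⟩ := lintegral_wt_le (α := 0) (s := s) (by linarith)
  refine ⟨(C * (M : ℝ≥0∞) ^ (1 / 2 : ℝ)).toReal, ENNReal.toReal_nonneg, fun f hf => ?_⟩
  have hi := integrable_of_hsq hs (hf.trans_lt ENNReal.coe_lt_top)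
  filter_upwards [ae_eq_fourierInv_fourier hi] with x hx
  rw [hx]
  refine (norm_fourierInv_le _ x).trans ?_
  rw [integral_norm_eq_lintegral_enorm hi.1]
  have h1 := hF (𝓕 f : L2C)
  simp only [wt_zero, ENNReal.ofReal_one, one_mul] at h1
  refine ENNReal.toReal_mono (ENNReal.mul_lt_top hC
    (ENNReal.rpow_lt_top_of_nonneg (by norm_num) ENNReal.coe_ne_top)).ne (h1.trans ?_)
  gcongr

/-- Interpolation between the bounds `2` and `C |h ξ|`. -/
theorem norm_chr_sub_one_le {α : ℝ} (h0 : 0 ≤ α) (h1 : α ≤ 1) (h ξ : ℝ) :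
    ‖chr h ξ - 1‖ ≤ 8 * |h| ^ α * wt α ξ := by
  have a1 : ‖chr h ξ - 1‖ ≤ 2 := by
    have := norm_sub_le (chr h ξ) 1
    rw [norm_chr, norm_one] at this
    linarith
  have a2 : ‖chr h ξ - 1‖ ≤ 8 * (|h| * |ξ|) := by
    have := Real.norm_exp_I_mul_ofReal_sub_one_le (x := 2 * Real.pi * (h * ξ))
    rw [mul_comm] at this
    refine this.trans ?_
    rw [norm_mul, norm_mul, norm_mul, Real.norm_eq_abs, Real.norm_eq_abs, Real.norm_eq_abs,
      Real.norm_eq_abs, abs_of_pos Real.pi_pos, abs_of_pos (by norm_num : (0 : ℝ) < 2)]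
    have := Real.pi_le_four
    have h3 : 0 ≤ |h| * |ξ| := by positivity
    nlinarith
  have a3 : |ξ| ^ α ≤ wt α ξ := by
    unfold wt
    have : |ξ| ^ α = (ξ ^ 2) ^ (α / 2) := by
      rw [← sq_abs, ← Real.rpow_natCast, ← Real.rpow_mul (abs_nonneg ξ)]
      congr 1
      push_cast
      ring
    rw [this]
    gcongr
    linarith
  have a4 : ‖chr h ξ - 1‖ ≤ 8 * (|h| * |ξ|) ^ α := by
    rcases le_total (|h| * |ξ|) 1 with hle | hle
    · refine a2.trans ?_
      gcongr
      exact Real.self_le_rpow_of_le_one (by positivity) hle h1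
    · refine a1.trans ?_
      have := Real.one_le_rpow hle h0
      linarith
  refine a4.trans ?_
  rw [Real.mul_rpow (abs_nonneg _) (abs_nonneg _), ← mul_assoc]
  gcongr

/-- `H^s` embeds into the `α`-Hölder functions for `s - α > 1/2`. -/
theorem exists_holder_bound {s α : ℝ} (h0 : 0 ≤ α) (h1 : α ≤ 1) (hs : 1 / 2 < s - α) (M : NNReal) :
    ∃ K : ℝ, 0 ≤ K ∧ ∀ f : L2C, hsq s (𝓕 f : L2C) ≤ M → ∀ h : ℝ,
      ∀ᵐ x ∂(volume : Measure ℝ), ‖f (x + h) - f x‖ ≤ K * |h| ^ α := by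
  obtain ⟨C, hC, hF⟩ := lintegral_wt_le (α := α) (s := s) hs
  refine ⟨8 * (C * (M : ℝ≥0∞) ^ (1 / 2 : ℝ)).toReal, by positivity, fun f hf h => ?_⟩
  have hi := integrable_of_hsq (by linarith) (hf.trans_lt ENNReal.coe_lt_top)
  have hq := (measurePreserving_add_right volume h).quasiMeasurePreserving
  have hb : C * (M : ℝ≥0∞) ^ (1 / 2 : ℝ) < ⊤ := ENNReal.mul_lt_top hC
    (ENNReal.rpow_lt_top_of_nonneg (by norm_num) ENNReal.coe_ne_top)
  have hle : ∫⁻ ξ, ENNReal.ofReal (wt α ξ) * ‖(𝓕 f : L2C) ξ‖ₑ ≤ C * (M : ℝ≥0∞) ^ (1 / 2 : ℝ) := by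
    refine (hF _).trans ?_
    gcongr
  have hint : Integrable (fun ξ => wt α ξ * ‖(𝓕 f : L2C) ξ‖) volume := by
    refine ⟨(continuous_wt α).aestronglyMeasurable.mul hi.1.norm, ?_⟩
    refine lt_of_le_of_lt (le_of_eq ?_) (hle.trans_lt hb)
    congr 1
    ext ξ
    rw [enorm_mul, enorm_norm, Real.enorm_eq_ofReal (wt_pos _ _).le]
  have hint2 : ∫ ξ, wt α ξ * ‖(𝓕 f : L2C) ξ‖ ≤ (C * (M : ℝ≥0∞) ^ (1 / 2 : ℝ)).toReal := by
    rw [integral_eq_lintegral_of_nonneg_ae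
      (Filter.Eventually.of_forall fun ξ => mul_nonneg (wt_pos _ _).le (norm_nonneg _)) hint.1]
    refine ENNReal.toReal_mono hb.ne (le_trans (le_of_eq ?_) hle)
    congr 1
    ext ξ
    rw [ENNReal.ofReal_mul (wt_pos _ _).le, ofReal_norm]
  filter_upwards [ae_eq_fourierInv_fourier hi, hq.ae (ae_eq_fourierInv_fourier hi)] with x hx hx'
  rw [hx, hx', Real.fourierInv_eq', Real.fourierInv_eq', ← integral_sub]
  · refine (norm_integral_le_of_norm_le (hint.const_mul (8 * |h| ^ α))
      (Filter.Eventually.of_forall fun ξ => ?_)).trans ?_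
    · have hc : Complex.exp ((2 * Real.pi * inner ℝ ξ (x + h) : ℝ) * Complex.I) =
          Complex.exp ((2 * Real.pi * inner ℝ ξ x : ℝ) * Complex.I) * chr h ξ := by
        rw [chr, ← Complex.exp_add, ← add_mul, ← Complex.ofReal_add]
        congr 3
        have hin : ∀ y z : ℝ, inner ℝ y z = z * y := fun y z => by simp
        rw [hin, hin]
        ring
      rw [hc, smul_eq_mul, smul_eq_mul, ← sub_mul, ← mul_sub_one, norm_mul, norm_mul,
        Complex.norm_exp_ofReal_mul_I, one_mul, ← mul_assoc]
      gcongr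
      exact norm_chr_sub_one_le h0 h1 h ξ
    · rw [integral_const_mul]
      have : 0 ≤ 8 * |h| ^ α := by positivity
      nlinarith
  · have := (Real.fourierIntegral_convergent_iff (-(x + h)) (f := ((𝓕 f : L2C) : ℝ → ℂ))).2 hi
    refine this.congr (Filter.Eventually.of_forall fun ξ => ?_)
    simp only [Circle.smul_def, Real.fourierChar_apply]
    congr 2
    simp
    ring
  · have := (Real.fourierIntegral_convergent_iff (-x) (f := ((𝓕 f : L2C) : ℝ → ℂ))).2 hi
    refine this.congr (Filter.Eventually.of_forall fun ξ => ?_)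
    simp [Circle.smul_def, Real.fourierChar_apply]

/-! ### Superposition operators on `L²` -/

theorem exists_lipschitz {g : ℝ → ℝ} (hg : ContDiff ℝ 1 g) (R : ℝ) : ∃ K : ℝ, 0 ≤ K ∧
    ∀ x y, |x| ≤ R → |y| ≤ R → |g x - g y| ≤ K * |x - y| := by
  have hc : Continuous (deriv g) := hg.continuous_deriv le_rfl
  obtain ⟨K, hK⟩ := (isCompact_Icc (a := -R) (b := R)).exists_bound_of_continuousOn hc.continuousOn
  refine ⟨max K 0, le_max_right _ _, fun x y hx hy => ?_⟩
  exact (convex_Icc (-R) R).norm_image_sub_le_of_norm_deriv_le (𝕜 := ℝ) (f := g)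
    (fun z _ => hg.differentiable one_ne_zero z)
    (fun z hz => (hK z hz).trans (le_max_left _ _)) (abs_le.1 hy) (abs_le.1 hx)

open Classical in
/-- The superposition operator `u ↦ g ∘ u` on `L²` (zero if `g ∘ u` is not in `L²`). -/
def nem (g : ℝ → ℝ) (u : L2) : L2 :=
  if h : MemLp (fun x => g (u x)) 2 volume then h.toLp _ else 0

theorem nem_ae {g : ℝ → ℝ} (hg : Continuous g) (g0 : g 0 = 0) {R K : ℝ}
    (hK : ∀ x y, |x| ≤ R → |y| ≤ R → |g x - g y| ≤ K * |x - y|) {u : L2}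
    (hu : ∀ᵐ x ∂(volume : Measure ℝ), |u x| ≤ R) :
    nem g u =ᵐ[volume] fun x => g (u x) := by
  have : MemLp (fun x => g (u x)) 2 volume := by
    refine (Lp.memLp u).of_le_mul (c := K)
      (hg.comp_aestronglyMeasurable (Lp.aestronglyMeasurable u)) ?_
    filter_upwards [hu] with x hx
    have := hK (u x) 0 hx (by simpa using (abs_nonneg _).trans hx)
    simpa [g0] using this
  rw [nem, dif_pos this]
  exact this.coeFn_toLp

theorem norm_nem_sub_le {g : ℝ → ℝ} (hg : Continuous g) (g0 : g 0 = 0) {R K : ℝ}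
    (hK : ∀ x y, |x| ≤ R → |y| ≤ R → |g x - g y| ≤ K * |x - y|) {u v : L2}
    (hu : ∀ᵐ x ∂(volume : Measure ℝ), |u x| ≤ R) (hv : ∀ᵐ x ∂(volume : Measure ℝ), |v x| ≤ R) :
    ‖nem g u - nem g v‖ ≤ K * ‖u - v‖ := by
  apply Lp.norm_le_mul_norm_of_ae_le_mul
  filter_upwards [nem_ae hg g0 hK hu, nem_ae hg g0 hK hv, Lp.coeFn_sub (nem g u) (nem g v),
    Lp.coeFn_sub u v, hu, hv] with x h1 h2 h3 h4 h5 h6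
  rw [h3, h4, Pi.sub_apply, Pi.sub_apply, h1, h2]
  exact hK _ _ h5 h6

theorem norm_nem_le {g : ℝ → ℝ} (hg : Continuous g) (g0 : g 0 = 0) {R K : ℝ}
    (hK : ∀ x y, |x| ≤ R → |y| ≤ R → |g x - g y| ≤ K * |x - y|) {u : L2}
    (hu : ∀ᵐ x ∂(volume : Measure ℝ), |u x| ≤ R) : ‖nem g u‖ ≤ K * ‖u‖ := by
  apply Lp.norm_le_mul_norm_of_ae_le_mul
  filter_upwards [nem_ae hg g0 hK hu, hu] with x h1 hx
  rw [h1]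
  have := hK (u x) 0 hx (by simpa using (abs_nonneg _).trans hx)
  simpa [g0] using this

theorem wsq_ds_nem_le {g : ℝ → ℝ} (hg : Continuous g) (g0 : g 0 = 0) {R K : ℝ}
    (hK0 : 0 ≤ K) (hK : ∀ x y, |x| ≤ R → |y| ≤ R → |g x - g y| ≤ K * |x - y|) {u : L2}
    (hu : ∀ᵐ x ∂(volume : Measure ℝ), |u x| ≤ R) (h : ℝ) :
    wsq (ds h) (𝓕 (cplx (nem g u)) : L2C) ≤ ENNReal.ofReal (K ^ 2) *
      wsq (ds h) (𝓕 (cplx u) : L2C) := by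
  have hq := (measurePreserving_add_right volume h).quasiMeasurePreserving
  have : ‖shift h (cplx (nem g u)) - cplx (nem g u)‖ ≤ K * ‖shift h (cplx u) - cplx u‖ := by
    apply Lp.norm_le_mul_norm_of_ae_le_mul
    filter_upwards [nem_ae hg g0 hK hu, hq.ae (nem_ae hg g0 hK hu), hu, hq.ae hu,
      shift_ae h (cplx u), shift_ae h (cplx (nem g u)), cplx_ae u, hq.ae (cplx_ae u),
      cplx_ae (nem g u), hq.ae (cplx_ae (nem g u)),
      Lp.coeFn_sub (shift h (cplx (nem g u))) (cplx (nem g u)),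
      Lp.coeFn_sub (shift h (cplx u)) (cplx u)] with x a1 a2 a3 a4 a5 a6 a7 a8 a9 a10 a11 a12
    rw [a11, a12, Pi.sub_apply, Pi.sub_apply, a5, a6, a7, a8, a9, a10, a1, a2,
      ← Complex.ofReal_sub, ← Complex.ofReal_sub, Complex.norm_real, Complex.norm_real]
    exact hK _ _ a4 a3
  rw [← enorm_shift_sub_sq, ← enorm_shift_sub_sq, ENNReal.ofReal_pow hK0, ← mul_pow]
  gcongr
  rw [← ofReal_norm, ← ofReal_norm, ← ENNReal.ofReal_mul hK0]
  exact ENNReal.ofReal_le_ofReal this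

/-- Superposition operators act boundedly on `H^σ`, `σ ≤ 1`, along bounded functions. -/
theorem hsq_nem_le {g : ℝ → ℝ} (hg : Continuous g) (g0 : g 0 = 0) {R K : ℝ}
    (hK0 : 0 ≤ K) (hK : ∀ x y, |x| ≤ R → |y| ≤ R → |g x - g y| ≤ K * |x - y|) {u : L2}
    (hu : ∀ᵐ x ∂(volume : Measure ℝ), |u x| ≤ R) {σ : ℝ} (h0 : 0 < σ) (h1 : σ ≤ 1) :
    hsq σ (𝓕 (cplx (nem g u)) : L2C) ≤ ENNReal.ofReal (2 * K ^ 2) *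
      hsq σ (𝓕 (cplx u) : L2C) := by
  have a1 := wsq_abs_le_of_ds h0 h1 (Lp.aestronglyMeasurable _) (Lp.aestronglyMeasurable _)
    ENNReal.ofReal_ne_top (wsq_ds_nem_le hg g0 hK0 hK hu)
  have a2 := wsq_abs_le_hsq h0.le (𝓕 (cplx u) : L2C)
  have a3 : ‖(𝓕 (cplx (nem g u)) : L2C)‖ₑ ^ 2 ≤
      ENNReal.ofReal (K ^ 2) * hsq σ (𝓕 (cplx u) : L2C) := by
    refine le_trans ?_ (mul_le_mul_right (hsq_mono h0.le _) _)
    rw [hsq_zero, ENNReal.ofReal_pow hK0, ← mul_pow, enorm_fourier, enorm_fourier]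
    gcongr
    rw [← ofReal_norm, ← ofReal_norm, ← ENNReal.ofReal_mul hK0, norm_cplx, norm_cplx]
    exact ENNReal.ofReal_le_ofReal (norm_nem_le hg g0 hK hu)
  refine (hsq_le_add_abs h0.le h1 _).trans ((add_le_add a3 (a1.trans
    (mul_le_mul_right a2 _))).trans (le_of_eq ?_))
  rw [← two_mul, ← mul_assoc, ENNReal.ofReal_mul (by norm_num)]
  norm_num

/-! ### Products in Sobolev spaces -/

/-- Young's inequality `‖a * b‖₂ ≤ ‖a‖₂ ‖b‖₁` for nonnegative functions. -/
theorem lintegral_conv_sq_le {a b : ℝ → ℝ≥0∞} (ha : AEMeasurable a volume)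
    (hb : AEMeasurable b volume) :
    ∫⁻ ξ, (∫⁻ η, a η * b (ξ - η)) ^ 2 ≤ (∫⁻ η, b η) ^ 2 * ∫⁻ η, a η ^ 2 := by
  have hq : ∀ ξ : ℝ, Measure.QuasiMeasurePreserving (fun η : ℝ => ξ - η) volume volume := fun ξ =>
    (Measure.measurePreserving_sub_left volume ξ).quasiMeasurePreserving
  have hbs : ∀ ξ : ℝ, ∫⁻ η, b (ξ - η) = ∫⁻ η, b η := fun ξ => lintegral_sub_left_eq_self b ξ
  have h1 : ∀ ξ, (∫⁻ η, a η * b (ξ - η)) ^ 2 ≤ (∫⁻ η, a η ^ 2 * b (ξ - η)) * ∫⁻ η, b η := by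
    intro ξ
    have hbm : AEMeasurable (fun η => b (ξ - η)) volume := hb.comp_quasiMeasurePreserving (hq ξ)
    have h2 := ENNReal.lintegral_mul_le_Lp_mul_Lq (volume : Measure ℝ)
      (p := 2) (q := 2) Real.HolderConjugate.two_two
      (f := fun η => a η * b (ξ - η) ^ (1 / 2 : ℝ)) (g := fun η => b (ξ - η) ^ (1 / 2 : ℝ))
      (ha.mul (hbm.pow_const _)) (hbm.pow_const _)
    have hhalf : ∀ x : ℝ≥0∞, x ^ (1 / 2 : ℝ) * x ^ (1 / 2 : ℝ) = x := by
      intro x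
      rw [← ENNReal.rpow_add_of_nonneg _ _ (by norm_num) (by norm_num)]
      norm_num
    have hhalf2 : ∀ x : ℝ≥0∞, (x ^ (1 / 2 : ℝ)) ^ (2 : ℝ) = x := by
      intro x
      rw [← ENNReal.rpow_mul]
      norm_num
    simp only [Pi.mul_apply, mul_assoc, hhalf, ENNReal.mul_rpow_of_nonneg _ _ zero_le_two,
      hhalf2] at h2
    rw [hbs] at h2
    calc _ ≤ ((∫⁻ η, a η ^ (2 : ℝ) * b (ξ - η)) ^ (1 / 2 : ℝ) *
          (∫⁻ η, b η) ^ (1 / 2 : ℝ)) ^ 2 := by gcongr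
      _ = _ := by
        rw [mul_pow, ← ENNReal.rpow_two, ← ENNReal.rpow_two, hhalf2, hhalf2]
        simp_rw [ENNReal.rpow_two]
  calc _ ≤ ∫⁻ ξ, (∫⁻ η, a η ^ 2 * b (ξ - η)) * ∫⁻ η, b η := lintegral_mono h1
    _ ≤ (∫⁻ ξ, ∫⁻ η, a η ^ 2 * b (ξ - η)) * ∫⁻ η, b η := by
        rw [lintegral_mul_const'']
        refine AEMeasurable.lintegral_prod_right' (f := fun p : ℝ × ℝ => a p.2 ^ 2 * b (p.1 - p.2)) ?_
        exact (ha.comp_snd.pow_const 2).mul (hb.comp_quasiMeasurePreserving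
          (quasiMeasurePreserving_sub volume volume))
    _ = _ := by
        rw [lintegral_lintegral_swap]
        · have h3 : ∀ η, ∫⁻ ξ, a η ^ 2 * b (ξ - η) = a η ^ 2 * ∫⁻ ξ, b ξ := by
            intro η
            rw [lintegral_const_mul'', lintegral_sub_right_eq_self b η]
            exact hb.comp_quasiMeasurePreserving
              (measurePreserving_sub_right volume η).quasiMeasurePreserving
          simp_rw [h3]
          rw [lintegral_mul_const'' _ (ha.pow_const 2)]
          ring
        · exact (ha.comp_snd.pow_const 2).mul (hb.comp_quasiMeasurePreserving
            (quasiMeasurePreserving_sub volume volume))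

theorem wt_add_le {τ : ℝ} (hτ : 0 ≤ τ) (x y : ℝ) : wt τ (x + y) ≤ 2 ^ τ * (wt τ x + wt τ y) := by
  have key : ∀ x y : ℝ, |y| ≤ |x| → wt τ (x + y) ≤ 2 ^ τ * wt τ x := by
    intro x y h
    have h1 : 1 + (x + y) ^ 2 ≤ 2 ^ 2 * (1 + x ^ 2) := by
      have : y ^ 2 ≤ x ^ 2 := sq_le_sq.2 h
      nlinarith [sq_nonneg (x - y)]
    unfold wt
    calc (1 + (x + y) ^ 2) ^ (τ / 2) ≤ (2 ^ 2 * (1 + x ^ 2)) ^ (τ / 2) := by gcongr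
      _ = _ := by
        rw [Real.mul_rpow (by norm_num) (by positivity), ← Real.rpow_natCast,
          ← Real.rpow_mul (by norm_num)]
        congr 2
        push_cast
        ring
  have h2 : (0 : ℝ) < 2 ^ τ := by positivity
  rcases le_total |y| |x| with h | h
  · have := key x y h
    nlinarith [wt_pos τ x, wt_pos τ y]
  · have := key y x h
    rw [add_comm y x] at this
    nlinarith [wt_pos τ x, wt_pos τ y]

/-- `H^τ` is an algebra for `τ > 1/2`. -/
theorem exists_hsq_mul_le {τ : ℝ} (hτ : 1 / 2 < τ) (M M' : NNReal) : ∃ C : NNReal,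
    ∀ p q r : L2C, hsq τ (𝓕 p : L2C) ≤ M → hsq τ (𝓕 q : L2C) ≤ M' →
      (r =ᵐ[volume] fun x => p x * q x) → hsq τ (𝓕 r : L2C) ≤ C := by
  obtain ⟨D, hD, hF⟩ := lintegral_wt_le (α := 0) (s := τ) (by linarith)
  simp only [wt_zero, ENNReal.ofReal_one, one_mul] at hF
  set B : ℝ≥0∞ := 2 * ENNReal.ofReal ((2 ^ τ) ^ 2) *
    ((D * (M' : ℝ≥0∞) ^ (1 / 2 : ℝ)) ^ 2 * M + (D * (M : ℝ≥0∞) ^ (1 / 2 : ℝ)) ^ 2 * M') with hB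
  have hBt : B ≠ ⊤ := by
    have h1 : ∀ N : NNReal, D * (N : ℝ≥0∞) ^ (1 / 2 : ℝ) ≠ ⊤ := fun N =>
      (ENNReal.mul_lt_top hD (ENNReal.rpow_lt_top_of_nonneg (by norm_num) ENNReal.coe_ne_top)).ne
    refine ENNReal.mul_ne_top (ENNReal.mul_ne_top (by norm_num) ENNReal.ofReal_ne_top)
      (ENNReal.add_ne_top.2 ⟨?_, ?_⟩) <;>
    exact ENNReal.mul_ne_top (ENNReal.pow_ne_top (h1 _)) ENNReal.coe_ne_top
  refine ⟨B.toNNReal, fun p q r hp hq hr => ?_⟩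
  rw [ENNReal.coe_toNNReal hBt]
  set P : L2C := 𝓕 p with hP
  set Q : L2C := 𝓕 q with hQ
  have iP := integrable_of_hsq hτ (hp.trans_lt ENNReal.coe_lt_top)
  have iQ := integrable_of_hsq hτ (hq.trans_lt ENNReal.coe_lt_top)
  -- the transform of the product is the convolution `R` of the transforms
  set R : ℝ → ℂ := fun ξ => ∫ η, P η * Q (ξ - η) with hR
  have hRc : R = convolution P Q (ContinuousLinearMap.mul ℂ ℂ) volume := by
    ext ξ
    simp [hR, convolution]
  have hRm : AEStronglyMeasurable R volume := by
    rw [hRc]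
    exact (iP.integrable_convolution (ContinuousLinearMap.mul ℂ ℂ) iQ).aestronglyMeasurable
  have mP : AEMeasurable (fun ξ => ‖P ξ‖ₑ) volume := iP.1.enorm
  have mQ : AEMeasurable (fun ξ => ‖Q ξ‖ₑ) volume := iQ.1.enorm
  have mw : AEMeasurable (fun ξ => ENNReal.ofReal (wt τ ξ)) volume :=
    (continuous_wt _).measurable.ennreal_ofReal.aemeasurable
  have hqm : ∀ ξ : ℝ, Measure.QuasiMeasurePreserving (fun η : ℝ => ξ - η) volume volume := fun ξ =>
    (Measure.measurePreserving_sub_left volume ξ).quasiMeasurePreserving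
  -- `wt τ ξ ≤ 2 ^ τ (wt τ η + wt τ (ξ - η))` lets the weight fall on one of the two factors
  have hpt : ∀ ξ, ENNReal.ofReal (wt (2 * τ) ξ) * ‖R ξ‖ₑ ^ 2 ≤
      2 * ENNReal.ofReal ((2 ^ τ) ^ 2) *
      ((∫⁻ η, (ENNReal.ofReal (wt τ η) * ‖P η‖ₑ) * ‖Q (ξ - η)‖ₑ) ^ 2 +
       (∫⁻ η, (ENNReal.ofReal (wt τ η) * ‖Q η‖ₑ) * ‖P (ξ - η)‖ₑ) ^ 2) := by
    intro ξ
    have e1 : ∫⁻ η, (ENNReal.ofReal (wt τ η) * ‖Q η‖ₑ) * ‖P (ξ - η)‖ₑ =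
        ∫⁻ η, (ENNReal.ofReal (wt τ (ξ - η)) * ‖Q (ξ - η)‖ₑ) * ‖P η‖ₑ := by
      rw [← lintegral_sub_left_eq_self _ ξ]
      simp
    have e2 : ENNReal.ofReal (wt τ ξ) * ‖R ξ‖ₑ ≤ ENNReal.ofReal (2 ^ τ) *
        ((∫⁻ η, (ENNReal.ofReal (wt τ η) * ‖P η‖ₑ) * ‖Q (ξ - η)‖ₑ) +
        ∫⁻ η, (ENNReal.ofReal (wt τ (ξ - η)) * ‖Q (ξ - η)‖ₑ) * ‖P η‖ₑ) := by
      calc _ ≤ ENNReal.ofReal (wt τ ξ) * ∫⁻ η, ‖P η * Q (ξ - η)‖ₑ := by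
            gcongr
            exact enorm_integral_le_lintegral_enorm _
        _ = ∫⁻ η, ENNReal.ofReal (wt τ ξ) * ‖P η * Q (ξ - η)‖ₑ :=
            (lintegral_const_mul' _ _ ENNReal.ofReal_ne_top).symm
        _ ≤ ∫⁻ η, ENNReal.ofReal (2 ^ τ) * ((ENNReal.ofReal (wt τ η) * ‖P η‖ₑ) * ‖Q (ξ - η)‖ₑ +
              (ENNReal.ofReal (wt τ (ξ - η)) * ‖Q (ξ - η)‖ₑ) * ‖P η‖ₑ) := by
            apply lintegral_mono
            intro η
            have := wt_add_le (by linarith : 0 ≤ τ) η (ξ - η)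
            rw [add_sub_cancel] at this
            calc ENNReal.ofReal (wt τ ξ) * ‖P η * Q (ξ - η)‖ₑ
                ≤ ENNReal.ofReal (2 ^ τ * (wt τ η + wt τ (ξ - η))) * ‖P η * Q (ξ - η)‖ₑ := by
                  gcongr
              _ = _ := by
                  rw [ENNReal.ofReal_mul (by positivity),
                    ENNReal.ofReal_add (wt_pos _ _).le (wt_pos _ _).le, enorm_mul]
                  ring
        _ = _ := by
            rw [lintegral_const_mul' _ _ ENNReal.ofReal_ne_top, lintegral_add_left']
            exact (mw.mul mP).mul (mQ.comp_quasiMeasurePreserving (hqm ξ))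
    rw [e1, two_mul τ, wt_add, ENNReal.ofReal_mul (wt_pos _ _).le, ← sq, ← mul_pow]
    refine (pow_le_pow_left' e2 2).trans ?_
    rw [mul_pow, mul_comm 2 (ENNReal.ofReal _), mul_assoc, ENNReal.ofReal_pow (by positivity)]
    gcongr
    have := ENNReal.rpow_add_le_mul_rpow_add_rpow
      (∫⁻ η, (ENNReal.ofReal (wt τ η) * ‖P η‖ₑ) * ‖Q (ξ - η)‖ₑ)
      (∫⁻ η, (ENNReal.ofReal (wt τ (ξ - η)) * ‖Q (ξ - η)‖ₑ) * ‖P η‖ₑ) (one_le_two (α := ℝ))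
    simpa [ENNReal.rpow_two, show (2 : ℝ) - 1 = 1 by norm_num] using this
  have hsq_eq : ∀ A : L2C, ∫⁻ η, (ENNReal.ofReal (wt τ η) * ‖A η‖ₑ) ^ 2 = hsq τ A := by
    intro A
    rw [hsq, wsq]
    congr 1
    ext η
    rw [mul_pow, two_mul τ, wt_add, ENNReal.ofReal_mul (wt_pos _ _).le, ← sq]
  -- in each convolution one factor is in `L²` and the other in `L¹`, so Young's inequality applies
  have hRle : hsq τ R ≤ B := by
    refine (lintegral_mono hpt).trans ?_
    rw [lintegral_const_mul' _ _ (ENNReal.mul_ne_top (by norm_num) ENNReal.ofReal_ne_top), hB]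
    gcongr
    rw [lintegral_add_left']
    swap
    · refine AEMeasurable.pow_const (AEMeasurable.lintegral_prod_right'
        (f := fun p : ℝ × ℝ => ENNReal.ofReal (wt τ p.2) * ‖P p.2‖ₑ * ‖Q (p.1 - p.2)‖ₑ) ?_) 2
      exact (mw.mul mP).comp_snd.mul (mQ.comp_quasiMeasurePreserving
        (quasiMeasurePreserving_sub volume volume))
    gcongr
    · refine (lintegral_conv_sq_le (mw.mul mP) mQ).trans ?_
      simp only [Pi.mul_apply]
      rw [hsq_eq]
      gcongr
      refine (hF Q).trans ?_
      gcongr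
    · refine (lintegral_conv_sq_le (mw.mul mQ) mP).trans ?_
      simp only [Pi.mul_apply]
      rw [hsq_eq]
      gcongr
      refine (hF P).trans ?_
      gcongr
  have hR2 : MemLp R 2 volume := by
    refine ⟨hRm, ?_⟩
    rw [eLpNorm_lt_top_iff_lintegral_rpow_enorm_lt_top (by norm_num) (by norm_num)]
    refine lt_of_le_of_lt ?_ (hRle.trans_lt hBt.lt_top)
    refine le_trans (le_of_eq ?_) (hsq_mono (by linarith : (0 : ℝ) ≤ τ) R)
    simp [hsq, wsq, wt_zero]
  have hR1 : Integrable R volume := by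
    rw [hRc]
    exact iP.integrable_convolution (ContinuousLinearMap.mul ℂ ℂ) iQ
  -- inverse transforms of integrable functions turn the convolution into a product
  have hr2 : r = 𝓕⁻ (hR2.toLp R) := by
    apply Lp.ext
    have c1 := fourierInv_ae (hR2.toLp R) (hR1.congr hR2.coeFn_toLp.symm)
    filter_upwards [hr, ae_eq_fourierInv_fourier iP, ae_eq_fourierInv_fourier iQ, c1]
      with x d1 d2 d3 d4
    rw [d1, d2, d3, d4]
    have c2 : (𝓕⁻ ((hR2.toLp R : L2C) : ℝ → ℂ) : ℝ → ℂ) = 𝓕⁻ R := by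
      ext y
      rw [Real.fourierInv_eq', Real.fourierInv_eq']
      apply integral_congr_ae
      filter_upwards [hR2.coeFn_toLp] with ξ hξ
      rw [hξ]
    rw [c2, Real.fourierInv_eq_fourier_neg, Real.fourierInv_eq_fourier_neg,
      Real.fourierInv_eq_fourier_neg, hRc, Real.fourier_mul_convolution_eq iP iQ]
  rw [hr2]
  have c3 : (𝓕 (𝓕⁻ (hR2.toLp R) : L2C) : L2C) = hR2.toLp R := by simp
  rw [c3, hsq, wsq_congr hR2.coeFn_toLp]
  exact hRle

/-! ### The chain rule -/

theorem enorm_add_sq_le (a b : ℂ) : ‖a + b‖ₑ ^ 2 ≤ 2 * (‖a‖ₑ ^ 2 + ‖b‖ₑ ^ 2) := by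
  have h1 := ENNReal.rpow_add_le_mul_rpow_add_rpow ‖a‖ₑ ‖b‖ₑ (one_le_two (α := ℝ))
  simp only [ENNReal.rpow_two, show (2 : ℝ) - 1 = 1 by norm_num, ENNReal.rpow_one] at h1
  exact (pow_le_pow_left' (enorm_add_le a b) 2).trans h1

theorem wsq_add_fun_le {m : ℝ → ℝ} (hm : Measurable m) (F G : L2C) :
    wsq m (F + G : L2C) ≤ 2 * (wsq m F + wsq m G) := by
  rw [wsq_congr (Lp.coeFn_add F G)]
  unfold wsq
  rw [← lintegral_add_left', ← lintegral_const_mul' _ _ (by norm_num)]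
  · apply lintegral_mono
    intro ξ
    calc ENNReal.ofReal (m ξ) * ‖F ξ + G ξ‖ₑ ^ 2
        ≤ ENNReal.ofReal (m ξ) * (2 * (‖F ξ‖ₑ ^ 2 + ‖G ξ‖ₑ ^ 2)) := by
          gcongr
          exact enorm_add_sq_le _ _
      _ = _ := by ring
  · exact hm.ennreal_ofReal.aemeasurable.mul ((Lp.aestronglyMeasurable F).enorm.pow_const 2)

theorem wsq_smul (m : ℝ → ℝ) (c : ℝ) (F : L2C) :
    wsq m (c • F : L2C) = ENNReal.ofReal (c ^ 2) * wsq m F := by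
  rw [wsq_congr (Lp.coeFn_smul c F)]
  unfold wsq
  rw [← lintegral_const_mul' _ _ ENNReal.ofReal_ne_top]
  congr 1
  ext ξ
  have : ‖c‖ₑ ^ 2 = ENNReal.ofReal (c ^ 2) := by
    rw [← ofReal_norm, ← ENNReal.ofReal_pow (norm_nonneg _), Real.norm_eq_abs, sq_abs]
  rw [Pi.smul_apply, enorm_smul, mul_pow, this]
  ring

theorem fourier_add (f g : L2C) : (𝓕 (f + g) : L2C) = 𝓕 f + 𝓕 g :=
  (Lp.fourierTransformₗᵢ ℝ ℂ).map_add f g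

theorem fourier_smul_real (c : ℝ) (f : L2C) : (𝓕 (c • f) : L2C) = c • (𝓕 f : L2C) :=
  (Lp.fourierTransformₗᵢ ℝ ℂ).toLinearEquiv.toLinearMap.map_smul_of_tower c f

/-- The difference quotient with step `1 / (n + 1)`. -/
def dq (n : ℕ) (f : L2C) : L2C := ((n : ℝ) + 1) • (shift (1 / ((n : ℝ) + 1)) f - f)

theorem fourier_dq_ae (n : ℕ) (f : L2C) : (𝓕 (dq n f) : L2C) =ᵐ[volume] fun ξ =>
    (((n : ℝ) + 1 : ℝ) : ℂ) * (chr (1 / ((n : ℝ) + 1)) ξ - 1) * (𝓕 f : L2C) ξ := by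
  have h0 : (𝓕 (shift (1 / ((n : ℝ) + 1)) f - f) : L2C) = 𝓕 (shift (1 / ((n : ℝ) + 1)) f) - 𝓕 f :=
    (Lp.fourierTransformₗᵢ ℝ ℂ).map_sub _ _
  rw [dq, fourier_smul_real, h0]
  filter_upwards [Lp.coeFn_smul ((n : ℝ) + 1)
      ((𝓕 (shift (1 / ((n : ℝ) + 1)) f) : L2C) - 𝓕 f),
    Lp.coeFn_sub (𝓕 (shift (1 / ((n : ℝ) + 1)) f) : L2C) (𝓕 f),
    fourier_shift_ae (1 / ((n : ℝ) + 1)) f] with ξ h1 h2 h3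
  rw [h1, Pi.smul_apply, h2, Pi.sub_apply, h3, Complex.real_smul]
  ring

theorem tendsto_chr_quotient (ξ : ℝ) :
    Tendsto (fun n : ℕ => (((n : ℝ) + 1 : ℝ) : ℂ) * (chr (1 / ((n : ℝ) + 1)) ξ - 1)) atTop
      (𝓝 ((2 * Real.pi * ξ : ℝ) * Complex.I)) := by
  have hd : HasDerivAt (fun t : ℝ => chr t ξ) ((2 * Real.pi * ξ : ℝ) * Complex.I) 0 := by
    have h1 : HasDerivAt (fun t : ℝ => 2 * Real.pi * (t * ξ)) (2 * Real.pi * ξ) 0 := by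
      simpa using ((hasDerivAt_id (0 : ℝ)).mul_const ξ).const_mul (2 * Real.pi)
    have h2 := (h1.ofReal_comp.mul_const Complex.I).cexp
    simpa [chr] using h2
  have h4 := hd.tendsto_slope_zero_right
  have h5 : Tendsto (fun n : ℕ => 1 / ((n : ℝ) + 1)) atTop (𝓝[>] 0) :=
    tendsto_nhdsWithin_iff.2 ⟨tendsto_one_div_add_atTop_nhds_zero_nat,
      Filter.Eventually.of_forall fun n => by simp only [Set.mem_Ioi]; positivity⟩
  refine (h4.comp h5).congr fun n => ?_
  simp [chr]

theorem norm_chr_quotient_le (n : ℕ) (ξ : ℝ) :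
    ‖(((n : ℝ) + 1 : ℝ) : ℂ) * (chr (1 / ((n : ℝ) + 1)) ξ - 1)‖ ≤ 2 * Real.pi * |ξ| := by
  have h1 : ‖chr (1 / ((n : ℝ) + 1)) ξ - 1‖ ≤ |2 * Real.pi * (1 / ((n : ℝ) + 1) * ξ)| := by
    apply abs_le_of_sq_le_sq' _ (abs_nonneg _) |>.2
    rw [norm_chr_sub_one_sq, sq_abs]
    exact ds_le_sq _ _
  have hn : (0 : ℝ) < n + 1 := by positivity
  rw [norm_mul, Complex.norm_real, Real.norm_of_nonneg hn.le]
  refine (mul_le_mul_of_nonneg_left h1 hn.le).trans (le_of_eq ?_)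
  rw [abs_mul, abs_mul, abs_mul, abs_of_pos Real.pi_pos, abs_of_pos (two_pos (α := ℝ)),
    abs_of_pos (by positivity : 0 < 1 / ((n : ℝ) + 1))]
  field_simp

/-- `d` is the derivative of `f` in `L²`, on the Fourier side. -/
def IsDeriv (f d : L2C) : Prop :=
  (𝓕 d : L2C) =ᵐ[volume] fun ξ => ((2 * Real.pi * ξ : ℝ) * Complex.I) * (𝓕 f : L2C) ξ

theorem exists_isDeriv {f : L2C} (h : hsq 1 (𝓕 f : L2C) < ⊤) : ∃ d, IsDeriv f d := by
  have hm : MemLp (fun ξ => ((2 * Real.pi * ξ : ℝ) * Complex.I) * (𝓕 f : L2C) ξ) 2 volume := by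
    refine ⟨?_, ?_⟩
    · exact (Continuous.aestronglyMeasurable (by fun_prop)).mul (Lp.aestronglyMeasurable _)
    rw [eLpNorm_lt_top_iff_lintegral_rpow_enorm_lt_top (by norm_num) (by norm_num)]
    refine lt_of_le_of_lt ?_ (ENNReal.mul_lt_top
      (ENNReal.ofReal_lt_top (r := (2 * Real.pi) ^ 2)) h)
    rw [hsq, ← wsq_const_mul (by positivity)]
    apply lintegral_mono
    intro ξ
    simp only [ENNReal.toReal_ofNat, ENNReal.rpow_ofNat]
    rw [enorm_mul, mul_pow]
    gcongr
    rw [← ofReal_norm, norm_mul, Complex.norm_real, Complex.norm_I, mul_one,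
      ← ENNReal.ofReal_pow (norm_nonneg _), Real.norm_eq_abs, sq_abs, mul_one, wt_two]
    apply ENNReal.ofReal_le_ofReal
    nlinarith [sq_nonneg (2 * Real.pi)]
  refine ⟨𝓕⁻ (hm.toLp _), ?_⟩
  have : (𝓕 (𝓕⁻ (hm.toLp _) : L2C) : L2C) = hm.toLp _ := by simp
  rw [IsDeriv, this]
  exact hm.coeFn_toLp

theorem norm_sq_eq_toReal (F : L2C) : ‖F‖ ^ 2 = (‖F‖ₑ ^ 2).toReal := by simp

/-- The difference quotients converge to the derivative in `L²`, by dominated convergence on the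
Fourier side. -/
theorem IsDeriv.tendsto {f d : L2C} (h : IsDeriv f d) :
    Tendsto (fun n => dq n f) atTop (𝓝 d) := by
  rw [tendsto_iff_norm_sub_tendsto_zero]
  have hF : ∀ n, ‖dq n f - d‖ₑ ^ 2 = ∫⁻ ξ, ‖((((n : ℝ) + 1 : ℝ) : ℂ) *
      (chr (1 / ((n : ℝ) + 1)) ξ - 1) - ((2 * Real.pi * ξ : ℝ) * Complex.I)) *
        (𝓕 f : L2C) ξ‖ₑ ^ 2 := by
    intro n
    have h0 : (𝓕 (dq n f - d) : L2C) = 𝓕 (dq n f) - 𝓕 d :=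
      (Lp.fourierTransformₗᵢ ℝ ℂ).map_sub _ _
    rw [← enorm_fourier, enorm_sq_eq_wsq, wsq, h0]
    apply lintegral_congr_ae
    filter_upwards [Lp.coeFn_sub (𝓕 (dq n f) : L2C) (𝓕 d), fourier_dq_ae n f, h] with ξ h1 h2 h3
    rw [h1, Pi.sub_apply, h2, h3, ← sub_mul]
    simp
  have hlim : Tendsto (fun n => ‖dq n f - d‖ₑ ^ 2) atTop (𝓝 0) := by
    simp_rw [hF]
    have : (0 : ℝ≥0∞) = ∫⁻ ξ : ℝ, 0 := by simp
    rw [this]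
    refine tendsto_lintegral_of_dominated_convergence'
      (fun ξ => 4 * ‖(𝓕 d : L2C) ξ‖ₑ ^ 2) (fun n => ?_) (fun n => ?_) ?_ ?_
    · refine (AEStronglyMeasurable.enorm ?_).pow_const 2
      refine AEStronglyMeasurable.mul (Continuous.aestronglyMeasurable ?_)
        (Lp.aestronglyMeasurable _)
      unfold chr
      fun_prop
    · filter_upwards [h] with ξ h3
      rw [h3, enorm_mul, mul_pow, enorm_mul, mul_pow, ← mul_assoc]
      gcongr
      rw [show (4 : ℝ≥0∞) = 2 ^ 2 by norm_num, ← mul_pow]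
      gcongr
      have h4 := norm_chr_quotient_le n ξ
      have h5 : ‖((2 * Real.pi * ξ : ℝ) : ℂ) * Complex.I‖ = 2 * Real.pi * |ξ| := by
        rw [norm_mul, Complex.norm_I, mul_one, Complex.norm_real, Real.norm_eq_abs, abs_mul,
          abs_of_pos Real.two_pi_pos]
      rw [← ofReal_norm, ← ofReal_norm, show (2 : ℝ≥0∞) = ENNReal.ofReal 2 by simp,
        ← ENNReal.ofReal_mul (by norm_num)]
      apply ENNReal.ofReal_le_ofReal
      refine (norm_sub_le _ _).trans ?_
      rw [h5]
      linarith
    · rw [lintegral_const_mul' _ _ (by norm_num)]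
      refine ENNReal.mul_ne_top (by norm_num) ?_
      have := enorm_sq_eq_wsq (𝓕 d : L2C)
      simp only [wsq, ENNReal.ofReal_one, one_mul] at this
      rw [← this]
      exact ENNReal.pow_ne_top enorm_ne_top
    · refine Filter.Eventually.of_forall fun ξ => ?_
      have h6 := ((tendsto_chr_quotient ξ).sub_const ((2 * Real.pi * ξ : ℝ) * Complex.I)).mul_const
        ((𝓕 f : L2C) ξ)
      have h7 := ((ENNReal.continuous_pow 2).tendsto _).comp h6.enorm
      simpa [Function.comp_def] using h7
  have h8 := (ENNReal.tendsto_toReal (by simp)).comp hlim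
  have h9 : Tendsto (fun n => ‖dq n f - d‖ ^ 2) atTop (𝓝 0) := by
    refine h8.congr fun n => ?_
    simp
  have h10 := h9.sqrt
  simpa using h10

theorem isDeriv_of_tendsto {f d : L2C} (h : Tendsto (fun n => dq n f) atTop (𝓝 d)) :
    IsDeriv f d := by
  have h1 : Tendsto (fun n => (𝓕 (dq n f) : L2C)) atTop (𝓝 (𝓕 d)) :=
    ((Lp.fourierTransformₗᵢ ℝ ℂ).continuous.tendsto d).comp h
  have h2 := tendstoInMeasure_of_tendsto_Lp h1
  obtain ⟨ns, hns, hae⟩ := h2.exists_seq_tendsto_ae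
  have h3 : ∀ᵐ ξ ∂(volume : Measure ℝ), ∀ n, (𝓕 (dq n f) : L2C) ξ =
      (((n : ℝ) + 1 : ℝ) : ℂ) * (chr (1 / ((n : ℝ) + 1)) ξ - 1) * (𝓕 f : L2C) ξ :=
    ae_all_iff.2 fun n => fourier_dq_ae n f
  filter_upwards [hae, h3] with ξ h4 h5
  refine tendsto_nhds_unique h4 ?_
  simp_rw [h5]
  exact ((tendsto_chr_quotient ξ).comp hns.tendsto_atTop).mul_const _

/-- Truncation to `[-R, R]`. -/
def clamp (R y : ℝ) : ℝ := max (-R) (min R y)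

theorem abs_clamp_le {R : ℝ} (hR : 0 ≤ R) (y : ℝ) : |clamp R y| ≤ R :=
  abs_le.2 ⟨le_max_left _ _, max_le (by linarith) (min_le_left _ _)⟩

theorem clamp_of_abs_le {R y : ℝ} (h : |y| ≤ R) : clamp R y = y := by
  obtain ⟨h1, h2⟩ := abs_le.1 h
  rw [clamp, min_eq_right h2, max_eq_right h1]

theorem continuous_clamp (R : ℝ) : Continuous (clamp R) := by unfold clamp; fun_prop

theorem isBdd_comp_clamp {f : ℝ → ℝ} (hf : Continuous f) {R : ℝ} (hR : 0 ≤ R) (u : L2) :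
    IsBdd (fun x => f (clamp R (u x))) := by
  obtain ⟨K, hK⟩ := (isCompact_Icc (a := -R) (b := R)).exists_bound_of_continuousOn hf.continuousOn
  refine ⟨(hf.comp (continuous_clamp R)).measurable.comp (Lp.stronglyMeasurable u).measurable,
    K, fun x => hK _ (abs_le.1 (abs_clamp_le hR _))⟩

/-- A `C¹` function is differentiable uniformly on compact sets. -/
theorem exists_uniform_deriv {g : ℝ → ℝ} (hg : ContDiff ℝ 1 g) (R : ℝ) {ε : ℝ} (hε : 0 < ε) :
    ∃ δ > 0, ∀ x y, |x| ≤ R → |y| ≤ R → |x - y| ≤ δ →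
      |g x - g y - deriv g y * (x - y)| ≤ ε * |x - y| := by
  have hc : Continuous (deriv g) := hg.continuous_deriv le_rfl
  have hu := (isCompact_Icc (a := -R) (b := R)).uniformContinuousOn_of_continuous hc.continuousOn
  obtain ⟨δ, hδ, h⟩ := Metric.uniformContinuousOn_iff_le.1 hu ε hε
  refine ⟨δ, hδ, fun x y hx hy hxy => ?_⟩
  have hsub : Set.uIcc y x ⊆ Set.Icc (-R) R :=
    Set.uIcc_subset_Icc (abs_le.1 hy) (abs_le.1 hx)
  have hd : ∀ z, HasDerivAt (fun z => g z - deriv g y * z) (deriv g z - deriv g y) z := by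
    intro z
    have h1 := (hg.differentiable one_ne_zero z).hasDerivAt
    have h2 := (hasDerivAt_id z).const_mul (deriv g y)
    have h3 := h1.sub h2
    rw [mul_one] at h3
    exact h3
  have := (convex_uIcc y x).norm_image_sub_le_of_norm_hasDerivWithin_le (𝕜 := ℝ)
    (f := fun z => g z - deriv g y * z) (f' := fun z => deriv g z - deriv g y) (C := ε)
    (fun z _ => (hd z).hasDerivWithinAt) (fun z hz => ?_) Set.left_mem_uIcc Set.right_mem_uIcc
  · simp only [Real.norm_eq_abs] at this
    convert this using 2
    ring
  · have hz' : dist z y ≤ δ := by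
      rw [Real.dist_eq]
      have : |z - y| ≤ |x - y| := Set.abs_sub_left_of_mem_uIcc hz
      exact this.trans hxy
    have := h z (hsub hz) y (abs_le.1 hy) hz'
    rwa [Real.dist_eq] at this

/-- The chain rule `(g (u))' = g' (u) u'` for bounded functions that are uniformly continuous in
the mean. -/
theorem isDeriv_nem {g : ℝ → ℝ} (hg : ContDiff ℝ 1 g) (g0 : g 0 = 0) {R : ℝ} (hR : 0 ≤ R)
    {u : L2} (hu : ∀ᵐ x ∂(volume : Measure ℝ), |u x| ≤ R) {K α : ℝ} (hα : 0 < α)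
    (hK : ∀ h : ℝ, ∀ᵐ x ∂(volume : Measure ℝ), ‖cplx u (x + h) - cplx u x‖ ≤ K * |h| ^ α)
    {d : L2C} (hd : IsDeriv (cplx u) d) :
    IsDeriv (cplx (nem g u)) (mulOp (fun x => deriv g (clamp R (u x))) d) := by
  obtain ⟨L, hL0, hL⟩ := exists_lipschitz hg R
  have hb := isBdd_comp_clamp (hg.continuous_deriv le_rfl) hR u
  apply isDeriv_of_tendsto
  have hlim := hd.tendsto
  have h1 := ((mulOp (fun x => deriv g (clamp R (u x)))).continuous.tendsto d).comp hlim
  have hne := nem_ae hg.continuous g0 hL hu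
  -- by the uniform differentiability of `g` the error is small relative to the quotient of `u`
  have key : Tendsto (fun n => dq n (cplx (nem g u)) -
      mulOp (fun x => deriv g (clamp R (u x))) (dq n (cplx u))) atTop (𝓝 0) := by
    have hlit : (fun n => dq n (cplx (nem g u)) -
        mulOp (fun x => deriv g (clamp R (u x))) (dq n (cplx u))) =o[atTop]
        fun n => dq n (cplx u) := by
      refine Asymptotics.isLittleO_iff.2 fun ε hε => ?_
      obtain ⟨δ, hδ, hδ'⟩ := exists_uniform_deriv hg R hε
      have h2 : Tendsto (fun n : ℕ => K * |1 / ((n : ℝ) + 1)| ^ α) atTop (𝓝 0) := by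
        have h3 : Tendsto (fun n : ℕ => |1 / ((n : ℝ) + 1)|) atTop (𝓝 0) := by
          simpa using (tendsto_one_div_add_atTop_nhds_zero_nat (𝕜 := ℝ)).abs
        have := (h3.rpow_const (Or.inr hα.le) (p := α)).const_mul K
        simpa [Real.zero_rpow hα.ne'] using this
      filter_upwards [h2.eventually_le_const hδ] with n hn
      set h : ℝ := 1 / ((n : ℝ) + 1) with hh
      have hq := (measurePreserving_add_right volume h).quasiMeasurePreserving
      apply Lp.norm_le_mul_norm_of_ae_le_mul
      filter_upwards [hu, hq.ae hu, hne, hq.ae hne, hK h, cplx_ae u, hq.ae (cplx_ae u),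
        cplx_ae (nem g u), hq.ae (cplx_ae (nem g u)), shift_ae h (cplx u),
        shift_ae h (cplx (nem g u)), mulOp_ae hb (dq n (cplx u)),
        Lp.coeFn_sub (dq n (cplx (nem g u)))
          (mulOp (fun x => deriv g (clamp R (u x))) (dq n (cplx u))),
        Lp.coeFn_smul ((n : ℝ) + 1) (shift h (cplx u) - cplx u),
        Lp.coeFn_smul ((n : ℝ) + 1) (shift h (cplx (nem g u)) - cplx (nem g u)),
        Lp.coeFn_sub (shift h (cplx u)) (cplx u),
        Lp.coeFn_sub (shift h (cplx (nem g u))) (cplx (nem g u))]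
        with x a1 a2 a3 a4 a5 a6 a7 a8 a9 a10 a11 a12 a13 a14 a15 a16 a17
      have e1 : dq n (cplx u) x = (((n : ℝ) + 1) * (u (x + h) - u x) : ℝ) := by
        rw [dq, a14, Pi.smul_apply, a16, Pi.sub_apply, a10, a6, a7, Complex.real_smul]
        push_cast; ring
      have e2 : dq n (cplx (nem g u)) x = (((n : ℝ) + 1) * (g (u (x + h)) - g (u x)) : ℝ) := by
        rw [dq, a15, Pi.smul_apply, a17, Pi.sub_apply, a11, a8, a9, a3, a4, Complex.real_smul]
        push_cast; ring
      rw [a13, Pi.sub_apply, a12, e1, e2, clamp_of_abs_le a1, ← Complex.ofReal_mul,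
        ← Complex.ofReal_sub, Complex.norm_real, Complex.norm_real, Real.norm_eq_abs,
        Real.norm_eq_abs]
      rw [a6, a7, ← Complex.ofReal_sub, Complex.norm_real, Real.norm_eq_abs] at a5
      have a18 := hδ' _ _ a2 a1 (a5.trans hn)
      have hn0 : (0 : ℝ) < n + 1 := by positivity
      rw [abs_mul, abs_of_pos hn0]
      have : ((n : ℝ) + 1) * (g (u (x + h)) - g (u x)) -
          deriv g (u x) * (((n : ℝ) + 1) * (u (x + h) - u x)) = ((n : ℝ) + 1) *
          (g (u (x + h)) - g (u x) - deriv g (u x) * (u (x + h) - u x)) := by ring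
      rw [this, abs_mul, abs_of_pos hn0]
      nlinarith
    have hbig : (fun n => dq n (cplx u)) =O[atTop] fun _ => (1 : ℝ) := hlim.isBigO_one ℝ
    exact (Asymptotics.isLittleO_one_iff ℝ).1 (hlit.trans_isBigO hbig)
  have := key.add h1
  simpa using this

/-! ### Superposition operators on Sobolev spaces -/

theorem hsq_deriv_le {f d : L2C} (h : IsDeriv f d) {s : ℝ} :
    hsq (s - 1) (𝓕 d : L2C) ≤ ENNReal.ofReal ((2 * Real.pi) ^ 2) * hsq s (𝓕 f : L2C) := by
  rw [hsq, hsq, wsq_congr h, ← wsq_const_mul (by positivity)]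
  unfold wsq
  apply lintegral_mono
  intro ξ
  simp only
  rw [enorm_mul, mul_pow, ← mul_assoc]
  gcongr
  rw [← ofReal_norm, norm_mul, Complex.norm_real, Complex.norm_I, mul_one,
    ← ENNReal.ofReal_pow (norm_nonneg _), Real.norm_eq_abs, sq_abs,
    ← ENNReal.ofReal_mul (wt_pos _ _).le]
  apply ENNReal.ofReal_le_ofReal
  rw [show 2 * s = 2 * (s - 1) + 2 by ring, wt_add, wt_two]
  have := mul_pos (sq_pos_of_pos Real.two_pi_pos) (wt_pos (2 * (s - 1)) ξ)
  nlinarith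

/-- A function belongs to `H^s` if it and its derivative belong to `H^{s-1}`. -/
theorem hsq_le_of_deriv {f d : L2C} (h : IsDeriv f d) (s : ℝ) :
    hsq s (𝓕 f : L2C) ≤ hsq (s - 1) (𝓕 f : L2C) + hsq (s - 1) (𝓕 d : L2C) := by
  rw [hsq, hsq, hsq, wsq_congr h]
  unfold wsq
  rw [← lintegral_add_left']
  swap
  · exact (continuous_wt _).measurable.ennreal_ofReal.aemeasurable.mul
      ((Lp.aestronglyMeasurable _).enorm.pow_const 2)
  apply lintegral_mono
  intro ξ
  simp only
  rw [enorm_mul, mul_pow, ← mul_assoc, ← add_mul]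
  gcongr
  rw [← ofReal_norm, norm_mul, Complex.norm_real, Complex.norm_I, mul_one,
    ← ENNReal.ofReal_pow (norm_nonneg _), Real.norm_eq_abs, sq_abs,
    ← ENNReal.ofReal_mul (wt_pos _ _).le, ← ENNReal.ofReal_add (wt_pos _ _).le
      (mul_nonneg (wt_pos _ _).le (sq_nonneg _))]
  apply ENNReal.ofReal_le_ofReal
  rw [show 2 * s = 2 * (s - 1) + 2 by ring, wt_add, wt_two]
  have h1 : 1 ≤ (2 * Real.pi) ^ 2 := by nlinarith [Real.pi_gt_three]
  have h2 := mul_nonneg (wt_pos (2 * (s - 1)) ξ).le (sq_nonneg ξ)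
  nlinarith

theorem ae_abs_le_of_cplx {u : L2} {R : ℝ}
    (h : ∀ᵐ x ∂(volume : Measure ℝ), ‖cplx u x‖ ≤ R) : ∀ᵐ x ∂(volume : Measure ℝ), |u x| ≤ R := by
  filter_upwards [h, cplx_ae u] with x h1 h2
  rwa [h2, Complex.norm_real] at h1

/-- Multiplication by a bounded `α`-Hölder function preserves `H^σ` for `σ < α`, `σ < 1`. -/
theorem exists_hsq_mulOp_le {σ α : ℝ} (h0 : 0 < σ) (h1 : σ < 1) (hα : σ < α) (K E : ℝ)
    (M : NNReal) : ∃ C : NNReal, ∀ (m : ℝ → ℝ) (d : L2C), Measurable m → (∀ x, |m x| ≤ K) →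
      (∀ h : ℝ, ∀ᵐ x ∂(volume : Measure ℝ), |m (x + h) - m x| ≤ E * |h| ^ α) →
      hsq σ (𝓕 d : L2C) ≤ M → hsq σ (𝓕 (mulOp m d) : L2C) ≤ C := by
  set I : ℝ≥0∞ := ∫⁻ h, gker σ h * ENNReal.ofReal (min ((2 * K) ^ 2) (E ^ 2 * h ^ (2 * α))) with hI
  have hIt : I < ⊤ := lintegral_gker_min_lt_top h0 hα
  set G := gconst σ with hG
  have hGt : G < ⊤ := gconst_lt_top h0 h1
  have hG0 : G ≠ 0 := gconst_ne_zero σ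
  set B : ℝ≥0∞ := ENNReal.ofReal (K ^ 2) * M +
    G⁻¹ * (2 * (ENNReal.ofReal (K ^ 2) * (G * M) + M * I)) with hB
  have hBt : B ≠ ⊤ := by
    refine ENNReal.add_ne_top.2 ⟨ENNReal.mul_ne_top ENNReal.ofReal_ne_top ENNReal.coe_ne_top,
      ENNReal.mul_ne_top (ENNReal.inv_ne_top.2 hG0) (ENNReal.mul_ne_top (by norm_num)
        (ENNReal.add_ne_top.2 ⟨?_, ENNReal.mul_ne_top ENNReal.coe_ne_top hIt.ne⟩))⟩
    exact ENNReal.mul_ne_top ENNReal.ofReal_ne_top (ENNReal.mul_ne_top hGt.ne ENNReal.coe_ne_top)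
  refine ⟨B.toNNReal, fun m d hm hK hE hd => ?_⟩
  rw [ENNReal.coe_toNNReal hBt]
  have hK0 : 0 ≤ K := (abs_nonneg _).trans (hK 0)
  have hbm : IsBdd m := ⟨hm, K, hK⟩
  have hd2 : ‖d‖ₑ ^ 2 ≤ M := by
    rw [← enorm_fourier, ← hsq_zero]
    exact (hsq_mono h0.le _).trans hd
  -- a difference of `m d` is `m` shifted times a difference of `d`, plus a difference of `m` times `d`
  have hdiff : ∀ h : ℝ, 0 < h → wsq (ds h) (𝓕 (mulOp m d) : L2C) ≤
      2 * (ENNReal.ofReal (K ^ 2) * wsq (ds h) (𝓕 d : L2C) +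
        M * ENNReal.ofReal (min ((2 * K) ^ 2) (E ^ 2 * h ^ (2 * α)))) := by
    intro h hh
    have hq := (measurePreserving_add_right volume h).quasiMeasurePreserving
    rw [← enorm_shift_sub_sq, ← enorm_shift_sub_sq]
    have hbm2 : IsBdd fun x => m (x + h) :=
      ⟨hm.comp (measurable_add_const h), K, fun x => hK _⟩
    have hbm3 := hbm2.sub hbm
    have hsplit : shift h (mulOp m d) - mulOp m d =
        mulOp (fun x => m (x + h)) (shift h d - d) + mulOp (fun x => m (x + h) - m x) d := by
      rw [mulOp_sub hbm2 hbm, map_sub, sub_apply]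
      have : shift h (mulOp m d) = mulOp (fun x => m (x + h)) (shift h d) := by
        apply Lp.ext
        filter_upwards [shift_ae h (mulOp m d), hq.ae (mulOp_ae hbm d), shift_ae h d,
          mulOp_ae hbm2 (shift h d)] with x b1 b2 b3 b4
        rw [b1, b2, b4, b3]
      rw [this]
      abel
    have n1 : ‖mulOp (fun x => m (x + h)) (shift h d - d)‖ₑ ^ 2 ≤
        ENNReal.ofReal (K ^ 2) * ‖shift h d - d‖ₑ ^ 2 := by
      rw [ENNReal.ofReal_pow hK0, ← mul_pow]
      gcongr
      rw [← ofReal_norm, ← ofReal_norm, ← ENNReal.ofReal_mul hK0]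
      exact ENNReal.ofReal_le_ofReal (norm_mulOp_apply_le hbm2.1 (fun x => hK _) _)
    have n2 : ‖mulOp (fun x => m (x + h) - m x) d‖ₑ ^ 2 ≤
        M * ENNReal.ofReal (min ((2 * K) ^ 2) (E ^ 2 * h ^ (2 * α))) := by
      have e0 : 0 ≤ min ((2 * K) ^ 2) (E ^ 2 * h ^ (2 * α)) :=
        le_min (sq_nonneg _) (mul_nonneg (sq_nonneg _) (Real.rpow_nonneg hh.le _))
      have e1 : ‖mulOp (fun x => m (x + h) - m x) d‖ ≤
          √(min ((2 * K) ^ 2) (E ^ 2 * h ^ (2 * α))) * ‖d‖ := by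
        apply Lp.norm_le_mul_norm_of_ae_le_mul
        filter_upwards [mulOp_ae hbm3 d, hE h] with x b1 b2
        rw [b1, norm_mul, Complex.norm_real, Real.norm_eq_abs]
        gcongr
        refine Real.le_sqrt_of_sq_le (le_min ?_ ?_)
        · gcongr
          refine (abs_sub _ _).trans ?_
          linarith [hK (x + h), hK x]
        · calc |m (x + h) - m x| ^ 2 ≤ (E * |h| ^ α) ^ 2 := by gcongr
            _ = _ := by
              rw [mul_pow, abs_of_pos hh, ← Real.rpow_natCast, ← Real.rpow_natCast,
                ← Real.rpow_mul hh.le]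
              congr 2
              push_cast
              ring
      calc _ ≤ (ENNReal.ofReal (√(min ((2 * K) ^ 2) (E ^ 2 * h ^ (2 * α)))) * ‖d‖ₑ) ^ 2 := by
            gcongr
            rw [← ofReal_norm, ← ofReal_norm, ← ENNReal.ofReal_mul (Real.sqrt_nonneg _)]
            exact ENNReal.ofReal_le_ofReal e1
        _ ≤ _ := by
            rw [mul_pow, ← ENNReal.ofReal_pow (Real.sqrt_nonneg _), Real.sq_sqrt e0, mul_comm]
            gcongr
    rw [hsplit, enorm_sq_eq_wsq]
    refine (wsq_add_fun_le measurable_const _ _).trans ?_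
    rw [← enorm_sq_eq_wsq, ← enorm_sq_eq_wsq]
    gcongr
  -- integration against the Gagliardo kernel
  have hint : G * wsq (fun ξ => |ξ| ^ (2 * σ)) (𝓕 (mulOp m d) : L2C) ≤
      2 * (ENNReal.ofReal (K ^ 2) * (G * M) + M * I) := by
    rw [hG, ← lintegral_gker_wsq h0 (Lp.aestronglyMeasurable _)]
    calc ∫⁻ h, gker σ h * wsq (ds h) (𝓕 (mulOp m d) : L2C)
        ≤ ∫⁻ h, 2 * (ENNReal.ofReal (K ^ 2) * (gker σ h * wsq (ds h) (𝓕 d : L2C)) +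
          M * (gker σ h * ENNReal.ofReal (min ((2 * K) ^ 2) (E ^ 2 * h ^ (2 * α))))) := by
          apply lintegral_mono
          intro h
          simp only
          rcases lt_or_ge 0 h with hh | hh
          · refine (mul_le_mul_right (hdiff h hh) _).trans (le_of_eq ?_)
            ring
          · have : gker σ h = 0 := by
              unfold gker
              rw [Set.indicator_of_notMem (by simpa using hh)]
            simp [this]
      _ = 2 * (ENNReal.ofReal (K ^ 2) * (∫⁻ h, gker σ h * wsq (ds h) (𝓕 d : L2C)) + M * I) := by
          rw [lintegral_const_mul' _ _ (by norm_num), lintegral_add_right,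
            lintegral_const_mul' _ _ ENNReal.ofReal_ne_top,
            lintegral_const_mul' _ _ ENNReal.coe_ne_top]
          refine Measurable.const_mul ((measurable_gker σ).mul ?_) _
          fun_prop
      _ ≤ _ := by
          rw [lintegral_gker_wsq h0 (Lp.aestronglyMeasurable _)]
          gcongr
          exact (wsq_abs_le_hsq h0.le _).trans hd
  refine (hsq_le_add_abs h0.le h1.le _).trans ?_
  rw [hB]
  gcongr
  · rw [enorm_fourier]
    calc ‖mulOp m d‖ₑ ^ 2 ≤ (ENNReal.ofReal K * ‖d‖ₑ) ^ 2 := by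
          gcongr
          rw [← ofReal_norm, ← ofReal_norm, ← ENNReal.ofReal_mul hK0]
          exact ENNReal.ofReal_le_ofReal (norm_mulOp_apply_le hm hK d)
      _ ≤ _ := by
          rw [mul_pow, ENNReal.ofReal_pow hK0]
          gcongr
  · rw [← ENNReal.mul_le_iff_le_inv hG0 hGt.ne]
    exact hint

/-- For `s ≤ 1` it suffices that `g` is Lipschitz on bounded sets: composition with `g` then does not
increase finite differences by more than a constant factor. -/
theorem exists_hsq_nem_le_of_le_one {s : ℝ} (hs : 1 / 2 < s) (hs1 : s ≤ 1) {g : ℝ → ℝ}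
    (hg : ContDiff ℝ 1 g) (g0 : g 0 = 0) (M : NNReal) : ∃ K : NNReal, ∀ u : L2,
      hsq s (𝓕 (cplx u) : L2C) ≤ M → hsq s (𝓕 (cplx (nem g u)) : L2C) ≤ K := by
  obtain ⟨R, hR, hsup⟩ := exists_sup_bound hs M
  obtain ⟨L, hL0, hL⟩ := exists_lipschitz hg R
  refine ⟨(2 * L ^ 2).toNNReal * M, fun u hu => ?_⟩
  refine (hsq_nem_le hg.continuous g0 hL0 hL (ae_abs_le_of_cplx (hsup _ hu))
    (by linarith) hs1).trans ?_
  rw [ENNReal.coe_mul]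
  gcongr
  exact le_rfl

/-- For `s > 1/2` and `g ∈ C^{[s]+1}` with `g 0 = 0`, the superposition operator maps bounded sets
of `H^s` to bounded sets of `H^s`. -/
theorem exists_hsq_nem_le {s : ℝ} (hs : 1 / 2 < s) {g : ℝ → ℝ}
    (hg : ContDiff ℝ ((⌊s⌋₊ + 1 : ℕ) : WithTop ℕ∞) g) (g0 : g 0 = 0) (M : NNReal) :
    ∃ K : NNReal, ∀ u : L2,
      hsq s (𝓕 (cplx u) : L2C) ≤ M → hsq s (𝓕 (cplx (nem g u)) : L2C) ≤ K := by
  obtain ⟨n, hn⟩ : ∃ n : ℕ, s ≤ n + 1 := ⟨⌈s⌉₊, (Nat.le_ceil s).trans (by linarith)⟩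
  induction n generalizing s g M with
  | zero =>
    refine exists_hsq_nem_le_of_le_one hs (by simpa using hn) (hg.of_le ?_) g0 M
    exact_mod_cast Nat.le_add_left 1 _
  | succ n ih =>
    rcases le_or_gt s 1 with hs1 | hs1
    · refine exists_hsq_nem_le_of_le_one hs hs1 (hg.of_le ?_) g0 M
      exact_mod_cast Nat.le_add_left 1 _
    have hgc1 : ContDiff ℝ 1 g := hg.of_le (by exact_mod_cast Nat.le_add_left 1 _)
    have hfl : ⌊s - 1⌋₊ + 1 = ⌊s⌋₊ := by
      rw [Nat.floor_sub_one]
      have : 1 ≤ ⌊s⌋₊ := Nat.le_floor (by exact_mod_cast hs1.le)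
      omega
    have hg' : ContDiff ℝ ((⌊s - 1⌋₊ + 1 : ℕ) : WithTop ℕ∞) (deriv g) := by
      rw [hfl]
      have := hg
      push_cast at this
      exact (contDiff_succ_iff_deriv.1 this).2.2
    have hg'c1 : ContDiff ℝ 1 (deriv g) := hg'.of_le (by exact_mod_cast Nat.le_add_left 1 _)
    obtain ⟨R, hR, hsup⟩ := exists_sup_bound hs M
    obtain ⟨Kq, hKq0, hKq⟩ := exists_holder_bound (s := s) (α := 1 / 4) (by norm_num) (by norm_num)
      (by linarith) M
    -- it suffices to bound `g (u)` and its derivative `g' (u) u'` in `H^{s-1}`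
    suffices H : ∃ K₁ K₂ : NNReal, ∀ (u : L2) (d : L2C), hsq s (𝓕 (cplx u) : L2C) ≤ M →
        hsq (s - 1) (𝓕 d : L2C) ≤ ((2 * Real.pi) ^ 2).toNNReal * M →
        hsq (s - 1) (𝓕 (cplx (nem g u)) : L2C) ≤ K₁ ∧
        hsq (s - 1) (𝓕 (mulOp (fun x => deriv g (clamp R (u x))) d) : L2C) ≤ K₂ by
      obtain ⟨K₁, K₂, H⟩ := H
      refine ⟨K₁ + K₂, fun u hu => ?_⟩
      obtain ⟨d, hd⟩ := exists_isDeriv ((hsq_mono hs1.le _).trans_lt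
        (hu.trans_lt ENNReal.coe_lt_top))
      have hdn := isDeriv_nem hgc1 g0 hR (ae_abs_le_of_cplx (hsup _ hu))
        (by norm_num : (0 : ℝ) < 1 / 4) (hKq _ hu) hd
      obtain ⟨h1, h2⟩ := H u d hu ((hsq_deriv_le hd).trans (by
        gcongr
        exact le_rfl))
      rw [ENNReal.coe_add]
      exact (hsq_le_of_deriv hdn s).trans (add_le_add h1 h2)
    rcases le_or_gt s (3 / 2) with hs3 | hs3
    -- here `s - 1` may be at most `1/2`, so `H^{s-1}` is no algebra, but `g' (u)` is Hölder continuous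
    · obtain ⟨K₁, hK₁⟩ := exists_hsq_nem_le_of_le_one (s := 1) (by norm_num) le_rfl hgc1 g0 M
      obtain ⟨L, hL0, hL⟩ := exists_lipschitz hg'c1 R
      obtain ⟨Kα, hKα0, hKα⟩ := exists_holder_bound (s := s) (α := s - 1 + 1 / 4) (by linarith)
        (by linarith) (by linarith) M
      obtain ⟨D, hD⟩ := (isCompact_Icc (a := -R) (b := R)).exists_bound_of_continuousOn
        hg'c1.continuous.continuousOn
      obtain ⟨K₂, hK₂⟩ := exists_hsq_mulOp_le (σ := s - 1) (α := s - 1 + 1 / 4) (by linarith)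
        (by linarith) (by linarith) D (L * Kα) (((2 * Real.pi) ^ 2).toNNReal * M)
      refine ⟨K₁, K₂, fun u d hu hd => ⟨(hsq_mono (by linarith) _).trans
        (hK₁ u ((hsq_mono hs1.le _).trans hu)), ?_⟩⟩
      refine hK₂ _ d (isBdd_comp_clamp hg'c1.continuous hR u).1
        (fun x => hD _ (abs_le.1 (abs_clamp_le hR _))) (fun h => ?_) (by
          rw [ENNReal.coe_mul]; exact hd)
      have hq := (measurePreserving_add_right volume h).quasiMeasurePreserving
      have hb := ae_abs_le_of_cplx (hsup _ hu)
      filter_upwards [hb, hq.ae hb, hKα _ hu h, cplx_ae u, hq.ae (cplx_ae u)]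
        with x a1 a2 a3 a4 a5
      rw [clamp_of_abs_le a1, clamp_of_abs_le a2, mul_assoc]
      rw [a4, a5, ← Complex.ofReal_sub, Complex.norm_real, Real.norm_eq_abs] at a3
      exact (hL _ _ a2 a1).trans (by gcongr)
    -- here `H^{s-1}` is an algebra, and `g' (u) - g' 0` belongs to it by the induction hypothesis
    · have hsn : s - 1 ≤ (n : ℝ) + 1 := by push_cast at hn; linarith
      have hg1 : ContDiff ℝ ((⌊s - 1⌋₊ + 1 : ℕ) : WithTop ℕ∞) g := by
        refine hg.of_le ?_
        rw [hfl]
        exact_mod_cast Nat.le_add_right _ 1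
      obtain ⟨K₁, hK₁⟩ := ih (by linarith) hg1 g0 M hsn
      obtain ⟨K₃, hK₃⟩ := ih (g := fun z => deriv g z - deriv g 0) (by linarith)
        (hg'.sub contDiff_const) (by simp) M hsn
      obtain ⟨L, hL0, hL⟩ := exists_lipschitz (hg'c1.sub (contDiff_const (c := deriv g 0))) R
      obtain ⟨C, hC⟩ := exists_hsq_mul_le (τ := s - 1) (by linarith) K₃
        (((2 * Real.pi) ^ 2).toNNReal * M)
      refine ⟨K₁, 2 * (C + (deriv g 0 ^ 2).toNNReal * (((2 * Real.pi) ^ 2).toNNReal * M)),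
        fun u d hu hd => ⟨hK₁ u ((hsq_mono (by linarith) _).trans hu), ?_⟩⟩
      set e := mulOp (fun x => deriv g (clamp R (u x))) d with he
      have hb := ae_abs_le_of_cplx (hsup _ hu)
      have hC' := hC (cplx (nem (fun z => deriv g z - deriv g 0) u)) d (e - deriv g 0 • d)
        (hK₃ u ((hsq_mono (by linarith) _).trans hu)) (by rw [ENNReal.coe_mul]; exact hd) (by
          have hne := nem_ae (g := fun z => deriv g z - deriv g 0)
            (hg'c1.continuous.sub continuous_const) (by simp) hL hb
          filter_upwards [hb, hne, cplx_ae (nem (fun z => deriv g z - deriv g 0) u),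
            Lp.coeFn_sub e (deriv g 0 • d), Lp.coeFn_smul (deriv g 0) d,
            mulOp_ae (isBdd_comp_clamp hg'c1.continuous hR u) d] with x a1 a2 a3 a4 a5 a6
          rw [a4, Pi.sub_apply, a5, a6, Pi.smul_apply, a3, a2, clamp_of_abs_le a1,
            Complex.real_smul]
          push_cast
          ring)
      have hee : e = (e - deriv g 0 • d) + deriv g 0 • d := by abel
      rw [hee, fourier_add]
      refine (wsq_add_fun_le (continuous_wt _).measurable _ _).trans ?_
      push_cast
      rw [fourier_smul_real, wsq_smul]
      gcongr
      · exact hC'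
      · exact le_rfl
      · exact hd

/-! ### Symbols -/

/-- A measurable symbol of order at most `σ`. -/
def HasOrder (σ : ℝ) (m : ℝ → ℝ) : Prop := Measurable m ∧ ∃ C, ∀ ξ, |m ξ| ≤ C * wt σ ξ

theorem HasOrder.mul {σ τ : ℝ} {m n : ℝ → ℝ} (hm : HasOrder σ m) (hn : HasOrder τ n) :
    HasOrder (σ + τ) (fun ξ => m ξ * n ξ) := by
  obtain ⟨hm, C, hC⟩ := hm
  obtain ⟨hn, D, hD⟩ := hn
  refine ⟨hm.mul hn, C * D, fun ξ => ?_⟩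
  rw [abs_mul, wt_add]
  calc |m ξ| * |n ξ| ≤ (C * wt σ ξ) * (D * wt τ ξ) :=
        mul_le_mul (hC ξ) (hD ξ) (abs_nonneg _) ((abs_nonneg _).trans (hC ξ))
    _ = _ := by ring

theorem HasOrder.isBdd {σ : ℝ} {m : ℝ → ℝ} (hm : HasOrder σ m) (hσ : σ ≤ 0) : IsBdd m := by
  obtain ⟨hm, C, hC⟩ := hm
  refine ⟨hm, |C|, fun ξ => (hC ξ).trans ?_⟩
  calc C * wt σ ξ ≤ |C| * 1 :=
        mul_le_mul (le_abs_self C) (wt_le_one hσ ξ) (wt_pos _ _).le (abs_nonneg _)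
    _ = |C| := mul_one _

theorem IsBdd.hasOrder {m : ℝ → ℝ} (hm : IsBdd m) : HasOrder 0 m := by
  obtain ⟨hm, C, hC⟩ := hm
  exact ⟨hm, C, fun ξ => by rw [wt_zero, mul_one]; exact hC ξ⟩

theorem hasOrder_wt (σ : ℝ) : HasOrder σ (wt σ) :=
  ⟨(continuous_wt σ).measurable, 1, fun ξ => by rw [abs_of_pos (wt_pos _ _), one_mul]⟩

theorem isBdd_wt {σ : ℝ} (hσ : σ ≤ 0) : IsBdd (wt σ) := (hasOrder_wt σ).isBdd hσ

/-- The hypotheses on the symbols `l` and `b` of `L` and `B`. -/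
structure IsSymbolPair (l b : ℝ → ℝ) (ρ r : ℝ) : Prop where
  rho : 0 ≤ ρ
  order : 1 ≤ ρ / 2 + r
  r_nonneg : 0 ≤ r
  meas_l : Measurable l
  meas_b : Measurable b
  even_l : ∀ ξ, l (-ξ) = l ξ
  even_b : ∀ ξ, b (-ξ) = b ξ
  bound_l : ∃ c₁ > 0, ∃ c₂ > 0, ∀ ξ, c₁ ^ 2 * wt ρ ξ ≤ l ξ ∧ l ξ ≤ c₂ ^ 2 * wt ρ ξ
  bound_b : ∃ c > 0, ∀ ξ, 0 < b ξ ∧ b ξ ≤ c ^ 2 * wt (-r) ξ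

/-- The frequency `ω = |D| l(D)^{1/2}` of the linear equation. -/
def om (l : ℝ → ℝ) (ξ : ℝ) : ℝ := |2 * Real.pi * ξ| * √(l (2 * Real.pi * ξ))

/-- The symbol `D² b(D)` of the forcing term. -/
def be (b : ℝ → ℝ) (ξ : ℝ) : ℝ := (2 * Real.pi * ξ) ^ 2 * b (2 * Real.pi * ξ)

/-- The bounded quotient of the symbols of the forcing term and of the frequency. -/
def ka (l b : ℝ → ℝ) (ξ : ℝ) : ℝ := |2 * Real.pi * ξ| * (b (2 * Real.pi * ξ) / √(l (2 * Real.pi * ξ)))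

theorem wt_sq (σ ξ : ℝ) : wt σ ξ ^ 2 = wt (2 * σ) ξ := by rw [two_mul, wt_add, sq]

theorem abs_le_wt_one (ξ : ℝ) : |ξ| ≤ wt 1 ξ := by
  refine abs_le_of_sq_le_sq' ?_ (wt_pos _ _).le |> abs_le.2
  rw [wt_sq, mul_one, wt_two]
  linarith

theorem wt_le_wt_two_pi {σ : ℝ} (h : 0 ≤ σ) (ξ : ℝ) : wt σ ξ ≤ wt σ (2 * Real.pi * ξ) := by
  unfold wt
  refine Real.rpow_le_rpow (by positivity) ?_ (by positivity)
  have h1 : 1 ≤ (2 * Real.pi) ^ 2 := by nlinarith [Real.pi_gt_three]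
  rw [mul_pow]
  nlinarith [sq_nonneg ξ]

theorem wt_two_pi_le {σ : ℝ} (h : 0 ≤ σ) (ξ : ℝ) :
    wt σ (2 * Real.pi * ξ) ≤ ((2 * Real.pi) ^ 2) ^ (σ / 2) * wt σ ξ := by
  unfold wt
  rw [← Real.mul_rpow (by positivity) (by positivity)]
  gcongr
  have h1 : 1 ≤ (2 * Real.pi) ^ 2 := by nlinarith [Real.pi_gt_three]
  rw [mul_pow]
  nlinarith [sq_nonneg ξ]

namespace IsSymbolPair

variable {l b : ℝ → ℝ} {ρ r : ℝ}

theorem l_pos (h : IsSymbolPair l b ρ r) (ξ : ℝ) : 0 < l ξ := by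
  obtain ⟨c₁, hc₁, c₂, hc₂, hl⟩ := h.bound_l
  exact (mul_pos (by positivity) (wt_pos _ _)).trans_le (hl ξ).1

theorem b_pos (h : IsSymbolPair l b ρ r) (ξ : ℝ) : 0 < b ξ := by
  obtain ⟨c, hc, hb⟩ := h.bound_b
  exact (hb ξ).1

theorem sqrt_l_ge (h : IsSymbolPair l b ρ r) : ∃ c > 0, ∀ ξ, c * wt (ρ / 2) ξ ≤ √(l ξ) := by
  obtain ⟨c₁, hc₁, c₂, hc₂, hl⟩ := h.bound_l
  refine ⟨c₁, hc₁, fun ξ => Real.le_sqrt_of_sq_le ?_⟩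
  rw [mul_pow, wt_sq]
  convert (hl ξ).1 using 3
  ring

theorem sqrt_l_le (h : IsSymbolPair l b ρ r) : ∃ c > 0, ∀ ξ, √(l ξ) ≤ c * wt (ρ / 2) ξ := by
  obtain ⟨c₁, hc₁, c₂, hc₂, hl⟩ := h.bound_l
  refine ⟨c₂, hc₂, fun ξ => Real.sqrt_le_iff.2 ⟨(mul_pos hc₂ (wt_pos _ _)).le, ?_⟩⟩
  rw [mul_pow, wt_sq]
  convert (hl ξ).2 using 3
  ring

theorem om_nonneg (ξ : ℝ) : 0 ≤ om l ξ := by unfold om; positivity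

theorem om_even (h : IsSymbolPair l b ρ r) (ξ : ℝ) : om l (-ξ) = om l ξ := by
  unfold om
  rw [mul_neg, abs_neg, h.even_l]

theorem be_even (h : IsSymbolPair l b ρ r) (ξ : ℝ) : be b (-ξ) = be b ξ := by
  unfold be
  rw [mul_neg, h.even_b]
  ring

theorem ka_even (h : IsSymbolPair l b ρ r) (ξ : ℝ) : ka l b (-ξ) = ka l b ξ := by
  unfold ka
  rw [mul_neg, abs_neg, h.even_l, h.even_b]

theorem be_eq (h : IsSymbolPair l b ρ r) (ξ : ℝ) : be b ξ = om l ξ * ka l b ξ := by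
  have h1 : √(l (2 * Real.pi * ξ)) ≠ 0 := (Real.sqrt_pos.2 (h.l_pos _)).ne'
  unfold be om ka
  rw [← sq_abs (2 * Real.pi * ξ)]
  field_simp

theorem hasOrder_om (h : IsSymbolPair l b ρ r) : HasOrder (1 + ρ / 2) (om l) := by
  obtain ⟨c, hc, hl⟩ := h.sqrt_l_le
  refine ⟨?_, c * ((2 * Real.pi) ^ 2) ^ ((1 + ρ / 2) / 2), fun ξ => ?_⟩
  · unfold om
    have := h.meas_l
    fun_prop
  · rw [abs_of_nonneg (om_nonneg ξ), mul_assoc]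
    have h0 : 0 ≤ 1 + ρ / 2 := by have := h.rho; positivity
    calc om l ξ ≤ wt 1 (2 * Real.pi * ξ) * (c * wt (ρ / 2) (2 * Real.pi * ξ)) := by
          unfold om
          exact mul_le_mul (abs_le_wt_one _) (hl _) (Real.sqrt_nonneg _) (wt_pos _ _).le
      _ = c * wt (1 + ρ / 2) (2 * Real.pi * ξ) := by rw [wt_add]; ring
      _ ≤ _ := by
          gcongr
          exact wt_two_pi_le h0 ξ

/-- The symbol `om` dominates the weight of order `1 + ρ/2` away from frequency zero. -/
theorem wt_le_om (h : IsSymbolPair l b ρ r) : ∃ C, 0 < C ∧ ∀ ξ,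
    wt (1 + ρ / 2) ξ ≤ C * (1 + om l ξ) := by
  obtain ⟨c, hc, hl⟩ := h.sqrt_l_ge
  have h0 : 0 ≤ ρ / 2 := by have := h.rho; positivity
  refine ⟨max (2 ^ (1 + ρ / 2)) (2 / c), by positivity, fun ξ => ?_⟩
  set η := 2 * Real.pi * ξ with hη
  refine (wt_le_wt_two_pi (by positivity) ξ).trans ?_
  rcases le_or_gt |η| 1 with h1 | h1
  · have : wt (1 + ρ / 2) η ≤ 2 ^ (1 + ρ / 2) := by
      unfold wt
      have hη2 : 1 + η ^ 2 ≤ 2 := by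
        have : η ^ 2 ≤ 1 := by rw [← sq_abs]; exact pow_le_one₀ (abs_nonneg _) h1
        linarith
      calc (1 + η ^ 2) ^ ((1 + ρ / 2) / 2) ≤ 2 ^ ((1 + ρ / 2) / 2) := by gcongr
        _ ≤ _ := Real.rpow_le_rpow_of_exponent_le (by norm_num) (by linarith)
    calc _ ≤ max (2 ^ (1 + ρ / 2)) (2 / c) * 1 := by
          rw [mul_one]; exact this.trans (le_max_left _ _)
      _ ≤ _ := by
          gcongr
          linarith [om_nonneg (l := l) ξ]
  · have hw : wt 1 η ≤ 2 * |η| := by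
      refine abs_le_of_sq_le_sq' ?_ (by positivity) |>.2
      have h4 : (2 * |η|) ^ 2 = 4 * η ^ 2 := by rw [← sq_abs η]; ring
      rw [wt_sq, mul_one, wt_two, h4]
      have : 1 ≤ η ^ 2 := by rw [← sq_abs]; exact one_le_pow₀ h1.le
      linarith
    calc wt (1 + ρ / 2) η = wt 1 η * wt (ρ / 2) η := wt_add _ _ _
      _ ≤ (2 * |η|) * (√(l η) / c) := by
          refine mul_le_mul hw ?_ (wt_pos _ _).le (by positivity)
          rw [le_div_iff₀ hc, mul_comm]
          exact hl η
      _ = (2 / c) * om l ξ := by unfold om; ring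
      _ ≤ max (2 ^ (1 + ρ / 2)) (2 / c) * (1 + om l ξ) := by
          gcongr
          · exact om_nonneg ξ
          · exact le_max_right _ _
          · linarith

/-- This is where `ρ / 2 + r ≥ 1` is used: `ka` has order `1 - r - ρ / 2 ≤ 0`. -/
theorem isBdd_ka (h : IsSymbolPair l b ρ r) : IsBdd (ka l b) := by
  obtain ⟨c, hc, hl⟩ := h.sqrt_l_ge
  obtain ⟨d, hd, hb⟩ := h.bound_b
  refine ⟨?_, d ^ 2 / c, fun ξ => ?_⟩
  · unfold ka
    have := h.meas_l
    have := h.meas_b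
    fun_prop
  · have hbp := h.b_pos (2 * Real.pi * ξ)
    have hlp := Real.sqrt_pos.2 (h.l_pos (2 * Real.pi * ξ))
    unfold ka
    set η := 2 * Real.pi * ξ
    rw [abs_of_nonneg (by positivity)]
    have hw := wt_pos (ρ / 2) η
    calc |η| * (b η / √(l η)) ≤ wt 1 η * (d ^ 2 * wt (-r) η / (c * wt (ρ / 2) η)) := by
          refine mul_le_mul (abs_le_wt_one _) ?_ (by positivity) (wt_pos _ _).le
          exact div_le_div₀ (mul_pos (by positivity) (wt_pos _ _)).le (hb η).2
            (mul_pos hc hw) (hl η)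
      _ = d ^ 2 / c * wt (1 - r - ρ / 2) η := by
          rw [show 1 - r - ρ / 2 = 1 + -r + -(ρ / 2) by ring, wt_add, wt_add, wt_neg (ρ / 2)]
          field_simp
      _ ≤ d ^ 2 / c * 1 := by
          gcongr
          exact wt_le_one (by linarith [h.order]) _
      _ = _ := mul_one _

theorem hasOrder_be (h : IsSymbolPair l b ρ r) : HasOrder (1 + ρ / 2) (be b) := by
  have := h.hasOrder_om.mul h.isBdd_ka.hasOrder
  rw [add_zero] at this
  convert this using 1
  ext ξ
  exact h.be_eq ξ

end IsSymbolPair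

/-! ### Solutions on the Fourier side -/

/-- The Fourier transform of a real `L²` function. -/
def ft (u : L2) : L2C := 𝓕 (cplx u)

theorem continuous_ft : Continuous ft :=
  (Lp.fourierTransformₗᵢ ℝ ℂ).continuous.comp cplx.continuous

theorem norm_ft (u : L2) : ‖ft u‖ = ‖u‖ := by rw [ft, Lp.norm_fourier_eq, norm_cplx]

theorem ft_sub (u v : L2) : ft (u - v) = ft u - ft v := by
  rw [ft, map_sub]
  exact (Lp.fourierTransformₗᵢ ℝ ℂ).map_sub _ _

/-- `u` solves the equation on `I`, on the Fourier side: `U` and `V` are the transforms of `u` and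
of `u_t`, multiplied by the weights of `H^s` and of `H^{s-1-ρ/2}`. -/
structure IsFourierSolution (l b g : ℝ → ℝ) (ρ s : ℝ) (I : Set ℝ) (u : ℝ → L2)
    (U V : ℝ → L2C) : Prop where
  continuousOn_U : ContinuousOn U I
  continuousOn_V : ContinuousOn V I
  fourier_u : ∀ t ∈ I, ft (u t) = mulOp (wt (-s)) (U t)
  deriv_u : ∀ t ∈ I,
    HasDerivWithinAt (fun τ => mulOp (wt (-(1 + ρ / 2))) (U τ)) (V t) I t
  continuousOn_N : ContinuousOn (fun t => nem g (u t)) I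
  deriv_v : ∀ t ∈ I, HasDerivWithinAt (fun τ => mulOp (wt (-2 * (1 + ρ / 2) - s)) (V τ))
    (-(mulOp (fun ξ => wt (-3 * (1 + ρ / 2)) ξ * om l ξ ^ 2) (ft (u t)) +
      mulOp (fun ξ => wt (-3 * (1 + ρ / 2)) ξ * be b ξ) (ft (nem g (u t))))) I t

theorem hsq_of_eq_mulOp {s : ℝ} (hs : 0 ≤ s) {F U : L2C} (h : F = mulOp (wt (-s)) U) :
    hsq s F = ‖U‖ₑ ^ 2 := by
  rw [h, hsq, wsq_mulOp (fun ξ => (wt_pos _ _).le) (isBdd_wt (by linarith)), enorm_sq_eq_wsq]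
  congr 1
  ext ξ
  rw [wt_sq, ← wt_add, show 2 * s + 2 * -s = 0 by ring, wt_zero]

theorem exists_eq_mulOp_of_hsq {s : ℝ} (hs : 0 ≤ s) {F : L2C} (h : hsq s F < ⊤) :
    ∃ U, F = mulOp (wt (-s)) U := by
  have hm : MemLp (fun ξ => (wt s ξ : ℂ) * F ξ) 2 volume := by
    refine ⟨(Complex.continuous_ofReal.comp (continuous_wt s)).aestronglyMeasurable.mul
      (Lp.aestronglyMeasurable F), ?_⟩
    rw [eLpNorm_lt_top_iff_lintegral_rpow_enorm_lt_top (by norm_num) (by norm_num)]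
    refine lt_of_le_of_lt (le_of_eq ?_) h
    have := wsq_mul (m := fun _ => 1) (n := wt s) F (fun _ => zero_le_one)
    simp only [wt_sq, one_mul] at this
    rw [hsq, show wt (2 * s) = fun ξ => wt (2 * s) ξ from rfl, ← this]
    simp [wsq]
  refine ⟨hm.toLp _, ?_⟩
  apply Lp.ext
  filter_upwards [mulOp_ae (isBdd_wt (by linarith : -s ≤ 0)) (hm.toLp _), hm.coeFn_toLp]
    with ξ h1 h2
  rw [h1, h2, ← mul_assoc, ← Complex.ofReal_mul, ← wt_add]
  simp [wt_zero]

/-! ### Time intervals -/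

theorem timeInterval_ordConnected {T : EReal} {t t' : ℝ} (h : t' ∈ timeInterval T) (h0 : 0 ≤ t)
    (ht : t ≤ t') : t ∈ timeInterval T :=
  ⟨h0, lt_of_le_of_lt (EReal.coe_le_coe_iff.2 ht) h.2⟩

theorem exists_gt_mem_timeInterval {T : EReal} {t : ℝ} (h : t ∈ timeInterval T) :
    ∃ t' ∈ timeInterval T, t < t' := by
  obtain ⟨q, hq1, hq2⟩ := EReal.lt_iff_exists_real_btwn.1 h.2
  have hq1' : t < q := EReal.coe_lt_coe_iff.1 hq1
  exact ⟨q, ⟨h.1.trans hq1'.le, hq2⟩, hq1'⟩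

theorem Icc_subset_timeInterval {T : EReal} {t' : ℝ} (h : t' ∈ timeInterval T) :
    Set.Icc 0 t' ⊆ timeInterval T := fun _ ht => timeInterval_ordConnected h ht.1 ht.2

theorem Icc_mem_nhdsWithin {T : EReal} {t t' : ℝ} (h : t < t') :
    Set.Icc 0 t' ∈ 𝓝[timeInterval T] t := by
  filter_upwards [self_mem_nhdsWithin, mem_nhdsWithin_of_mem_nhds (Iic_mem_nhds h)] with x h1 h2
  exact ⟨h1.1, h2⟩

theorem continuousOn_timeInterval {E : Type*} [TopologicalSpace E] {T : EReal} {f : ℝ → E}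
    (h : ∀ t' ∈ timeInterval T, ContinuousOn f (Set.Icc 0 t')) : ContinuousOn f (timeInterval T) := by
  intro t ht
  obtain ⟨t', ht', htt'⟩ := exists_gt_mem_timeInterval ht
  exact (h t' ht' t ⟨ht.1, htt'.le⟩).mono_of_mem_nhdsWithin (Icc_mem_nhdsWithin htt')

theorem hasDerivWithinAt_timeInterval {E : Type*} [NormedAddCommGroup E] [NormedSpace ℝ E]
    [CompleteSpace E] {T : EReal} {X f : ℝ → E} (hf : ContinuousOn f (timeInterval T))
    (hX : ∀ t ∈ timeInterval T, X t = X 0 + ∫ τ in (0 : ℝ)..t, f τ) {t : ℝ}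
    (ht : t ∈ timeInterval T) : HasDerivWithinAt X (f t) (timeInterval T) t := by
  obtain ⟨t', ht', htt'⟩ := exists_gt_mem_timeInterval ht
  have hsub := Icc_subset_timeInterval ht'
  have h0 : 0 < t' := ht.1.trans_lt htt'
  have : Fact (t ∈ Set.Icc 0 t') := ⟨⟨ht.1, htt'.le⟩⟩
  have hint : IntervalIntegrable f volume 0 t :=
    (hf.mono (by
      rw [Set.uIcc_of_le ht.1]
      exact (Set.Icc_subset_Icc_right htt'.le).trans hsub)).intervalIntegrable
  have hmeas : StronglyMeasurableAtFilter f (𝓝[Set.Icc 0 t'] t) volume :=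
    ⟨Set.Icc 0 t', self_mem_nhdsWithin,
      (hf.mono hsub).aestronglyMeasurable measurableSet_Icc⟩
  have key := intervalIntegral.integral_hasDerivWithinAt_right
    (s := Set.Icc 0 t') (t := Set.Icc 0 t') hint hmeas
    ((hf.mono hsub) t ⟨ht.1, htt'.le⟩)
  have h2 : HasDerivWithinAt X (f t) (Set.Icc 0 t') t := by
    refine (key.const_add (X 0)).congr (fun τ hτ => hX τ (hsub hτ)) (hX t ht)
  exact h2.mono_of_mem_nhdsWithin (Icc_mem_nhdsWithin htt')

/-- A weak form of the fundamental theorem of calculus, tested against a separating family of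
functionals. -/
theorem eq_add_integral_of_weak {E ι : Type*} [NormedAddCommGroup E] [NormedSpace ℝ E]
    [CompleteSpace E] {T : EReal} {X f : ℝ → E} (hX : ContinuousOn X (timeInterval T))
    (hf : ContinuousOn f (timeInterval T)) (Λ : ι → E →L[ℝ] ℂ)
    (hΛ : ∀ x y, (∀ i, Λ i x = Λ i y) → x = y)
    (h : ∀ i, ∀ t ∈ timeInterval T,
      HasDerivWithinAt (fun τ => Λ i (X τ)) (Λ i (f t)) (timeInterval T) t) {t : ℝ}
    (ht : t ∈ timeInterval T) : X t = X 0 + ∫ τ in (0 : ℝ)..t, f τ := by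
  have hsub := Icc_subset_timeInterval ht
  have hint : IntervalIntegrable f volume 0 t :=
    (hf.mono (by rw [Set.uIcc_of_le ht.1]; exact hsub)).intervalIntegrable
  apply hΛ
  intro i
  rw [map_add, ← ContinuousLinearMap.intervalIntegral_comp_comm _ hint]
  have := intervalIntegral.integral_eq_sub_of_hasDeriv_right_of_le ht.1
    (f := fun τ => Λ i (X τ)) (f' := fun τ => Λ i (f τ))
    ((Λ i).continuous.comp_continuousOn (hX.mono hsub)) (fun τ hτ => ?_)
    (((Λ i).continuous.comp_continuousOn (hf.mono (by
      rw [Set.uIcc_of_le ht.1]; exact hsub))).intervalIntegrable)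
  · rw [this]
    simp
  · refine (h i τ (hsub ⟨hτ.1.le, hτ.2.le⟩)).mono_of_mem_nhdsWithin ?_
    refine mem_nhdsWithin_of_mem_nhds ?_ |> fun h' => Filter.mem_of_superset h'
      (fun x hx => hsub (Set.Ioo_subset_Icc_self hx))
    exact Ioo_mem_nhds hτ.1 hτ.2

/-! ### The Fourier transform as a real-linear isometry -/

/-- The Fourier transform on `L²`, as a continuous real-linear map. -/
def fourierR : L2C →L[ℝ] L2C :=
  (Lp.fourierTransformₗᵢ ℝ ℂ).toContinuousLinearEquiv.toContinuousLinearMap.restrictScalars ℝ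

/-- The inverse Fourier transform on `L²`, as a continuous real-linear map. -/
def fourierInvR : L2C →L[ℝ] L2C :=
  (Lp.fourierTransformₗᵢ ℝ ℂ).symm.toContinuousLinearEquiv.toContinuousLinearMap.restrictScalars ℝ

theorem fourier_fourierInv_L2 (F : L2C) : (𝓕 (𝓕⁻ F : L2C) : L2C) = F :=
  (Lp.fourierTransformₗᵢ ℝ ℂ).apply_symm_apply F

theorem fourierInv_fourier_L2 (F : L2C) : (𝓕⁻ (𝓕 F : L2C) : L2C) = F :=
  (Lp.fourierTransformₗᵢ ℝ ℂ).symm_apply_apply F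

/-- The real part of the inverse Fourier transform. -/
def ift : L2C →L[ℝ] L2 := rePart.comp fourierInvR

theorem ift_ft (u : L2) : ift (ft u) = u := by
  change rePart (𝓕⁻ (𝓕 (cplx u) : L2C) : L2C) = u
  rw [fourierInv_fourier_L2, rePart_cplx]

theorem ft_ift {F : L2C} (h : IsHerm F) : ft (ift F) = F := by
  change (𝓕 (cplx (rePart (𝓕⁻ F : L2C))) : L2C) = F
  rw [h, fourier_fourierInv_L2]

theorem norm_ift_le (F : L2C) : ‖ift F‖ ≤ ‖F‖ :=
  (norm_rePart_le _).trans ((Lp.fourierTransformₗᵢ ℝ ℂ).symm.norm_map F).le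

theorem isHerm_ft (u : L2) : IsHerm (ft u) := isHerm_fourier u

theorem derivCLM_eq_lineDeriv (S : 𝓢'(ℝ, ℂ)) : derivCLM ℂ S = LineDeriv.lineDerivOp (1:ℝ) S := by
  ext w
  rw [derivCLM_apply_apply, lineDerivOp_apply_apply]
  have : LineDeriv.lineDerivOp (1:ℝ) w = SchwartzMap.derivCLM ℂ ℂ w := by
    ext x
    rw [SchwartzMap.lineDerivOp_apply, SchwartzMap.derivCLM_apply]
    simp [lineDeriv, deriv_comp_const_add]
  rw [this]

theorem IsFunction.fourier_deriv {S : 𝓢'(ℝ, ℂ)} {f : ℝ → ℂ} (h : IsFunction (𝓕 S) f) :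
    IsFunction (𝓕 (derivCLM ℂ S)) (fun ξ => (2 * Real.pi * Complex.I * ξ) * f ξ) := by
  have hg : (fun x : ℝ => ((2 * Real.pi * Complex.I) * (x:ℂ))).HasTemperateGrowth := by fun_prop
  have hg1 : (fun x : ℝ => (x:ℂ)).HasTemperateGrowth := by fun_prop
  rw [derivCLM_eq_lineDeriv, fourier_lineDerivOp_eq]
  have key := h.smulLeft hg
  have h2 : (2 * Real.pi * Complex.I : ℂ) •
      smulLeftCLM ℂ (fun x : ℝ => ((inner ℝ x (1 : ℝ) : ℝ) : ℂ)) (𝓕 S) =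
      smulLeftCLM ℂ (fun x : ℝ => ((2 * Real.pi * Complex.I) * (x:ℂ))) (𝓕 S) := by
    have := smulLeftCLM_smul (F := ℂ) hg1 (2 * Real.pi * Complex.I)
    have h3 : (fun x : ℝ => ((inner ℝ x (1 : ℝ) : ℝ) : ℂ)) = fun x : ℝ => (x : ℂ) := by
      ext x; simp
    rw [h3]
    exact (congrArg (fun L : 𝓢'(ℝ, ℂ) →L[ℂ] 𝓢'(ℝ, ℂ) => L (𝓕 S)) this).symm
  rw [h2]
  exact key

theorem IsFunction.add {S R : 𝓢'(ℝ, ℂ)} {f f' : ℝ → ℂ} (h : IsFunction S f)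
    (h' : IsFunction R f') : IsFunction (S + R) (fun ξ => f ξ + f' ξ) := by
  refine ⟨h.1.add h'.1, fun w => ?_⟩
  have h1 := h.2 w
  have h2 := h'.2 w
  have h3 : (fun ξ => w ξ * (f ξ + f' ξ)) = fun ξ => w ξ * f ξ + w ξ * f' ξ := by
    ext ξ; ring
  rw [h3]
  refine ⟨h1.1.add h2.1, ?_⟩
  rw [integral_add h1.1 h2.1, ← h1.2, ← h2.2]
  rfl

/-- Pairing of an `L²` function with a Schwartz function. -/
def pair (w : 𝓢(ℝ, ℂ)) : L2C →L[ℝ] ℂ :=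
  ((PointwiseConvergenceCLM.evalCLM (RingHom.id ℂ) ℂ w).comp
    (Lp.toTemperedDistributionCLM ℂ volume 2)).restrictScalars ℝ

theorem pair_apply (w : 𝓢(ℝ, ℂ)) (F : L2C) : pair w F = (F : 𝓢'(ℝ, ℂ)) w := rfl

theorem pair_injective {F G : L2C} (h : ∀ w, pair w F = pair w G) : F = G := by
  apply coe_injective
  ext w
  exact h w

theorem IsFunction.apply_smulLeft_eq_pair {S : 𝓢'(ℝ, ℂ)} {f : ℝ → ℂ} (h : IsFunction S f) (σ : ℝ)
    {F : L2C} (hF : F =ᵐ[volume] fun ξ => (wt σ ξ : ℂ) * f ξ) (w : 𝓢(ℝ, ℂ)) :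
    S (SchwartzMap.smulLeftCLM ℂ (fun ξ => (wt σ ξ : ℂ)) w) = pair w F := by
  have h1 := (h.smulLeft (wt_hasTemperateGrowth σ)).dist_eq ((isFunction_coe F).congr hF)
  rw [pair_apply, ← h1, smulLeftCLM_apply_apply]

theorem sobolevNorm_eq {σ : ℝ} {S : 𝓢'(ℝ, ℂ)} {W : L2C}
    (h : besselPotential ℝ ℂ σ S = (W : 𝓢'(ℝ, ℂ))) : sobolevNorm σ S = ‖W‖ₑ := by
  unfold sobolevNorm
  apply le_antisymm
  · exact iInf₂_le W h
  · refine le_iInf₂ fun W' h' => ?_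
    rw [coe_injective (h.symm.trans h')]

/-! ### The nonlinearity on bounded subsets of `H^s` -/

theorem exists_sup_lipschitz {s : ℝ} (hs : 1 / 2 < s) {g : ℝ → ℝ} (hg : ContDiff ℝ 1 g)
    (M : NNReal) : ∃ R K : ℝ, 0 ≤ R ∧ 0 ≤ K ∧
      (∀ x y, |x| ≤ R → |y| ≤ R → |g x - g y| ≤ K * |x - y|) ∧
      ∀ u : L2, hsq s (ft u) ≤ M → ∀ᵐ x ∂(volume : Measure ℝ), |u x| ≤ R := by
  obtain ⟨R, hR, h⟩ := exists_sup_bound hs M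
  obtain ⟨K, hK, hl⟩ := exists_lipschitz hg R
  exact ⟨R, K, hR, hK, hl, fun u hu => ae_abs_le_of_cplx (h _ hu)⟩

theorem continuousOn_nem {s : ℝ} (hs : 1 / 2 < s) {g : ℝ → ℝ} (hg : ContDiff ℝ 1 g)
    (g0 : g 0 = 0) (M : NNReal) : ContinuousOn (nem g) {u | hsq s (ft u) ≤ M} := by
  obtain ⟨R, K, hR, hK, hl, hb⟩ := exists_sup_lipschitz hs hg M
  have : LipschitzOnWith K.toNNReal (nem g) {u | hsq s (ft u) ≤ M} := by
    refine LipschitzOnWith.of_dist_le_mul fun u hu v hv => ?_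
    rw [dist_eq_norm, dist_eq_norm, Real.coe_toNNReal K hK]
    exact norm_nem_sub_le hg.continuous g0 hl (hb u hu) (hb v hv)
  exact this.continuousOn

theorem nem_ae_of_hsq {s : ℝ} (hs : 1 / 2 < s) {g : ℝ → ℝ} (hg : ContDiff ℝ 1 g)
    (g0 : g 0 = 0) {u : L2} (hu : hsq s (ft u) < ⊤) : nem g u =ᵐ[volume] fun x => g (u x) := by
  obtain ⟨R, K, hR, hK, hl, hb⟩ := exists_sup_lipschitz hs hg (hsq s (ft u)).toNNReal
  exact nem_ae hg.continuous g0 hl (hb u (ENNReal.coe_toNNReal hu.ne).ge)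

theorem continuousOn_of_ft {I : Set ℝ} {u : ℝ → L2} {s : ℝ} {U : ℝ → L2C}
    (hU : ContinuousOn U I) (h : ∀ t ∈ I, ft (u t) = mulOp (wt (-s)) (U t)) :
    ContinuousOn u I := by
  have h1 : ContinuousOn (fun t => ift (mulOp (wt (-s)) (U t))) I :=
    (ift.continuous.comp (mulOp (wt (-s))).continuous).comp_continuousOn hU
  exact h1.congr fun t ht => by simp only [← h t ht, ift_ft]

theorem continuousOn_nem_timeInterval {s : ℝ} (hs : 1 / 2 < s) {g : ℝ → ℝ} (hg : ContDiff ℝ 1 g)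
    (g0 : g 0 = 0) {T : EReal} {u : ℝ → L2} {U : ℝ → L2C}
    (hU : ContinuousOn U (timeInterval T))
    (h : ∀ t ∈ timeInterval T, ft (u t) = mulOp (wt (-s)) (U t)) :
    ContinuousOn (fun t => nem g (u t)) (timeInterval T) := by
  apply continuousOn_timeInterval
  intro t' ht'
  have hsub := Icc_subset_timeInterval ht'
  obtain ⟨M, hM⟩ := isCompact_Icc.exists_bound_of_continuousOn (hU.mono hsub)
  refine (continuousOn_nem hs hg g0 ((M.toNNReal) ^ 2)).comp
    (continuousOn_of_ft (hU.mono hsub) fun t ht => h t (hsub ht)) fun t ht => ?_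
  change hsq s (ft (u t)) ≤ _
  rw [hsq_of_eq_mulOp (by linarith) (h t (hsub ht)), ENNReal.coe_pow]
  gcongr
  rw [← ofReal_norm]
  exact ENNReal.ofReal_le_ofReal (hM t ht)

/-! ### Distributional and Fourier forms of the equation -/

section

variable {l b g : ℝ → ℝ} {ρ r s : ℝ} {φ : L2} {ψ : 𝓢'(ℝ, ℂ)} {T : EReal} {u : ℝ → L2}
  {v : ℝ → 𝓢'(ℝ, ℂ)}

theorem isFunction_fourier_deriv_deriv {S : 𝓢'(ℝ, ℂ)} {m : ℝ → ℝ} {f : ℝ → ℂ}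
    (h : IsFunction (𝓕 S) (fun ξ => (m (2 * Real.pi * ξ) : ℂ) * f ξ)) :
    IsFunction (𝓕 (derivCLM ℂ (derivCLM ℂ S)))
      (fun ξ => -(((2 * Real.pi * ξ) ^ 2 * m (2 * Real.pi * ξ) : ℝ) : ℂ) * f ξ) := by
  refine h.fourier_deriv.fourier_deriv.congr (Eventually.of_forall fun ξ => ?_)
  push_cast
  linear_combination (4 * Real.pi ^ 2 * ξ ^ 2 * m (2 * Real.pi * ξ) * f ξ : ℂ) * Complex.I_sq

theorem isBdd_wt_mul_om_sq (hsym : IsSymbolPair l b ρ r) :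
    IsBdd (fun ξ => wt (-3 * (1 + ρ / 2)) ξ * om l ξ ^ 2) := by
  have h1 := (hasOrder_wt (-3 * (1 + ρ / 2))).mul (hsym.hasOrder_om.mul hsym.hasOrder_om)
  simp only [← sq] at h1
  exact h1.isBdd (by have := hsym.rho; linarith)

theorem isBdd_wt_mul_be (hsym : IsSymbolPair l b ρ r) :
    IsBdd (fun ξ => wt (-3 * (1 + ρ / 2)) ξ * be b ξ) :=
  ((hasOrder_wt _).mul hsym.hasOrder_be).isBdd (by have := hsym.rho; linarith)

theorem IsSymbolPair.om_sq (hsym : IsSymbolPair l b ρ r) (ξ : ℝ) :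
    om l ξ ^ 2 = (2 * Real.pi * ξ) ^ 2 * l (2 * Real.pi * ξ) := by
  rw [om, mul_pow, sq_abs, Real.sq_sqrt (hsym.l_pos _).le]

/-- A solution in the sense of distributions solves the equation on the Fourier side. -/
theorem IsSolution.exists_isFourierSolution (hsym : IsSymbolPair l b ρ r) (hs : 1 / 2 < s)
    (hg : ContDiff ℝ 1 g) (g0 : g 0 = 0) (h : IsSolution l b g ρ s φ ψ T u v) :
    ∃ U V, IsFourierSolution l b g ρ s (timeInterval T) u U V ∧
      (∀ t ∈ timeInterval T,
        IsFunction (𝓕 (v t)) (fun ξ => (wt (-(s - (1 + ρ / 2))) ξ : ℂ) * V t ξ)) ∧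
      ∀ t ∈ timeInterval T, sobolevNorm s (toDist (u t)) = ‖U t‖ₑ := by
  have hρ := hsym.rho
  obtain ⟨W, hWc, hW⟩ := h.continuous_u
  obtain ⟨W₁, W₁', hW₁⟩ := h.deriv_u
  obtain ⟨W₂, hW₂c, hW₂⟩ := h.continuous_v
  rw [sub_sub] at hW₁ hW₂
  set a := 1 + ρ / 2 with ha
  have hft : ∀ t ∈ timeInterval T, ft (u t) = mulOp (wt (-s)) (𝓕 (W t)) := by
    intro t ht
    have h1 := (bessel_eq_iff s).1 (hW t ht)
    have h2 := isFunction_fourier_coe (cplx (u t))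
    exact Lp.ext ((h2.ae_eq h1).trans (mulOp_ae (isBdd_wt (by linarith)) _).symm)
  have hUc : ContinuousOn (fun t => (𝓕 (W t) : L2C)) (timeInterval T) :=
    fourierR.continuous.comp_continuousOn hWc
  have hVc : ContinuousOn (fun t => (𝓕 (W₂ t) : L2C)) (timeInterval T) :=
    fourierR.continuous.comp_continuousOn hW₂c
  have hNc := continuousOn_nem_timeInterval hs hg g0 hUc hft
  have huc := continuousOn_of_ft hUc hft
  have hv : ∀ t ∈ timeInterval T,
      IsFunction (𝓕 (v t)) (fun ξ => (wt (-(s - a)) ξ : ℂ) * (𝓕 (W₂ t) : L2C) ξ) :=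
    fun t ht => (bessel_eq_iff _).1 (hW₂ t ht)
  refine ⟨fun t => 𝓕 (W t), fun t => 𝓕 (W₂ t), ⟨hUc, hVc, hft, ?_, hNc, ?_⟩, hv, ?_⟩
  · intro t ht
    -- the representatives of `u` in `H^s` and in `H^{s-1-ρ/2}` differ by the weight of order `a`
    have h1 : ∀ τ ∈ timeInterval T, mulOp (wt (-a)) (𝓕 (W τ)) = 𝓕 (W₁ τ) := by
      intro τ hτ
      have h2 := (bessel_eq_iff _).1 (hW₁ τ hτ).1
      have h3 := (bessel_eq_iff _).1 (hW τ hτ)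
      apply Lp.ext
      filter_upwards [mulOp_ae (isBdd_wt (by linarith : -a ≤ 0)) (𝓕 (W τ)), h2.ae_eq h3]
        with ξ h4 h5
      have hw := (wt_pos (-(s - a)) ξ).ne'
      rw [h4]
      have : (wt (-(s - a)) ξ : ℂ) ≠ 0 := by exact_mod_cast hw
      apply mul_left_cancel₀ this
      rw [h5, ← mul_assoc, ← Complex.ofReal_mul, ← wt_add]
      congr 3
      ring
    have h2 : W₁' t = W₂ t := coe_injective ((hW₁ t ht).2.1.symm.trans (hW₂ t ht))
    have h3 := fourierR.hasFDerivAt.comp_hasDerivWithinAt t (hW₁ t ht).2.2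
    rw [h2] at h3
    exact h3.congr h1 (h1 t ht)
  · intro t ht
    -- tested with `w`; the weight of order `-3 a` makes all terms of the equation square integrable
    have hF : ∀ t ∈ timeInterval T, ∀ w : 𝓢(ℝ, ℂ), HasDerivWithinAt
        (fun τ => pair w (mulOp (wt (-2 * a - s)) (𝓕 (W₂ τ))))
        (pair w (-(mulOp (fun ξ => wt (-3 * a) ξ * om l ξ ^ 2) (ft (u t)) +
          mulOp (fun ξ => wt (-3 * a) ξ * be b ξ) (ft (nem g (u t)))))) (timeInterval T) t := by
      intro t ht w
      obtain ⟨N, Lu, BN, hN, ⟨f₁, hf₁, hL⟩, ⟨f₂, hf₂, hB⟩, hw⟩ := h.equation t ht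
      have hN' : N = nem g (u t) := by
        have hN2 : N =ᵐ[volume] fun x => g (u t x) := hN
        refine Lp.ext (hN2.trans (nem_ae_of_hsq hs hg g0 ?_).symm)
        rw [hsq_of_eq_mulOp (by linarith) (hft t ht)]
        exact ENNReal.pow_lt_top (by simp)
      subst hN'
      have e1 := hf₁.ae_eq (isFunction_fourier_coe (cplx (u t)))
      have e2 := hf₂.ae_eq (isFunction_fourier_coe (cplx (nem g (u t))))
      have key := (isFunction_fourier_deriv_deriv hL).add (isFunction_fourier_deriv_deriv hB)
      have key2 := hw (𝓕 (SchwartzMap.smulLeftCLM ℂ (fun ξ => (wt (-3 * a) ξ : ℂ)) w))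
      have key3 : (derivCLM ℂ (derivCLM ℂ Lu) + derivCLM ℂ (derivCLM ℂ BN))
          (𝓕 (SchwartzMap.smulLeftCLM ℂ (fun ξ => (wt (-3 * a) ξ : ℂ)) w)) =
          pair w (-(mulOp (fun ξ => wt (-3 * a) ξ * om l ξ ^ 2) (ft (u t)) +
          mulOp (fun ξ => wt (-3 * a) ξ * be b ξ) (ft (nem g (u t))))) := by
        rw [← key.apply_smulLeft_eq_pair]
        · rfl
        · filter_upwards [e1, e2, mulOp_ae (isBdd_wt_mul_om_sq hsym) (ft (u t)),
            mulOp_ae (isBdd_wt_mul_be hsym) (ft (nem g (u t))),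
            Lp.coeFn_neg (mulOp (fun ξ => wt (-3 * a) ξ * om l ξ ^ 2) (ft (u t)) +
              mulOp (fun ξ => wt (-3 * a) ξ * be b ξ) (ft (nem g (u t)))),
            Lp.coeFn_add (mulOp (fun ξ => wt (-3 * a) ξ * om l ξ ^ 2) (ft (u t)))
              (mulOp (fun ξ => wt (-3 * a) ξ * be b ξ) (ft (nem g (u t))))]
            with ξ h1 h2 h3 h4 h5 h6
          rw [h5, Pi.neg_apply, h6, Pi.add_apply, h3, h4, h1, h2, hsym.om_sq]
          unfold be ft
          push_cast
          ring
      rw [key3] at key2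
      have h3 : ∀ τ ∈ timeInterval T, v τ (𝓕 (SchwartzMap.smulLeftCLM ℂ
          (fun ξ => (wt (-3 * a) ξ : ℂ)) w)) =
          pair w (mulOp (wt (-2 * a - s)) (𝓕 (W₂ τ))) := by
        intro τ hτ
        rw [← TemperedDistribution.fourier_apply]
        refine (hv τ hτ).apply_smulLeft_eq_pair _ ?_ _
        filter_upwards [mulOp_ae (isBdd_wt (by linarith : -2 * a - s ≤ 0)) (𝓕 (W₂ τ))] with ξ h1
        rw [h1, ← mul_assoc, ← Complex.ofReal_mul, ← wt_add]
        congr 3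
        ring
      exact key2.congr (fun τ hτ => (h3 τ hτ).symm) (h3 t ht).symm
    have hfc : ContinuousOn (fun t => -(mulOp (fun ξ => wt (-3 * a) ξ * om l ξ ^ 2) (ft (u t)) +
          mulOp (fun ξ => wt (-3 * a) ξ * be b ξ) (ft (nem g (u t))))) (timeInterval T) :=
      (((mulOp _).continuous.comp_continuousOn (continuous_ft.comp_continuousOn huc)).add
        ((mulOp _).continuous.comp_continuousOn (continuous_ft.comp_continuousOn hNc))).neg
    have hXc : ContinuousOn (fun t => mulOp (wt (-2 * a - s)) (𝓕 (W₂ t))) (timeInterval T) :=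
      (mulOp _).continuous.comp_continuousOn hVc
    -- both sides are continuous in `L²`, so the weak derivative is a strong one
    exact hasDerivWithinAt_timeInterval hfc (fun t ht => eq_add_integral_of_weak hXc hfc pair
      (fun x y => pair_injective) (fun w t ht => hF t ht w) ht) ht
  · intro t ht
    rw [sobolevNorm_eq (hW t ht)]
    exact (enorm_fourier _).symm

theorem exists_isMultiplierImage {m : ℝ → ℝ} {σ : ℝ}
    (hm : HasOrder σ (fun ξ => m (2 * Real.pi * ξ))) (f : L2) :
    ∃ S, IsMultiplierImage m (toDist f) S ∧
      IsFunction (𝓕 S) (fun ξ => (m (2 * Real.pi * ξ) : ℂ) * ft f ξ) := by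
  have hb : IsBdd (fun ξ => wt (-σ) ξ * m (2 * Real.pi * ξ)) :=
    ((hasOrder_wt (-σ)).mul hm).isBdd (by linarith)
  have h1 := isFunction_fourier_bessel (isFunction_fourier_coe
    (𝓕⁻ (mulOp (fun ξ => wt (-σ) ξ * m (2 * Real.pi * ξ)) (ft f)) : L2C)) σ
  rw [fourier_fourierInv_L2] at h1
  have h2 : IsFunction (𝓕 (besselPotential ℝ ℂ σ
      ((𝓕⁻ (mulOp (fun ξ => wt (-σ) ξ * m (2 * Real.pi * ξ)) (ft f)) : L2C) : 𝓢'(ℝ, ℂ))))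
      (fun ξ => (m (2 * Real.pi * ξ) : ℂ) * ft f ξ) := by
    refine h1.congr ?_
    filter_upwards [mulOp_ae hb (ft f)] with ξ h2
    rw [h2, ← mul_assoc, ← Complex.ofReal_mul, ← mul_assoc, ← wt_add]
    simp [wt_zero]
  exact ⟨_, ⟨ft f, isFunction_fourier_coe (cplx f), h2⟩, h2⟩

/-- A solution on the Fourier side is the transform of a solution in the sense of
distributions. -/
theorem IsFourierSolution.exists_isSolution (hsym : IsSymbolPair l b ρ r) (hs : 1 / 2 < s)
    (hg : ContDiff ℝ 1 g) (g0 : g 0 = 0) (hT : 0 < T) {U V : ℝ → L2C}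
    (h : IsFourierSolution l b g ρ s (timeInterval T) u U V) (hφ : u 0 = φ)
    (hψ : IsFunction (𝓕 ψ) (fun ξ => (wt (-(s - (1 + ρ / 2))) ξ : ℂ) * V 0 ξ)) :
    ∃ v, IsSolution l b g ρ s φ ψ T u v := by
  have hρ := hsym.rho
  have hl : HasOrder ρ (fun ξ => l (2 * Real.pi * ξ)) := by
    obtain ⟨c₁, hc₁, c₂, hc₂, hl⟩ := hsym.bound_l
    refine ⟨hsym.meas_l.comp (by fun_prop), c₂ ^ 2 * ((2 * Real.pi) ^ 2) ^ (ρ / 2), fun ξ => ?_⟩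
    rw [abs_of_pos (hsym.l_pos _), mul_assoc (c₂ ^ 2)]
    exact (hl _).2.trans (mul_le_mul_of_nonneg_left (wt_two_pi_le hρ ξ) (by positivity))
  have hb : HasOrder 0 (fun ξ => b (2 * Real.pi * ξ)) := by
    obtain ⟨c, hc, hb⟩ := hsym.bound_b
    refine ⟨hsym.meas_b.comp (by fun_prop), c ^ 2, fun ξ => ?_⟩
    rw [abs_of_pos (hsym.b_pos _), wt_zero]
    exact (hb _).2.trans (mul_le_mul_of_nonneg_left
      (wt_le_one (by have := hsym.r_nonneg; linarith) _) (by positivity))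
  set a := 1 + ρ / 2 with ha
  set v : ℝ → 𝓢'(ℝ, ℂ) := fun t =>
    besselPotential ℝ ℂ (-(s - a)) ((𝓕⁻ (V t) : L2C) : 𝓢'(ℝ, ℂ)) with hv
  have hvF : ∀ t, IsFunction (𝓕 (v t)) (fun ξ => (wt (-(s - a)) ξ : ℂ) * V t ξ) := by
    intro t
    have h1 := isFunction_fourier_bessel (isFunction_fourier_coe (𝓕⁻ (V t) : L2C)) (-(s - a))
    rwa [fourier_fourierInv_L2] at h1
  have hvW : ∀ t, besselPotential ℝ ℂ (s - a) (v t) = ((𝓕⁻ (V t) : L2C) : 𝓢'(ℝ, ℂ)) := by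
    intro t
    rw [bessel_eq_iff, fourier_fourierInv_L2]
    exact hvF t
  have huF : ∀ t ∈ timeInterval T,
      IsFunction (𝓕 (toDist (u t))) (fun ξ => (wt (-s) ξ : ℂ) * U t ξ) := by
    intro t ht
    refine (isFunction_fourier_coe (cplx (u t))).congr ?_
    change ft (u t) =ᵐ[volume] _
    rw [h.fourier_u t ht]
    exact mulOp_ae (isBdd_wt (by linarith)) _
  refine ⟨v, hT, ⟨fun t => 𝓕⁻ (U t), fourierInvR.continuous.comp_continuousOn h.continuousOn_U,
    fun t ht => ?_⟩, ⟨fun t => 𝓕⁻ (mulOp (wt (-a)) (U t)), fun t => 𝓕⁻ (V t), fun t ht =>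
      ⟨?_, ?_, ?_⟩⟩, ⟨fun t => 𝓕⁻ (V t), fourierInvR.continuous.comp_continuousOn h.continuousOn_V,
    fun t ht => ?_⟩, fun t ht => ?_, hφ, ?_⟩
  · rw [bessel_eq_iff, fourier_fourierInv_L2]
    exact huF t ht
  · rw [sub_sub, bessel_eq_iff, fourier_fourierInv_L2]
    refine (huF t ht).congr ?_
    filter_upwards [mulOp_ae (isBdd_wt (by linarith : -a ≤ 0)) (U t)] with ξ h1
    rw [h1, ← mul_assoc, ← Complex.ofReal_mul, ← wt_add]
    congr 3
    ring
  · rw [sub_sub]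
    exact hvW t
  · exact fourierInvR.hasFDerivAt.comp_hasDerivWithinAt t (h.deriv_u t ht)
  · rw [sub_sub]
    exact hvW t
  · obtain ⟨Lu, hL, hLF⟩ := exists_isMultiplierImage hl (u t)
    obtain ⟨BN, hB, hBF⟩ := exists_isMultiplierImage hb (nem g (u t))
    refine ⟨nem g (u t), Lu, BN, nem_ae_of_hsq hs hg g0 ?_, hL, hB, fun w => ?_⟩
    · rw [hsq_of_eq_mulOp (by linarith) (h.fourier_u t ht)]
      exact ENNReal.pow_lt_top (by simp)
    · have key := (isFunction_fourier_deriv_deriv hLF).add (isFunction_fourier_deriv_deriv hBF)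
      -- every test function is the transform of another one times the weight of order `-3 a`
      obtain ⟨w', hw2⟩ : ∃ w' : 𝓢(ℝ, ℂ),
          𝓕 (SchwartzMap.smulLeftCLM ℂ (fun ξ => (wt (-3 * a) ξ : ℂ)) w') = w := by
        refine ⟨SchwartzMap.smulLeftCLM ℂ (fun ξ => (wt (3 * a) ξ : ℂ)) (𝓕⁻ w), ?_⟩
        have : SchwartzMap.smulLeftCLM ℂ (fun ξ => (wt (-3 * a) ξ : ℂ))
            (SchwartzMap.smulLeftCLM ℂ (fun ξ => (wt (3 * a) ξ : ℂ)) (𝓕⁻ w)) = 𝓕⁻ w := by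
          ext ξ
          rw [SchwartzMap.smulLeftCLM_apply_apply (wt_hasTemperateGrowth _),
            SchwartzMap.smulLeftCLM_apply_apply (wt_hasTemperateGrowth _), smul_smul,
            ← Complex.ofReal_mul, ← wt_add]
          simp [wt_zero]
        rw [this]
        exact FourierTransform.fourier_fourierInv_eq w
      have h1 := (pair w').hasFDerivAt.comp_hasDerivWithinAt t (h.deriv_v t ht)
      have h2 : (derivCLM ℂ (derivCLM ℂ Lu) + derivCLM ℂ (derivCLM ℂ BN)) w =
          pair w' (-(mulOp (fun ξ => wt (-3 * a) ξ * om l ξ ^ 2) (ft (u t)) +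
          mulOp (fun ξ => wt (-3 * a) ξ * be b ξ) (ft (nem g (u t))))) := by
        rw [← key.apply_smulLeft_eq_pair (-3 * a)]
        · nth_rewrite 1 [← hw2]
          rfl
        · filter_upwards [mulOp_ae (isBdd_wt_mul_om_sq hsym) (ft (u t)),
            mulOp_ae (isBdd_wt_mul_be hsym) (ft (nem g (u t))),
            Lp.coeFn_neg (mulOp (fun ξ => wt (-3 * a) ξ * om l ξ ^ 2) (ft (u t)) +
              mulOp (fun ξ => wt (-3 * a) ξ * be b ξ) (ft (nem g (u t)))),
            Lp.coeFn_add (mulOp (fun ξ => wt (-3 * a) ξ * om l ξ ^ 2) (ft (u t)))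
              (mulOp (fun ξ => wt (-3 * a) ξ * be b ξ) (ft (nem g (u t))))]
            with ξ h3 h4 h5 h6
          rw [h5, Pi.neg_apply, h6, Pi.add_apply, h3, h4, hsym.om_sq]
          unfold be
          push_cast
          ring
      have h3 : ∀ τ, v τ w = pair w' (mulOp (wt (-2 * a - s)) (V τ)) := by
        intro τ
        have h4 : v τ w = (𝓕 (v τ))
            (SchwartzMap.smulLeftCLM ℂ (fun ξ => (wt (-3 * a) ξ : ℂ)) w') := by
          rw [TemperedDistribution.fourier_apply, hw2]
        rw [h4]
        refine (hvF τ).apply_smulLeft_eq_pair _ ?_ _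
        filter_upwards [mulOp_ae (isBdd_wt (by linarith : -2 * a - s ≤ 0)) (V τ)] with ξ h3
        rw [h3, ← mul_assoc, ← Complex.ofReal_mul, ← wt_add]
        congr 3
        ring
      rw [h2]
      exact h1.congr (fun τ _ => h3 τ) (h3 t)
  · exact fourier_dist_injective ((hvF 0).dist_eq hψ)

end

/-! ### Families of multiplication operators -/

theorem mulOp_mulOp_congr {m n m' n' : ℝ → ℝ} (hm : IsBdd m) (hn : IsBdd n) (hm' : IsBdd m')
    (hn' : IsBdd n') (h : ∀ ξ, m ξ * n ξ = m' ξ * n' ξ) (F : L2C) :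
    mulOp m (mulOp n F) = mulOp m' (mulOp n' F) := by
  rw [mulOp_mulOp hm hn, mulOp_mulOp hm' hn']
  congr 2
  ext ξ
  exact h ξ

theorem mulOp_comm {m n : ℝ → ℝ} (hm : IsBdd m) (hn : IsBdd n) (F : L2C) :
    mulOp m (mulOp n F) = mulOp n (mulOp m F) :=
  mulOp_mulOp_congr hm hn hn hm (fun _ => mul_comm _ _) F

theorem mulOp_mulOp_eq {m n k : ℝ → ℝ} (hm : IsBdd m) (hn : IsBdd n)
    (h : ∀ ξ, m ξ * n ξ = k ξ) (F : L2C) : mulOp m (mulOp n F) = mulOp k F := by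
  rw [mulOp_mulOp hm hn]
  congr 2
  ext ξ
  exact h ξ

/-- Dominated convergence for multiplication operators. -/
theorem tendsto_mulOp {ι : Type*} {L : Filter ι} [L.IsCountablyGenerated] {m : ι → ℝ → ℝ}
    {m₀ : ℝ → ℝ} {C : ℝ} (hm : ∀ᶠ i in L, Measurable (m i)) (hC : ∀ᶠ i in L, ∀ ξ, |m i ξ| ≤ C)
    (hm₀ : IsBdd m₀) (h : ∀ ξ, Tendsto (fun i => m i ξ) L (𝓝 (m₀ ξ))) {F : ι → L2C} {F₀ : L2C}
    (hF : Tendsto F L (𝓝 F₀)) : Tendsto (fun i => mulOp (m i) (F i)) L (𝓝 (mulOp m₀ F₀)) := by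
  have h1 : Tendsto (fun i => ‖mulOp (m i) F₀ - mulOp m₀ F₀‖ ^ 2) L (𝓝 0) := by
    obtain ⟨D, hD⟩ := hm₀.2
    have h2 : ∀ᶠ i in L, ‖mulOp (m i) F₀ - mulOp m₀ F₀‖ ^ 2 =
        (wsq (fun ξ => (m i ξ - m₀ ξ) ^ 2) F₀).toReal := by
      filter_upwards [hm, hC] with i hi hCi
      have hb : IsBdd (m i) := ⟨hi, C, hCi⟩
      rw [norm_sq_eq_toReal, ← enorm_mulOp_sq (hb.sub hm₀), mulOp_sub hb hm₀]
      rfl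
    rw [tendsto_congr' h2, ← ENNReal.toReal_zero]
    refine (ENNReal.tendsto_toReal ENNReal.zero_ne_top).comp ?_
    have h3 : wsq (fun _ => (C + D) ^ 2) F₀ ≠ ⊤ := by
      have := wsq_const_mul (m := fun _ => 1) (sq_nonneg (C + D)) F₀
      simp only [mul_one] at this
      rw [this, ← enorm_sq_eq_wsq]
      exact (ENNReal.mul_lt_top ENNReal.ofReal_lt_top (ENNReal.pow_lt_top (by simp))).ne
    have h4 : (0 : ℝ≥0∞) = ∫⁻ ξ : ℝ, 0 := by simp
    rw [h4]
    refine tendsto_lintegral_filter_of_dominated_convergence'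
      (fun ξ => ENNReal.ofReal ((C + D) ^ 2) * ‖F₀ ξ‖ₑ ^ 2) ?_ ?_ h3 ?_
    · filter_upwards [hm] with i hi
      have h5 := hm₀.1
      have h6 := (Lp.aestronglyMeasurable F₀).enorm
      exact (((hi.sub h5).pow_const 2).ennreal_ofReal.aemeasurable).mul (h6.pow_const 2)
    · filter_upwards [hC] with i hi
      filter_upwards with ξ
      refine mul_le_mul_left (ENNReal.ofReal_le_ofReal ?_) _
      calc (m i ξ - m₀ ξ) ^ 2 = |m i ξ - m₀ ξ| ^ 2 := (sq_abs _).symm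
        _ ≤ (C + D) ^ 2 := by
            gcongr
            exact (abs_sub _ _).trans (add_le_add (hi ξ) (hD ξ))
    · filter_upwards with ξ
      have h5 : Tendsto (fun i => ENNReal.ofReal ((m i ξ - m₀ ξ) ^ 2)) L (𝓝 0) := by
        rw [← ENNReal.ofReal_zero]
        apply ENNReal.tendsto_ofReal
        have := ((h ξ).sub_const (m₀ ξ)).pow 2
        simpa using this
      have := ENNReal.Tendsto.mul_const (b := ‖F₀ ξ‖ₑ ^ 2) h5 (Or.inr (by finiteness))
      simpa using this
  have h1' : Tendsto (fun i => ‖mulOp (m i) F₀ - mulOp m₀ F₀‖) L (𝓝 0) := by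
    have := h1.sqrt
    simpa [Real.sqrt_sq] using this
  rw [tendsto_iff_norm_sub_tendsto_zero]
  have h5 : Tendsto (fun i => C * ‖F i - F₀‖ + ‖mulOp (m i) F₀ - mulOp m₀ F₀‖) L (𝓝 0) := by
    have := ((tendsto_iff_norm_sub_tendsto_zero.1 hF).const_mul C).add h1'
    simpa using this
  refine squeeze_zero' (Eventually.of_forall fun i => norm_nonneg _) ?_ h5
  filter_upwards [hm, hC] with i hi hCi
  calc ‖mulOp (m i) (F i) - mulOp m₀ F₀‖
      = ‖mulOp (m i) (F i - F₀) + (mulOp (m i) F₀ - mulOp m₀ F₀)‖ := by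
        rw [map_sub]; congr 1; abel
    _ ≤ _ := (norm_add_le _ _).trans (add_le_add_left (norm_mulOp_apply_le hi hCi _) _)

/-- A family of symbols that is bounded locally uniformly in time. -/
structure IsBddFamily (m : ℝ → ℝ → ℝ) : Prop where
  meas : ∀ t, Measurable (m t)
  bound : ∀ R : ℝ, ∃ C, ∀ t, |t| ≤ R → ∀ ξ, |m t ξ| ≤ C
  cont : ∀ ξ, Continuous fun t => m t ξ

theorem IsBddFamily.isBdd {m : ℝ → ℝ → ℝ} (h : IsBddFamily m) (t : ℝ) : IsBdd (m t) := by
  obtain ⟨C, hC⟩ := h.bound |t|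
  exact ⟨h.meas t, C, hC t le_rfl⟩

theorem IsBddFamily.continuousOn {m : ℝ → ℝ → ℝ} (h : IsBddFamily m) {X : ℝ → L2C} {I : Set ℝ}
    (hX : ContinuousOn X I) : ContinuousOn (fun t => mulOp (m t) (X t)) I := by
  intro t ht
  obtain ⟨C, hC⟩ := h.bound (|t| + 1)
  refine tendsto_mulOp (C := C) (Eventually.of_forall h.meas) ?_ (h.isBdd t) (fun ξ => ?_) (hX t ht)
  · have : ∀ᶠ τ in 𝓝 t, |τ| < |t| + 1 :=
      continuous_abs.continuousAt.eventually_lt continuousAt_const (by linarith)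
    filter_upwards [nhdsWithin_le_nhds this] with τ hτ
    exact hC τ hτ.le
  · exact (h.cont ξ).continuousAt.continuousWithinAt

theorem IsBddFamily.const_mul {m : ℝ → ℝ → ℝ} (h : IsBddFamily m) {n : ℝ → ℝ} (hn : IsBdd n) :
    IsBddFamily fun t ξ => n ξ * m t ξ := by
  obtain ⟨hn, D, hD⟩ := hn
  refine ⟨fun t => hn.mul (h.meas t), fun R => ?_, fun ξ => continuous_const.mul (h.cont ξ)⟩
  obtain ⟨C, hC⟩ := h.bound R
  refine ⟨D * C, fun t ht ξ => ?_⟩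
  rw [abs_mul]
  exact mul_le_mul (hD ξ) (hC t ht ξ) (abs_nonneg _) ((abs_nonneg _).trans (hD ξ))

/-- Taylor's estimate of first order. -/
theorem abs_taylor_le {f f' : ℝ → ℝ} {L : ℝ} (hf : ∀ x, HasDerivAt f (f' x) x)
    (hL : ∀ x y, |f' x - f' y| ≤ L * |x - y|) (t τ : ℝ) :
    |f τ - f t - (τ - t) * f' t| ≤ L * (τ - t) ^ 2 := by
  have hL0 : 0 ≤ L := by
    have := (abs_nonneg _).trans (hL 1 0)
    simpa using this
  have h1 : ∀ x ∈ Set.uIcc t τ, HasDerivWithinAt (fun x => f x - x * f' t) (f' x - f' t)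
      (Set.uIcc t τ) x := by
    intro x _
    have := ((hf x).sub ((hasDerivAt_id x).mul_const (f' t))).hasDerivWithinAt (s := Set.uIcc t τ)
    rw [one_mul] at this
    exact this
  have h2 : ∀ x ∈ Set.uIcc t τ, ‖f' x - f' t‖ ≤ L * |τ - t| := by
    intro x hx
    refine (hL x t).trans (mul_le_mul_of_nonneg_left ?_ hL0)
    exact Set.abs_sub_left_of_mem_uIcc hx
  have h3 := (convex_uIcc t τ).norm_image_sub_le_of_norm_hasDerivWithin_le h1 h2
    Set.left_mem_uIcc Set.right_mem_uIcc
  rw [Real.norm_eq_abs, Real.norm_eq_abs, mul_assoc, abs_mul_abs_self] at h3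
  calc _ = |f τ - τ * f' t - (f t - t * f' t)| := by congr 1; ring
    _ ≤ _ := h3
    _ = _ := by ring

/-! ### The propagators of the linear equation -/

/-- `sin (tω) / ω`, extended by `t` to `ω = 0`. -/
def sn (ω t : ℝ) : ℝ := if ω = 0 then t else Real.sin (t * ω) / ω

theorem mul_sn (ω t : ℝ) : ω * sn ω t = Real.sin (t * ω) := by
  unfold sn
  split_ifs with h
  · simp [h]
  · field_simp

theorem hasDerivAt_sn (ω t : ℝ) : HasDerivAt (sn ω) (Real.cos (t * ω)) t := by
  unfold sn
  split_ifs with h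
  · rw [h, mul_zero, Real.cos_zero]
    exact hasDerivAt_id t
  · have := ((hasDerivAt_id t).mul_const ω).sin.div_const ω
    simpa [h] using this

theorem abs_cos_sub_le (ω x y : ℝ) : |Real.cos (x * ω) - Real.cos (y * ω)| ≤ |ω| * |x - y| := by
  refine (Real.abs_cos_sub_cos_le _ _).trans ?_
  rw [← sub_mul, abs_mul, mul_comm]

theorem abs_sin_sub_le (ω x y : ℝ) : |Real.sin (x * ω) - Real.sin (y * ω)| ≤ |ω| * |x - y| := by
  refine (Real.abs_sin_sub_sin_le _ _).trans ?_
  rw [← sub_mul, abs_mul, mul_comm]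

theorem abs_sn_le (ω t : ℝ) : |sn ω t| ≤ |t| := by
  unfold sn
  split_ifs with h
  · exact le_rfl
  · rw [abs_div, div_le_iff₀ (abs_pos.2 h), ← abs_mul]
    exact Real.abs_sin_le_abs

section

variable {l b : ℝ → ℝ} {ρ r : ℝ}

/-- `cos (tω)`. -/
def pc (l : ℝ → ℝ) (t ξ : ℝ) : ℝ := Real.cos (t * om l ξ)

/-- `sin (tω) / ω`, as an operator from the regularity of `u_t` to that of `u`. -/
def ps (ρ : ℝ) (l : ℝ → ℝ) (t ξ : ℝ) : ℝ := wt (1 + ρ / 2) ξ * sn (om l ξ) t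

/-- `ω sin (tω)`, as an operator from the regularity of `u` to that of `u_t`. -/
def pt (ρ : ℝ) (l : ℝ → ℝ) (t ξ : ℝ) : ℝ :=
  wt (-(1 + ρ / 2)) ξ * (om l ξ * Real.sin (t * om l ξ))

/-- The symbol applied to the forcing in the Duhamel formula for `cos (tω) u - sin (tω) / ω u_t`. -/
def ks (l b : ℝ → ℝ) (t ξ : ℝ) : ℝ := ka l b ξ * Real.sin (t * om l ξ)

/-- The symbol applied to the forcing in the Duhamel formula for `ω sin (tω) u + cos (tω) u_t`. -/
def kc (ρ : ℝ) (l b : ℝ → ℝ) (t ξ : ℝ) : ℝ :=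
  wt (-(1 + ρ / 2)) ξ * be b ξ * Real.cos (t * om l ξ)

theorem isBddFamily_pc (h : IsSymbolPair l b ρ r) : IsBddFamily (pc l) := by
  have hm := h.hasOrder_om.1
  refine ⟨fun t => by unfold pc; fun_prop, fun R => ⟨1, fun t _ ξ => Real.abs_cos_le_one _⟩,
    fun ξ => by unfold pc; fun_prop⟩

theorem isBddFamily_sin (h : IsSymbolPair l b ρ r) :
    IsBddFamily (fun t ξ => Real.sin (t * om l ξ)) := by
  have hm := h.hasOrder_om.1
  refine ⟨fun t => by fun_prop, fun R => ⟨1, fun t _ ξ => Real.abs_sin_le_one _⟩,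
    fun ξ => by fun_prop⟩

/-- `sin (tω) / ω` gains `1 + ρ/2` derivatives at high frequencies, while at low frequencies it is
bounded by `|t|`. -/
theorem isBddFamily_ps (h : IsSymbolPair l b ρ r) : IsBddFamily (ps ρ l) := by
  have hm := h.hasOrder_om.1
  obtain ⟨C, hC, hw⟩ := h.wt_le_om
  refine ⟨fun t => ?_, fun R => ⟨C * (R + 1), fun t ht ξ => ?_⟩, fun ξ => ?_⟩
  · unfold ps sn
    refine (continuous_wt _).measurable.mul (Measurable.ite (hm (measurableSet_singleton 0))
      measurable_const ?_)
    fun_prop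
  · have h0 := IsSymbolPair.om_nonneg (l := l) ξ
    unfold ps
    rw [abs_mul, abs_of_pos (wt_pos _ _)]
    calc wt (1 + ρ / 2) ξ * |sn (om l ξ) t| ≤ C * (1 + om l ξ) * |sn (om l ξ) t| := by
          gcongr
          exact hw ξ
      _ = C * (|sn (om l ξ) t| + |om l ξ * sn (om l ξ) t|) := by
          rw [abs_mul, abs_of_nonneg h0]; ring
      _ ≤ C * (R + 1) := by
          gcongr
          · exact (abs_sn_le _ _).trans ht
          · rw [mul_sn]; exact Real.abs_sin_le_one _
  · unfold ps
    refine continuous_const.mul ?_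
    exact continuous_iff_continuousAt.2 fun t => (hasDerivAt_sn _ t).continuousAt

theorem isBdd_wt_mul_om (h : IsSymbolPair l b ρ r) :
    IsBdd (fun ξ => wt (-(1 + ρ / 2)) ξ * om l ξ) :=
  ((hasOrder_wt _).mul h.hasOrder_om).isBdd (by linarith)

theorem isBdd_wt_mul_be' (h : IsSymbolPair l b ρ r) :
    IsBdd (fun ξ => wt (-(1 + ρ / 2)) ξ * be b ξ) :=
  ((hasOrder_wt _).mul h.hasOrder_be).isBdd (by linarith)

theorem isBddFamily_pt (h : IsSymbolPair l b ρ r) : IsBddFamily (pt ρ l) := by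
  have := (isBddFamily_sin h).const_mul (isBdd_wt_mul_om h)
  simp only [mul_assoc] at this
  exact this

theorem isBddFamily_ks (h : IsSymbolPair l b ρ r) : IsBddFamily (ks l b) :=
  (isBddFamily_sin h).const_mul h.isBdd_ka

theorem isBddFamily_kc (h : IsSymbolPair l b ρ r) : IsBddFamily (kc ρ l b) :=
  (isBddFamily_pc h).const_mul (isBdd_wt_mul_be' h)

theorem hasDerivAt_mulOp_weighted {f f' : ℝ → ℝ → ℝ} {n L : ℝ → ℝ}
    (hf : ∀ t, IsBdd fun ξ => n ξ * f t ξ) (hf' : ∀ t, IsBdd fun ξ => n ξ * f' t ξ)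
    (hd : ∀ ξ t, HasDerivAt (fun t => f t ξ) (f' t ξ) t)
    (hL : ∀ ξ x y, |f' x ξ - f' y ξ| ≤ L ξ * |x - y|) (hn : IsBdd fun ξ => n ξ * L ξ) (t : ℝ) :
    HasDerivAt (fun t => mulOp (fun ξ => n ξ * f t ξ)) (mulOp fun ξ => n ξ * f' t ξ) t := by
  obtain ⟨C, hC⟩ := hn.2
  refine hasDerivAt_mulOp (C := C) hf hf' t fun τ ξ => ?_
  have hL0 : 0 ≤ L ξ := by
    have := (abs_nonneg _).trans (hL ξ 1 0)
    simpa using this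
  calc _ = |n ξ| * |f τ ξ - f t ξ - (τ - t) * f' t ξ| := by rw [← abs_mul]; congr 1; ring
    _ ≤ |n ξ| * (L ξ * (τ - t) ^ 2) := by
        gcongr
        exact abs_taylor_le (hd ξ) (hL ξ) t τ
    _ = |n ξ * L ξ| * (τ - t) ^ 2 := by rw [abs_mul, abs_of_nonneg hL0]; ring
    _ ≤ _ := by
        gcongr
        exact hC ξ

theorem hasDerivAt_pc (h : IsSymbolPair l b ρ r) (t : ℝ) :
    HasDerivAt (fun t => mulOp fun ξ => wt (-2 * (1 + ρ / 2)) ξ * pc l t ξ)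
      (mulOp fun ξ => wt (-2 * (1 + ρ / 2)) ξ * -(om l ξ * Real.sin (t * om l ξ))) t := by
  have hρ := h.rho
  refine hasDerivAt_mulOp_weighted (n := wt (-2 * (1 + ρ / 2)))
    (f' := fun t ξ => -(om l ξ * Real.sin (t * om l ξ))) (L := fun ξ => om l ξ * om l ξ)
    (fun t => (isBdd_wt (by linarith)).mul ((isBddFamily_pc h).isBdd t)) (fun t => ?_)
    (fun ξ t => ?_) (fun ξ x y => ?_) ?_ t
  · have := (((hasOrder_wt (-2 * (1 + ρ / 2))).mul (h.hasOrder_om.mul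
      ((isBddFamily_sin h).isBdd t).hasOrder)).isBdd (by linarith)).neg
    simpa only [mul_neg] using this
  · have := ((hasDerivAt_id t).mul_const (om l ξ)).cos
    simpa [pc, mul_comm] using this
  · have h1 := abs_sin_sub_le (om l ξ) x y
    rw [abs_of_nonneg (IsSymbolPair.om_nonneg ξ)] at h1
    calc _ = om l ξ * |Real.sin (x * om l ξ) - Real.sin (y * om l ξ)| := by
          rw [← abs_of_nonneg (IsSymbolPair.om_nonneg (l := l) ξ), ← abs_mul, abs_sub_comm,
            abs_of_nonneg (IsSymbolPair.om_nonneg (l := l) ξ)]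
          congr 1; ring
      _ ≤ om l ξ * (om l ξ * |x - y|) := by
          gcongr
          exact IsSymbolPair.om_nonneg ξ
      _ = _ := by ring
  · exact ((hasOrder_wt _).mul (h.hasOrder_om.mul h.hasOrder_om)).isBdd (by linarith)

theorem hasDerivAt_ps (h : IsSymbolPair l b ρ r) (t : ℝ) :
    HasDerivAt (fun t => mulOp fun ξ => wt (-2 * (1 + ρ / 2)) ξ * ps ρ l t ξ)
      (mulOp fun ξ => wt (-2 * (1 + ρ / 2)) ξ * (wt (1 + ρ / 2) ξ * pc l t ξ)) t := by
  have hρ := h.rho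
  refine hasDerivAt_mulOp_weighted (n := wt (-2 * (1 + ρ / 2)))
    (f' := fun t ξ => wt (1 + ρ / 2) ξ * pc l t ξ) (L := fun ξ => wt (1 + ρ / 2) ξ * om l ξ)
    (fun t => (isBdd_wt (by linarith)).mul ((isBddFamily_ps h).isBdd t)) (fun t => ?_)
    (fun ξ t => (hasDerivAt_sn _ t).const_mul _) (fun ξ x y => ?_) ?_ t
  · exact ((hasOrder_wt (-2 * (1 + ρ / 2))).mul ((hasOrder_wt (1 + ρ / 2)).mul
      ((isBddFamily_pc h).isBdd t).hasOrder)).isBdd (by linarith)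
  · have h1 := abs_cos_sub_le (om l ξ) x y
    rw [abs_of_nonneg (IsSymbolPair.om_nonneg ξ)] at h1
    unfold pc
    rw [← mul_sub, abs_mul, abs_of_pos (wt_pos _ _), mul_assoc]
    gcongr
    exact (wt_pos _ _).le
  · exact ((hasOrder_wt _).mul ((hasOrder_wt _).mul h.hasOrder_om)).isBdd (by linarith)

theorem hasDerivAt_pt (h : IsSymbolPair l b ρ r) (t : ℝ) :
    HasDerivAt (fun t => mulOp fun ξ => wt (-2 * (1 + ρ / 2)) ξ * pt ρ l t ξ)
      (mulOp fun ξ => wt (-2 * (1 + ρ / 2)) ξ *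
        (wt (-(1 + ρ / 2)) ξ * (om l ξ * (om l ξ * pc l t ξ)))) t := by
  have hρ := h.rho
  refine hasDerivAt_mulOp_weighted (n := wt (-2 * (1 + ρ / 2)))
    (f' := fun t ξ => wt (-(1 + ρ / 2)) ξ * (om l ξ * (om l ξ * pc l t ξ)))
    (L := fun ξ => wt (-(1 + ρ / 2)) ξ * (om l ξ * (om l ξ * om l ξ)))
    (fun t => (isBdd_wt (by linarith)).mul ((isBddFamily_pt h).isBdd t)) (fun t => ?_)
    (fun ξ t => ?_) (fun ξ x y => ?_) ?_ t
  · exact ((hasOrder_wt (-2 * (1 + ρ / 2))).mul ((hasOrder_wt (-(1 + ρ / 2))).mul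
      (h.hasOrder_om.mul (h.hasOrder_om.mul
      ((isBddFamily_pc h).isBdd t).hasOrder)))).isBdd (by linarith)
  · have := (((hasDerivAt_id t).mul_const (om l ξ)).sin.const_mul (om l ξ)).const_mul
      (wt (-(1 + ρ / 2)) ξ)
    change HasDerivAt (fun t => wt (-(1 + ρ / 2)) ξ * (om l ξ * Real.sin (t * om l ξ))) _ t
    simpa [pc, mul_comm] using this
  · have h1 := abs_cos_sub_le (om l ξ) x y
    have h0 := IsSymbolPair.om_nonneg (l := l) ξ
    rw [abs_of_nonneg h0] at h1
    unfold pc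
    rw [← mul_sub, ← mul_sub, ← mul_sub, abs_mul, abs_of_pos (wt_pos _ _), abs_mul, abs_mul,
      abs_of_nonneg h0]
    calc _ ≤ wt (-(1 + ρ / 2)) ξ * (om l ξ * (om l ξ * (om l ξ * |x - y|))) := by
          gcongr
          exact (wt_pos _ _).le
      _ = _ := by ring
  · exact ((hasOrder_wt _).mul ((hasOrder_wt _).mul (h.hasOrder_om.mul
      (h.hasOrder_om.mul h.hasOrder_om)))).isBdd (by linarith)

end

/-! ### Lifting curves to `H^s` -/

open Classical in
/-- The element `U` of `L²` with `F = (1 + ξ²)^{-s/2} U`, if there is one, and `0` otherwise. -/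
def wtLp (s : ℝ) (F : L2C) : L2C := if h : ∃ U, F = mulOp (wt (-s)) U then h.choose else 0

theorem mulOp_wtLp {s : ℝ} (hs : 0 ≤ s) {F : L2C} (h : hsq s F < ⊤) :
    mulOp (wt (-s)) (wtLp s F) = F := by
  have h1 := exists_eq_mulOp_of_hsq hs h
  rw [wtLp, dif_pos h1]
  exact h1.choose_spec.symm

theorem mulOp_wt_injective {s : ℝ} (hs : 0 ≤ s) {F G : L2C}
    (h : mulOp (wt (-s)) F = mulOp (wt (-s)) G) : F = G :=
  mulOp_injective (isBdd_wt (by linarith)) (fun ξ => (wt_pos _ _).ne') h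

theorem norm_le_of_hsq {s : ℝ} (hs : 0 ≤ s) {F U : L2C} (h : F = mulOp (wt (-s)) U) {M : NNReal}
    (hM : hsq s F ≤ M) : ‖U‖ ≤ √(M : ℝ) := by
  rw [hsq_of_eq_mulOp hs h] at hM
  apply Real.le_sqrt_of_sq_le
  rw [norm_sq_eq_toReal]
  exact ENNReal.toReal_le_coe_of_le_coe hM

theorem norm_wtLp_le {s : ℝ} (hs : 0 ≤ s) {F : L2C} {M : NNReal} (h : hsq s F ≤ M) :
    ‖wtLp s F‖ ≤ √(M : ℝ) :=
  norm_le_of_hsq hs (mulOp_wtLp hs (h.trans_lt ENNReal.coe_lt_top)).symm h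

/-- The indicator function of `|ξ| ≤ n`. -/
def cut (n : ℕ) (ξ : ℝ) : ℝ := if |ξ| ≤ n then 1 else 0

theorem measurable_cut (n : ℕ) : Measurable (cut n) :=
  Measurable.ite (measurableSet_le (by fun_prop) measurable_const) measurable_const
    measurable_const

theorem abs_cut_le (n : ℕ) (ξ : ℝ) : |cut n ξ| ≤ 1 := by
  unfold cut; split_ifs <;> simp

theorem tendsto_cut (ξ : ℝ) : Tendsto (fun n => cut n ξ) atTop (𝓝 1) := by
  apply tendsto_const_nhds.congr'
  obtain ⟨N, hN⟩ := exists_nat_ge |ξ|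
  filter_upwards [eventually_ge_atTop N] with n hn
  rw [cut, if_pos (hN.trans (by exact_mod_cast hn))]

theorem tendsto_mulOp_cut (F : L2C) : Tendsto (fun n => mulOp (cut n) F) atTop (𝓝 F) := by
  have := tendsto_mulOp (L := atTop) (Eventually.of_forall measurable_cut)
    (Eventually.of_forall abs_cut_le) (isBdd_const 1) tendsto_cut (tendsto_const_nhds (x := F))
  simpa [mulOp_one] using this

theorem isBdd_cut_mul_wt (n : ℕ) (s : ℝ) : IsBdd (fun ξ => cut n ξ * wt s ξ) := by
  refine ⟨(measurable_cut n).mul (continuous_wt s).measurable, (1 + (n : ℝ) ^ 2) ^ (|s| / 2),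
    fun ξ => ?_⟩
  simp only [cut]
  split_ifs with h
  · rw [one_mul, abs_of_pos (wt_pos _ _)]
    refine (wt_mono (le_abs_self s) ξ).trans ?_
    refine Real.rpow_le_rpow (by positivity) ?_ (by positivity)
    rw [← sq_abs ξ]
    gcongr
  · simp only [zero_mul, abs_zero]
    positivity

theorem aestronglyMeasurable_wtLp {s : ℝ} (hs : 0 ≤ s) {μ : Measure ℝ} {X : ℝ → L2C}
    (hX : AEStronglyMeasurable X μ) (h : ∀ᵐ τ ∂μ, hsq s (X τ) < ⊤) :
    AEStronglyMeasurable (fun τ => wtLp s (X τ)) μ := by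
  refine aestronglyMeasurable_of_tendsto_ae atTop (f := fun n τ =>
    mulOp (fun ξ => cut n ξ * wt s ξ) (X τ))
    (fun n => (mulOp _).continuous.comp_aestronglyMeasurable hX) ?_
  filter_upwards [h] with τ hτ
  have h1 : ∀ n, mulOp (fun ξ => cut n ξ * wt s ξ) (X τ) = mulOp (cut n) (wtLp s (X τ)) := by
    intro n
    nth_rewrite 1 [← mulOp_wtLp hs hτ]
    refine mulOp_mulOp_eq (isBdd_cut_mul_wt n s) (isBdd_wt (by linarith)) (fun ξ => ?_) _
    rw [mul_assoc, ← wt_add]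
    simp [wt_zero]
  simp only [h1]
  exact tendsto_mulOp_cut _

theorem ae_Ioc_of_forall_Ioo {c d : ℝ} {p : ℝ → Prop} (h : ∀ τ ∈ Set.Ioo c d, p τ) :
    ∀ᵐ τ ∂(volume.restrict (Set.Ioc c d)), p τ := by
  rw [← restrict_Ioo_eq_restrict_Ioc]
  exact (ae_restrict_iff' measurableSet_Ioo).2 (Eventually.of_forall h)

theorem intervalIntegrable_of_bound {E : Type*} [NormedAddCommGroup E] {c d : ℝ} (hcd : c ≤ d)
    {X : ℝ → E} (hX : AEStronglyMeasurable X (volume.restrict (Set.Ioc c d))) {M : ℝ}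
    (hM : ∀ τ ∈ Set.Ioo c d, ‖X τ‖ ≤ M) : IntervalIntegrable X volume c d := by
  rw [intervalIntegrable_iff_integrableOn_Ioc_of_le hcd]
  exact (integrable_const M).mono' hX (ae_Ioc_of_forall_Ioo hM)

theorem ContinuousOn.aestronglyMeasurable_Ioc {E : Type*} [TopologicalSpace E]
    [TopologicalSpace.PseudoMetrizableSpace E] [SecondCountableTopologyEither ℝ E] {c d : ℝ}
    {X : ℝ → E} (hX : ContinuousOn X (Set.Ioo c d)) :
    AEStronglyMeasurable X (volume.restrict (Set.Ioc c d)) := by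
  rw [← restrict_Ioo_eq_restrict_Ioc]
  exact hX.aestronglyMeasurable measurableSet_Ioo

theorem intervalIntegrable_wtLp {s : ℝ} (hs : 0 ≤ s) {c d : ℝ} (hcd : c ≤ d) {X : ℝ → L2C}
    (hX : ContinuousOn X (Set.Ioo c d)) {M : NNReal} (hM : ∀ τ ∈ Set.Ioo c d, hsq s (X τ) ≤ M) :
    IntervalIntegrable (fun τ => wtLp s (X τ)) volume c d :=
  intervalIntegrable_of_bound hcd
    (aestronglyMeasurable_wtLp hs (ContinuousOn.aestronglyMeasurable_Ioc hX)
      (ae_Ioc_of_forall_Ioo fun τ hτ => (hM τ hτ).trans_lt ENNReal.coe_lt_top))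
    (fun τ hτ => norm_wtLp_le hs (hM τ hτ))

theorem mulOp_integral_wtLp {s : ℝ} (hs : 0 ≤ s) {c d : ℝ} (hcd : c ≤ d) {X : ℝ → L2C}
    (hX : ContinuousOn X (Set.Ioo c d)) {M : NNReal} (hM : ∀ τ ∈ Set.Ioo c d, hsq s (X τ) ≤ M) :
    mulOp (wt (-s)) (∫ τ in c..d, wtLp s (X τ)) = ∫ τ in c..d, X τ := by
  rw [← ContinuousLinearMap.intervalIntegral_comp_comm _ (intervalIntegrable_wtLp hs hcd hX hM),
    intervalIntegral.integral_of_le hcd, intervalIntegral.integral_of_le hcd]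
  exact integral_congr_ae (ae_Ioc_of_forall_Ioo fun τ hτ =>
    mulOp_wtLp hs ((hM τ hτ).trans_lt ENNReal.coe_lt_top))

theorem hsq_mulOp_le {s C : ℝ} {m : ℝ → ℝ} (hm : Measurable m) (hC : ∀ ξ, |m ξ| ≤ C) (F : L2C) :
    hsq s (mulOp m F) ≤ ENNReal.ofReal (C ^ 2) * hsq s F := by
  have hC0 : 0 ≤ C := (abs_nonneg _).trans (hC 0)
  rw [hsq, wsq_mulOp (fun ξ => (wt_pos _ _).le) ⟨hm, C, hC⟩, hsq, ← wsq_const_mul (sq_nonneg C)]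
  refine wsq_mono (fun ξ => ?_) _
  rw [mul_comm]
  refine mul_le_mul_of_nonneg_right ?_ (wt_pos _ _).le
  rw [← sq_abs]
  gcongr
  exact hC ξ

/-! ### Duhamel's formula -/

/-- The hypotheses on the nonlinearity. -/
structure IsNonlinearity (g : ℝ → ℝ) (s : ℝ) : Prop where
  reg : 1 / 2 < s
  smooth : ContDiff ℝ ((⌊s⌋₊ + 1 : ℕ) : WithTop ℕ∞) g
  zero : g 0 = 0

theorem IsNonlinearity.contDiff_one {g : ℝ → ℝ} {s : ℝ} (h : IsNonlinearity g s) :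
    ContDiff ℝ 1 g := h.smooth.of_le (by exact_mod_cast Nat.le_add_left 1 _)

theorem IsNonlinearity.pos {g : ℝ → ℝ} {s : ℝ} (h : IsNonlinearity g s) : 0 ≤ s := by
  linarith [h.reg]

section

variable {l b g : ℝ → ℝ} {ρ r s : ℝ} {T : EReal} {u : ℝ → L2} {U V : ℝ → L2C} {U₀ V₀ : L2C}

/-- The forcing in the Duhamel formula for `cos (tω) u - sin (tω) / ω u_t`. -/
def srcS (l b g : ℝ → ℝ) (s : ℝ) (u : ℝ → L2) (τ : ℝ) : L2C :=
  wtLp s (mulOp (ks l b τ) (ft (nem g (u τ))))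

/-- The forcing in the Duhamel formula for `ω sin (tω) u + cos (tω) u_t`. -/
def srcC (ρ : ℝ) (l b g : ℝ → ℝ) (s : ℝ) (u : ℝ → L2) (τ : ℝ) : L2C :=
  wtLp s (mulOp (kc ρ l b τ) (ft (nem g (u τ))))

/-- `u` satisfies Duhamel's formula on `[0, T)`, on the Fourier side: `U` and `V` are the transforms
of `u` and of `u_t`, multiplied by the weights of `H^s` and of `H^{s-1-ρ/2}`. -/
structure IsMild (l b g : ℝ → ℝ) (ρ s : ℝ) (T : EReal) (U₀ V₀ : L2C) (u : ℝ → L2)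
    (U V : ℝ → L2C) : Prop where
  continuousOn_u : ContinuousOn u (timeInterval T)
  bounded : ∀ t' ∈ timeInterval T, ∃ M : NNReal, ∀ t ∈ Set.Icc 0 t', hsq s (ft (u t)) ≤ M
  fourier_u : ∀ t ∈ timeInterval T, ft (u t) = mulOp (wt (-s)) (U t)
  eq_U : ∀ t ∈ timeInterval T, U t = mulOp (pc l t) (U₀ + ∫ τ in (0 : ℝ)..t, srcS l b g s u τ) +
    mulOp (ps ρ l t) (V₀ - ∫ τ in (0 : ℝ)..t, srcC ρ l b g s u τ)
  eq_V : ∀ t ∈ timeInterval T, V t = mulOp (pc l t) (V₀ - ∫ τ in (0 : ℝ)..t, srcC ρ l b g s u τ) -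
    mulOp (pt ρ l t) (U₀ + ∫ τ in (0 : ℝ)..t, srcS l b g s u τ)

theorem continuousOn_nem_of_bdd (hn : IsNonlinearity g s) {I : Set ℝ} (hu : ContinuousOn u I)
    {M : NNReal} (hM : ∀ t ∈ I, hsq s (ft (u t)) ≤ M) : ContinuousOn (fun t => nem g (u t)) I :=
  (continuousOn_nem hn.reg hn.contDiff_one hn.zero M).comp hu hM

/-- On bounded subsets of `H^s` and bounded time intervals the forcing is bounded in `H^s`. -/
theorem exists_hsq_forcing_le (hn : IsNonlinearity g s) {m : ℝ → ℝ → ℝ} (hm : IsBddFamily m)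
    (R : ℝ) (M : NNReal) : ∃ K : NNReal, ∀ τ, |τ| ≤ R → ∀ u : L2, hsq s (ft u) ≤ M →
      hsq s (mulOp (m τ) (ft (nem g u))) ≤ K := by
  obtain ⟨K, hK⟩ := exists_hsq_nem_le hn.reg hn.smooth hn.zero M
  obtain ⟨C, hC⟩ := hm.bound R
  refine ⟨(C ^ 2).toNNReal * K, fun τ hτ u hu => ?_⟩
  rw [ENNReal.coe_mul]
  exact (hsq_mulOp_le (hm.meas τ) (hC τ hτ) _).trans (mul_le_mul_right (hK u hu) _)

theorem continuousOn_forcing (hn : IsNonlinearity g s) {m : ℝ → ℝ → ℝ} (hm : IsBddFamily m)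
    {I : Set ℝ} (hu : ContinuousOn u I) {M : NNReal} (hM : ∀ t ∈ I, hsq s (ft (u t)) ≤ M) :
    ContinuousOn (fun τ => mulOp (m τ) (ft (nem g (u τ)))) I :=
  hm.continuousOn (continuous_ft.comp_continuousOn (continuousOn_nem_of_bdd hn hu hM))

theorem intervalIntegrable_forcing (hn : IsNonlinearity g s) {m : ℝ → ℝ → ℝ} (hm : IsBddFamily m)
    {c d : ℝ} (hcd : c ≤ d) (hu : ContinuousOn u (Set.Ioo c d)) {M : NNReal}
    (hM : ∀ t ∈ Set.Ioo c d, hsq s (ft (u t)) ≤ M) :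
    IntervalIntegrable (fun τ => wtLp s (mulOp (m τ) (ft (nem g (u τ))))) volume c d := by
  obtain ⟨K, hK⟩ := exists_hsq_forcing_le hn hm (max |c| |d|) M
  exact intervalIntegrable_wtLp hn.pos hcd (continuousOn_forcing hn hm hu hM)
    fun τ hτ => hK τ (abs_le_max_abs_abs hτ.1.le hτ.2.le) _ (hM τ hτ)

theorem mulOp_integral_forcing (hn : IsNonlinearity g s) {m : ℝ → ℝ → ℝ} (hm : IsBddFamily m)
    {c d : ℝ} (hcd : c ≤ d) (hu : ContinuousOn u (Set.Ioo c d)) {M : NNReal}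
    (hM : ∀ t ∈ Set.Ioo c d, hsq s (ft (u t)) ≤ M) :
    mulOp (wt (-s)) (∫ τ in c..d, wtLp s (mulOp (m τ) (ft (nem g (u τ))))) =
      ∫ τ in c..d, mulOp (m τ) (ft (nem g (u τ))) := by
  obtain ⟨K, hK⟩ := exists_hsq_forcing_le hn hm (max |c| |d|) M
  exact mulOp_integral_wtLp hn.pos hcd (continuousOn_forcing hn hm hu hM)
    fun τ hτ => hK τ (abs_le_max_abs_abs hτ.1.le hτ.2.le) _ (hM τ hτ)

/-- The primitive of the forcing is continuous. -/
theorem continuousOn_integral_forcing (hn : IsNonlinearity g s) {m : ℝ → ℝ → ℝ}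
    (hm : IsBddFamily m) (hu : ContinuousOn u (timeInterval T))
    (hM : ∀ t' ∈ timeInterval T, ∃ M : NNReal, ∀ t ∈ Set.Icc 0 t', hsq s (ft (u t)) ≤ M) :
    ContinuousOn (fun t => ∫ τ in (0 : ℝ)..t, wtLp s (mulOp (m τ) (ft (nem g (u τ)))))
      (timeInterval T) := by
  apply continuousOn_timeInterval
  intro t' ht'
  obtain ⟨M, hM⟩ := hM t' ht'
  have h1 := intervalIntegrable_forcing hn hm ht'.1
    (hu.mono (Set.Ioo_subset_Icc_self.trans (Icc_subset_timeInterval ht')))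
    (fun t ht => hM t (Set.Ioo_subset_Icc_self ht))
  have h2 := intervalIntegral.continuousOn_primitive_interval' h1 (Set.left_mem_uIcc)
  rwa [Set.uIcc_of_le ht'.1] at h2

theorem hasDerivWithinAt_integral_forcing (hn : IsNonlinearity g s) {m : ℝ → ℝ → ℝ}
    (hm : IsBddFamily m) (hu : ContinuousOn u (timeInterval T))
    (hM : ∀ t' ∈ timeInterval T, ∃ M : NNReal, ∀ t ∈ Set.Icc 0 t', hsq s (ft (u t)) ≤ M)
    (Y : L2C) {t : ℝ} (ht : t ∈ timeInterval T) :
    HasDerivWithinAt (fun t => mulOp (wt (-s)) (Y + ∫ τ in (0 : ℝ)..t,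
      wtLp s (mulOp (m τ) (ft (nem g (u τ))))))
      (mulOp (m t) (ft (nem g (u t)))) (timeInterval T) t := by
  refine hasDerivWithinAt_timeInterval
    (f := fun τ => mulOp (m τ) (ft (nem g (u τ)))) ?_ (fun t ht => ?_) ht
  · apply continuousOn_timeInterval
    intro t' ht'
    obtain ⟨M, hM⟩ := hM t' ht'
    exact continuousOn_forcing hn hm (hu.mono (Icc_subset_timeInterval ht')) hM
  · obtain ⟨M, hM⟩ := hM t ht
    rw [map_add, mulOp_integral_forcing hn hm ht.1
      (hu.mono (Set.Ioo_subset_Icc_self.trans (Icc_subset_timeInterval ht)))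
      (fun t ht => hM t (Set.Ioo_subset_Icc_self ht))]
    simp

theorem hasDerivWithinAt_pc_apply (h : IsSymbolPair l b ρ r) {X : ℝ → L2C} {X' : L2C} {I : Set ℝ}
    {t : ℝ} (hX : HasDerivWithinAt X X' I t) :
    HasDerivWithinAt (fun t => mulOp (fun ξ => wt (-2 * (1 + ρ / 2)) ξ * pc l t ξ) (X t))
      (mulOp (fun ξ => wt (-2 * (1 + ρ / 2)) ξ * -(om l ξ * Real.sin (t * om l ξ))) (X t) +
        mulOp (fun ξ => wt (-2 * (1 + ρ / 2)) ξ * pc l t ξ) X') I t :=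
  (hasDerivAt_pc h t).hasDerivWithinAt.clm_apply hX

theorem hasDerivWithinAt_ps_apply (h : IsSymbolPair l b ρ r) {X : ℝ → L2C} {X' : L2C} {I : Set ℝ}
    {t : ℝ} (hX : HasDerivWithinAt X X' I t) :
    HasDerivWithinAt (fun t => mulOp (fun ξ => wt (-2 * (1 + ρ / 2)) ξ * ps ρ l t ξ) (X t))
      (mulOp (fun ξ => wt (-2 * (1 + ρ / 2)) ξ * (wt (1 + ρ / 2) ξ * pc l t ξ)) (X t) +
        mulOp (fun ξ => wt (-2 * (1 + ρ / 2)) ξ * ps ρ l t ξ) X') I t :=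
  (hasDerivAt_ps h t).hasDerivWithinAt.clm_apply hX

theorem hasDerivWithinAt_pt_apply (h : IsSymbolPair l b ρ r) {X : ℝ → L2C} {X' : L2C} {I : Set ℝ}
    {t : ℝ} (hX : HasDerivWithinAt X X' I t) :
    HasDerivWithinAt (fun t => mulOp (fun ξ => wt (-2 * (1 + ρ / 2)) ξ * pt ρ l t ξ) (X t))
      (mulOp (fun ξ => wt (-2 * (1 + ρ / 2)) ξ *
          (wt (-(1 + ρ / 2)) ξ * (om l ξ * (om l ξ * pc l t ξ)))) (X t) +
        mulOp (fun ξ => wt (-2 * (1 + ρ / 2)) ξ * pt ρ l t ξ) X') I t :=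
  (hasDerivAt_pt h t).hasDerivWithinAt.clm_apply hX

theorem mulOp₃_congr {m n k m' n' : ℝ → ℝ} (hm : IsBdd m) (hn : IsBdd n) (hk : IsBdd k)
    (hm' : IsBdd m') (hn' : IsBdd n') (h : ∀ ξ, m ξ * n ξ * k ξ = m' ξ * n' ξ) (F : L2C) :
    mulOp m (mulOp n (mulOp k F)) = mulOp m' (mulOp n' F) := by
  rw [mulOp_mulOp hm hn]
  exact mulOp_mulOp_congr (hm.mul hn) hk hm' hn' h F

theorem mulOp_add_mulOp_eq_self {m n m' n' : ℝ → ℝ} (hm : IsBdd m) (hn : IsBdd n) (hm' : IsBdd m')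
    (hn' : IsBdd n') (h : ∀ ξ, m ξ * n ξ + m' ξ * n' ξ = 1) (F : L2C) :
    mulOp m (mulOp n F) + mulOp m' (mulOp n' F) = F := by
  rw [mulOp_mulOp hm hn, mulOp_mulOp hm' hn', ← add_apply,
    ← mulOp_add (hm.mul hn) (hm'.mul hn')]
  simp only [h]
  exact mulOp_one F

set_option maxHeartbeats 1000000 in
/-- Solutions on the Fourier side satisfy Duhamel's formula. -/
theorem IsFourierSolution.isMild (hsym : IsSymbolPair l b ρ r) (hn : IsNonlinearity g s)
    (h : IsFourierSolution l b g ρ s (timeInterval T) u U V) :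
    IsMild l b g ρ s T (U 0) (V 0) u U V := by
  have hρ := hsym.rho
  have hs := hn.pos
  have huc := continuousOn_of_ft h.continuousOn_U h.fourier_u
  have hbdd : ∀ t' ∈ timeInterval T, ∃ M : NNReal, ∀ t ∈ Set.Icc 0 t', hsq s (ft (u t)) ≤ M := by
    intro t' ht'
    have hsub := Icc_subset_timeInterval ht'
    obtain ⟨M, hM⟩ := isCompact_Icc.exists_bound_of_continuousOn (h.continuousOn_U.mono hsub)
    refine ⟨M.toNNReal ^ 2, fun t ht => ?_⟩
    rw [hsq_of_eq_mulOp hs (h.fourier_u t (hsub ht)), ENNReal.coe_pow]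
    gcongr
    rw [← ofReal_norm]
    exact ENNReal.ofReal_le_ofReal (hM t ht)
  set a := 1 + ρ / 2 with ha
  -- the derivatives of `U` and `V`, in a space of low regularity
  have hX : ∀ t ∈ timeInterval T, HasDerivWithinAt (fun t => mulOp (wt (-2 * a - s)) (U t))
      (mulOp (wt (-a - s)) (V t)) (timeInterval T) t := by
    intro t ht
    have h1 := (mulOp (wt (-a - s))).hasFDerivAt.comp_hasDerivWithinAt t (h.deriv_u t ht)
    refine h1.congr_of_mem (fun τ _ => ?_) ht
    refine (mulOp_mulOp_eq (isBdd_wt (by linarith)) (isBdd_wt (by linarith)) (fun ξ => ?_) _).symm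
    rw [← wt_add]
    congr 1
    ring
  have hbc := fun t => (isBdd_wt (by linarith : -2 * a ≤ 0)).mul ((isBddFamily_pc hsym).isBdd t)
  have hbs := fun t => (isBdd_wt (by linarith : -2 * a ≤ 0)).mul ((isBddFamily_ps hsym).isBdd t)
  have hbt := fun t => (isBdd_wt (by linarith : -2 * a ≤ 0)).mul ((isBddFamily_pt hsym).isBdd t)
  have hbks := fun t => (isBddFamily_ks hsym).isBdd t
  have hbkc := fun t => (isBddFamily_kc hsym).isBdd t
  have hsin := fun t => (isBddFamily_sin hsym).isBdd t
  have hbc' : ∀ t, IsBdd fun ξ => wt (-2 * a) ξ * -(om l ξ * Real.sin (t * om l ξ)) := by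
    intro t
    have := (((hasOrder_wt (-2 * a)).mul (hsym.hasOrder_om.mul
      (hsin t).hasOrder)).isBdd (by linarith)).neg
    simpa only [mul_neg] using this
  have hbs' : ∀ t, IsBdd fun ξ => wt (-2 * a) ξ * (wt a ξ * pc l t ξ) := fun t =>
    ((hasOrder_wt (-2 * a)).mul ((hasOrder_wt a).mul
      ((isBddFamily_pc hsym).isBdd t).hasOrder)).isBdd (by linarith)
  have hbt' : ∀ t, IsBdd fun ξ => wt (-2 * a) ξ *
      (wt (-a) ξ * (om l ξ * (om l ξ * pc l t ξ))) := fun t =>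
    ((hasOrder_wt (-2 * a)).mul ((hasOrder_wt (-a)).mul (hsym.hasOrder_om.mul (hsym.hasOrder_om.mul
      ((isBddFamily_pc hsym).isBdd t).hasOrder)))).isBdd (by linarith)
  have hb1 : IsBdd fun ξ => wt (-3 * a) ξ * om l ξ ^ 2 := isBdd_wt_mul_om_sq hsym
  have hb2 : IsBdd fun ξ => wt (-3 * a) ξ * be b ξ := isBdd_wt_mul_be hsym
  have hw4 : IsBdd (wt (-4 * a)) := isBdd_wt (by linarith)
  have hw2 : IsBdd (wt (-2 * a - s)) := isBdd_wt (by linarith)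
  have hw1 : IsBdd (wt (-a - s)) := isBdd_wt (by linarith)
  have hwa : ∀ ξ, wt a ξ * wt (-a) ξ = 1 := fun ξ => by rw [← wt_add]; simp [wt_zero]
  have e1 : ∀ ξ, wt (-2 * a) ξ = wt (-a) ξ * wt (-a) ξ := fun ξ => by
    rw [← wt_add]; congr 1; ring
  have e2 : ∀ ξ, wt (-2 * a - s) ξ = wt (-a) ξ * wt (-a) ξ * wt (-s) ξ := fun ξ => by
    rw [← wt_add, ← wt_add]; congr 1; ring
  have e3 : ∀ ξ, wt (-a - s) ξ = wt (-a) ξ * wt (-s) ξ := fun ξ => by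
    rw [← wt_add]; congr 1
  have e4 : ∀ ξ, wt (-3 * a) ξ = wt (-a) ξ * wt (-a) ξ * wt (-a) ξ := fun ξ => by
    rw [← wt_add, ← wt_add]; congr 1; ring
  have e5 : ∀ ξ, wt (-4 * a) ξ = wt (-a) ξ * wt (-a) ξ * wt (-a) ξ * wt (-a) ξ := fun ξ => by
    rw [← wt_add, ← wt_add, ← wt_add]; congr 1; ring
  have hint : ∀ {m : ℝ → ℝ → ℝ}, IsBddFamily m → ∀ t ∈ timeInterval T,
      mulOp (wt (-s)) (∫ τ in (0 : ℝ)..t, wtLp s (mulOp (m τ) (ft (nem g (u τ))))) =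
      ∫ τ in (0 : ℝ)..t, mulOp (m τ) (ft (nem g (u τ))) := by
    intro m hm t ht
    obtain ⟨M, hM⟩ := hbdd t ht
    exact mulOp_integral_forcing hn hm ht.1
      (huc.mono (Set.Ioo_subset_Icc_self.trans (Icc_subset_timeInterval ht)))
      (fun t ht => hM t (Set.Ioo_subset_Icc_self ht))
  have hcont : ∀ {m : ℝ → ℝ → ℝ}, IsBddFamily m →
      ContinuousOn (fun τ => mulOp (m τ) (ft (nem g (u τ)))) (timeInterval T) := fun hm =>
    hm.continuousOn (continuous_ft.comp_continuousOn h.continuousOn_N)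
  -- an antiderivative determines the quantity up to its initial value
  have hfin : ∀ {m : ℝ → ℝ → ℝ}, IsBddFamily m → ∀ {Z : ℝ → L2C},
      (∀ t ∈ timeInterval T, HasDerivWithinAt (fun t => mulOp (wt (-4 * a)) (mulOp (wt (-s)) (Z t)))
        (mulOp (wt (-4 * a)) (mulOp (m t) (ft (nem g (u t))))) (timeInterval T) t) →
      ∀ t ∈ timeInterval T, Z t = Z 0 + ∫ τ in (0 : ℝ)..t,
        wtLp s (mulOp (m τ) (ft (nem g (u τ)))) := by
    intro m hm Z hZ t ht
    have hc := (mulOp (wt (-4 * a))).continuous.comp_continuousOn (hcont hm)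
    have hsub : Set.uIcc 0 t ⊆ timeInterval T := by
      rw [Set.uIcc_of_le ht.1]; exact Icc_subset_timeInterval ht
    have h1 := intervalIntegral.integral_eq_sub_of_hasDeriv_right_of_le ht.1
      (fun τ hτ => ((hZ τ (Icc_subset_timeInterval ht hτ)).continuousWithinAt).mono
        (Icc_subset_timeInterval ht))
      (fun τ hτ => (hZ τ (Icc_subset_timeInterval ht ⟨hτ.1.le, hτ.2.le⟩)).mono_of_mem_nhdsWithin
        (mem_nhdsWithin_of_mem_nhds (Filter.mem_of_superset (Ioo_mem_nhds hτ.1 hτ.2)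
          (Set.Ioo_subset_Icc_self.trans (Icc_subset_timeInterval ht)))))
      ((hc.mono hsub).intervalIntegrable)
    have h2 : ∫ τ in (0 : ℝ)..t, mulOp (wt (-4 * a)) (mulOp (m τ) (ft (nem g (u τ)))) =
        mulOp (wt (-4 * a)) (∫ τ in (0 : ℝ)..t, mulOp (m τ) (ft (nem g (u τ)))) :=
      ContinuousLinearMap.intervalIntegral_comp_comm _ (((hcont hm).mono hsub).intervalIntegrable)
    rw [h2, ← hint hm t ht, ← map_sub, ← map_sub] at h1
    have h3 := mulOp_wt_injective hs (mulOp_injective hw4 (fun ξ => (wt_pos _ _).ne') h1)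
    rw [h3]
    abel
  have hA : ∀ t ∈ timeInterval T, mulOp (pc l t) (U t) - mulOp (ps ρ l t) (V t) =
      U 0 + ∫ τ in (0 : ℝ)..t, srcS l b g s u τ := by
    have h0 : mulOp (pc l 0) (U 0) - mulOp (ps ρ l 0) (V 0) = U 0 := by
      have h1 : pc l 0 = fun _ => 1 := by ext ξ; simp [pc]
      have h2 : ps ρ l 0 = fun _ => 0 * 1 := by ext ξ; simp [ps, sn]
      rw [h1, h2, mulOp_one, mulOp_const_mul (isBdd_const 1)]
      simp
    intro t ht
    have := hfin (isBddFamily_ks hsym)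
      (Z := fun t => mulOp (pc l t) (U t) - mulOp (ps ρ l t) (V t)) ?_ t ht
    · rw [h0] at this
      exact this
    · intro t ht
      have h1 := (hasDerivWithinAt_pc_apply hsym (hX t ht)).sub
        (hasDerivWithinAt_ps_apply hsym (h.deriv_v t ht))
      rw [← ha] at h1
      have q1 : mulOp (fun ξ => wt (-2 * a) ξ * ps ρ l t ξ)
          (mulOp (fun ξ => wt (-3 * a) ξ * om l ξ ^ 2) (ft (u t))) =
          -mulOp (fun ξ => wt (-2 * a) ξ * -(om l ξ * Real.sin (t * om l ξ)))
            (mulOp (wt (-2 * a - s)) (U t)) := by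
        rw [h.fourier_u t ht, ← neg_apply, ← mulOp_neg (hbc' t)]
        refine mulOp₃_congr (hbs t) hb1 (isBdd_wt (by linarith)) (hbc' t).neg hw2 (fun ξ => ?_) _
        simp only [ps, ← ha, e1, e2, e4, ← mul_sn]
        linear_combination (wt (-a) ξ ^ 4 * om l ξ ^ 2 * sn (om l ξ) t * wt (-s) ξ) * hwa ξ
      have q2 : mulOp (fun ξ => wt (-2 * a) ξ * pc l t ξ) (mulOp (wt (-a - s)) (V t)) =
          mulOp (fun ξ => wt (-2 * a) ξ * (wt a ξ * pc l t ξ))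
            (mulOp (wt (-2 * a - s)) (V t)) := by
        refine mulOp_mulOp_congr (hbc t) hw1 (hbs' t) hw2 (fun ξ => ?_) _
        simp only [e1, e2, e3]
        linear_combination (-wt (-a) ξ ^ 3 * pc l t ξ * wt (-s) ξ) * hwa ξ
      have q3 : mulOp (fun ξ => wt (-2 * a) ξ * ps ρ l t ξ)
          (mulOp (fun ξ => wt (-3 * a) ξ * be b ξ) (ft (nem g (u t)))) =
          mulOp (wt (-4 * a)) (mulOp (ks l b t) (ft (nem g (u t)))) := by
        refine mulOp_mulOp_congr (hbs t) hb2 hw4 (hbks t) (fun ξ => ?_) _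
        simp only [ps, ks, ← ha, e1, e4, e5, ← mul_sn, hsym.be_eq]
        linear_combination (wt (-a) ξ ^ 4 * om l ξ * sn (om l ξ) t * ka l b ξ) * hwa ξ
      refine (h1.congr_of_mem (fun τ _ => ?_) ht).congr_deriv ?_
      · simp only [map_sub, Pi.sub_apply]
        congr 1
        · refine mulOp₃_congr hw4 (isBdd_wt (by linarith)) ((isBddFamily_pc hsym).isBdd τ)
            (hbc τ) hw2 (fun ξ => ?_) _
          simp only [e1, e2, e5]
          ring
        · refine mulOp₃_congr hw4 (isBdd_wt (by linarith)) ((isBddFamily_ps hsym).isBdd τ)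
            (hbs τ) hw2 (fun ξ => ?_) _
          simp only [e1, e2, e5]
          ring
      · rw [map_neg, map_add, q1, q2, q3]
        abel
  have hB : ∀ t ∈ timeInterval T, mulOp (pt ρ l t) (U t) + mulOp (pc l t) (V t) =
      V 0 - ∫ τ in (0 : ℝ)..t, srcC ρ l b g s u τ := by
    have h0 : mulOp (pt ρ l 0) (U 0) + mulOp (pc l 0) (V 0) = V 0 := by
      have h1 : pc l 0 = fun _ => 1 := by ext ξ; simp [pc]
      have h2 : pt ρ l 0 = fun _ => 0 * 1 := by ext ξ; simp [pt]
      rw [h1, h2, mulOp_one, mulOp_const_mul (isBdd_const 1)]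
      simp
    intro t ht
    have := hfin (isBddFamily_kc hsym)
      (Z := fun t => -(mulOp (pt ρ l t) (U t) + mulOp (pc l t) (V t))) ?_ t ht
    · simp only [h0] at this
      rw [← neg_inj, this]
      unfold srcC
      abel
    · intro t ht
      have h1 := ((hasDerivWithinAt_pt_apply hsym (hX t ht)).add
        (hasDerivWithinAt_pc_apply hsym (h.deriv_v t ht))).neg
      rw [← ha] at h1
      have q1 : mulOp (fun ξ => wt (-2 * a) ξ * pc l t ξ)
          (mulOp (fun ξ => wt (-3 * a) ξ * om l ξ ^ 2) (ft (u t))) =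
          mulOp (fun ξ => wt (-2 * a) ξ * (wt (-a) ξ * (om l ξ * (om l ξ * pc l t ξ))))
            (mulOp (wt (-2 * a - s)) (U t)) := by
        rw [h.fourier_u t ht]
        refine mulOp₃_congr (hbc t) hb1 (isBdd_wt (by linarith)) (hbt' t) hw2 (fun ξ => ?_) _
        simp only [e1, e2, e4]
        ring
      have q2 : mulOp (fun ξ => wt (-2 * a) ξ * pt ρ l t ξ) (mulOp (wt (-a - s)) (V t)) =
          -mulOp (fun ξ => wt (-2 * a) ξ * -(om l ξ * Real.sin (t * om l ξ)))
            (mulOp (wt (-2 * a - s)) (V t)) := by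
        rw [← neg_apply, ← mulOp_neg (hbc' t)]
        refine mulOp_mulOp_congr (hbt t) hw1 (hbc' t).neg hw2 (fun ξ => ?_) _
        simp only [pt, ← ha, e1, e2, e3]
        ring
      have q3 : mulOp (fun ξ => wt (-2 * a) ξ * pc l t ξ)
          (mulOp (fun ξ => wt (-3 * a) ξ * be b ξ) (ft (nem g (u t)))) =
          mulOp (wt (-4 * a)) (mulOp (kc ρ l b t) (ft (nem g (u t)))) := by
        refine mulOp_mulOp_congr (hbc t) hb2 hw4 (hbkc t) (fun ξ => ?_) _
        simp only [pc, kc, ← ha, e1, e4, e5]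
        ring
      refine (h1.congr_of_mem (fun τ _ => ?_) ht).congr_deriv ?_
      · simp only [map_neg, map_add, Pi.neg_apply, Pi.add_apply]
        congr 2
        · refine mulOp₃_congr hw4 (isBdd_wt (by linarith)) ((isBddFamily_pt hsym).isBdd τ)
            (hbt τ) hw2 (fun ξ => ?_) _
          simp only [e1, e2, e5]
          ring
        · refine mulOp₃_congr hw4 (isBdd_wt (by linarith)) ((isBddFamily_pc hsym).isBdd τ)
            (hbc τ) hw2 (fun ξ => ?_) _
          simp only [e1, e2, e5]
          ring
      · rw [map_neg, map_add, q1, q2, q3]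
        abel
  have hone : ∀ t ξ, pc l t ξ * pc l t ξ + ps ρ l t ξ * pt ρ l t ξ = 1 := by
    intro t ξ
    have h1 := Real.sin_sq_add_cos_sq (t * om l ξ)
    simp only [pc, ps, pt, ← ha]
    rw [← mul_sn] at h1 ⊢
    linear_combination h1 + (sn (om l ξ) t ^ 2 * om l ξ ^ 2) * hwa ξ
  have bc := fun t => (isBddFamily_pc hsym).isBdd t
  have bs := fun t => (isBddFamily_ps hsym).isBdd t
  have bt := fun t => (isBddFamily_pt hsym).isBdd t
  refine ⟨huc, hbdd, h.fourier_u, fun t ht => ?_, fun t ht => ?_⟩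
  · rw [← hA t ht, ← hB t ht, map_sub, map_add,
      mulOp_mulOp_congr (bc t) (bs t) (bs t) (bc t) (fun ξ => mul_comm _ _)]
    nth_rewrite 1 [← mulOp_add_mulOp_eq_self (bc t) (bc t) (bs t) (bt t) (hone t) (U t)]
    abel
  · rw [← hA t ht, ← hB t ht, map_sub, map_add,
      mulOp_mulOp_congr (bc t) (bt t) (bt t) (bc t) (fun ξ => mul_comm _ _)]
    nth_rewrite 1 [← mulOp_add_mulOp_eq_self (bc t) (bc t) (bt t) (bs t)
      (fun ξ => by rw [mul_comm (pt ρ l t ξ)]; exact hone t ξ) (V t)]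
    abel

set_option maxHeartbeats 1000000 in
/-- Duhamel's formula defines a solution on the Fourier side. -/
theorem IsMild.isFourierSolution (hsym : IsSymbolPair l b ρ r) (hn : IsNonlinearity g s)
    (h : IsMild l b g ρ s T U₀ V₀ u U V) :
    IsFourierSolution l b g ρ s (timeInterval T) u U V := by
  have hρ := hsym.rho
  have hs := hn.pos
  have huc := h.continuousOn_u
  have hN : ContinuousOn (fun t => nem g (u t)) (timeInterval T) := by
    apply continuousOn_timeInterval
    intro t' ht'
    obtain ⟨M, hM⟩ := h.bounded t' ht'
    exact continuousOn_nem_of_bdd hn (huc.mono (Icc_subset_timeInterval ht')) hM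
  set A : ℝ → L2C := fun t => U₀ + ∫ τ in (0 : ℝ)..t, srcS l b g s u τ with hA
  set B : ℝ → L2C := fun t => V₀ - ∫ τ in (0 : ℝ)..t, srcC ρ l b g s u τ with hB
  have hAc : ContinuousOn A (timeInterval T) :=
    continuousOn_const.add (continuousOn_integral_forcing hn (isBddFamily_ks hsym) huc h.bounded)
  have hBc : ContinuousOn B (timeInterval T) :=
    continuousOn_const.sub (continuousOn_integral_forcing hn (isBddFamily_kc hsym) huc h.bounded)
  have hUc : ContinuousOn U (timeInterval T) :=
    (((isBddFamily_pc hsym).continuousOn hAc).add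
      ((isBddFamily_ps hsym).continuousOn hBc)).congr fun t ht => h.eq_U t ht
  have hVc : ContinuousOn V (timeInterval T) :=
    (((isBddFamily_pc hsym).continuousOn hBc).sub
      ((isBddFamily_pt hsym).continuousOn hAc)).congr fun t ht => h.eq_V t ht
  -- the integrals in Duhamel's formula are differentiable in the norm of `L²`, hence the weight `-s`
  have hAd : ∀ t ∈ timeInterval T, HasDerivWithinAt (fun t => mulOp (wt (-s)) (A t))
      (mulOp (ks l b t) (ft (nem g (u t)))) (timeInterval T) t := fun t ht =>
    hasDerivWithinAt_integral_forcing hn (isBddFamily_ks hsym) huc h.bounded U₀ ht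
  have hBd : ∀ t ∈ timeInterval T, HasDerivWithinAt (fun t => mulOp (wt (-s)) (B t))
      (-(mulOp (kc ρ l b t) (ft (nem g (u t))))) (timeInterval T) t := by
    intro t ht
    have h1 := (hasDerivWithinAt_integral_forcing hn (isBddFamily_kc hsym) huc h.bounded
      (-V₀) ht).neg
    refine h1.congr_of_mem (fun τ _ => ?_) ht
    simp only [hB, Pi.neg_apply]
    rw [← map_neg]
    congr 1
    unfold srcC
    abel
  have hEU : ∀ t ∈ timeInterval T, U t = mulOp (pc l t) (A t) + mulOp (ps ρ l t) (B t) := h.eq_U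
  have hEV : ∀ t ∈ timeInterval T, V t = mulOp (pc l t) (B t) - mulOp (pt ρ l t) (A t) := h.eq_V
  clear_value A B
  set a := 1 + ρ / 2 with ha
  have hbc := fun t => (isBdd_wt (by linarith : -2 * a ≤ 0)).mul ((isBddFamily_pc hsym).isBdd t)
  have hbs := fun t => (isBdd_wt (by linarith : -2 * a ≤ 0)).mul ((isBddFamily_ps hsym).isBdd t)
  have hbt := fun t => (isBdd_wt (by linarith : -2 * a ≤ 0)).mul ((isBddFamily_pt hsym).isBdd t)
  have hbks := fun t => (isBddFamily_ks hsym).isBdd t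
  have hbkc := fun t => (isBddFamily_kc hsym).isBdd t
  have bc := fun t => (isBddFamily_pc hsym).isBdd t
  have bs := fun t => (isBddFamily_ps hsym).isBdd t
  have bt := fun t => (isBddFamily_pt hsym).isBdd t
  have hbc' : ∀ t, IsBdd fun ξ => wt (-2 * a) ξ * -(om l ξ * Real.sin (t * om l ξ)) := by
    intro t
    have := (((hasOrder_wt (-2 * a)).mul (hsym.hasOrder_om.mul
      ((isBddFamily_sin hsym).isBdd t).hasOrder)).isBdd (by linarith)).neg
    simpa only [mul_neg] using this
  have hbs' : ∀ t, IsBdd fun ξ => wt (-2 * a) ξ * (wt a ξ * pc l t ξ) := fun t =>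
    ((hasOrder_wt (-2 * a)).mul ((hasOrder_wt a).mul (bc t).hasOrder)).isBdd (by linarith)
  have hbt' : ∀ t, IsBdd fun ξ => wt (-2 * a) ξ *
      (wt (-a) ξ * (om l ξ * (om l ξ * pc l t ξ))) := fun t =>
    ((hasOrder_wt (-2 * a)).mul ((hasOrder_wt (-a)).mul (hsym.hasOrder_om.mul (hsym.hasOrder_om.mul
      (bc t).hasOrder)))).isBdd (by linarith)
  have hb1 : IsBdd fun ξ => wt (-3 * a) ξ * om l ξ ^ 2 := isBdd_wt_mul_om_sq hsym
  have hb2 : IsBdd fun ξ => wt (-3 * a) ξ * be b ξ := isBdd_wt_mul_be hsym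
  have hws : IsBdd (wt (-s)) := isBdd_wt (by linarith)
  have hw2 : IsBdd (wt (-2 * a - s)) := isBdd_wt (by linarith)
  have hw1 : IsBdd (wt (-a - s)) := isBdd_wt (by linarith)
  have hwa : ∀ ξ, wt a ξ * wt (-a) ξ = 1 := fun ξ => by rw [← wt_add]; simp [wt_zero]
  have e1 : ∀ ξ, wt (-2 * a) ξ = wt (-a) ξ * wt (-a) ξ := fun ξ => by
    rw [← wt_add]; congr 1; ring
  have e2 : ∀ ξ, wt (-2 * a - s) ξ = wt (-a) ξ * wt (-a) ξ * wt (-s) ξ := fun ξ => by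
    rw [← wt_add, ← wt_add]; congr 1; ring
  have e3 : ∀ ξ, wt (-a - s) ξ = wt (-a) ξ * wt (-s) ξ := fun ξ => by
    rw [← wt_add]; congr 1
  have e4 : ∀ ξ, wt (-3 * a) ξ = wt (-a) ξ * wt (-a) ξ * wt (-a) ξ := fun ξ => by
    rw [← wt_add, ← wt_add]; congr 1; ring
  -- further weights compensate the unbounded factors `ω` that differentiating the propagators produces
  have hUd : ∀ t ∈ timeInterval T, HasDerivWithinAt (fun t => mulOp (wt (-2 * a - s)) (U t))
      (mulOp (wt (-a - s)) (V t)) (timeInterval T) t := by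
    intro t ht
    have h1 := (hasDerivWithinAt_pc_apply hsym (hAd t ht)).add
      (hasDerivWithinAt_ps_apply hsym (hBd t ht))
    rw [← ha] at h1
    refine (h1.congr_of_mem (fun τ hτ => ?_) ht).congr_deriv ?_
    · simp only [Pi.add_apply]
      rw [hEU τ hτ, map_add]
      congr 1
      · refine mulOp_mulOp_congr hw2 (bc τ) (hbc τ) hws (fun ξ => ?_) _
        simp only [e1, e2]
        ring
      · refine mulOp_mulOp_congr hw2 (bs τ) (hbs τ) hws (fun ξ => ?_) _
        simp only [e1, e2]
        ring
    · have q1 : mulOp (fun ξ => wt (-2 * a) ξ * -(om l ξ * Real.sin (t * om l ξ)))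
          (mulOp (wt (-s)) (A t)) = -mulOp (wt (-a - s)) (mulOp (pt ρ l t) (A t)) := by
        rw [← neg_inj, neg_neg, ← neg_apply, ← mulOp_neg (hbc' t)]
        refine mulOp_mulOp_congr (hbc' t).neg hws hw1 (bt t) (fun ξ => ?_) _
        simp only [pt, ← ha, e1, e3]
        ring
      have q2 : mulOp (fun ξ => wt (-2 * a) ξ * (wt a ξ * pc l t ξ)) (mulOp (wt (-s)) (B t)) =
          mulOp (wt (-a - s)) (mulOp (pc l t) (B t)) := by
        refine mulOp_mulOp_congr (hbs' t) hws hw1 (bc t) (fun ξ => ?_) _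
        simp only [e1, e3]
        linear_combination (wt (-a) ξ * pc l t ξ * wt (-s) ξ) * hwa ξ
      have q3 : mulOp (fun ξ => wt (-2 * a) ξ * pc l t ξ)
          (mulOp (ks l b t) (ft (nem g (u t)))) = mulOp (fun ξ => wt (-2 * a) ξ * ps ρ l t ξ)
          (mulOp (kc ρ l b t) (ft (nem g (u t)))) := by
        refine mulOp_mulOp_congr (hbc t) (hbks t) (hbs t) (hbkc t) (fun ξ => ?_) _
        simp only [pc, ps, ks, kc, ← ha, hsym.be_eq, ← mul_sn]
        linear_combination (-wt (-2 * a) ξ * Real.cos (t * om l ξ) * om l ξ * ka l b ξ *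
          sn (om l ξ) t) * hwa ξ
      rw [hEV t ht, map_sub, map_neg (mulOp _), q1, q2, q3]
      abel
  refine ⟨hUc, hVc, h.fourier_u, fun t ht => ?_, hN, fun t ht => ?_⟩
  · refine hasDerivWithinAt_timeInterval hVc (fun t ht => ?_) ht
    have hsub := Icc_subset_timeInterval ht
    have hint : IntervalIntegrable V volume 0 t :=
      (hVc.mono (by rw [Set.uIcc_of_le ht.1]; exact hsub)).intervalIntegrable
    have h1 := intervalIntegral.integral_eq_sub_of_hasDeriv_right_of_le ht.1
      (fun τ hτ => ((hUd τ (hsub hτ)).continuousWithinAt).mono hsub)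
      (fun τ hτ => (hUd τ (hsub ⟨hτ.1.le, hτ.2.le⟩)).mono_of_mem_nhdsWithin
        (mem_nhdsWithin_of_mem_nhds (Filter.mem_of_superset (Ioo_mem_nhds hτ.1 hτ.2)
          (Set.Ioo_subset_Icc_self.trans hsub))))
      (((mulOp (wt (-a - s))).continuous.comp_continuousOn
        (hVc.mono (by rw [Set.uIcc_of_le ht.1]; exact hsub))).intervalIntegrable)
    rw [ContinuousLinearMap.intervalIntegral_comp_comm _ hint] at h1
    have h2 : ∀ F, mulOp (wt (-2 * a - s)) F = mulOp (wt (-a - s)) (mulOp (wt (-a)) F) := by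
      intro F
      refine (mulOp_mulOp_eq hw1 (isBdd_wt (by linarith)) (fun ξ => ?_) F).symm
      simp only [e2, e3]
      ring
    rw [h2, h2, ← map_sub] at h1
    rw [mulOp_injective hw1 (fun ξ => (wt_pos _ _).ne') h1]
    abel
  · have h1 := (hasDerivWithinAt_pc_apply hsym (hBd t ht)).sub
      (hasDerivWithinAt_pt_apply hsym (hAd t ht))
    rw [← ha] at h1
    refine (h1.congr_of_mem (fun τ hτ => ?_) ht).congr_deriv ?_
    · simp only [Pi.sub_apply]
      rw [hEV τ hτ, map_sub]
      congr 1
      · refine mulOp_mulOp_congr hw2 (bc τ) (hbc τ) hws (fun ξ => ?_) _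
        simp only [e1, e2]
        ring
      · refine mulOp_mulOp_congr hw2 (bt τ) (hbt τ) hws (fun ξ => ?_) _
        simp only [e1, e2]
        ring
    · have q1 : mulOp (fun ξ => wt (-2 * a) ξ * -(om l ξ * Real.sin (t * om l ξ)))
          (mulOp (wt (-s)) (B t)) = -mulOp (fun ξ => wt (-3 * a) ξ * om l ξ ^ 2)
            (mulOp (wt (-s)) (mulOp (ps ρ l t) (B t))) := by
        rw [← neg_inj, neg_neg, ← neg_apply, ← mulOp_neg (hbc' t)]
        refine (mulOp₃_congr hb1 hws (bs t) (hbc' t).neg hws (fun ξ => ?_) _).symm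
        simp only [ps, ← ha, e1, e4, ← mul_sn]
        linear_combination (wt (-a) ξ ^ 2 * om l ξ ^ 2 * wt (-s) ξ * sn (om l ξ) t) * hwa ξ
      have q2 : mulOp (fun ξ => wt (-2 * a) ξ * (wt (-a) ξ * (om l ξ * (om l ξ * pc l t ξ))))
          (mulOp (wt (-s)) (A t)) = mulOp (fun ξ => wt (-3 * a) ξ * om l ξ ^ 2)
            (mulOp (wt (-s)) (mulOp (pc l t) (A t))) := by
        refine (mulOp₃_congr hb1 hws (bc t) (hbt' t) hws (fun ξ => ?_) _).symm
        simp only [e1, e4]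
        ring
      have q3 : mulOp (fun ξ => wt (-2 * a) ξ * pc l t ξ)
          (mulOp (kc ρ l b t) (ft (nem g (u t)))) + mulOp (fun ξ => wt (-2 * a) ξ * pt ρ l t ξ)
          (mulOp (ks l b t) (ft (nem g (u t)))) =
          mulOp (fun ξ => wt (-3 * a) ξ * be b ξ) (ft (nem g (u t))) := by
        rw [mulOp_mulOp (hbc t) (hbkc t), mulOp_mulOp (hbt t) (hbks t),
          ← add_apply, ← mulOp_add ((hbc t).mul (hbkc t))
          ((hbt t).mul (hbks t))]
        congr 2
        ext ξ
        have h2 := Real.sin_sq_add_cos_sq (t * om l ξ)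
        simp only [pc, pt, ks, kc, ← ha, hsym.be_eq, e1, e4]
        linear_combination (wt (-a) ξ ^ 3 * om l ξ * ka l b ξ) * h2
      rw [h.fourier_u t ht, hEU t ht, map_add, map_add, ← q3, ← q2, map_neg, q1]
      abel

end

/-! ### Transforms of real functions -/

/-- The map `ft` as a continuous linear map. -/
def ftL : L2 →L[ℝ] L2C := fourierR.comp cplx

theorem ftL_apply (u : L2) : ftL u = ft u := rfl

theorem isHerm_iff_ft_ift (F : L2C) : IsHerm F ↔ ft (ift F) = F :=
  ⟨ft_ift, fun h => h ▸ isHerm_ft _⟩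

theorem isHerm_integral {X : ℝ → L2C} {c d : ℝ} (hX : IntervalIntegrable X volume c d)
    (h : ∀ τ ∈ Set.uIoc c d, IsHerm (X τ)) : IsHerm (∫ τ in c..d, X τ) := by
  rw [isHerm_iff_ft_ift, ← ftL_apply, ← ContinuousLinearMap.comp_apply,
    ← ContinuousLinearMap.intervalIntegral_comp_comm _ hX]
  refine intervalIntegral.integral_congr_ae (Eventually.of_forall fun τ hτ => ?_)
  exact ft_ift (h τ hτ)

theorem isHerm_wtLp {s : ℝ} (hs : 0 ≤ s) {F : L2C} (hF : IsHerm F) : IsHerm (wtLp s F) := by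
  by_cases h : hsq s F < ⊤
  · have h1 : ∀ n, mulOp (fun ξ => cut n ξ * wt s ξ) F = mulOp (cut n) (wtLp s F) := by
      intro n
      nth_rewrite 1 [← mulOp_wtLp hs h]
      refine mulOp_mulOp_eq (isBdd_cut_mul_wt n s) (isBdd_wt (by linarith)) (fun ξ => ?_) _
      rw [mul_assoc, ← wt_add]
      simp [wt_zero]
    rw [← mem_herm]
    refine isClosed_herm.mem_of_tendsto (tendsto_mulOp_cut (wtLp s F))
      (Eventually.of_forall fun n => ?_)
    rw [← h1]
    refine hF.mulOp (isBdd_cut_mul_wt n s) fun ξ => ?_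
    simp [cut, wt_even]
  · have : ¬ ∃ U, F = mulOp (wt (-s)) U := by
      rintro ⟨U, hU⟩
      apply h
      rw [hsq_of_eq_mulOp hs hU]
      exact ENNReal.pow_lt_top (by simp)
    rw [wtLp, dif_neg this]
    exact herm.zero_mem

theorem IsHerm.add {F G : L2C} (hF : IsHerm F) (hG : IsHerm G) : IsHerm (F + G) :=
  herm.add_mem hF hG

theorem IsHerm.sub {F G : L2C} (hF : IsHerm F) (hG : IsHerm G) : IsHerm (F - G) :=
  herm.sub_mem hF hG

/-! ### Fatou's lemma for weighted norms -/

theorem wsq_le_of_tendsto {m : ℕ → ℝ → ℝ} {m₀ : ℝ → ℝ} (hm : ∀ n, Measurable (m n))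
    (h : ∀ ξ, Tendsto (fun n => m n ξ) atTop (𝓝 (m₀ ξ))) {F : ℝ → ℂ}
    (hF : AEStronglyMeasurable F volume) {C : ℝ≥0∞} (hC : ∀ n, wsq (m n) F ≤ C) :
    wsq m₀ F ≤ C := by
  have h1 : wsq m₀ F = ∫⁻ ξ, liminf (fun n => ENNReal.ofReal (m n ξ) * ‖F ξ‖ₑ ^ 2) atTop := by
    unfold wsq
    congr 1
    ext ξ
    refine (Tendsto.liminf_eq ?_).symm
    by_cases h0 : F ξ = 0
    · simp [h0]
    · exact ENNReal.Tendsto.mul_const (ENNReal.tendsto_ofReal (h ξ)) (Or.inr (by finiteness))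
  rw [h1]
  refine (lintegral_liminf_le' fun n => ?_).trans ?_
  · exact ((hm n).ennreal_ofReal.aemeasurable).mul (hF.enorm.pow_const 2)
  · exact liminf_le_of_le (by isBoundedDefault) fun c hc => by
      obtain ⟨n, hn⟩ := hc.exists
      exact hn.trans (hC n)

theorem hsq_le_iff (s : ℝ) (F : L2C) (C : ℝ≥0∞) :
    hsq s F ≤ C ↔ ∀ n, ‖mulOp (fun ξ => cut n ξ * wt s ξ) F‖ₑ ^ 2 ≤ C := by
  constructor
  · intro h n
    rw [enorm_mulOp_sq (isBdd_cut_mul_wt n s)]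
    refine (wsq_mono (fun ξ => ?_) _).trans h
    rw [mul_pow, wt_sq]
    refine mul_le_of_le_one_left (wt_pos _ _).le ?_
    rw [← sq_abs]
    exact pow_le_one₀ (abs_nonneg _) (abs_cut_le n ξ)
  · intro h
    refine wsq_le_of_tendsto (m := fun n ξ => (cut n ξ * wt s ξ) ^ 2)
      (fun n => (isBdd_cut_mul_wt n s).1.pow_const 2) (fun ξ => ?_) (Lp.aestronglyMeasurable F)
      fun n => ?_
    · have := ((tendsto_cut ξ).mul_const (wt s ξ)).pow 2
      rwa [one_mul, wt_sq] at this
    · rw [← enorm_mulOp_sq (isBdd_cut_mul_wt n s)]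
      exact h n

/-! ### Local existence and continuation -/

section

variable {l b g : ℝ → ℝ} {ρ r s : ℝ} {u : ℝ → L2} {U V : ℝ → L2C} {U₀ V₀ : L2C}

theorem pc_even (h : IsSymbolPair l b ρ r) (t ξ : ℝ) : pc l t (-ξ) = pc l t ξ := by
  simp [pc, h.om_even]

theorem ps_even (h : IsSymbolPair l b ρ r) (t ξ : ℝ) : ps ρ l t (-ξ) = ps ρ l t ξ := by
  simp [ps, h.om_even, wt_even]

theorem ks_even (h : IsSymbolPair l b ρ r) (t ξ : ℝ) : ks l b t (-ξ) = ks l b t ξ := by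
  simp [ks, h.om_even, h.ka_even]

theorem kc_even (h : IsSymbolPair l b ρ r) (t ξ : ℝ) : kc ρ l b t (-ξ) = kc ρ l b t ξ := by
  simp [kc, h.om_even, h.be_even, wt_even]

theorem isHerm_forcing (hn : IsNonlinearity g s) {m : ℝ → ℝ → ℝ} (hm : IsBddFamily m)
    (he : ∀ t ξ, m t (-ξ) = m t ξ) (τ : ℝ) (u : L2) :
    IsHerm (wtLp s (mulOp (m τ) (ft (nem g u)))) :=
  isHerm_wtLp hn.pos ((isHerm_ft _).mulOp (hm.isBdd τ) (he τ))

theorem norm_integral_forcing_le (hn : IsNonlinearity g s) {m : ℝ → ℝ → ℝ} {c d : ℝ} (hcd : c ≤ d)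
    {K : NNReal} (hK : ∀ τ ∈ Set.Icc c d, hsq s (mulOp (m τ) (ft (nem g (u τ)))) ≤ K) :
    ‖∫ τ in c..d, wtLp s (mulOp (m τ) (ft (nem g (u τ))))‖ ≤ √(K : ℝ) * (d - c) := by
  rw [← abs_of_nonneg (sub_nonneg.2 hcd)]
  refine intervalIntegral.norm_integral_le_of_norm_le_const fun τ hτ => ?_
  rw [Set.uIoc_of_le hcd] at hτ
  exact norm_wtLp_le hn.pos (hK τ (Set.Ioc_subset_Icc_self hτ))

/-- Difference of two forcings in `L²`. -/
theorem norm_integral_forcing_sub_le {m : ℝ → ℝ → ℝ} (hm : IsBddFamily m) {c d : ℝ} (hcd : c ≤ d)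
    {u₁ u₂ : ℝ → L2} (h₁ : Continuous fun τ => nem g (u₁ τ)) (h₂ : Continuous fun τ => nem g (u₂ τ))
    {C : ℝ} (hC : ∀ τ ∈ Set.Icc c d, ∀ ξ, |m τ ξ| ≤ C) {D : ℝ}
    (hD : ∀ τ, ‖nem g (u₁ τ) - nem g (u₂ τ)‖ ≤ D) :
    ‖(∫ τ in c..d, mulOp (m τ) (ft (nem g (u₁ τ)))) -
      ∫ τ in c..d, mulOp (m τ) (ft (nem g (u₂ τ)))‖ ≤ C * D * (d - c) := by
  have hi : ∀ {u : ℝ → L2}, (Continuous fun τ => nem g (u τ)) →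
      IntervalIntegrable (fun τ => mulOp (m τ) (ft (nem g (u τ)))) volume c d := fun h =>
    (hm.continuousOn (continuous_ft.comp h).continuousOn).intervalIntegrable
  rw [← intervalIntegral.integral_sub (hi h₁) (hi h₂), ← abs_of_nonneg (sub_nonneg.2 hcd)]
  refine intervalIntegral.norm_integral_le_of_norm_le_const fun τ hτ => ?_
  rw [Set.uIoc_of_le hcd] at hτ
  have hτ' := Set.Ioc_subset_Icc_self hτ
  have hC0 : 0 ≤ C := (abs_nonneg _).trans (hC τ hτ' 0)
  rw [← map_sub, ← ft_sub]
  calc _ ≤ C * ‖ft (nem g (u₁ τ) - nem g (u₂ τ))‖ := norm_mulOp_apply_le (hm.meas τ) (hC τ hτ') _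
    _ ≤ C * D := by
        rw [norm_ft]
        exact mul_le_mul_of_nonneg_left (hD τ) hC0

/-- Duhamel's formula, started at time `T`, can be solved on a short time interval. -/
theorem exists_local_mild (hsym : IsSymbolPair l b ρ r) (hn : IsNonlinearity g s) {T : ℝ}
    (hT : 0 ≤ T) {A₀ B₀ : L2C} (hA₀ : IsHerm A₀) (hB₀ : IsHerm B₀) :
    ∃ δ > 0, ∃ w : ℝ → L2, ∃ M : NNReal, Continuous w ∧ (∀ t, hsq s (ft (w t)) ≤ M) ∧
      ∀ t ∈ Set.Icc T (T + δ), ft (w t) = mulOp (wt (-s))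
        (mulOp (pc l t) (A₀ + ∫ τ in T..t, srcS l b g s w τ) +
          mulOp (ps ρ l t) (B₀ - ∫ τ in T..t, srcC ρ l b g s w τ)) := by
  have hs := hn.pos
  have fc := isBddFamily_pc hsym
  have fs := isBddFamily_ps hsym
  have gs := isBddFamily_ks hsym
  have gc := isBddFamily_kc hsym
  obtain ⟨Cc, hCc⟩ := fc.bound (T + 1)
  obtain ⟨Cs, hCs⟩ := fs.bound (T + 1)
  obtain ⟨Ds, hDs⟩ := gs.bound (T + 1)
  obtain ⟨Dc, hDc⟩ := gc.bound (T + 1)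
  have hCc0 : 0 ≤ Cc := (abs_nonneg _).trans (hCc 0 (by simpa using by positivity) 0)
  have hCs0 : 0 ≤ Cs := (abs_nonneg _).trans (hCs 0 (by simpa using by positivity) 0)
  have hDs0 : 0 ≤ Ds := (abs_nonneg _).trans (hDs 0 (by simpa using by positivity) 0)
  have hDc0 : 0 ≤ Dc := (abs_nonneg _).trans (hDc 0 (by simpa using by positivity) 0)
  -- the radius of the ball in `H^s` that the fixed point map preserves
  set m : NNReal := (Cc * (‖A₀‖ + 1) + Cs * (‖B₀‖ + 1)).toNNReal with hm
  obtain ⟨K₁, hK₁⟩ := exists_hsq_forcing_le hn gs (T + 1) (m ^ 2)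
  obtain ⟨K₂, hK₂⟩ := exists_hsq_forcing_le hn gc (T + 1) (m ^ 2)
  obtain ⟨R, K, hR, hK, hl, hb⟩ := exists_sup_lipschitz hn.reg hn.contDiff_one (m ^ 2)
  have hlip : ∀ u v : L2, hsq s (ft u) ≤ (m ^ 2 : NNReal) → hsq s (ft v) ≤ (m ^ 2 : NNReal) →
      ‖nem g u - nem g v‖ ≤ K * ‖u - v‖ := fun u v hu hv =>
    norm_nem_sub_le hn.contDiff_one.continuous hn.zero hl (hb u hu) (hb v hv)
  -- the length of the time interval
  obtain ⟨δ, hδ, hδ1, hδ2, hδ3, hδ4⟩ : ∃ δ : ℝ, 0 < δ ∧ δ ≤ 1 ∧ √(K₁ : ℝ) * δ ≤ 1 ∧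
      √(K₂ : ℝ) * δ ≤ 1 ∧ (Cc * Ds + Cs * Dc) * K * δ ≤ 1 / 2 := by
    set Q := √(K₁ : ℝ) + √(K₂ : ℝ) + 2 * ((Cc * Ds + Cs * Dc) * K) + 1 with hQ
    have h1 := Real.sqrt_nonneg (K₁ : ℝ)
    have h2 := Real.sqrt_nonneg (K₂ : ℝ)
    have h3 : 0 ≤ (Cc * Ds + Cs * Dc) * K := by positivity
    have hQ0 : 0 < Q := by linarith
    refine ⟨1 / Q, by positivity, ?_, ?_, ?_, ?_⟩
    · rw [div_le_one hQ0]; linarith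
    · rw [mul_one_div, div_le_one hQ0]; linarith
    · rw [mul_one_div, div_le_one hQ0]; linarith
    · rw [mul_one_div, div_le_iff₀ hQ0]; linarith
  have hTδ : T ≤ T + δ := by linarith
  have habs : ∀ t ∈ Set.Icc T (T + δ), |t| ≤ T + 1 := fun t ht =>
    abs_le.2 ⟨by linarith [ht.1], by linarith [ht.2]⟩
  -- the ball of `H^s`, with the metric of `L²`, in which the superposition operator is Lipschitz
  let X := {w : C(Set.Icc T (T + δ), L2) // ∀ t, hsq s (ft (w t)) ≤ (m ^ 2 : NNReal)}
  let ex : X → ℝ → L2 := fun w => Set.IccExtend hTδ w.1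
  have exc : ∀ w : X, Continuous (ex w) := fun w => w.1.continuous.Icc_extend'
  have exb : ∀ (w : X) t, hsq s (ft (ex w t)) ≤ (m ^ 2 : NNReal) := fun w t => w.2 _
  have exN : ∀ w : X, Continuous fun τ => nem g (ex w τ) := fun w => by
    have := continuousOn_nem_of_bdd hn (exc w).continuousOn (I := Set.univ) fun t _ => exb w t
    exact continuousOn_univ.1 this
  let A : X → ℝ → L2C := fun w t => A₀ + ∫ τ in T..t, srcS l b g s (ex w) τ
  let B : X → ℝ → L2C := fun w t => B₀ - ∫ τ in T..t, srcC ρ l b g s (ex w) τ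
  let P : X → ℝ → L2C := fun w t => mulOp (pc l t) (A w t) + mulOp (ps ρ l t) (B w t)
  have hJ : ∀ (w : X), ∀ t ∈ Set.Icc T (T + δ), mulOp (wt (-s)) (P w t) =
      mulOp (pc l t) (mulOp (wt (-s)) A₀ + ∫ τ in T..t, mulOp (ks l b τ) (ft (nem g (ex w τ)))) +
      mulOp (ps ρ l t)
        (mulOp (wt (-s)) B₀ - ∫ τ in T..t, mulOp (kc ρ l b τ) (ft (nem g (ex w τ)))) := by
    intro w t ht
    have hw : IsBdd (wt (-s)) := isBdd_wt (by linarith)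
    simp only [P, A, B]
    rw [map_add, mulOp_mulOp_congr hw (fc.isBdd t) (fc.isBdd t) hw (fun ξ => mul_comm _ _),
      mulOp_mulOp_congr hw (fs.isBdd t) (fs.isBdd t) hw (fun ξ => mul_comm _ _),
      map_add (mulOp (wt (-s))), map_sub (mulOp (wt (-s)))]
    unfold srcS srcC
    rw [mulOp_integral_forcing hn gs ht.1 (exc w).continuousOn (fun t _ => exb w t),
      mulOp_integral_forcing hn gc ht.1 (exc w).continuousOn (fun t _ => exb w t)]
  have hint : ∀ {m : ℝ → ℝ → ℝ}, IsBddFamily m → ∀ (w : X), ∀ t ∈ Set.Icc T (T + δ),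
      IntervalIntegrable (fun τ => wtLp s (mulOp (m τ) (ft (nem g (ex w τ))))) volume T t :=
    fun hm w t ht => intervalIntegrable_forcing hn hm ht.1 (exc w).continuousOn
      (fun t _ => exb w t)
  have hherm : ∀ (w : X), ∀ t ∈ Set.Icc T (T + δ), IsHerm (P w t) := by
    intro w t ht
    refine ((hA₀.add (isHerm_integral (hint gs w t ht) fun τ _ =>
      isHerm_forcing hn gs (ks_even hsym) _ _)).mulOp (fc.isBdd t) (pc_even hsym t)).add ?_
    exact ((hB₀.sub (isHerm_integral (hint gc w t ht) fun τ _ =>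
      isHerm_forcing hn gc (kc_even hsym) _ _)).mulOp (fs.isBdd t) (ps_even hsym t))
  have hft : ∀ (w : X), ∀ t ∈ Set.Icc T (T + δ),
      ft (ift (mulOp (wt (-s)) (P w t))) = mulOp (wt (-s)) (P w t) := fun w t ht =>
    ft_ift ((hherm w t ht).mulOp (isBdd_wt (by linarith)) (wt_even _))
  have hPn : ∀ (w : X), ∀ t ∈ Set.Icc T (T + δ), ‖P w t‖ ≤ m := by
    intro w t ht
    have h1 : ‖A w t‖ ≤ ‖A₀‖ + 1 := by
      refine (norm_add_le _ _).trans (add_le_add_right ?_ _)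
      refine (norm_integral_forcing_le hn ht.1 fun τ hτ =>
        hK₁ τ (habs τ ⟨hτ.1, hτ.2.trans ht.2⟩) _ (exb w τ)).trans (le_trans ?_ hδ2)
      exact mul_le_mul_of_nonneg_left (by linarith [ht.2]) (Real.sqrt_nonneg _)
    have h2 : ‖B w t‖ ≤ ‖B₀‖ + 1 := by
      refine (norm_sub_le _ _).trans (add_le_add_right ?_ _)
      refine (norm_integral_forcing_le hn ht.1 fun τ hτ =>
        hK₂ τ (habs τ ⟨hτ.1, hτ.2.trans ht.2⟩) _ (exb w τ)).trans (le_trans ?_ hδ3)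
      exact mul_le_mul_of_nonneg_left (by linarith [ht.2]) (Real.sqrt_nonneg _)
    rw [hm, Real.coe_toNNReal _ (by positivity)]
    refine (norm_add_le _ _).trans (add_le_add ?_ ?_)
    · exact (norm_mulOp_apply_le (fc.meas t) (hCc t (habs t ht)) _).trans
        (mul_le_mul_of_nonneg_left h1 hCc0)
    · exact (norm_mulOp_apply_le (fs.meas t) (hCs t (habs t ht)) _).trans
        (mul_le_mul_of_nonneg_left h2 hCs0)
  have hPc : ∀ w : X, ContinuousOn (P w) (Set.Icc T (T + δ)) := by
    intro w
    have hc : ∀ {m : ℝ → ℝ → ℝ}, IsBddFamily m → ContinuousOn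
        (fun t => ∫ τ in T..t, wtLp s (mulOp (m τ) (ft (nem g (ex w τ))))) (Set.Icc T (T + δ)) := by
      intro m hm
      have h2 := intervalIntegral.continuousOn_primitive_interval'
        (hint hm w (T + δ) ⟨hTδ, le_rfl⟩) Set.left_mem_uIcc
      rwa [Set.uIcc_of_le hTδ] at h2
    exact (fc.continuousOn (continuousOn_const.add (hc gs))).add
      (fs.continuousOn (continuousOn_const.sub (hc gc)))
  have hΦ : ∀ w : X, ∃ w' : X, ∀ t : Set.Icc T (T + δ),
      w'.1 t = ift (mulOp (wt (-s)) (P w t)) := by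
    intro w
    have hc : Continuous fun t : Set.Icc T (T + δ) => ift (mulOp (wt (-s)) (P w t)) :=
      (ift.continuous.comp (mulOp (wt (-s))).continuous).comp (hPc w).domRestrict
    refine ⟨⟨⟨_, hc⟩, fun t => ?_⟩, fun t => rfl⟩
    change hsq s (ft (ift (mulOp (wt (-s)) (P w t)))) ≤ _
    rw [hsq_of_eq_mulOp hs (hft w t t.2), ENNReal.coe_pow]
    gcongr
    exact enorm_le_coe.2 (hPn w t t.2)
  choose Φ hΦ using hΦ
  -- balls of `H^s` are closed in `L²`, as the weighted norm is a supremum of continuous functions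
  have hclosed : IsClosed {w : C(Set.Icc T (T + δ), L2) |
      ∀ t, hsq s (ft (w t)) ≤ (m ^ 2 : NNReal)} := by
    simp only [hsq_le_iff, Set.ofPred_forall]
    refine isClosed_iInter fun t => isClosed_iInter fun n => isClosed_le ?_ continuous_const
    exact (ENNReal.continuous_pow 2).comp (continuous_enorm.comp ((mulOp _).continuous.comp
      (continuous_ft.comp (continuous_eval_const t))))
  have : CompleteSpace X := hclosed.completeSpace_coe
  have : Nonempty X := by
    refine ⟨⟨0, fun t => ?_⟩⟩
    have : hsq s (ft (0 : L2)) = ‖(0 : L2C)‖ₑ ^ 2 := hsq_of_eq_mulOp hs (by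
      rw [map_zero, ← ftL_apply, map_zero])
    simp [this]
  have hcontr : ContractingWith (1 / 2) Φ := by
    refine ⟨by norm_num, LipschitzWith.of_dist_le_mul fun w₁ w₂ => ?_⟩
    have hd : ∀ τ, ‖nem g (ex w₁ τ) - nem g (ex w₂ τ)‖ ≤ K * dist w₁ w₂ := by
      intro τ
      refine (hlip _ _ (exb _ _) (exb _ _)).trans (mul_le_mul_of_nonneg_left ?_ hK)
      rw [← dist_eq_norm]
      exact ContinuousMap.dist_apply_le_dist _
    have h0 : 0 ≤ dist w₁ w₂ := dist_nonneg
    change dist (Φ w₁).1 (Φ w₂).1 ≤ _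
    rw [ContinuousMap.dist_le (by positivity)]
    intro t
    rw [hΦ, hΦ, dist_eq_norm, ← map_sub]
    refine (norm_ift_le _).trans ?_
    rw [hJ w₁ t t.2, hJ w₂ t t.2, add_sub_add_comm, ← map_sub, ← map_sub, add_sub_add_left_eq_sub,
      sub_sub_sub_cancel_left]
    have e1 := norm_integral_forcing_sub_le gs t.2.1 (exN w₁) (exN w₂)
      (fun τ hτ => hDs τ (habs τ ⟨hτ.1, hτ.2.trans t.2.2⟩)) hd
    have e2 := norm_integral_forcing_sub_le gc t.2.1 (exN w₂) (exN w₁)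
      (fun τ hτ => hDc τ (habs τ ⟨hτ.1, hτ.2.trans t.2.2⟩)) (fun τ => by
        rw [norm_sub_rev]; exact hd τ)
    have ht : (t : ℝ) - T ≤ δ := by linarith [t.2.2]
    calc _ ≤ Cc * (Ds * (K * dist w₁ w₂) * (t - T)) + Cs * (Dc * (K * dist w₁ w₂) * (t - T)) :=
          (norm_add_le _ _).trans (add_le_add
            ((norm_mulOp_apply_le (fc.meas t) (hCc t (habs t t.2)) _).trans
              (mul_le_mul_of_nonneg_left e1 hCc0))
            ((norm_mulOp_apply_le (fs.meas t) (hCs t (habs t t.2)) _).trans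
              (mul_le_mul_of_nonneg_left e2 hCs0)))
      _ = (Cc * Ds + Cs * Dc) * K * (t - T) * dist w₁ w₂ := by ring
      _ ≤ (Cc * Ds + Cs * Dc) * K * δ * dist w₁ w₂ := by gcongr
      _ ≤ 1 / 2 * dist w₁ w₂ := by gcongr
      _ = _ := by norm_num
  set w := hcontr.fixedPoint Φ with hw
  have hfix : Φ w = w := hcontr.fixedPoint_isFixedPt
  refine ⟨δ, hδ, ex w, m ^ 2, exc w, exb w, fun t ht => ?_⟩
  have h1 := hΦ w ⟨t, ht⟩
  rw [hfix] at h1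
  have h2 : ex w t = w.1 ⟨t, ht⟩ := Set.IccExtend_of_mem hTδ _ ht
  rw [h2, h1]
  exact hft w t ht

/-- A solution of Duhamel's formula that stays bounded in `H^s` up to time `T` can be continued. -/
theorem IsMild.exists_extension (hsym : IsSymbolPair l b ρ r) (hn : IsNonlinearity g s) {T : ℝ}
    (hT : 0 ≤ T) (h : IsMild l b g ρ s T U₀ V₀ u U V) (hU₀ : IsHerm U₀) (hV₀ : IsHerm V₀)
    {M : NNReal} (hM : ∀ t ∈ timeInterval T, hsq s (ft (u t)) ≤ M) :
    ∃ δ > 0, ∃ u' U' V', IsMild l b g ρ s ((T + δ : ℝ) : EReal) U₀ V₀ u' U' V' ∧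
      ∀ t ∈ timeInterval T, u' t = u t := by
  have hs := hn.pos
  have fc := isBddFamily_pc hsym
  have fs := isBddFamily_ps hsym
  have gs := isBddFamily_ks hsym
  have gc := isBddFamily_kc hsym
  have hmem : ∀ {t S : ℝ}, t ∈ timeInterval S ↔ 0 ≤ t ∧ t < S := fun {t S} =>
    and_congr_right fun _ => EReal.coe_lt_coe_iff
  have hioo : ∀ {t : ℝ}, t ≤ T → Set.Ioo 0 t ⊆ timeInterval T := fun ht τ hτ =>
    hmem.2 ⟨hτ.1.le, hτ.2.trans_le ht⟩
  have hint : ∀ {m : ℝ → ℝ → ℝ}, IsBddFamily m → IntervalIntegrable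
      (fun τ => wtLp s (mulOp (m τ) (ft (nem g (u τ))))) volume 0 T := fun hm =>
    intervalIntegrable_forcing hn hm hT (h.continuousOn_u.mono (hioo le_rfl))
      fun t ht => hM t (hioo le_rfl ht)
  -- the local problem at time `T` takes the values of the integrals at `T` as its initial data
  obtain ⟨δ, hδ, w, M', hw, hwM, hwt⟩ := exists_local_mild hsym hn hT
    (hU₀.add (isHerm_integral (hint gs) fun τ _ => isHerm_forcing hn gs (ks_even hsym) _ _))
    (hV₀.sub (isHerm_integral (hint gc) fun τ _ => isHerm_forcing hn gc (kc_even hsym) _ _))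
  let u' : ℝ → L2 := fun t => if t < T then u t else w t
  have hu'1 : ∀ t, t < T → u' t = u t := fun t ht => if_pos ht
  have hu'2 : ∀ t, T ≤ t → u' t = w t := fun t ht => if_neg ht.not_gt
  have hbd : ∀ t, 0 ≤ t → hsq s (ft (u' t)) ≤ (max M M' : NNReal) := by
    intro t h0
    rcases lt_or_ge t T with ht | ht
    · rw [hu'1 t ht]
      exact (hM t (hmem.2 ⟨h0, ht⟩)).trans (by exact_mod_cast le_max_left M M')
    · rw [hu'2 t ht]
      exact (hwM t).trans (by exact_mod_cast le_max_right M M')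
  have hI1 : ∀ {m : ℝ → ℝ → ℝ} (t : ℝ), 0 ≤ t → t ≤ T →
      ∫ τ in (0 : ℝ)..t, wtLp s (mulOp (m τ) (ft (nem g (u' τ)))) =
      ∫ τ in (0 : ℝ)..t, wtLp s (mulOp (m τ) (ft (nem g (u τ)))) := by
    intro m t h0 ht
    rw [intervalIntegral.integral_of_le h0, intervalIntegral.integral_of_le h0]
    exact integral_congr_ae (ae_Ioc_of_forall_Ioo fun τ hτ => by
      simp only [hu'1 τ (hτ.2.trans_le ht)])
  have hI2 : ∀ {m : ℝ → ℝ → ℝ} (t : ℝ), T ≤ t →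
      ∫ τ in T..t, wtLp s (mulOp (m τ) (ft (nem g (u' τ)))) =
      ∫ τ in T..t, wtLp s (mulOp (m τ) (ft (nem g (w τ)))) := by
    intro m t ht
    refine intervalIntegral.integral_congr fun τ hτ => ?_
    rw [Set.uIcc_of_le ht] at hτ
    simp only [hu'2 τ hτ.1]
  have hi1 : ∀ {m : ℝ → ℝ → ℝ}, IsBddFamily m → IntervalIntegrable
      (fun τ => wtLp s (mulOp (m τ) (ft (nem g (u' τ))))) volume 0 T := fun hm =>
    intervalIntegrable_forcing hn hm hT ((h.continuousOn_u.mono (hioo le_rfl)).congr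
      fun t ht => hu'1 t ht.2) fun t ht => hbd t ht.1.le
  have hi2 : ∀ {m : ℝ → ℝ → ℝ}, IsBddFamily m → ∀ t, T ≤ t → IntervalIntegrable
      (fun τ => wtLp s (mulOp (m τ) (ft (nem g (u' τ))))) volume T t := fun hm t ht =>
    intervalIntegrable_forcing hn hm ht (hw.continuousOn.congr fun t ht => hu'2 t ht.1.le)
      fun t ht => hbd t (hT.trans ht.1.le)
  have hc : ∀ {m : ℝ → ℝ → ℝ}, IsBddFamily m → ContinuousOn
      (fun t => ∫ τ in (0 : ℝ)..t, wtLp s (mulOp (m τ) (ft (nem g (u' τ)))))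
      (timeInterval ((T + δ : ℝ) : EReal)) := by
    intro m hm
    have h2 := intervalIntegral.continuousOn_primitive_interval'
      ((hi1 hm).trans (hi2 hm (T + δ) (by linarith))) Set.left_mem_uIcc
    rw [Set.uIcc_of_le (by linarith)] at h2
    exact h2.mono fun t ht => ⟨(hmem.1 ht).1, (hmem.1 ht).2.le⟩
  let U' : ℝ → L2C := fun t => mulOp (pc l t) (U₀ + ∫ τ in (0 : ℝ)..t, srcS l b g s u' τ) +
    mulOp (ps ρ l t) (V₀ - ∫ τ in (0 : ℝ)..t, srcC ρ l b g s u' τ)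
  have hU'c : ContinuousOn U' (timeInterval ((T + δ : ℝ) : EReal)) :=
    (fc.continuousOn (continuousOn_const.add (hc gs))).add
      (fs.continuousOn (continuousOn_const.sub (hc gc)))
  have hft : ∀ t ∈ timeInterval ((T + δ : ℝ) : EReal), ft (u' t) = mulOp (wt (-s)) (U' t) := by
    intro t ht
    rcases lt_or_ge t T with htT | htT
    · rw [hu'1 t htT, h.fourier_u t (hmem.2 ⟨ht.1, htT⟩), h.eq_U t (hmem.2 ⟨ht.1, htT⟩)]
      simp only [U', srcS, srcC]
      rw [hI1 t ht.1 htT.le, hI1 t ht.1 htT.le]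
    · rw [hu'2 t htT, hwt t ⟨htT, (hmem.1 ht).2.le⟩]
      simp only [U', srcS, srcC]
      rw [← intervalIntegral.integral_add_adjacent_intervals (hi1 gs) (hi2 gs t htT),
        ← intervalIntegral.integral_add_adjacent_intervals (hi1 gc) (hi2 gc t htT),
        hI1 T hT le_rfl, hI1 T hT le_rfl, hI2 t htT, hI2 t htT, add_assoc, sub_sub]
  refine ⟨δ, hδ, u', U', fun t => mulOp (pc l t) (V₀ - ∫ τ in (0 : ℝ)..t, srcC ρ l b g s u' τ) -
    mulOp (pt ρ l t) (U₀ + ∫ τ in (0 : ℝ)..t, srcS l b g s u' τ),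
    ⟨continuousOn_of_ft hU'c hft, fun t' _ => ⟨max M M', fun t ht => hbd t ht.1⟩, hft,
      fun t _ => rfl, fun t _ => rfl⟩, fun t ht => hu'1 t (hmem.1 ht).2⟩

theorem IsFourierSolution.isHerm_U {T : EReal} (hs : 0 ≤ s)
    (h : IsFourierSolution l b g ρ s (timeInterval T) u U V) {t : ℝ} (ht : t ∈ timeInterval T) :
    IsHerm (U t) := by
  have h1 := h.fourier_u t ht
  have h2 : U t = wtLp s (ft (u t)) := by
    apply mulOp_wt_injective hs
    rw [mulOp_wtLp hs, h1]
    rw [hsq_of_eq_mulOp hs h1]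
    exact ENNReal.pow_lt_top (by simp)
  rw [h2]
  exact isHerm_wtLp hs (isHerm_ft _)

/-- The transform of `u_t` is that of a real function. -/
theorem IsFourierSolution.isHerm_V (hρ : 0 ≤ ρ) {T : EReal} (hs : 0 ≤ s)
    (h : IsFourierSolution l b g ρ s (timeInterval T) u U V) {t : ℝ} (ht : t ∈ timeInterval T) :
    IsHerm (V t) := by
  -- the derivative of a curve of transforms of real functions is one too, by uniqueness of derivatives
  obtain ⟨t', ht', htt'⟩ := exists_gt_mem_timeInterval ht
  have hsub : Set.Icc t t' ⊆ timeInterval T := fun τ hτ =>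
    timeInterval_ordConnected ht' (ht.1.trans hτ.1) hτ.2
  have h1 := (h.deriv_u t ht).mono hsub
  have h2 := (ftL.comp ift).hasFDerivAt.comp_hasDerivWithinAt t h1
  have hX : ∀ τ ∈ timeInterval T, (ftL.comp ift) (mulOp (wt (-(1 + ρ / 2))) (U τ)) =
      mulOp (wt (-(1 + ρ / 2))) (U τ) := fun τ hτ =>
    ft_ift ((h.isHerm_U hs hτ).mulOp (isBdd_wt (by linarith)) (wt_even _))
  have h3 := h2.congr (fun τ hτ => (hX τ (hsub hτ)).symm) (hX t ht).symm
  rw [isHerm_iff_ft_ift]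
  exact (uniqueDiffOn_Icc htt' t (Set.left_mem_Icc.2 htt'.le)).eq_deriv _ h3 h1

theorem zero_mem_timeInterval {T : EReal} (hT : 0 < T) : (0 : ℝ) ∈ timeInterval T :=
  ⟨le_rfl, by exact_mod_cast hT⟩

theorem IsMild.initial_V {T : EReal} (hT : 0 < T)
    (h : IsMild l b g ρ s T U₀ V₀ u U V) : V 0 = V₀ := by
  have h1 : pc l 0 = fun _ => 1 := by ext ξ; simp [pc]
  have h2 : pt ρ l 0 = fun _ => 0 * 1 := by ext ξ; simp [pt]
  rw [h.eq_V 0 (zero_mem_timeInterval hT), h1, h2, mulOp_one, mulOp_const_mul (isBdd_const 1)]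
  simp

/-- A solution that stays bounded in `H^s` up to time `T` can be continued. -/
theorem IsSolution.exists_extension (hsym : IsSymbolPair l b ρ r) (hn : IsNonlinearity g s) {T : ℝ}
    {φ : L2} {ψ : 𝓢'(ℝ, ℂ)} {v : ℝ → 𝓢'(ℝ, ℂ)} (h : IsSolution l b g ρ s φ ψ T u v) {M : NNReal}
    (hM : ∀ t ∈ timeInterval T, sobolevNorm s (toDist (u t)) ≤ M) :
    ∃ (T' : EReal) (u' : ℝ → L2) (v' : ℝ → 𝓢'(ℝ, ℂ)), (T : EReal) < T' ∧
      IsSolution l b g ρ s φ ψ T' u' v' ∧ ∀ t ∈ timeInterval T, u' t = u t := by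
  have hT := h.pos
  have hT' : 0 < T := by exact_mod_cast hT
  have h0 := zero_mem_timeInterval hT
  obtain ⟨U, V, hF, hv, hnorm⟩ := h.exists_isFourierSolution hsym hn.reg hn.contDiff_one hn.zero
  obtain ⟨δ, hδ, u', U', V', hm, hu'⟩ := (hF.isMild hsym hn).exists_extension hsym hn hT'.le
    (hF.isHerm_U hn.pos h0) (hF.isHerm_V hsym.rho hn.pos h0) (M := M ^ 2) fun t ht => by
      rw [hsq_of_eq_mulOp hn.pos (hF.fourier_u t ht), ← hnorm t ht, ENNReal.coe_pow]
      gcongr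
      exact hM t ht
  have hTT' : (T : EReal) < ((T + δ : ℝ) : EReal) := EReal.coe_lt_coe_iff.2 (by linarith)
  obtain ⟨v', hv'⟩ := (hm.isFourierSolution hsym hn).exists_isSolution hsym hn.reg hn.contDiff_one
    hn.zero (hT.trans hTT') (φ := φ) (ψ := ψ) (by rw [hu' 0 h0, h.initial_u]) (by
      rw [hm.initial_V (hT.trans hTT'), ← h.initial_v]
      exact hv 0 h0)
  exact ⟨_, u', v', hTT', hv', hu'⟩

end

/-! ### Persistence of the regularity of the energy space -/

/-- The symbol of `B^{1/2} Λ`. -/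
def rb (b : ℝ → ℝ) (ξ : ℝ) : ℝ := |2 * Real.pi * ξ| * √(b (2 * Real.pi * ξ))

/-- The symbol of `B^{1/2} K⁻¹`. -/
def th (l b : ℝ → ℝ) (ξ : ℝ) : ℝ := √(b (2 * Real.pi * ξ)) / √(l (2 * Real.pi * ξ))

namespace IsSymbolPair

variable {l b : ℝ → ℝ} {ρ r : ℝ}

theorem rb_sq (h : IsSymbolPair l b ρ r) (ξ : ℝ) : rb b ξ ^ 2 = be b ξ := by
  unfold rb be
  rw [mul_pow, sq_abs, Real.sq_sqrt (h.b_pos _).le]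

theorem om_mul_th (h : IsSymbolPair l b ρ r) (ξ : ℝ) : om l ξ * th l b ξ = rb b ξ := by
  have h1 : √(l (2 * Real.pi * ξ)) ≠ 0 := (Real.sqrt_pos.2 (h.l_pos _)).ne'
  unfold om th rb
  field_simp

theorem rb_mul_th (h : IsSymbolPair l b ρ r) (ξ : ℝ) : rb b ξ * th l b ξ = ka l b ξ := by
  unfold ka th rb
  rw [mul_assoc, mul_div_assoc', Real.mul_self_sqrt (h.b_pos _).le]

theorem measurable_th (h : IsSymbolPair l b ρ r) : Measurable (th l b) := by
  have h1 := h.meas_b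
  have h2 := h.meas_l
  unfold th
  fun_prop

theorem measurable_rb (h : IsSymbolPair l b ρ r) : Measurable (rb b) := by
  have h1 := h.meas_b
  unfold rb
  fun_prop

/-- The order of `D² b(D)`. -/
theorem exists_be_le (h : IsSymbolPair l b ρ r) {σ : ℝ} (h0 : 0 ≤ σ) (hσ : 1 - r / 2 ≤ σ) :
    ∃ C : ℝ, 0 ≤ C ∧ ∀ ξ, be b ξ ≤ C * wt (2 * σ) ξ := by
  obtain ⟨c, hc, hb⟩ := h.bound_b
  refine ⟨c ^ 2 * ((2 * Real.pi) ^ 2) ^ (2 * σ / 2), by positivity, fun ξ => ?_⟩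
  calc be b ξ ≤ wt 2 (2 * Real.pi * ξ) * (c ^ 2 * wt (-r) (2 * Real.pi * ξ)) := by
        unfold be
        refine mul_le_mul ?_ (hb _).2 (hb _).1.le (wt_pos _ _).le
        rw [wt_two]
        linarith
    _ = c ^ 2 * wt (2 + -r) (2 * Real.pi * ξ) := by rw [wt_add]; ring
    _ ≤ c ^ 2 * wt (2 * σ) (2 * Real.pi * ξ) := by
        gcongr
        exact wt_mono (by linarith) _
    _ ≤ _ := (mul_le_mul_of_nonneg_left (wt_two_pi_le (by linarith) ξ) (sq_nonneg c)).trans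
        (mul_assoc _ _ _).ge

/-- The gain of regularity of `B^{1/2} K⁻¹`; the weight is that of `H^{1 - r/2}`, in which `D² b(D)`
is bounded as a quadratic form. -/
theorem exists_wt_mul_th_sq_le (h : IsSymbolPair l b ρ r) (hr : r ≤ 2) :
    ∃ C : ℝ, 0 ≤ C ∧ ∀ ξ, wt (2 * (1 - r / 2)) ξ * th l b ξ ^ 2 ≤ C := by
  obtain ⟨c, hc, hb⟩ := h.bound_b
  obtain ⟨c₁, hc₁, c₂, hc₂, hl⟩ := h.bound_l
  refine ⟨c ^ 2 / c₁ ^ 2, by positivity, fun ξ => ?_⟩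
  have hw := wt_le_wt_two_pi (by linarith : 0 ≤ 2 * (1 - r / 2)) ξ
  set η := 2 * Real.pi * ξ with hη
  have hwρ := wt_pos ρ η
  have hth : th l b ξ ^ 2 ≤ (c ^ 2 / c₁ ^ 2) * wt (-r + -ρ) η := by
    unfold th
    rw [div_pow, Real.sq_sqrt (h.b_pos _).le, Real.sq_sqrt (h.l_pos _).le, wt_add, wt_neg ρ,
      div_le_iff₀ (h.l_pos _)]
    refine (hb η).2.trans ?_
    calc c ^ 2 * wt (-r) η = c ^ 2 / c₁ ^ 2 * (wt (-r) η * (wt ρ η)⁻¹) * (c₁ ^ 2 * wt ρ η) := by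
          field_simp
      _ ≤ _ := by
          have := wt_pos (-r) η
          gcongr
          exact (hl η).1
  calc _ ≤ wt (2 * (1 - r / 2)) η * ((c ^ 2 / c₁ ^ 2) * wt (-r + -ρ) η) := by
        have := wt_pos (2 * (1 - r / 2)) η
        gcongr
    _ = (c ^ 2 / c₁ ^ 2) * wt (2 * (1 - r / 2) + (-r + -ρ)) η := by
        rw [wt_add (2 * (1 - r / 2))]; ring
    _ ≤ (c ^ 2 / c₁ ^ 2) * 1 := by
        gcongr
        exact wt_le_one (by linarith [h.order]) _
    _ = _ := mul_one _

theorem isBdd_th (h : IsSymbolPair l b ρ r) : IsBdd (th l b) := by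
  obtain ⟨c, hc, hb⟩ := h.bound_b
  obtain ⟨d, hd, hl⟩ := h.sqrt_l_ge
  refine ⟨h.measurable_th, c / d, fun ξ => ?_⟩
  have h1 : √(b (2 * Real.pi * ξ)) ≤ c := by
    rw [Real.sqrt_le_left hc.le]
    refine (hb _).2.trans (mul_le_of_le_one_right (by positivity) (wt_le_one ?_ _))
    linarith [h.r_nonneg]
  have h2 : d ≤ √(l (2 * Real.pi * ξ)) := by
    refine le_trans ?_ (hl _)
    exact le_mul_of_one_le_right hd.le (one_le_wt (by linarith [h.rho]) _)
  unfold th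
  rw [abs_of_nonneg (by positivity)]
  gcongr

theorem hasOrder_rb (h : IsSymbolPair l b ρ r) : HasOrder 1 (rb b) := by
  obtain ⟨C, hC0, hC⟩ := h.exists_be_le zero_le_one (by linarith [h.r_nonneg])
  refine ⟨h.measurable_rb, √C, fun ξ => ?_⟩
  refine abs_le_of_sq_le_sq ?_ (mul_nonneg (Real.sqrt_nonneg _) (wt_pos _ _).le)
  rw [h.rb_sq, mul_pow, Real.sq_sqrt hC0, wt_sq]
  exact hC ξ

end IsSymbolPair

/-- An integral form of Grönwall's inequality. -/
theorem le_mul_exp_of_le_add_integral {n : ℝ → ℝ} {t' A L : ℝ} (ht' : 0 ≤ t') (hL : 0 ≤ L)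
    (hn : ContinuousOn n (Set.Icc 0 t'))
    (h : ∀ t ∈ Set.Icc 0 t', n t ≤ A + L * ∫ τ in (0 : ℝ)..t, n τ) :
    ∀ t ∈ Set.Icc 0 t', n t ≤ A * Real.exp (L * t) := by
  have hint : IntegrableOn n (Set.uIcc 0 t') := by
    rw [Set.uIcc_of_le ht']
    exact hn.integrableOn_Icc
  have hc : ContinuousOn (fun t => (A + L * ∫ τ in (0 : ℝ)..t, n τ) * Real.exp (-(L * t)))
      (Set.Icc 0 t') := by
    have := intervalIntegral.continuousOn_primitive_interval hint
    rw [Set.uIcc_of_le ht'] at this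
    fun_prop
  have hanti : AntitoneOn (fun t => (A + L * ∫ τ in (0 : ℝ)..t, n τ) * Real.exp (-(L * t)))
      (Set.Icc 0 t') := by
    refine antitoneOn_of_hasDerivWithinAt_nonpos (convex_Icc 0 t') hc
      (f' := fun t => (L * n t) * Real.exp (-(L * t)) +
        (A + L * ∫ τ in (0 : ℝ)..t, n τ) * (Real.exp (-(L * t)) * -(L * 1))) ?_ ?_
    · intro t ht
      rw [interior_Icc] at ht
      have ht1 := Set.Ioo_subset_Icc_self ht
      have hnh : Set.Icc 0 t' ∈ 𝓝 t := Icc_mem_nhds ht.1 ht.2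
      have h1 : HasDerivAt (fun t => ∫ τ in (0 : ℝ)..t, n τ) (n t) t := by
        refine intervalIntegral.integral_hasDerivAt_right ?_ ?_ (hn.continuousAt hnh)
        · refine (hn.mono ?_).intervalIntegrable
          rw [Set.uIcc_of_le ht.1.le]
          exact Set.Icc_subset_Icc_right ht.2.le
        · exact (hn.mono Set.Ioo_subset_Icc_self).stronglyMeasurableAtFilter isOpen_Ioo t ht
      have h2 : HasDerivAt (fun t => Real.exp (-(L * t))) (Real.exp (-(L * t)) * -(L * 1)) t :=
        (((hasDerivAt_id t).const_mul L).neg).exp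
      exact (((h1.const_mul L).const_add A).mul h2).hasDerivWithinAt
    · intro t ht
      rw [interior_Icc] at ht
      have := mul_le_mul_of_nonneg_left (h t (Set.Ioo_subset_Icc_self ht)) hL
      have he := (Real.exp_pos (-(L * t))).le
      nlinarith [mul_nonneg (sub_nonneg.2 this) he]
  intro t ht
  have h1 := hanti (Set.left_mem_Icc.2 ht') ht ht.1
  simp only [intervalIntegral.integral_same, mul_zero, add_zero, neg_zero, Real.exp_zero,
    mul_one] at h1
  refine (h t ht).trans ?_
  rw [Real.exp_neg, ← div_eq_mul_inv, div_le_iff₀ (Real.exp_pos _)] at h1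
  exact h1

section

variable {l b g : ℝ → ℝ} {ρ r s : ℝ} {T : EReal} {u : ℝ → L2} {U V : ℝ → L2C} {U₀ V₀ : L2C}
variable {Y₀ D₀ : L2C}

/-- The subtraction formula for the sine merges the two integrals of Duhamel's formula into one. -/
theorem mulOp_cos_sin_integral (hsym : IsSymbolPair l b ρ r) {N : ℝ → L2C} {t : ℝ} (ht : 0 ≤ t)
    (hN : ContinuousOn N (Set.Icc 0 t)) :
    mulOp (pc l t) (∫ τ in (0 : ℝ)..t, mulOp (ks l b τ) (N τ)) -
      mulOp (ps ρ l t) (∫ τ in (0 : ℝ)..t, mulOp (kc ρ l b τ) (N τ)) =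
      ∫ τ in (0 : ℝ)..t, mulOp (ks l b (τ - t)) (N τ) := by
  have hu := Set.uIcc_of_le ht
  have h1 : IntervalIntegrable (fun τ => mulOp (ks l b τ) (N τ)) volume 0 t :=
    ((isBddFamily_ks hsym).continuousOn (hu ▸ hN)).intervalIntegrable
  have h2 : IntervalIntegrable (fun τ => mulOp (kc ρ l b τ) (N τ)) volume 0 t :=
    ((isBddFamily_kc hsym).continuousOn (hu ▸ hN)).intervalIntegrable
  rw [← ContinuousLinearMap.intervalIntegral_comp_comm _ h1,
    ← ContinuousLinearMap.intervalIntegral_comp_comm _ h2, ← intervalIntegral.integral_sub]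
  · refine intervalIntegral.integral_congr fun τ _ => ?_
    have hks := fun t => (isBddFamily_ks hsym).isBdd t
    have hb1 := (isBddFamily_pc hsym).isBdd t
    have hb2 := (isBddFamily_ps hsym).isBdd t
    have hb3 := (isBddFamily_kc hsym).isBdd τ
    change mulOp _ _ - mulOp _ _ = _
    rw [mulOp_mulOp hb1 (hks τ), mulOp_mulOp hb2 hb3, ← sub_apply,
      ← mulOp_sub (hb1.mul (hks τ)) (hb2.mul hb3)]
    congr 2
    ext ξ
    have hw : wt (1 + ρ / 2) ξ * wt (-(1 + ρ / 2)) ξ = 1 := by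
      rw [wt_neg]
      exact mul_inv_cancel₀ (wt_pos _ _).ne'
    simp only [pc, ps, ks, kc, sub_mul, Real.sin_sub, ← mul_sn (om l ξ) t, hsym.be_eq]
    linear_combination (-(sn (om l ξ) t * (om l ξ * ka l b ξ * Real.cos (τ * om l ξ)))) * hw
  · exact ⟨(mulOp (pc l t)).integrable_comp h1.1, (mulOp (pc l t)).integrable_comp h1.2⟩
  · exact ⟨(mulOp (ps ρ l t)).integrable_comp h2.1, (mulOp (ps ρ l t)).integrable_comp h2.2⟩

/-- Duhamel's formula for initial data of finite energy: `Y₀` and `D₀` are the transforms of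
`B^{-1/2} K φ` and of `B^{-1/2} Λ⁻¹ ψ`. -/
theorem IsMild.duhamel (hsym : IsSymbolPair l b ρ r) (hn : IsNonlinearity g s)
    (h : IsMild l b g ρ s T U₀ V₀ u U V) (hY₀ : mulOp (wt (-s)) U₀ = mulOp (th l b) Y₀)
    (hD₀ : mulOp (wt (-s)) V₀ = mulOp (fun ξ => wt (-(1 + ρ / 2)) ξ * rb b ξ) D₀) {t : ℝ}
    (ht : t ∈ timeInterval T) :
    ft (u t) = mulOp (th l b) (mulOp (pc l t) Y₀ + mulOp (fun ξ => Real.sin (t * om l ξ)) D₀) +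
      ∫ τ in (0 : ℝ)..t, mulOp (ks l b (τ - t)) (ft (nem g (u τ))) := by
  obtain ⟨M, hM⟩ := h.bounded t ht
  have hρ := hsym.rho
  have hsub := Icc_subset_timeInterval ht
  have huc := h.continuousOn_u.mono hsub
  have hws := isBdd_wt (neg_nonpos.2 hn.pos)
  have hpc := (isBddFamily_pc hsym).isBdd t
  have hps := (isBddFamily_ps hsym).isBdd t
  have hint : ∀ {m : ℝ → ℝ → ℝ}, IsBddFamily m →
      mulOp (wt (-s)) (∫ τ in (0 : ℝ)..t, wtLp s (mulOp (m τ) (ft (nem g (u τ))))) =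
      ∫ τ in (0 : ℝ)..t, mulOp (m τ) (ft (nem g (u τ))) := fun hm =>
    mulOp_integral_forcing hn hm ht.1 (huc.mono Set.Ioo_subset_Icc_self)
      fun t ht => hM t (Set.Ioo_subset_Icc_self ht)
  have hrb : IsBdd (fun ξ => wt (-(1 + ρ / 2)) ξ * rb b ξ) :=
    ((hasOrder_wt _).mul hsym.hasOrder_rb).isBdd (by linarith)
  have hsin := (isBddFamily_sin hsym).isBdd t
  rw [h.fourier_u t ht, h.eq_U t ht, map_add, mulOp_comm hws hpc, mulOp_comm hws hps]
  simp only [map_add, map_sub, srcS, srcC]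
  rw [hint (isBddFamily_ks hsym), hint (isBddFamily_kc hsym), hY₀, hD₀, mulOp_comm hpc hsym.isBdd_th,
    ← mulOp_cos_sin_integral hsym (N := fun τ => ft (nem g (u τ))) ht.1
      (continuous_ft.comp_continuousOn (continuousOn_nem_of_bdd hn huc hM)),
    mulOp_mulOp_congr hps hrb hsym.isBdd_th hsin (fun ξ => ?_)]
  · abel
  · have hw : wt (1 + ρ / 2) ξ * wt (-(1 + ρ / 2)) ξ = 1 := by
      rw [wt_neg]
      exact mul_inv_cancel₀ (wt_pos _ _).ne'
    simp only [ps, ← mul_sn (om l ξ) t, ← hsym.om_mul_th]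
    linear_combination (sn (om l ξ) t * (om l ξ * th l b ξ)) * hw

/-- The symbol of a difference operator, up to a factor of modulus one. -/
def dsRoot (h ξ : ℝ) : ℝ := 2 * Real.sin (Real.pi * (h * ξ))

theorem isBdd_dsRoot (h : ℝ) : IsBdd (dsRoot h) := by
  refine ⟨by unfold dsRoot; fun_prop, 2, fun ξ => ?_⟩
  unfold dsRoot
  rw [abs_mul, abs_two]
  linarith [Real.abs_sin_le_one (Real.pi * (h * ξ))]

theorem enorm_dsRoot_sq (h : ℝ) (F : L2C) : ‖mulOp (dsRoot h) F‖ₑ ^ 2 = wsq (ds h) F :=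
  enorm_mulOp_sq (isBdd_dsRoot h) F

/-- Finite differences of the solution grow at most exponentially, at a rate that does not depend
on the step. -/
theorem IsMild.exists_norm_dsRoot_le (hsym : IsSymbolPair l b ρ r) (hn : IsNonlinearity g s)
    (h : IsMild l b g ρ s T U₀ V₀ u U V) (hY₀ : mulOp (wt (-s)) U₀ = mulOp (th l b) Y₀)
    (hD₀ : mulOp (wt (-s)) V₀ = mulOp (fun ξ => wt (-(1 + ρ / 2)) ξ * rb b ξ) D₀) {t' : ℝ}
    (ht' : t' ∈ timeInterval T) :
    ∃ C : ℝ, 0 ≤ C ∧ ∀ t ∈ Set.Icc 0 t', ∀ k, ‖mulOp (dsRoot k) (ft (u t))‖ ≤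
      C * (‖mulOp (dsRoot k) (mulOp (th l b) Y₀)‖ + ‖mulOp (dsRoot k) (mulOp (th l b) D₀)‖) := by
  obtain ⟨M, hM⟩ := h.bounded t' ht'
  obtain ⟨R, K, hR, hK, hlip, hsup⟩ := exists_sup_lipschitz hn.reg hn.contDiff_one M
  obtain ⟨κ, hκ⟩ := (hsym.isBdd_ka).2
  have hκ0 : 0 ≤ κ := (abs_nonneg _).trans (hκ 0)
  have hsub := Icc_subset_timeInterval ht'
  have huc := h.continuousOn_u.mono hsub
  refine ⟨Real.exp (κ * K * t'), (Real.exp_pos _).le, fun t ht k => ?_⟩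
  have hd := isBdd_dsRoot k
  set A := ‖mulOp (dsRoot k) (mulOp (th l b) Y₀)‖ + ‖mulOp (dsRoot k) (mulOp (th l b) D₀)‖ with hA
  have hcont : ContinuousOn (fun τ => ‖mulOp (dsRoot k) (ft (u τ))‖) (Set.Icc 0 t') :=
    ((mulOp (dsRoot k)).continuous.comp_continuousOn (continuous_ft.comp_continuousOn huc)).norm
  -- `g` is Lipschitz on the range of the solution, so it preserves bounds on differences
  have hN : ∀ τ ∈ Set.Icc 0 t', ‖mulOp (dsRoot k) (ft (nem g (u τ)))‖ ≤
      K * ‖mulOp (dsRoot k) (ft (u τ))‖ := by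
    intro τ hτ
    have h1 := wsq_ds_nem_le hn.contDiff_one.continuous hn.zero hK hlip (hsup _ (hM τ hτ)) k
    change wsq (ds k) (ft _) ≤ _ * wsq (ds k) (ft _) at h1
    rw [← enorm_dsRoot_sq, ← enorm_dsRoot_sq] at h1
    refine abs_le_of_sq_le_sq' ?_ (by positivity) |>.2
    rw [mul_pow, norm_sq_eq_toReal, norm_sq_eq_toReal, ← ENNReal.toReal_ofReal (sq_nonneg K),
      ← ENNReal.toReal_mul]
    exact ENNReal.toReal_mono (by finiteness) h1
  -- Duhamel's formula, whose propagators commute with differences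
  have hkey : ∀ t ∈ Set.Icc 0 t', ‖mulOp (dsRoot k) (ft (u t))‖ ≤
      A + κ * K * ∫ τ in (0 : ℝ)..t, ‖mulOp (dsRoot k) (ft (u τ))‖ := by
    intro t ht
    have hst : Set.Icc 0 t ⊆ Set.Icc 0 t' := Set.Icc_subset_Icc_right ht.2
    have hNc : ContinuousOn (fun τ => ft (nem g (u τ))) (Set.Icc 0 t') :=
      continuous_ft.comp_continuousOn (continuousOn_nem_of_bdd hn huc hM)
    have hfam : IsBddFamily fun τ => ks l b (τ - t) := by
      have h0 := isBddFamily_ks hsym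
      refine ⟨fun τ => h0.meas _, fun R => ?_, fun ξ => (h0.cont ξ).comp (by fun_prop)⟩
      obtain ⟨C, hC⟩ := h0.bound (R + |t|)
      exact ⟨C, fun τ hτ => hC _ ((abs_sub _ _).trans (by linarith))⟩
    have hint : IntervalIntegrable (fun τ => mulOp (ks l b (τ - t)) (ft (nem g (u τ)))) volume 0 t := by
      refine ContinuousOn.intervalIntegrable ?_
      rw [Set.uIcc_of_le ht.1]
      exact hfam.continuousOn (hNc.mono hst)
    rw [h.duhamel hsym hn hY₀ hD₀ (hsub ht), map_add]
    refine (norm_add_le _ _).trans (add_le_add ?_ ?_)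
    · simp only [map_add]
      refine (norm_add_le _ _).trans (add_le_add ?_ ?_)
      · rw [mulOp_comm hsym.isBdd_th ((isBddFamily_pc hsym).isBdd t),
          mulOp_comm hd ((isBddFamily_pc hsym).isBdd t)]
        refine (norm_mulOp_apply_le ((isBddFamily_pc hsym).meas t)
          (fun ξ => Real.abs_cos_le_one _) _).trans (one_mul _).le
      · rw [mulOp_comm hsym.isBdd_th ((isBddFamily_sin hsym).isBdd t),
          mulOp_comm hd ((isBddFamily_sin hsym).isBdd t)]
        refine (norm_mulOp_apply_le ((isBddFamily_sin hsym).meas t)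
          (fun ξ => Real.abs_sin_le_one _) _).trans (one_mul _).le
    · rw [← ContinuousLinearMap.intervalIntegral_comp_comm _ hint,
        ← intervalIntegral.integral_const_mul]
      refine intervalIntegral.norm_integral_le_of_norm_le ht.1
        (Eventually.of_forall fun τ hτ => ?_) ?_
      · rw [mulOp_comm hd (hfam.isBdd τ)]
        have hb : ∀ ξ, |ks l b (τ - t) ξ| ≤ κ := by
          intro ξ
          unfold ks
          rw [abs_mul]
          exact (mul_le_of_le_one_right (abs_nonneg _) (Real.abs_sin_le_one _)).trans (hκ ξ)
        refine (norm_mulOp_apply_le (hfam.meas τ) hb _).trans ?_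
        rw [mul_assoc]
        exact mul_le_mul_of_nonneg_left (hN τ ⟨hτ.1.le, hτ.2.trans ht.2⟩) hκ0
      · refine (ContinuousOn.intervalIntegrable ?_).const_mul _
        rw [Set.uIcc_of_le ht.1]
        exact hcont.mono hst
  refine (le_mul_exp_of_le_add_integral ht'.1 (by positivity) hcont hkey t ht).trans ?_
  rw [mul_comm]
  gcongr
  exact ht.2

/-- Solutions with initial data of finite energy stay in `H^{1 - r/2}`, locally uniformly in time. -/
theorem IsMild.exists_hsq_le (hsym : IsSymbolPair l b ρ r) (hn : IsNonlinearity g s)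
    (h : IsMild l b g ρ s T U₀ V₀ u U V) (hY₀ : mulOp (wt (-s)) U₀ = mulOp (th l b) Y₀)
    (hD₀ : mulOp (wt (-s)) V₀ = mulOp (fun ξ => wt (-(1 + ρ / 2)) ξ * rb b ξ) D₀) (hr : r < 2)
    {t' : ℝ} (ht' : t' ∈ timeInterval T) :
    ∃ M : NNReal, ∀ t ∈ Set.Icc 0 t', hsq (1 - r / 2) (ft (u t)) ≤ M := by
  obtain ⟨C, hC0, hC⟩ := h.exists_norm_dsRoot_le hsym hn hY₀ hD₀ ht'
  obtain ⟨M, hM⟩ := h.bounded t' ht'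
  obtain ⟨E, hE0, hE⟩ := hsym.exists_wt_mul_th_sq_le hr.le
  have hσ : 0 < 1 - r / 2 := by linarith
  have hσ1 : 1 - r / 2 ≤ 1 := by linarith [hsym.r_nonneg]
  set F₁ := mulOp (th l b) Y₀ with hF₁
  set F₂ := mulOp (th l b) D₀ with hF₂
  have hth : ∀ F, wsq (fun ξ => |ξ| ^ (2 * (1 - r / 2))) (mulOp (th l b) F) ≤
      ENNReal.ofReal E * ‖F‖ₑ ^ 2 := by
    intro F
    refine (wsq_abs_le_hsq hσ.le _).trans ?_
    rw [hsq, wsq_mulOp (fun ξ => (wt_pos _ _).le) hsym.isBdd_th, enorm_sq_eq_wsq,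
      ← wsq_const_mul hE0]
    exact wsq_mono (fun ξ => by rw [mul_one]; exact hE ξ) _
  -- a single function whose differences dominate those of both data
  set G : ℝ → ℂ := fun ξ => ((√(‖F₁ ξ‖ ^ 2 + ‖F₂ ξ‖ ^ 2) : ℝ) : ℂ) with hG
  have hGm : AEStronglyMeasurable G volume := by
    have h1 := (Lp.aestronglyMeasurable F₁).norm
    have h2 := (Lp.aestronglyMeasurable F₂).norm
    exact Complex.continuous_ofReal.comp_aestronglyMeasurable
      (Real.continuous_sqrt.comp_aestronglyMeasurable ((h1.pow 2).add (h2.pow 2)))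
  have hGw : ∀ m : ℝ → ℝ, Measurable m → wsq m G = wsq m F₁ + wsq m F₂ := by
    intro m hm
    unfold wsq
    rw [← lintegral_add_left']
    · refine lintegral_congr fun ξ => ?_
      rw [← mul_add]
      congr 1
      have h1 : ∀ z : ℂ, ‖z‖ₑ ^ 2 = ENNReal.ofReal (‖z‖ ^ 2) := fun z => by
        rw [← ofReal_norm, ENNReal.ofReal_pow (norm_nonneg _)]
      rw [h1, h1, h1, ← ENNReal.ofReal_add (by positivity) (by positivity), hG]
      simp only [Complex.norm_real, Real.norm_eq_abs, sq_abs]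
      rw [Real.sq_sqrt (by positivity)]
    · exact (by fun_prop : Measurable fun ξ => ENNReal.ofReal (m ξ)).aemeasurable.mul
        ((Lp.aestronglyMeasurable F₁).enorm.pow_const 2)
  have hbound : ∀ t ∈ Set.Icc 0 t', hsq (1 - r / 2) (ft (u t)) ≤
      M + ENNReal.ofReal (2 * C ^ 2) *
        (ENNReal.ofReal E * ‖Y₀‖ₑ ^ 2 + ENNReal.ofReal E * ‖D₀‖ₑ ^ 2) := by
    intro t ht
    refine (hsq_le_add_abs hσ.le hσ1 _).trans (add_le_add ?_ ?_)
    · rw [← hsq_zero]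
      exact (hsq_mono hn.pos _).trans (hM t ht)
    · have hk : ∀ k, wsq (ds k) (ft (u t)) ≤ ENNReal.ofReal (2 * C ^ 2) * wsq (ds k) G := by
        intro k
        rw [hGw _ (measurable_ds k), ← enorm_dsRoot_sq, ← enorm_dsRoot_sq, ← enorm_dsRoot_sq]
        have h1 : ∀ z : L2C, ‖z‖ₑ ^ 2 = ENNReal.ofReal (‖z‖ ^ 2) := fun z => by
          rw [← ofReal_norm, ENNReal.ofReal_pow (norm_nonneg _)]
        rw [h1, h1, h1, ← ENNReal.ofReal_add (by positivity) (by positivity),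
          ← ENNReal.ofReal_mul (by positivity)]
        refine ENNReal.ofReal_le_ofReal ?_
        have h2 := pow_le_pow_left₀ (norm_nonneg _) (hC t ht k) 2
        refine h2.trans ?_
        rw [mul_pow]
        nlinarith [mul_nonneg (sq_nonneg C) (sq_nonneg (‖mulOp (dsRoot k) F₁‖ -
          ‖mulOp (dsRoot k) F₂‖))]
      refine (wsq_abs_le_of_ds hσ hσ1 (Lp.aestronglyMeasurable _) hGm (by finiteness) hk).trans ?_
      rw [hGw _ (by fun_prop)]
      gcongr
      · exact hth _
      · exact hth _
  have hfin : (M + ENNReal.ofReal (2 * C ^ 2) *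
        (ENNReal.ofReal E * ‖Y₀‖ₑ ^ 2 + ENNReal.ofReal E * ‖D₀‖ₑ ^ 2) : ℝ≥0∞) ≠ ⊤ := by finiteness
  refine ⟨_, fun t ht => (hbound t ht).trans (ENNReal.coe_toNNReal hfin).ge⟩

/-- For initial data of finite energy, `B^{1/2} Λ g(u)` stays in `L²`, locally uniformly in time. -/
theorem IsMild.exists_wsq_be_nem_le (hsym : IsSymbolPair l b ρ r) (hn : IsNonlinearity g s)
    (h : IsMild l b g ρ s T U₀ V₀ u U V) (hY₀ : mulOp (wt (-s)) U₀ = mulOp (th l b) Y₀)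
    (hD₀ : mulOp (wt (-s)) V₀ = mulOp (fun ξ => wt (-(1 + ρ / 2)) ξ * rb b ξ) D₀)
    {t' : ℝ} (ht' : t' ∈ timeInterval T) :
    ∃ M : NNReal, ∀ t ∈ Set.Icc 0 t', wsq (be b) (ft (nem g (u t))) ≤ M := by
  obtain ⟨M, hM⟩ := h.bounded t' ht'
  have hbe : ∀ {σ : ℝ}, 0 ≤ σ → 1 - r / 2 ≤ σ →
      (∃ M : NNReal, ∀ t ∈ Set.Icc 0 t', hsq σ (ft (nem g (u t))) ≤ M) →
      ∃ M : NNReal, ∀ t ∈ Set.Icc 0 t', wsq (be b) (ft (nem g (u t))) ≤ M := by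
    rintro σ h0 hσ ⟨M, hM⟩
    obtain ⟨C, hC0, hC⟩ := hsym.exists_be_le h0 hσ
    refine ⟨C.toNNReal * M, fun t ht => ?_⟩
    rw [ENNReal.coe_mul]
    refine (wsq_mono hC _).trans ?_
    rw [wsq_const_mul hC0]
    exact mul_le_mul_right (hM t ht) _
  -- `be` has order `2 (1 - r / 2)`, so `H^s` is enough if `s ≥ 1 - r / 2`; otherwise the
  -- regularity `1 - r / 2 ≤ 1` that the finite energy gives `u` passes to `g (u)`
  rcases le_or_gt (1 - r / 2) s with h1 | h1
  · obtain ⟨K, hK⟩ := exists_hsq_nem_le hn.reg hn.smooth hn.zero M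
    exact hbe hn.pos h1 ⟨K, fun t ht => hK _ (hM t ht)⟩
  · have hσ : 0 < 1 - r / 2 := by linarith [hn.reg]
    obtain ⟨M', hM'⟩ := h.exists_hsq_le hsym hn hY₀ hD₀ (by linarith) ht'
    obtain ⟨R, K, hR, hK, hlip, hsup⟩ := exists_sup_lipschitz hn.reg hn.contDiff_one M
    refine hbe hσ.le le_rfl ⟨(2 * K ^ 2).toNNReal * M', fun t ht => ?_⟩
    rw [ENNReal.coe_mul]
    exact (hsq_nem_le hn.contDiff_one.continuous hn.zero hK hlip (hsup _ (hM t ht)) hσ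
      (by linarith [hsym.r_nonneg])).trans (mul_le_mul_right (hM' t ht) _)

end

/-! ### The equation in the energy space -/

section

variable {l b g : ℝ → ℝ} {ρ r s : ℝ} {T : EReal} {u : ℝ → L2} {U V : ℝ → L2C} {U₀ V₀ : L2C}
variable {P₀ Y₀ D₀ : L2C}

/-- The transform of `B^{1/2} Λ g(u)`. -/
def zsrc (b g : ℝ → ℝ) (u : ℝ → L2) (τ : ℝ) : L2C :=
  wtLp 1 (mulOp (fun ξ => wt (-1) ξ * rb b ξ) (ft (nem g (u τ))))

/-- The transforms `P`, `Y`, `D` of `B^{-1/2} Λ⁻¹ u`, `B^{-1/2} K u` and `B^{-1/2} Λ⁻¹ u_t`, as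
curves in `L²`: they satisfy `P' = D`, `Y' = ω D` and `D' = -ω Y - B^{1/2} Λ g(u)`, the last two at
bounded frequencies. The source `Z` is the transform of `B^{1/2} Λ g(u)`. -/
structure IsEnergyCurve (l b g : ℝ → ℝ) (s : ℝ) (T : EReal) (u : ℝ → L2) (P Y D Z : ℝ → L2C) :
    Prop where
  continuousOn_u : ContinuousOn u (timeInterval T)
  bounded : ∀ t' ∈ timeInterval T, ∃ M : NNReal, ∀ t ∈ Set.Icc 0 t', hsq s (ft (u t)) ≤ M
  continuousOn_Y : ContinuousOn Y (timeInterval T)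
  continuousOn_D : ContinuousOn D (timeInterval T)
  bounded_Z : ∀ t' ∈ timeInterval T, ∃ C : ℝ, ∀ t ∈ Set.Icc 0 t', ‖Z t‖ ≤ C
  cut_Z : ∀ n, ∀ t ∈ timeInterval T,
    mulOp (fun ξ => cut n ξ * rb b ξ) (ft (nem g (u t))) = mulOp (cut n) (Z t)
  ft_eq : ∀ t ∈ timeInterval T, ft (u t) = mulOp (th l b) (Y t)
  cut_Y : ∀ n, ∀ t ∈ timeInterval T,
    mulOp (cut n) (Y t) = mulOp (fun ξ => cut n ξ * om l ξ) (P t)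
  deriv_P : ∀ t ∈ timeInterval T, HasDerivWithinAt P (D t) (timeInterval T) t
  deriv_Y : ∀ n, ∀ t ∈ timeInterval T, HasDerivWithinAt (fun t => mulOp (cut n) (Y t))
    (mulOp (fun ξ => cut n ξ * om l ξ) (D t)) (timeInterval T) t
  deriv_D : ∀ n, ∀ t ∈ timeInterval T, HasDerivWithinAt (fun t => mulOp (cut n) (D t))
    (-(mulOp (fun ξ => cut n ξ * om l ξ) (Y t) + mulOp (cut n) (Z t))) (timeInterval T) t

theorem isBdd_cut (n : ℕ) : IsBdd (cut n) := ⟨measurable_cut n, 1, abs_cut_le n⟩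

theorem cut_mul_self (n : ℕ) (ξ : ℝ) : cut n ξ * cut n ξ = cut n ξ := by
  unfold cut
  split_ifs <;> simp

theorem HasOrder.isBdd_cut_mul {σ : ℝ} {m : ℝ → ℝ} (hm : HasOrder σ m) (n : ℕ) :
    IsBdd (fun ξ => cut n ξ * m ξ) := by
  obtain ⟨hm, C, hC⟩ := hm
  refine (isBdd_cut_mul_wt n σ).of_le ((measurable_cut n).mul hm) (c := C) fun ξ => ?_
  rw [abs_mul, abs_mul, abs_of_pos (wt_pos σ ξ)]
  nlinarith [mul_le_mul_of_nonneg_left (hC ξ) (abs_nonneg (cut n ξ))]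

theorem IsSymbolPair.isBdd_wt_mul_rb (hsym : IsSymbolPair l b ρ r) :
    IsBdd (fun ξ => wt (-1) ξ * rb b ξ) :=
  ((hasOrder_wt (-1)).mul hsym.hasOrder_rb).isBdd (by norm_num)

theorem hsq_one_wt_mul_rb (hsym : IsSymbolPair l b ρ r) (F : L2C) :
    hsq 1 (mulOp (fun ξ => wt (-1) ξ * rb b ξ) F) = wsq (be b) F := by
  rw [hsq, wsq_mulOp (fun ξ => (wt_pos _ _).le) hsym.isBdd_wt_mul_rb]
  congr 1
  ext ξ
  have h1 : wt (2 * 1) ξ * wt (-1) ξ ^ 2 = 1 := by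
    rw [wt_sq, ← wt_add, ← wt_zero ξ]
    congr 1
    norm_num
  rw [mul_pow, ← mul_assoc, h1, one_mul, hsym.rb_sq]

theorem mulOp_zsrc (hsym : IsSymbolPair l b ρ r) {τ : ℝ} (h : wsq (be b) (ft (nem g (u τ))) < ⊤) :
    mulOp (wt (-1)) (zsrc b g u τ) =
      mulOp (fun ξ => wt (-1) ξ * rb b ξ) (ft (nem g (u τ))) := by
  rw [← hsq_one_wt_mul_rb hsym] at h
  exact mulOp_wtLp zero_le_one h

theorem norm_zsrc_le (hsym : IsSymbolPair l b ρ r) {τ : ℝ} {M : NNReal}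
    (h : wsq (be b) (ft (nem g (u τ))) ≤ M) : ‖zsrc b g u τ‖ ≤ √(M : ℝ) := by
  rw [← hsq_one_wt_mul_rb hsym] at h
  exact norm_wtLp_le zero_le_one h

/-- `m(D) Z` for two symbols whose product with `B^{1/2} Λ` agree. -/
theorem mulOp_zsrc_eq (hsym : IsSymbolPair l b ρ r) {m n : ℝ → ℝ} (hm : IsBdd m) (hn : IsBdd n)
    (hmn : ∀ ξ, m ξ * rb b ξ = n ξ) {τ : ℝ} (h : wsq (be b) (ft (nem g (u τ))) < ⊤) :
    mulOp m (zsrc b g u τ) = mulOp n (ft (nem g (u τ))) := by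
  have hw := isBdd_wt (by norm_num : (-1 : ℝ) ≤ 0)
  refine mulOp_wt_injective zero_le_one ?_
  rw [mulOp_comm hw hm, mulOp_zsrc hsym h]
  refine mulOp_mulOp_congr hm hsym.isBdd_wt_mul_rb hw hn (fun ξ => ?_) _
  rw [← hmn]
  ring

/-- The source is only known to be continuous in a weaker norm, and bounded in `L²`; this suffices
for its integrability. -/
theorem intervalIntegrable_mulOp_zsrc (hsym : IsSymbolPair l b ρ r) {m : ℝ → ℝ → ℝ}
    (hm : IsBddFamily m) {t' : ℝ} (ht' : 0 ≤ t')
    (hN : ContinuousOn (fun t => nem g (u t)) (Set.Icc 0 t')) {M : NNReal}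
    (hM : ∀ t ∈ Set.Icc 0 t', wsq (be b) (ft (nem g (u t))) ≤ M) :
    IntervalIntegrable (fun τ => mulOp (m τ) (zsrc b g u τ)) volume 0 t' := by
  have hw := isBdd_wt (by norm_num : (-1 : ℝ) ≤ 0)
  obtain ⟨C, hC⟩ := hm.bound t'
  have hC0 : 0 ≤ C := (abs_nonneg _).trans (hC 0 (by simpa using ht') 0)
  have hX : ContinuousOn (fun τ => mulOp (m τ) (mulOp (fun ξ => wt (-1) ξ * rb b ξ)
      (ft (nem g (u τ))))) (Set.Icc 0 t') :=
    hm.continuousOn ((mulOp _).continuous.comp_continuousOn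
      (continuous_ft.comp_continuousOn hN))
  have hfin : ∀ τ ∈ Set.Icc 0 t', wsq (be b) (ft (nem g (u τ))) < ⊤ := fun τ hτ =>
    (hM τ hτ).trans_lt ENNReal.coe_lt_top
  have heq : ∀ τ ∈ Set.Icc 0 t', mulOp (wt (-1)) (mulOp (m τ) (zsrc b g u τ)) =
      mulOp (m τ) (mulOp (fun ξ => wt (-1) ξ * rb b ξ) (ft (nem g (u τ)))) := fun τ hτ => by
    rw [mulOp_comm hw (hm.isBdd τ), mulOp_zsrc hsym (hfin τ hτ)]
  have hbd : ∀ τ ∈ Set.Icc 0 t', hsq 1 (mulOp (m τ) (mulOp (fun ξ => wt (-1) ξ * rb b ξ)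
      (ft (nem g (u τ))))) ≤ ((C ^ 2).toNNReal * M : NNReal) := by
    intro τ hτ
    rw [ENNReal.coe_mul]
    refine (hsq_mulOp_le (hm.meas τ) (hC τ (by rw [abs_of_nonneg hτ.1]; exact hτ.2)) _).trans ?_
    rw [hsq_one_wt_mul_rb hsym]
    exact mul_le_mul_right (hM τ hτ) _
  have h1 := intervalIntegrable_wtLp zero_le_one ht' (hX.mono Set.Ioo_subset_Icc_self)
    fun τ hτ => hbd τ (Set.Ioo_subset_Icc_self hτ)
  refine h1.congr fun τ hτ => ?_
  rw [Set.uIoc_of_le ht'] at hτ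
  have hτ' := Set.Ioc_subset_Icc_self hτ
  refine mulOp_wt_injective zero_le_one ?_
  rw [mulOp_wtLp zero_le_one ((hbd τ hτ').trans_lt ENNReal.coe_lt_top), heq τ hτ']

/-- A curve whose derivative vanishes on a time interval is constant there. -/
theorem eq_of_hasDerivWithinAt_zero {E : Type*} [NormedAddCommGroup E] [NormedSpace ℝ E]
    {f : ℝ → E} (h : ∀ t ∈ timeInterval T, HasDerivWithinAt f 0 (timeInterval T) t) {t : ℝ}
    (ht : t ∈ timeInterval T) : f t = f 0 := by
  have h0 : (0 : ℝ) ∈ timeInterval T := timeInterval_ordConnected ht le_rfl ht.1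
  have hconv : Convex ℝ (Set.Icc 0 t) := convex_Icc 0 t
  have := hconv.norm_image_sub_le_of_norm_hasDerivWithin_le (C := 0) (f' := fun _ => (0 : E))
    (fun x hx => (h x (Icc_subset_timeInterval ht hx)).mono (Icc_subset_timeInterval ht))
    (by simp) (Set.left_mem_Icc.2 ht.1) (Set.right_mem_Icc.2 ht.1)
  rw [zero_mul, norm_le_zero_iff, sub_eq_zero] at this
  exact this

theorem hasDerivAt_cut_cos (hsym : IsSymbolPair l b ρ r) (n : ℕ) (t : ℝ) :
    HasDerivAt (fun t => mulOp fun ξ => cut n ξ * pc l t ξ)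
      (mulOp fun ξ => cut n ξ * -(om l ξ * Real.sin (t * om l ξ))) t := by
  refine hasDerivAt_mulOp_weighted (f := fun t ξ => pc l t ξ) (L := fun ξ => om l ξ * om l ξ)
    (f' := fun t ξ => -(om l ξ * Real.sin (t * om l ξ)))
    (fun t => (isBdd_cut n).mul ((isBddFamily_pc hsym).isBdd t)) (fun t => ?_) (fun ξ t => ?_)
    (fun ξ x y => ?_) ((hsym.hasOrder_om.mul hsym.hasOrder_om).isBdd_cut_mul n) t
  · have := ((hsym.hasOrder_om.isBdd_cut_mul n).mul ((isBddFamily_sin hsym).isBdd t)).neg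
    convert this using 2
    ring
  · have := ((hasDerivAt_id t).mul_const (om l ξ)).cos
    refine this.congr_deriv ?_
    simp only [id]
    ring
  · rw [show -(om l ξ * Real.sin (x * om l ξ)) - -(om l ξ * Real.sin (y * om l ξ)) =
      -(om l ξ * (Real.sin (x * om l ξ) - Real.sin (y * om l ξ))) by ring, abs_neg, abs_mul, mul_assoc]
    have h0 := IsSymbolPair.om_nonneg (l := l) ξ
    rw [abs_of_nonneg h0]
    have := abs_sin_sub_le (om l ξ) x y
    rw [abs_of_nonneg h0] at this
    gcongr

theorem hasDerivAt_cut_sin (hsym : IsSymbolPair l b ρ r) (n : ℕ) (t : ℝ) :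
    HasDerivAt (fun t => mulOp fun ξ => cut n ξ * Real.sin (t * om l ξ))
      (mulOp fun ξ => cut n ξ * (om l ξ * pc l t ξ)) t := by
  refine hasDerivAt_mulOp_weighted (f := fun t ξ => Real.sin (t * om l ξ))
    (L := fun ξ => om l ξ * om l ξ) (f' := fun t ξ => om l ξ * pc l t ξ)
    (fun t => (isBdd_cut n).mul ((isBddFamily_sin hsym).isBdd t)) (fun t => ?_) (fun ξ t => ?_)
    (fun ξ x y => ?_) ((hsym.hasOrder_om.mul hsym.hasOrder_om).isBdd_cut_mul n) t
  · have := (hsym.hasOrder_om.isBdd_cut_mul n).mul ((isBddFamily_pc hsym).isBdd t)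
    convert this using 2
    ring
  · have := ((hasDerivAt_id t).mul_const (om l ξ)).sin
    refine this.congr_deriv ?_
    simp only [id, pc]
    ring
  · rw [← mul_sub, abs_mul, mul_assoc]
    have h0 := IsSymbolPair.om_nonneg (l := l) ξ
    rw [abs_of_nonneg h0]
    have := abs_cos_sub_le (om l ξ) x y
    rw [abs_of_nonneg h0] at this
    unfold pc
    gcongr

set_option maxHeartbeats 1000000 in
/-- Solutions with initial data of finite energy define curves in the energy space. -/
theorem IsMild.exists_isEnergyCurve (hsym : IsSymbolPair l b ρ r) (hn : IsNonlinearity g s)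
    (h : IsMild l b g ρ s T U₀ V₀ u U V) (hY₀ : mulOp (wt (-s)) U₀ = mulOp (th l b) Y₀)
    (hD₀ : mulOp (wt (-s)) V₀ = mulOp (fun ξ => wt (-(1 + ρ / 2)) ξ * rb b ξ) D₀)
    (hP₀ : ∀ n, mulOp (cut n) Y₀ = mulOp (fun ξ => cut n ξ * om l ξ) P₀) :
    ∃ P Y D, IsEnergyCurve l b g s T u P Y D (zsrc b g u) ∧ P 0 = P₀ ∧ Y 0 = Y₀ ∧ D 0 = D₀ := by
  have hbdd := fun t' (ht' : t' ∈ timeInterval T) => h.exists_wsq_be_nem_le hsym hn hY₀ hD₀ ht'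
  have hfin : ∀ t ∈ timeInterval T, wsq (be b) (ft (nem g (u t))) < ⊤ := fun t ht => by
    obtain ⟨M, hM⟩ := hbdd t ht
    exact (hM t (Set.right_mem_Icc.2 ht.1)).trans_lt ENNReal.coe_lt_top
  have hNc : ContinuousOn (fun t => nem g (u t)) (timeInterval T) := by
    apply continuousOn_timeInterval
    intro t' ht'
    obtain ⟨M, hM⟩ := h.bounded t' ht'
    exact continuousOn_nem_of_bdd hn (h.continuousOn_u.mono (Icc_subset_timeInterval ht')) hM
  have hcos := isBddFamily_pc hsym
  have hsin := isBddFamily_sin hsym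
  have hint : ∀ {m : ℝ → ℝ → ℝ}, IsBddFamily m → ∀ t ∈ timeInterval T,
      IntervalIntegrable (fun τ => mulOp (m τ) (zsrc b g u τ)) volume 0 t := by
    intro m hm t ht
    obtain ⟨M, hM⟩ := hbdd t ht
    exact intervalIntegrable_mulOp_zsrc hsym hm ht.1 (hNc.mono (Icc_subset_timeInterval ht)) hM
  have hprim : ∀ {m : ℝ → ℝ → ℝ}, IsBddFamily m → ContinuousOn
      (fun t => ∫ τ in (0 : ℝ)..t, mulOp (m τ) (zsrc b g u τ)) (timeInterval T) := by
    intro m hm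
    apply continuousOn_timeInterval
    intro t' ht'
    have h2 := intervalIntegral.continuousOn_primitive_interval' (hint hm t' ht') Set.left_mem_uIcc
    rwa [Set.uIcc_of_le ht'.1] at h2
  have hcutrb := hsym.hasOrder_rb.isBdd_cut_mul
  have hcutZ : ∀ n, ∀ t ∈ timeInterval T,
      mulOp (fun ξ => cut n ξ * rb b ξ) (ft (nem g (u t))) = mulOp (cut n) (zsrc b g u t) :=
    fun n t ht => (mulOp_zsrc_eq hsym (isBdd_cut n) (hcutrb n) (fun ξ => rfl) (hfin t ht)).symm
  -- at bounded frequencies the integrals of the source are differentiable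
  have hderiv : ∀ {m : ℝ → ℝ → ℝ}, IsBddFamily m → ∀ (X : L2C) n, ∀ t ∈ timeInterval T,
      HasDerivWithinAt (fun t => mulOp (cut n)
        (X + ∫ τ in (0 : ℝ)..t, mulOp (m τ) (zsrc b g u τ)))
        (mulOp (m t) (mulOp (cut n) (zsrc b g u t))) (timeInterval T) t := by
    intro m hm X n t ht
    have hswap : ∀ t ∈ timeInterval T, mulOp (m t) (mulOp (cut n) (zsrc b g u t)) =
        mulOp (cut n) (mulOp (m t) (zsrc b g u t)) := fun t ht =>
      mulOp_comm (hm.isBdd t) (isBdd_cut n) _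
    refine hasDerivWithinAt_timeInterval
      (f := fun t => mulOp (m t) (mulOp (cut n) (zsrc b g u t))) ?_ (fun t ht => ?_) ht
    · refine hm.continuousOn (ContinuousOn.congr ?_ fun t ht => (hcutZ n t ht).symm)
      exact (mulOp _).continuous.comp_continuousOn (continuous_ft.comp_continuousOn hNc)
    · simp only [map_add, intervalIntegral.integral_same, add_zero]
      rw [← ContinuousLinearMap.intervalIntegral_comp_comm _ (hint hm t ht)]
      congr 1
      refine intervalIntegral.integral_congr fun τ hτ => ?_
      rw [Set.uIcc_of_le ht.1] at hτ
      exact (hswap τ (Icc_subset_timeInterval ht hτ)).symm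
  -- variation of constants, in the coordinates that rotate with the linear flow
  set A : ℝ → L2C := fun t => Y₀ +
    ∫ τ in (0 : ℝ)..t, mulOp (fun ξ => Real.sin (τ * om l ξ)) (zsrc b g u τ) with hA
  set E : ℝ → L2C := fun t => D₀ +
    ∫ τ in (0 : ℝ)..t, mulOp (fun ξ => -1 * pc l τ ξ) (zsrc b g u τ) with hE
  have hncos : IsBddFamily fun t ξ => -1 * pc l t ξ := hcos.const_mul (isBdd_const (-1))
  have hAc : ContinuousOn A (timeInterval T) := continuousOn_const.add (hprim hsin)
  have hEc : ContinuousOn E (timeInterval T) := continuousOn_const.add (hprim hncos)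
  set Y : ℝ → L2C := fun t =>
    mulOp (pc l t) (A t) + mulOp (fun ξ => Real.sin (t * om l ξ)) (E t) with hY
  set D : ℝ → L2C := fun t =>
    mulOp (pc l t) (E t) - mulOp (fun ξ => Real.sin (t * om l ξ)) (A t) with hD
  have hYc : ContinuousOn Y (timeInterval T) := (hcos.continuousOn hAc).add (hsin.continuousOn hEc)
  have hDc : ContinuousOn D (timeInterval T) := (hcos.continuousOn hEc).sub (hsin.continuousOn hAc)
  have hpc0 : pc l 0 = fun _ => 1 := by ext ξ; simp [pc]
  have hsin0 : mulOp (fun ξ => Real.sin (0 * om l ξ)) = 0 := by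
    have : (fun ξ => Real.sin (0 * om l ξ)) = fun _ => 0 * 1 := by ext ξ; simp
    rw [this, mulOp_const_mul (isBdd_const 1), zero_smul]
  have hY0 : Y 0 = Y₀ := by
    simp only [hY, hpc0, mulOp_one, hsin0, hA, intervalIntegral.integral_same, add_zero, zero_apply]
  have hD0 : D 0 = D₀ := by
    simp only [hD, hpc0, mulOp_one, hsin0, hE, intervalIntegral.integral_same, add_zero, zero_apply,
      sub_zero]
  have hcom := hsym.hasOrder_om.isBdd_cut_mul
  have hb1 := fun n t => (isBdd_cut n).mul (hcos.isBdd t)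
  have hb2 := fun n t => (isBdd_cut n).mul (hsin.isBdd t)
  have hb3 : ∀ n t, IsBdd fun ξ => cut n ξ * -(om l ξ * Real.sin (t * om l ξ)) := by
    intro n t
    have := ((hcom n).mul (hsin.isBdd t)).neg
    convert this using 2
    ring
  have hb4 : ∀ n t, IsBdd fun ξ => cut n ξ * (om l ξ * pc l t ξ) := by
    intro n t
    have := (hcom n).mul (hcos.isBdd t)
    convert this using 2
    ring
  have hdY : ∀ n, ∀ t ∈ timeInterval T, HasDerivWithinAt (fun t => mulOp (cut n) (Y t))
      (mulOp (fun ξ => cut n ξ * om l ξ) (D t)) (timeInterval T) t := by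
    intro n t ht
    have h1 := (hasDerivAt_cut_cos hsym n t).hasDerivWithinAt.clm_apply (hderiv hsin Y₀ n t ht)
    have h2 := (hasDerivAt_cut_sin hsym n t).hasDerivWithinAt.clm_apply (hderiv hncos D₀ n t ht)
    refine ((h1.add h2).congr_of_mem (fun τ _ => ?_) ht).congr_deriv ?_
    · change mulOp (cut n) (mulOp (pc l τ) (A τ) + mulOp _ (E τ)) =
        mulOp (fun ξ => cut n ξ * pc l τ ξ) (mulOp (cut n) (A τ)) +
        mulOp (fun ξ => cut n ξ * Real.sin (τ * om l ξ)) (mulOp (cut n) (E τ))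
      rw [map_add]
      congr 1
      · refine mulOp_mulOp_congr (isBdd_cut n) (hcos.isBdd τ) (hb1 n τ) (isBdd_cut n)
          (fun ξ => ?_) _
        linear_combination -(pc l τ ξ) * cut_mul_self n ξ
      · refine mulOp_mulOp_congr (isBdd_cut n) (hsin.isBdd τ) (hb2 n τ) (isBdd_cut n)
          (fun ξ => ?_) _
        linear_combination -(Real.sin (τ * om l ξ)) * cut_mul_self n ξ
    · change mulOp _ (mulOp (cut n) (A t)) + mulOp _ (mulOp _ (mulOp (cut n) (zsrc b g u t))) +
        (mulOp _ (mulOp (cut n) (E t)) + mulOp _ (mulOp _ (mulOp (cut n) (zsrc b g u t)))) =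
        mulOp _ (mulOp (pc l t) (E t) - mulOp _ (A t))
      rw [map_sub]
      have e1 : mulOp (fun ξ => cut n ξ * pc l t ξ) (mulOp (fun ξ => Real.sin (t * om l ξ))
          (mulOp (cut n) (zsrc b g u t))) = -mulOp (fun ξ => cut n ξ * Real.sin (t * om l ξ))
          (mulOp (fun ξ => -1 * pc l t ξ) (mulOp (cut n) (zsrc b g u t))) := by
        rw [← neg_apply, ← mulOp_neg (hb2 n t)]
        refine mulOp_mulOp_congr (hb1 n t) (hsin.isBdd t) (hb2 n t).neg (hncos.isBdd t)
          (fun ξ => ?_) _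
        ring
      have e2 : mulOp (fun ξ => cut n ξ * -(om l ξ * Real.sin (t * om l ξ)))
          (mulOp (cut n) (A t)) = -mulOp (fun ξ => cut n ξ * om l ξ)
            (mulOp (fun ξ => Real.sin (t * om l ξ)) (A t)) := by
        rw [← neg_apply, ← mulOp_neg (hcom n)]
        refine mulOp_mulOp_congr (hb3 n t) (isBdd_cut n) (hcom n).neg (hsin.isBdd t)
          (fun ξ => ?_) _
        linear_combination -(om l ξ * Real.sin (t * om l ξ)) * cut_mul_self n ξ
      have e3 : mulOp (fun ξ => cut n ξ * (om l ξ * pc l t ξ))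
          (mulOp (cut n) (E t)) = mulOp (fun ξ => cut n ξ * om l ξ) (mulOp (pc l t) (E t)) := by
        refine mulOp_mulOp_congr (hb4 n t) (isBdd_cut n) (hcom n) (hcos.isBdd t)
          (fun ξ => ?_) _
        linear_combination (om l ξ * pc l t ξ) * cut_mul_self n ξ
      rw [e1, e2, e3]
      abel
  have hdD : ∀ n, ∀ t ∈ timeInterval T, HasDerivWithinAt (fun t => mulOp (cut n) (D t))
      (-(mulOp (fun ξ => cut n ξ * om l ξ) (Y t) + mulOp (cut n) (zsrc b g u t)))
      (timeInterval T) t := by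
    intro n t ht
    have h1 := (hasDerivAt_cut_cos hsym n t).hasDerivWithinAt.clm_apply (hderiv hncos D₀ n t ht)
    have h2 := (hasDerivAt_cut_sin hsym n t).hasDerivWithinAt.clm_apply (hderiv hsin Y₀ n t ht)
    refine ((h1.sub h2).congr_of_mem (fun τ _ => ?_) ht).congr_deriv ?_
    · change mulOp (cut n) (mulOp (pc l τ) (E τ) - mulOp _ (A τ)) =
        mulOp (fun ξ => cut n ξ * pc l τ ξ) (mulOp (cut n) (E τ)) -
        mulOp (fun ξ => cut n ξ * Real.sin (τ * om l ξ)) (mulOp (cut n) (A τ))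
      rw [map_sub]
      congr 1
      · refine mulOp_mulOp_congr (isBdd_cut n) (hcos.isBdd τ) (hb1 n τ) (isBdd_cut n)
          (fun ξ => ?_) _
        linear_combination -(pc l τ ξ) * cut_mul_self n ξ
      · refine mulOp_mulOp_congr (isBdd_cut n) (hsin.isBdd τ) (hb2 n τ) (isBdd_cut n)
          (fun ξ => ?_) _
        linear_combination -(Real.sin (τ * om l ξ)) * cut_mul_self n ξ
    · change mulOp _ (mulOp (cut n) (E t)) + mulOp _ (mulOp _ (mulOp (cut n) (zsrc b g u t))) -
        (mulOp _ (mulOp (cut n) (A t)) + mulOp _ (mulOp _ (mulOp (cut n) (zsrc b g u t)))) =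
        -(mulOp _ (mulOp (pc l t) (A t) + mulOp _ (E t)) + _)
      rw [map_add (mulOp fun ξ => cut n ξ * om l ξ)]
      have e1 : mulOp (fun ξ => cut n ξ * Real.sin (t * om l ξ))
          (mulOp (fun ξ => Real.sin (t * om l ξ)) (mulOp (cut n) (zsrc b g u t))) -
          mulOp (fun ξ => cut n ξ * pc l t ξ) (mulOp (fun ξ => -1 * pc l t ξ)
          (mulOp (cut n) (zsrc b g u t))) = mulOp (cut n) (zsrc b g u t) := by
        rw [mulOp_mulOp (hb2 n t) (hsin.isBdd t), mulOp_mulOp (hb1 n t) (hncos.isBdd t),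
          ← sub_apply, ← mulOp_sub ((hb2 n t).mul (hsin.isBdd t)) ((hb1 n t).mul (hncos.isBdd t))]
        refine mulOp_mulOp_eq (((hb2 n t).mul (hsin.isBdd t)).sub
          ((hb1 n t).mul (hncos.isBdd t))) (isBdd_cut n) (fun ξ => ?_) _
        unfold pc
        linear_combination (cut n ξ * cut n ξ) * Real.sin_sq_add_cos_sq (t * om l ξ) +
          cut_mul_self n ξ
      have e2 : mulOp (fun ξ => cut n ξ * -(om l ξ * Real.sin (t * om l ξ)))
          (mulOp (cut n) (E t)) = -mulOp (fun ξ => cut n ξ * om l ξ)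
            (mulOp (fun ξ => Real.sin (t * om l ξ)) (E t)) := by
        rw [← neg_apply, ← mulOp_neg (hcom n)]
        refine mulOp_mulOp_congr (hb3 n t) (isBdd_cut n) (hcom n).neg (hsin.isBdd t)
          (fun ξ => ?_) _
        linear_combination -(om l ξ * Real.sin (t * om l ξ)) * cut_mul_self n ξ
      have e3 : mulOp (fun ξ => cut n ξ * (om l ξ * pc l t ξ))
          (mulOp (cut n) (A t)) = mulOp (fun ξ => cut n ξ * om l ξ) (mulOp (pc l t) (A t)) := by
        refine mulOp_mulOp_congr (hb4 n t) (isBdd_cut n) (hcom n) (hcos.isBdd t)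
          (fun ξ => ?_) _
        linear_combination (om l ξ * pc l t ξ) * cut_mul_self n ξ
      rw [sub_eq_iff_eq_add] at e1
      rw [e1, e2, e3]
      abel
  have hdP : ∀ t ∈ timeInterval T, HasDerivWithinAt (fun t => P₀ + ∫ τ in (0 : ℝ)..t, D τ) (D t)
      (timeInterval T) t := fun t ht =>
    hasDerivWithinAt_timeInterval hDc (fun t _ => by simp) ht
  refine ⟨fun t => P₀ + ∫ τ in (0 : ℝ)..t, D τ, Y, D, ⟨h.continuousOn_u, h.bounded, hYc, hDc,
    fun t' ht' => ?_, hcutZ, fun t ht => ?_, fun n t ht => ?_, hdP, hdY, hdD⟩, by simp, hY0, hD0⟩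
  · obtain ⟨M, hM⟩ := hbdd t' ht'
    exact ⟨√M, fun t ht => norm_zsrc_le hsym (hM t ht)⟩
  · have hth := hsym.isBdd_th
    rw [h.duhamel hsym hn hY₀ hD₀ ht]
    have hks : ∀ τ ∈ timeInterval T, mulOp (fun ξ => th l b ξ * Real.sin ((τ - t) * om l ξ))
        (zsrc b g u τ) = mulOp (ks l b (τ - t)) (ft (nem g (u τ))) := fun τ hτ =>
      mulOp_zsrc_eq hsym (hth.mul (hsin.isBdd _)) ((isBddFamily_ks hsym).isBdd _)
        (fun ξ => by rw [ks, ← hsym.rb_mul_th]; ring) (hfin τ hτ)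
    have hI : ∫ τ in (0 : ℝ)..t, mulOp (ks l b (τ - t)) (ft (nem g (u τ))) =
        mulOp (th l b) (mulOp (pc l t)
          (∫ τ in (0 : ℝ)..t, mulOp (fun ξ => Real.sin (τ * om l ξ)) (zsrc b g u τ))) +
        mulOp (th l b) (mulOp (fun ξ => Real.sin (t * om l ξ))
          (∫ τ in (0 : ℝ)..t, mulOp (fun ξ => -1 * pc l τ ξ) (zsrc b g u τ))) := by
      rw [mulOp_mulOp hth (hcos.isBdd t), mulOp_mulOp hth (hsin.isBdd t),
        ← ContinuousLinearMap.intervalIntegral_comp_comm _ (hint hsin t ht),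
        ← ContinuousLinearMap.intervalIntegral_comp_comm _ (hint hncos t ht),
        ← intervalIntegral.integral_add]
      · refine intervalIntegral.integral_congr fun τ hτ => ?_
        rw [Set.uIcc_of_le ht.1] at hτ
        change _ = mulOp _ (mulOp _ _) + mulOp _ (mulOp _ _)
        have hq1 := hth.mul (hcos.isBdd t)
        have hq2 := hth.mul (hsin.isBdd t)
        rw [mulOp_mulOp hq1 (hsin.isBdd τ), mulOp_mulOp hq2 (hncos.isBdd τ), ← add_apply,
          ← mulOp_add (hq1.mul (hsin.isBdd τ)) (hq2.mul (hncos.isBdd τ)),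
          ← hks τ (Icc_subset_timeInterval ht hτ)]
        congr 2
        ext ξ
        rw [sub_mul, Real.sin_sub]
        unfold pc
        ring
      · exact ⟨(mulOp _).integrable_comp (hint hsin t ht).1,
          (mulOp _).integrable_comp (hint hsin t ht).2⟩
      · exact ⟨(mulOp _).integrable_comp (hint hncos t ht).1,
          (mulOp _).integrable_comp (hint hncos t ht).2⟩
    rw [hI]
    simp only [hY, hA, hE, map_add]
    abel
  · have h1 := eq_of_hasDerivWithinAt_zero (T := T) (f := fun t => mulOp (cut n) (Y t) -
      mulOp (fun ξ => cut n ξ * om l ξ) (P₀ + ∫ τ in (0 : ℝ)..t, D τ)) (fun t ht => ?_) ht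
    · simp only [hY0, intervalIntegral.integral_same, add_zero, hP₀ n, sub_self] at h1
      exact sub_eq_zero.1 h1
    · have h2 := (mulOp (fun ξ => cut n ξ * om l ξ)).hasFDerivAt.comp_hasDerivWithinAt t (hdP t ht)
      exact ((hdY n t ht).sub h2).congr_deriv (sub_self _)

end

/-! ### Conservation of energy -/

theorem inner_mulOp_left {m : ℝ → ℝ} (hm : IsBdd m) (F G : L2C) :
    inner ℝ (mulOp m F) G = inner ℝ F (mulOp m G) := by
  rw [MeasureTheory.L2.inner_def, MeasureTheory.L2.inner_def]
  refine integral_congr_ae ?_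
  filter_upwards [mulOp_ae hm F, mulOp_ae hm G] with ξ h1 h2
  rw [h1, h2, Complex.inner, Complex.inner]
  simp
  ring

/-- Parseval's formula for real functions. -/
theorem inner_ft (u w : L2) : inner ℝ (ft u) (ft w) = inner ℝ u w :=
  LinearIsometry.inner_map_map (⟨ftL.toLinearMap, norm_ft⟩ : L2 →ₗᵢ[ℝ] L2C) u w

theorem inner_mulOp_cut_self (n : ℕ) (F G : L2C) :
    inner ℝ (mulOp (cut n) F) (mulOp (cut n) G) = inner ℝ (mulOp (cut n) F) G := by
  rw [← inner_mulOp_left (isBdd_cut n), mulOp_mulOp_eq (isBdd_cut n) (isBdd_cut n) (cut_mul_self n)]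

theorem tendsto_inner_cut (F G : L2C) :
    Tendsto (fun n => inner ℝ (mulOp (cut n) F) G) atTop (𝓝 (inner ℝ F G)) :=
  (tendsto_mulOp_cut F).inner tendsto_const_nhds

theorem norm_mulOp_cut_le (n : ℕ) (F : L2C) : ‖mulOp (cut n) F‖ ≤ ‖F‖ :=
  (norm_mulOp_apply_le (measurable_cut n) (abs_cut_le n) F).trans (one_mul _).le

theorem abs_inner_cut_le (n : ℕ) (F G : L2C) : |inner ℝ (mulOp (cut n) F) G| ≤ ‖F‖ * ‖G‖ :=
  (abs_real_inner_le_norm _ _).trans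
    (mul_le_mul_of_nonneg_right (norm_mulOp_cut_le n F) (norm_nonneg _))

/-- The fundamental theorem of calculus for a limit of differentiable functions whose derivatives
converge boundedly. -/
theorem integral_eq_sub_of_tendsto {T : EReal} {x f : ℝ → ℝ} {xs fs : ℕ → ℝ → ℝ} {t C : ℝ}
    (ht : t ∈ timeInterval T)
    (hd : ∀ n, ∀ τ ∈ timeInterval T, HasDerivWithinAt (xs n) (fs n τ) (timeInterval T) τ)
    (hc : ∀ n, ContinuousOn (fs n) (timeInterval T))
    (hx : ∀ τ ∈ timeInterval T, Tendsto (fun n => xs n τ) atTop (𝓝 (x τ)))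
    (hf : ∀ τ ∈ timeInterval T, Tendsto (fun n => fs n τ) atTop (𝓝 (f τ)))
    (hC : ∀ n, ∀ τ ∈ Set.Icc 0 t, |fs n τ| ≤ C) :
    IntervalIntegrable f volume 0 t ∧ ∫ τ in (0 : ℝ)..t, f τ = x t - x 0 := by
  have hsub := Icc_subset_timeInterval ht
  have hoc : ∀ τ, τ ∈ Set.uIoc 0 t → τ ∈ Set.Icc 0 t := fun τ hτ => by
    rw [Set.uIoc_of_le ht.1] at hτ
    exact Set.Ioc_subset_Icc_self hτ
  have hint : ∀ n, IntervalIntegrable (fs n) volume 0 t := fun n =>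
    ((hc n).mono (by rw [Set.uIcc_of_le ht.1]; exact hsub)).intervalIntegrable
  have hmeas : ∀ n, AEStronglyMeasurable (fs n) (volume.restrict (Set.uIoc 0 t)) := fun n => by
    rw [Set.uIoc_of_le ht.1]
    exact (hint n).1.aestronglyMeasurable
  have hlim : ∀ᵐ τ ∂(volume.restrict (Set.uIoc 0 t)), Tendsto (fun n => fs n τ) atTop (𝓝 (f τ)) := by
    refine (ae_restrict_iff' measurableSet_uIoc).2 (Eventually.of_forall fun τ hτ => ?_)
    exact hf τ (hsub (hoc τ hτ))
  have h1 := intervalIntegral.tendsto_integral_filter_of_dominated_convergence (a := 0) (b := t)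
    (μ := volume) (l := atTop) (F := fs) (f := f) (fun _ => C) (Eventually.of_forall hmeas)
    (Eventually.of_forall fun n => Eventually.of_forall fun τ hτ => hC n τ (hoc τ hτ))
    intervalIntegrable_const
    (Eventually.of_forall fun τ hτ => hf τ (hsub (hoc τ hτ)))
  have h2 : ∀ n, ∫ τ in (0 : ℝ)..t, fs n τ = xs n t - xs n 0 := by
    intro n
    refine intervalIntegral.integral_eq_sub_of_hasDerivAt_of_le ht.1
      (fun τ hτ => ((hd n τ (hsub hτ)).mono hsub).continuousWithinAt) (fun τ hτ => ?_) (hint n)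
    exact ((hd n τ (hsub (Set.Ioo_subset_Icc_self hτ))).mono hsub).hasDerivAt
      (Icc_mem_nhds hτ.1 hτ.2)
  simp only [h2] at h1
  refine ⟨?_, tendsto_nhds_unique h1 ((hx t ht).sub (hx 0 (hsub (Set.left_mem_Icc.2 ht.1))))⟩
  have h3 := aestronglyMeasurable_of_tendsto_ae atTop hmeas hlim
  rw [Set.uIoc_of_le ht.1] at h3
  exact intervalIntegrable_of_bound ht.1 h3 fun τ hτ =>
    le_of_tendsto (hf τ (hsub (Set.Ioo_subset_Icc_self hτ))).abs
      (Eventually.of_forall fun n => hC n τ (Set.Ioo_subset_Icc_self hτ))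

/-! ### The potential energy -/

theorem abs_primitive_sub_le {g : ℝ → ℝ} (hg : Continuous g) {R K : ℝ}
    (hK : ∀ x y, |x| ≤ R → |y| ≤ R → |g x - g y| ≤ K * |x - y|) (hK0 : 0 ≤ K) {p q : ℝ} (hp : |p| ≤ R)
    (hq : |q| ≤ R) : |primitive g q - primitive g p - g p * (q - p)| ≤ K * (q - p) ^ 2 := by
  have h1 : primitive g q - primitive g p - g p * (q - p) = ∫ y in p..q, (g y - g p) := by
    rw [intervalIntegral.integral_sub (hg.intervalIntegrable _ _) intervalIntegrable_const,
      intervalIntegral.integral_const, smul_eq_mul, primitive, primitive,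
      intervalIntegral.integral_interval_sub_left (hg.intervalIntegrable _ _)
      (hg.intervalIntegrable _ _)]
    ring
  have h2 := intervalIntegral.norm_integral_le_of_norm_le_const (a := p) (b := q)
    (f := fun y => g y - g p) (C := K * |q - p|) fun y hy => by
      have hy' := Set.uIoc_subset_uIcc hy
      have h3 : |y| ≤ R := by
        rw [abs_le] at hp hq ⊢
        rcases Set.mem_uIcc.1 hy' with h | h <;> constructor <;> linarith [h.1, h.2]
      exact (hK y p h3 hp).trans
        (mul_le_mul_of_nonneg_left (Set.abs_sub_left_of_mem_uIcc hy') hK0)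
  rw [h1]
  refine h2.trans (le_of_eq ?_)
  rw [mul_assoc, ← sq, sq_abs]

theorem integrable_primitive {g : ℝ → ℝ} (hg : Continuous g) (g0 : g 0 = 0) {R K : ℝ} (hR : 0 ≤ R)
    (hK : ∀ x y, |x| ≤ R → |y| ≤ R → |g x - g y| ≤ K * |x - y|) (hK0 : 0 ≤ K) {u : L2}
    (hu : ∀ᵐ x ∂(volume : Measure ℝ), |u x| ≤ R) :
    Integrable (fun x => primitive g (u x)) volume := by
  have hG : Continuous (primitive g) :=
    intervalIntegral.continuous_primitive (fun a b => hg.intervalIntegrable a b) 0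
  have h2 : Integrable (fun x => K * (u x) ^ 2) volume := ((Lp.memLp u).integrable_sq).const_mul K
  refine h2.mono' (hG.comp_aestronglyMeasurable (Lp.aestronglyMeasurable u)) ?_
  filter_upwards [hu] with x hx
  have := abs_primitive_sub_le hg hK hK0 (p := 0) (q := u x) (by simpa using hR) hx
  simpa [primitive, g0] using this

/-- The potential energy is differentiable, with derivative `g`. -/
theorem abs_integral_primitive_sub_le {g : ℝ → ℝ} (hg : Continuous g) (g0 : g 0 = 0) {R K : ℝ}
    (hR : 0 ≤ R) (hK : ∀ x y, |x| ≤ R → |y| ≤ R → |g x - g y| ≤ K * |x - y|) (hK0 : 0 ≤ K) {u w : L2}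
    (hu : ∀ᵐ x ∂(volume : Measure ℝ), |u x| ≤ R) (hw : ∀ᵐ x ∂(volume : Measure ℝ), |w x| ≤ R) :
    |(∫ x, primitive g (w x)) - (∫ x, primitive g (u x)) - inner ℝ (nem g u) (w - u)| ≤
      K * ‖w - u‖ ^ 2 := by
  have hi1 := integrable_primitive hg g0 hR hK hK0 hu
  have hi2 := integrable_primitive hg g0 hR hK hK0 hw
  have hi3 : Integrable (fun x => inner ℝ (nem g u x) ((w - u : L2) x)) volume :=
    MeasureTheory.L2.integrable_inner _ _
  have hi4 : Integrable (fun x => K * ((w - u : L2) x) ^ 2) volume :=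
    ((Lp.memLp (w - u)).integrable_sq).const_mul K
  rw [MeasureTheory.L2.inner_def, ← integral_sub hi2 hi1,
    ← integral_sub (f := fun x => primitive g (w x) - primitive g (u x)) (hi2.sub hi1) hi3]
  have h5 : K * ‖w - u‖ ^ 2 = ∫ x, K * ((w - u : L2) x) ^ 2 := by
    rw [integral_const_mul, ← real_inner_self_eq_norm_sq, MeasureTheory.L2.inner_def]
    congr 1
    refine integral_congr_ae (Eventually.of_forall fun x => ?_)
    simp [sq]
  rw [h5, ← Real.norm_eq_abs]
  refine norm_integral_le_of_norm_le hi4 ?_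
  filter_upwards [hu, hw, nem_ae hg g0 hK hu, Lp.coeFn_sub w u] with x h1 h2 h3 h4
  rw [h3, h4]
  have := abs_primitive_sub_le hg hK hK0 h1 h2
  simpa [mul_comm] using this

section

variable {l b g : ℝ → ℝ} {ρ r s : ℝ} {T : EReal} {u : ℝ → L2} {P Y D Z : ℝ → L2C}

namespace IsEnergyCurve

theorem continuousOn_N (h : IsEnergyCurve l b g s T u P Y D Z) (hn : IsNonlinearity g s) :
    ContinuousOn (fun t => ft (nem g (u t))) (timeInterval T) := by
  apply continuousOn_timeInterval
  intro t' ht'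
  obtain ⟨M, hM⟩ := h.bounded t' ht'
  exact continuous_ft.comp_continuousOn
    (continuousOn_nem_of_bdd hn (h.continuousOn_u.mono (Icc_subset_timeInterval ht')) hM)

theorem continuousOn_cut_Z (h : IsEnergyCurve l b g s T u P Y D Z) (hn : IsNonlinearity g s)
    (n : ℕ) : ContinuousOn (fun t => mulOp (cut n) (Z t)) (timeInterval T) :=
  ((mulOp fun ξ => cut n ξ * rb b ξ).continuous.comp_continuousOn (h.continuousOn_N hn)).congr
    fun t ht => (h.cut_Z n t ht).symm

theorem exists_bound {I : Set ℝ} (hI : IsCompact I) {F : ℝ → L2C} (hF : ContinuousOn F I) :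
    ∃ C, 0 ≤ C ∧ ∀ t ∈ I, ‖F t‖ ≤ C := by
  obtain ⟨C, hC⟩ := hI.exists_bound_of_continuousOn hF
  exact ⟨max C 0, le_max_right _ _, fun t ht => (hC t ht).trans (le_max_left _ _)⟩

theorem cut_ft (h : IsEnergyCurve l b g s T u P Y D Z) (hsym : IsSymbolPair l b ρ r) (n : ℕ) {t : ℝ}
    (ht : t ∈ timeInterval T) :
    mulOp (cut n) (ft (u t)) = mulOp (fun ξ => cut n ξ * rb b ξ) (P t) := by
  rw [h.ft_eq t ht, mulOp_comm (isBdd_cut n) hsym.isBdd_th, h.cut_Y n t ht]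
  refine mulOp_mulOp_eq hsym.isBdd_th (hsym.hasOrder_om.isBdd_cut_mul n) (fun ξ => ?_) _
  rw [← hsym.om_mul_th]
  ring

/-- The kinetic energy and the energy of the linear terms change at the rate `-2 ⟨Z, D⟩`. -/
theorem integral_inner_Z (h : IsEnergyCurve l b g s T u P Y D Z) (hsym : IsSymbolPair l b ρ r)
    (hn : IsNonlinearity g s) {t : ℝ} (ht : t ∈ timeInterval T) :
    IntervalIntegrable (fun τ => -2 * inner ℝ (D τ) (Z τ)) volume 0 t ∧
      ∫ τ in (0 : ℝ)..t, -2 * inner ℝ (D τ) (Z τ) =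
        (‖Y t‖ ^ 2 + ‖D t‖ ^ 2) - (‖Y 0‖ ^ 2 + ‖D 0‖ ^ 2) := by
  have hsub := Icc_subset_timeInterval ht
  obtain ⟨C₁, hC₁, hD⟩ := exists_bound isCompact_Icc (h.continuousOn_D.mono hsub)
  obtain ⟨C₂, hZ⟩ := h.bounded_Z t ht
  refine integral_eq_sub_of_tendsto (x := fun t => ‖Y t‖ ^ 2 + ‖D t‖ ^ 2) ht
    (xs := fun n t => ‖mulOp (cut n) (Y t)‖ ^ 2 + ‖mulOp (cut n) (D t)‖ ^ 2)
    (fs := fun n t => -2 * inner ℝ (mulOp (cut n) (D t)) (Z t)) (C := 2 * (C₁ * C₂))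
    (fun n τ hτ => ?_) (fun n => ?_) (fun τ hτ => ?_) (fun τ hτ => ?_) (fun n τ hτ => ?_)
  · refine ((h.deriv_Y n τ hτ).norm_sq.add (h.deriv_D n τ hτ).norm_sq).congr_deriv ?_
    have hb := hsym.hasOrder_om.isBdd_cut_mul n
    have e1 : inner ℝ (mulOp (cut n) (Y τ)) (mulOp (fun ξ => cut n ξ * om l ξ) (D τ)) =
        inner ℝ (mulOp (cut n) (D τ)) (mulOp (fun ξ => cut n ξ * om l ξ) (Y τ)) := by
      rw [real_inner_comm, inner_mulOp_left hb, inner_mulOp_left (isBdd_cut n), mulOp_comm hb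
        (isBdd_cut n)]
    rw [inner_neg_right, inner_add_right, e1, inner_mulOp_cut_self]
    ring
  · have h1 : ContinuousOn (fun t => inner ℝ (D t) (mulOp (cut n) (Z t))) (timeInterval T) :=
      h.continuousOn_D.inner (𝕜 := ℝ) (h.continuousOn_cut_Z hn n)
    simp only [inner_mulOp_left (isBdd_cut n)]
    exact continuousOn_const.mul h1
  · exact (((tendsto_mulOp_cut _).norm).pow 2).add (((tendsto_mulOp_cut _).norm).pow 2)
  · exact (tendsto_inner_cut _ _).const_mul _
  · rw [abs_mul, abs_neg, abs_two]
    refine mul_le_mul_of_nonneg_left ((abs_inner_cut_le _ _ _).trans ?_) two_pos.le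
    exact mul_le_mul (hD τ hτ) (hZ τ hτ) (norm_nonneg _) hC₁

/-- The virial identity. -/
theorem integral_virial (h : IsEnergyCurve l b g s T u P Y D Z) (hsym : IsSymbolPair l b ρ r)
    (hn : IsNonlinearity g s) {t : ℝ} (ht : t ∈ timeInterval T) :
    ∫ τ in (0 : ℝ)..t, (‖D τ‖ ^ 2 - ‖Y τ‖ ^ 2 - inner ℝ (ft (u τ)) (ft (nem g (u τ)))) =
      inner ℝ (P t) (D t) - inner ℝ (P 0) (D 0) := by
  have hsub := Icc_subset_timeInterval ht
  obtain ⟨C₁, hC₁, hD⟩ := exists_bound isCompact_Icc (h.continuousOn_D.mono hsub)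
  obtain ⟨C₂, hC₂, hY⟩ := exists_bound isCompact_Icc (h.continuousOn_Y.mono hsub)
  obtain ⟨C₃, hC₃, hu⟩ := exists_bound isCompact_Icc
    ((continuous_ft.comp_continuousOn h.continuousOn_u).mono hsub)
  obtain ⟨C₄, hC₄, hN⟩ := exists_bound isCompact_Icc ((h.continuousOn_N hn).mono hsub)
  have hcut := fun (n : ℕ) {F : ℝ → L2C} (hF : ContinuousOn F (timeInterval T)) =>
    (mulOp (cut n)).continuous.comp_continuousOn hF
  refine (integral_eq_sub_of_tendsto (x := fun t => inner ℝ (P t) (D t)) ht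
    (xs := fun n t => inner ℝ (P t) (mulOp (cut n) (D t)))
    (fs := fun n t => inner ℝ (mulOp (cut n) (D t)) (D t) - inner ℝ (mulOp (cut n) (Y t)) (Y t) -
      inner ℝ (mulOp (cut n) (ft (u t))) (ft (nem g (u t)))) (C := C₁ * C₁ + C₂ * C₂ + C₃ * C₄)
    (fun n τ hτ => ?_) (fun n => ?_) (fun τ hτ => ?_) (fun τ hτ => ?_) (fun n τ hτ => ?_)).2
  · refine ((h.deriv_P τ hτ).inner ℝ (h.deriv_D n τ hτ)).congr_deriv ?_
    rw [← h.cut_Z n τ hτ, inner_neg_right, inner_add_right,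
      ← inner_mulOp_left (hsym.hasOrder_om.isBdd_cut_mul n), ← h.cut_Y n τ hτ,
      ← inner_mulOp_left (hsym.hasOrder_rb.isBdd_cut_mul n), ← h.cut_ft hsym n hτ,
      ← inner_mulOp_left (isBdd_cut n) (D τ)]
    ring
  · exact (((hcut n h.continuousOn_D).inner (𝕜 := ℝ) h.continuousOn_D).sub
      ((hcut n h.continuousOn_Y).inner (𝕜 := ℝ) h.continuousOn_Y)).sub
      ((hcut n (continuous_ft.comp_continuousOn h.continuousOn_u)).inner (𝕜 := ℝ)
        (h.continuousOn_N hn))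
  · exact tendsto_const_nhds.inner (tendsto_mulOp_cut _)
  · simp only [← real_inner_self_eq_norm_sq]
    exact ((tendsto_inner_cut _ _).sub (tendsto_inner_cut _ _)).sub (tendsto_inner_cut _ _)
  · refine (abs_sub _ _).trans (add_le_add ((abs_sub _ _).trans (add_le_add ?_ ?_)) ?_)
    · exact (abs_inner_cut_le _ _ _).trans (mul_le_mul (hD τ hτ) (hD τ hτ) (norm_nonneg _) hC₁)
    · exact (abs_inner_cut_le _ _ _).trans (mul_le_mul (hY τ hτ) (hY τ hτ) (norm_nonneg _) hC₂)
    · exact (abs_inner_cut_le _ _ _).trans (mul_le_mul (hu τ hτ) (hN τ hτ) (norm_nonneg _) hC₃)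

theorem inner_nem_sub (h : IsEnergyCurve l b g s T u P Y D Z) (hsym : IsSymbolPair l b ρ r) {t τ : ℝ}
    (ht : t ∈ timeInterval T) (hτ : τ ∈ timeInterval T) :
    inner ℝ (nem g (u t)) (u τ - u t) = inner ℝ (Z t) (P τ - P t) := by
  rw [← inner_ft, ft_sub]
  refine tendsto_nhds_unique (tendsto_inner_cut _ _) ?_
  refine (tendsto_inner_cut (Z t) (P τ - P t)).congr fun n => ?_
  rw [← h.cut_Z n t ht, inner_mulOp_left (hsym.hasOrder_rb.isBdd_cut_mul n), map_sub,
    ← h.cut_ft hsym n ht, ← h.cut_ft hsym n hτ, ← map_sub, ← inner_mulOp_left (isBdd_cut n)]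

theorem norm_sub_sq_eq (h : IsEnergyCurve l b g s T u P Y D Z) (hsym : IsSymbolPair l b ρ r) {t τ : ℝ}
    (ht : t ∈ timeInterval T) (hτ : τ ∈ timeInterval T) :
    ‖u τ - u t‖ ^ 2 = inner ℝ (P τ - P t) (mulOp (ka l b) (Y τ - Y t)) := by
  rw [← norm_ft, ← real_inner_self_eq_norm_sq, ft_sub]
  have hth := hsym.isBdd_th
  refine tendsto_nhds_unique (tendsto_inner_cut _ _) ?_
  refine (tendsto_inner_cut (P τ - P t) (mulOp (ka l b) (Y τ - Y t))).congr fun n => ?_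
  have hrb := hsym.hasOrder_rb.isBdd_cut_mul n
  conv_rhs => rw [map_sub, h.cut_ft hsym n ht, h.cut_ft hsym n hτ, ← map_sub, h.ft_eq t ht,
    h.ft_eq τ hτ, ← map_sub, inner_mulOp_left hrb]
  rw [inner_mulOp_left (isBdd_cut n)]
  congr 1
  refine mulOp_mulOp_congr (isBdd_cut n) hsym.isBdd_ka hrb hth (fun ξ => ?_) _
  rw [← hsym.rb_mul_th]
  ring

/-- The potential energy changes at the rate `⟨Z, D⟩`. Since `u` need not be differentiable in `L²`,
this combines the differentiability of `P` with the continuity of `Y`. -/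
theorem hasDerivWithinAt_potential (h : IsEnergyCurve l b g s T u P Y D Z)
    (hsym : IsSymbolPair l b ρ r) (hn : IsNonlinearity g s) {t : ℝ} (ht : t ∈ timeInterval T) :
    HasDerivWithinAt (fun t => ∫ x, primitive g (u t x)) (inner ℝ (D t) (Z t)) (timeInterval T) t := by
  obtain ⟨t', ht', htt'⟩ := exists_gt_mem_timeInterval ht
  obtain ⟨M, hM⟩ := h.bounded t' ht'
  obtain ⟨R, K, hR, hK, hlip, hsup⟩ := exists_sup_lipschitz hn.reg hn.contDiff_one M
  obtain ⟨κ, hκ⟩ := hsym.isBdd_ka.2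
  have hP := (h.deriv_P t ht)
  have hI := Icc_mem_nhdsWithin (T := T) htt'
  rw [hasDerivWithinAt_iff_isLittleO]
  have h1 : (fun τ => inner ℝ (Z t) (P τ - P t) - (τ - t) • inner ℝ (D t) (Z t))
      =o[𝓝[timeInterval T] t] fun τ => τ - t := by
    have h2 := hasDerivWithinAt_iff_isLittleO.1
      ((innerSL ℝ (Z t)).hasFDerivAt.comp_hasDerivWithinAt t hP)
    refine h2.congr (fun τ => ?_) (fun τ => rfl)
    simp only [Function.comp, innerSL_apply_apply, inner_sub_right, real_inner_comm (Z t) (D t)]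
  have h3 : (fun τ => ‖u τ - u t‖ ^ 2) =o[𝓝[timeInterval T] t] fun τ => τ - t := by
    have hPO : (fun τ => P τ - P t) =O[𝓝[timeInterval T] t] fun τ => τ - t :=
      hP.hasFDerivWithinAt.isBigO_sub
    have hYo : (fun τ => Y τ - Y t) =o[𝓝[timeInterval T] t] fun _ => (1 : ℝ) := by
      rw [Asymptotics.isLittleO_one_iff]
      exact tendsto_sub_nhds_zero_iff.2 (h.continuousOn_Y t ht)
    have h4 := hPO.norm_left.mul_isLittleO hYo.norm_left
    simp only [mul_one] at h4
    refine Asymptotics.IsBigO.trans_isLittleO (Asymptotics.IsBigO.of_bound κ ?_) h4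
    filter_upwards [self_mem_nhdsWithin] with τ hτ
    rw [h.norm_sub_sq_eq hsym ht hτ]
    refine (abs_real_inner_le_norm _ _).trans ?_
    rw [norm_mul, norm_norm, norm_norm]
    calc _ ≤ ‖P τ - P t‖ * (κ * ‖Y τ - Y t‖) :=
          mul_le_mul_of_nonneg_left (norm_mulOp_apply_le hsym.isBdd_ka.1 hκ _) (norm_nonneg _)
      _ = _ := by ring
  refine ((Asymptotics.IsBigO.of_bound K ?_).trans_isLittleO h3).add h1 |>.congr_left
    (f₁ := fun τ => ((∫ x, primitive g (u τ x)) - (∫ x, primitive g (u t x)) -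
      inner ℝ (Z t) (P τ - P t)) + (inner ℝ (Z t) (P τ - P t) - (τ - t) • inner ℝ (D t) (Z t)))
    fun τ => by ring
  filter_upwards [self_mem_nhdsWithin, hI] with τ hτ hτI
  rw [← h.inner_nem_sub hsym ht hτ, norm_pow, norm_norm]
  exact abs_integral_primitive_sub_le hn.contDiff_one.continuous hn.zero hR hlip hK
    (hsup _ (hM t ⟨ht.1, htt'.le⟩)) (hsup _ (hM τ hτI))

/-- Conservation of energy. -/
theorem energy_eq (h : IsEnergyCurve l b g s T u P Y D Z) (hsym : IsSymbolPair l b ρ r)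
    (hn : IsNonlinearity g s) {t : ℝ} (ht : t ∈ timeInterval T) :
    ‖Y t‖ ^ 2 + ‖D t‖ ^ 2 + 2 * ∫ x, primitive g (u t x) =
      ‖Y 0‖ ^ 2 + ‖D 0‖ ^ 2 + 2 * ∫ x, primitive g (u 0 x) := by
  have hsub := Icc_subset_timeInterval ht
  obtain ⟨h1, h2⟩ := h.integral_inner_Z hsym hn ht
  have hd := fun τ (hτ : τ ∈ Set.Icc 0 t) =>
    ((h.hasDerivWithinAt_potential hsym hn (hsub hτ)).mono hsub).const_mul (-2)
  have h3 := intervalIntegral.integral_eq_sub_of_hasDerivAt_of_le ht.1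
    (fun τ hτ => (hd τ hτ).continuousWithinAt)
    (fun τ hτ => (hd τ (Set.Ioo_subset_Icc_self hτ)).hasDerivAt (Icc_mem_nhds hτ.1 hτ.2)) h1
  rw [h2] at h3
  linarith

/-- The derivative of `⟨P, D⟩`. -/
theorem hasDerivWithinAt_inner (h : IsEnergyCurve l b g s T u P Y D Z)
    (hsym : IsSymbolPair l b ρ r) (hn : IsNonlinearity g s) {t : ℝ} (ht : t ∈ timeInterval T) :
    HasDerivWithinAt (fun t => inner ℝ (P t) (D t))
      (‖D t‖ ^ 2 - ‖Y t‖ ^ 2 - inner ℝ (ft (u t)) (ft (nem g (u t)))) (timeInterval T) t := by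
  refine hasDerivWithinAt_timeInterval (f := fun t => ‖D t‖ ^ 2 - ‖Y t‖ ^ 2 -
    inner ℝ (ft (u t)) (ft (nem g (u t)))) ?_ (fun t ht => ?_) ht
  · exact ((h.continuousOn_D.norm.pow 2).sub (h.continuousOn_Y.norm.pow 2)).sub
      ((continuous_ft.comp_continuousOn h.continuousOn_u).inner (𝕜 := ℝ) (h.continuousOn_N hn))
  · rw [h.integral_virial hsym hn ht]
    ring

/-- The convexity hypothesis on the nonlinearity, integrated in space. -/
theorem inner_nem_le (h : IsEnergyCurve l b g s T u P Y D Z) (hn : IsNonlinearity g s) {ν : ℝ}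
    (hν : ∀ p : ℝ, p * g p ≤ 2 * (1 + 2 * ν) * primitive g p) {t : ℝ} (ht : t ∈ timeInterval T) :
    inner ℝ (ft (u t)) (ft (nem g (u t))) ≤ 2 * (1 + 2 * ν) * ∫ x, primitive g (u t x) := by
  obtain ⟨M, hM⟩ := h.bounded t ht
  obtain ⟨R, K, hR, hK, hlip, hsup⟩ := exists_sup_lipschitz hn.reg hn.contDiff_one M
  have hc := hn.contDiff_one.continuous
  have hu := hsup _ (hM t (Set.right_mem_Icc.2 ht.1))
  rw [inner_ft, MeasureTheory.L2.inner_def, ← integral_const_mul]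
  refine integral_mono_ae (MeasureTheory.L2.integrable_inner _ _)
    ((integrable_primitive hc hn.zero hR hlip hK hu).const_mul _) ?_
  filter_upwards [nem_ae hc hn.zero hlip hu] with x hx
  rw [hx]
  refine le_trans (le_of_eq ?_) (hν (u t x))
  simp [mul_comm]

end IsEnergyCurve

end

/-! ### Levine's concavity argument -/

/-- A function `y ≥ 0` on `[0, ∞)` whose second derivative dominates `(1 + ν) y'² / y` and stays
positive cannot exist: `y / y'` would be positive and decrease at a rate of at least `ν`. -/
theorem false_of_concavity {y z k d : ℝ → ℝ} {ν c : ℝ} (hν : 0 < ν) (hc : 0 < c)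
    (hy : ∀ t, 0 < t → HasDerivAt y (2 * z t) t) (hz : ∀ t, 0 < t → HasDerivAt z (k t) t)
    (hk : ∀ t, 0 < t → 2 * (1 + ν) * d t + c ≤ k t) (hy0 : ∀ t, 0 < t → 0 ≤ y t)
    (hd0 : ∀ t, 0 < t → 0 ≤ d t) (hzd : ∀ t, 0 < t → z t ^ 2 ≤ y t * d t) : False := by
  -- `z` grows at least linearly, so it is positive from some time `t₁` on
  have hmono : MonotoneOn (fun t => z t - c * t) (Set.Ici 1) := by
    have hd : ∀ t, 0 < t → HasDerivAt (fun t => z t - c * t) (k t - c * 1) t := fun t ht =>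
      (hz t ht).sub ((hasDerivAt_id t).const_mul c)
    refine monotoneOn_of_hasDerivWithinAt_nonneg (convex_Ici 1) (f' := fun t => k t - c * 1)
      (fun t ht => (hd t (by linarith [Set.mem_Ici.1 ht])).continuousAt.continuousWithinAt)
      (fun t ht => ?_) (fun t ht => ?_)
    · rw [interior_Ici, Set.mem_Ioi] at ht
      exact (hd t (by linarith)).hasDerivWithinAt
    · rw [interior_Ici, Set.mem_Ioi] at ht
      have h1 := hk t (by linarith)
      have h2 := hd0 t (by linarith)
      nlinarith [mul_nonneg hν.le h2]
  obtain ⟨t₁, ht₁, hpos⟩ : ∃ t₁, 1 ≤ t₁ ∧ ∀ t, t₁ ≤ t → 0 < z t := by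
    refine ⟨max 1 (1 + (1 - z 1) / c), le_max_left _ _, fun t ht => ?_⟩
    have h1 : 1 ≤ t := (le_max_left _ _).trans ht
    have h2 : (1 - z 1) / c ≤ t - 1 := by linarith [(le_max_right _ _).trans ht]
    rw [div_le_iff₀ hc] at h2
    have h3 := hmono Set.self_mem_Ici h1 h1
    simp only at h3
    linarith
  have hypos : ∀ t, t₁ ≤ t → 0 < y t := by
    intro t ht
    have h0 : 0 < t := by linarith
    have h1 := hzd t h0
    have h2 := pow_pos (hpos t ht) 2
    rcases (hy0 t h0).eq_or_lt with h | h
    · rw [← h, zero_mul] at h1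
      linarith
    · exact h
  have hd : ∀ t, t₁ ≤ t → HasDerivAt (fun t => y t / z t + 2 * ν * t)
      ((2 * z t * z t - y t * k t) / z t ^ 2 + 2 * ν * 1) t := fun t ht =>
    ((hy t (by linarith)).div (hz t (by linarith)) (hpos t ht).ne').add
      ((hasDerivAt_id t).const_mul (2 * ν))
  have hanti : AntitoneOn (fun t => y t / z t + 2 * ν * t) (Set.Ici t₁) := by
    refine antitoneOn_of_hasDerivWithinAt_nonpos (convex_Ici t₁)
      (f' := fun t => (2 * z t * z t - y t * k t) / z t ^ 2 + 2 * ν * 1)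
      (fun t ht => (hd t ht).continuousAt.continuousWithinAt)
      (fun t ht => ?_) (fun t ht => ?_)
    · rw [interior_Ici, Set.mem_Ioi] at ht
      exact (hd t ht.le).hasDerivWithinAt
    · rw [interior_Ici, Set.mem_Ioi] at ht
      have h0 : 0 < t := by linarith
      have hz2 := pow_pos (hpos t ht.le) 2
      rw [div_add' _ _ _ hz2.ne']
      refine div_nonpos_of_nonpos_of_nonneg ?_ hz2.le
      have h1 := mul_le_mul_of_nonneg_left (hk t h0) (hypos t ht.le).le
      have h2 := mul_le_mul_of_nonneg_left (hzd t h0) hν.le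
      have h3 := hzd t h0
      have h4 := mul_pos (hypos t ht.le) hc
      nlinarith
  set w := y t₁ / z t₁ with hw
  have hw0 : 0 < w := div_pos (hypos t₁ le_rfl) (hpos t₁ le_rfl)
  have h1 : t₁ ≤ t₁ + w / ν := by
    have := div_pos hw0 hν
    linarith
  have h2 := hanti Set.self_mem_Ici h1 h1
  have h3 := div_pos (hypos _ h1) (hpos _ h1)
  have h4 : 2 * ν * (t₁ + w / ν) = 2 * ν * t₁ + 2 * w := by
    field_simp
  simp only at h2
  rw [h4] at h2
  linarith

section

variable {l b g : ℝ → ℝ} {ρ r s : ℝ} {u : ℝ → L2} {P Y D Z : ℝ → L2C}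

/-- There are no global solutions of negative energy. -/
theorem IsEnergyCurve.false_of_neg (h : IsEnergyCurve l b g s ⊤ u P Y D Z)
    (hsym : IsSymbolPair l b ρ r) (hn : IsNonlinearity g s) {ν : ℝ} (hν0 : 0 < ν)
    (hν : ∀ p : ℝ, p * g p ≤ 2 * (1 + 2 * ν) * primitive g p)
    (hE : ‖Y 0‖ ^ 2 + ‖D 0‖ ^ 2 + 2 * ∫ x, primitive g (u 0 x) < 0) : False := by
  have hI : ∀ t : ℝ, 0 < t → t ∈ timeInterval ⊤ := fun t ht => ⟨ht.le, EReal.coe_lt_top t⟩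
  have hnh : ∀ t : ℝ, 0 < t → timeInterval ⊤ ∈ 𝓝 t := fun t ht =>
    mem_of_superset (Ioi_mem_nhds ht) fun τ hτ => hI τ hτ
  set E := ‖Y 0‖ ^ 2 + ‖D 0‖ ^ 2 + 2 * ∫ x, primitive g (u 0 x) with hE'
  refine false_of_concavity (y := fun t => ‖P t‖ ^ 2) (z := fun t => inner ℝ (P t) (D t))
    (k := fun t => ‖D t‖ ^ 2 - ‖Y t‖ ^ 2 - inner ℝ (ft (u t)) (ft (nem g (u t))))
    (d := fun t => ‖D t‖ ^ 2) (c := -((1 + 2 * ν) * E)) hν0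
    (by nlinarith) (fun t ht => ?_) (fun t ht => ?_) (fun t ht => ?_) (fun t _ => by positivity)
    (fun t _ => by positivity) (fun t ht => ?_)
  · exact (h.deriv_P t (hI t ht)).norm_sq.hasDerivAt (hnh t ht)
  · exact (h.hasDerivWithinAt_inner hsym hn (hI t ht)).hasDerivAt (hnh t ht)
  · have h1 := h.energy_eq hsym hn (hI t ht)
    have h2 := h.inner_nem_le hn hν (hI t ht)
    rw [← hE'] at h1
    have h3 : 2 * (1 + 2 * ν) * ∫ x, primitive g (u t x) =
        (1 + 2 * ν) * (E - ‖Y t‖ ^ 2 - ‖D t‖ ^ 2) := by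
      rw [← h1]
      ring
    rw [h3] at h2
    nlinarith [mul_nonneg hν0.le (sq_nonneg ‖Y t‖)]
  · rw [← mul_pow]
    exact sq_le_sq' (by linarith [neg_abs_le (inner ℝ (P t) (D t)), abs_real_inner_le_norm (P t) (D t)])
      (real_inner_le_norm _ _)

end

/-! ### Initial data, and the two halves of the blow-up alternative -/

/-- The convexity hypothesis forces `g` to vanish at `0`, where `2 (1 + 2 ν) G(p) - p g(p)` has a
minimum. -/
theorem eq_zero_of_le_primitive {g : ℝ → ℝ} (hg : ContDiff ℝ 1 g) {ν : ℝ} (hν0 : 0 < ν)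
    (hν : ∀ p : ℝ, p * g p ≤ 2 * (1 + 2 * ν) * primitive g p) : g 0 = 0 := by
  have h1 : HasDerivAt (primitive g) (g 0) 0 :=
    intervalIntegral.integral_hasDerivAt_right (hg.continuous.intervalIntegrable _ _)
      (hg.continuous.stronglyMeasurableAtFilter _ _) hg.continuous.continuousAt
  have h2 := (hasDerivAt_id (0 : ℝ)).mul (hg.differentiable one_ne_zero 0).hasDerivAt
  have h3 := (h1.const_mul (2 * (1 + 2 * ν))).sub h2
  have h4 : IsLocalMin (fun p => 2 * (1 + 2 * ν) * primitive g p - id p * g p) 0 :=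
    Eventually.of_forall fun p => by
      have := hν p
      simp only [primitive, intervalIntegral.integral_same, mul_zero, id, zero_mul, sub_zero]
      exact sub_nonneg.2 this
  have h5 := h4.hasDerivAt_eq_zero h3
  simp only [id, one_mul, zero_mul, add_zero] at h5
  have h6 : (1 + 4 * ν) * g 0 = 0 := by linarith
  exact (mul_eq_zero.1 h6).resolve_left (by positivity)

section

variable {l b g : ℝ → ℝ} {ρ r s : ℝ} {T : EReal} {φ : L2} {ψ : 𝓢'(ℝ, ℂ)} {u : ℝ → L2}
  {v : ℝ → 𝓢'(ℝ, ℂ)}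

theorem IsMultiplierImage.fourier_ae {m : ℝ → ℝ} {R : 𝓢'(ℝ, ℂ)} {S : L2C} {f : ℝ → ℂ}
    (h : IsMultiplierImage m R S) (hf : IsFunction (𝓕 R) f) :
    (𝓕 S : L2C) =ᵐ[volume] fun ξ => (m (2 * Real.pi * ξ) : ℂ) * f ξ := by
  obtain ⟨f', h1, h2⟩ := h
  filter_upwards [(isFunction_fourier_coe S).ae_eq h2, h1.ae_eq hf] with ξ e1 e2
  rw [e1, e2]

theorem isFunction_fourier_toDist (φ : L2) : IsFunction (𝓕 (toDist φ)) (ft φ) :=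
  isFunction_fourier_coe (cplx φ)

theorem ae_ne_zero : ∀ᵐ ξ : ℝ ∂(volume : Measure ℝ), ξ ≠ 0 :=
  compl_mem_ae_iff.2 (measure_singleton 0)

namespace IsSymbolPair

theorem th_mul_symbolBK (h : IsSymbolPair l b ρ r) (ξ : ℝ) :
    th l b ξ * symbolBK l b (2 * Real.pi * ξ) = 1 := by
  have h1 : √(l (2 * Real.pi * ξ)) ≠ 0 := (Real.sqrt_pos.2 (h.l_pos _)).ne'
  have h2 : √(b (2 * Real.pi * ξ)) ≠ 0 := (Real.sqrt_pos.2 (h.b_pos _)).ne'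
  unfold th symbolBK
  field_simp

theorem rb_mul_symbolBΛ (h : IsSymbolPair l b ρ r) {ξ : ℝ} (hξ : ξ ≠ 0) :
    rb b ξ * symbolBΛ b (2 * Real.pi * ξ) = 1 := by
  have h1 : |2 * Real.pi * ξ| ≠ 0 := abs_ne_zero.2 (by have := Real.pi_ne_zero; positivity)
  have h2 : √(b (2 * Real.pi * ξ)) ≠ 0 := (Real.sqrt_pos.2 (h.b_pos _)).ne'
  unfold rb symbolBΛ
  field_simp

theorem om_mul_symbolBΛ {ξ : ℝ} (hξ : ξ ≠ 0) :
    om l ξ * symbolBΛ b (2 * Real.pi * ξ) = symbolBK l b (2 * Real.pi * ξ) := by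
  have h1 : |2 * Real.pi * ξ| ≠ 0 := abs_ne_zero.2 (by have := Real.pi_ne_zero; positivity)
  unfold om symbolBΛ symbolBK
  field_simp

end IsSymbolPair

/-- There are no global solutions with initial data of finite, negative energy. -/
theorem IsSolution.false_of_neg (hsym : IsSymbolPair l b ρ r) (hn : IsNonlinearity g s)
    (h : IsSolution l b g ρ s φ ψ ⊤ u v) {BKφ BΛψ BΛφ : L2C}
    (hBKφ : IsMultiplierImage (symbolBK l b) (toDist φ) BKφ)
    (hBΛψ : IsMultiplierImage (symbolBΛ b) ψ BΛψ)
    (hBΛφ : IsMultiplierImage (symbolBΛ b) (toDist φ) BΛφ) {ν : ℝ} (hν0 : 0 < ν)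
    (hν : ∀ p : ℝ, p * g p ≤ 2 * (1 + 2 * ν) * primitive g p)
    (hE : ‖BΛψ‖ ^ 2 + ‖BKφ‖ ^ 2 + 2 * ∫ x, primitive g (φ x) < 0) : False := by
  obtain ⟨U, V, hUV, hv, -⟩ := h.exists_isFourierSolution hsym hn.reg hn.contDiff_one hn.zero
  have h0 := zero_mem_timeInterval h.pos
  have hv0 := hv 0 h0
  rw [h.initial_v] at hv0
  have hU0 := hUV.fourier_u 0 h0
  rw [h.initial_u] at hU0
  have eK := hBKφ.fourier_ae (isFunction_fourier_toDist φ)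
  have eψ := hBΛψ.fourier_ae hv0
  have eφ := hBΛφ.fourier_ae (isFunction_fourier_toDist φ)
  have hρ := hsym.rho
  have hwrb : IsBdd (fun ξ => wt (-(1 + ρ / 2)) ξ * rb b ξ) :=
    ((hasOrder_wt _).mul hsym.hasOrder_rb).isBdd (by linarith)
  have hY₀ : mulOp (wt (-s)) (U 0) = mulOp (th l b) (𝓕 BKφ) := by
    rw [← hU0]
    refine Lp.ext ?_
    filter_upwards [mulOp_ae hsym.isBdd_th (𝓕 BKφ), eK] with ξ e1 e2
    rw [e1, e2, ← mul_assoc, ← Complex.ofReal_mul, hsym.th_mul_symbolBK, Complex.ofReal_one, one_mul]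
  have hD₀ : mulOp (wt (-s)) (V 0) =
      mulOp (fun ξ => wt (-(1 + ρ / 2)) ξ * rb b ξ) (𝓕 BΛψ) := by
    refine Lp.ext ?_
    filter_upwards [mulOp_ae (isBdd_wt (neg_nonpos.2 hn.pos)) (V 0), mulOp_ae hwrb (𝓕 BΛψ), eψ,
      ae_ne_zero] with ξ e1 e2 e3 hξ
    have hw : wt (-s) ξ = wt (-(1 + ρ / 2)) ξ * rb b ξ *
        (symbolBΛ b (2 * Real.pi * ξ) * wt (-(s - (1 + ρ / 2))) ξ) := by
      have : wt (-s) ξ = wt (-(1 + ρ / 2)) ξ * wt (-(s - (1 + ρ / 2))) ξ := by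
        rw [← wt_add]
        congr 1
        ring
      rw [this]
      linear_combination -(wt (-(1 + ρ / 2)) ξ * wt (-(s - (1 + ρ / 2))) ξ) * hsym.rb_mul_symbolBΛ hξ
    rw [e1, e2, e3, hw]
    push_cast
    ring
  have hP₀ : ∀ n, mulOp (cut n) (𝓕 BKφ) = mulOp (fun ξ => cut n ξ * om l ξ) (𝓕 BΛφ) := by
    intro n
    refine Lp.ext ?_
    filter_upwards [mulOp_ae (isBdd_cut n) (𝓕 BKφ),
      mulOp_ae (hsym.hasOrder_om.isBdd_cut_mul n) (𝓕 BΛφ), eK, eφ, ae_ne_zero] with ξ e1 e2 e3 e4 hξ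
    rw [e1, e2, e3, e4, ← IsSymbolPair.om_mul_symbolBΛ hξ]
    push_cast
    ring
  obtain ⟨P, Y, D, hc, -, hY0, hD0⟩ :=
    (hUV.isMild hsym hn).exists_isEnergyCurve hsym hn hY₀ hD₀ hP₀
  refine hc.false_of_neg hsym hn hν0 hν ?_
  rw [hY0, hD0, h.initial_u, Lp.norm_fourier_eq, Lp.norm_fourier_eq]
  linarith

/-- Along a maximal solution with finite existence time the norm is unbounded. -/
theorem IsMaximalSolution.limsup_eq_top (hsym : IsSymbolPair l b ρ r) (hn : IsNonlinearity g s)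
    {T : ℝ} (h : IsMaximalSolution l b g ρ s φ ψ T u v) (w : ℝ → ℝ≥0∞) :
    limsup (fun t : ℝ => sobolevNorm s (toDist (u t)) + w t) (𝓝[<] T) = ⊤ := by
  by_contra hne
  obtain ⟨C, hC1, hC2⟩ := ENNReal.lt_iff_exists_nnreal_btwn.1 (lt_top_iff_ne_top.2 hne)
  have hev := eventually_lt_of_limsup_lt hC1
  obtain ⟨hsol, hmax⟩ := h
  have hT : 0 < T := by exact_mod_cast hsol.pos
  obtain ⟨c, hc, hcT⟩ := (mem_nhdsLT_iff_exists_Ioo_subset' hT).1 hev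
  obtain ⟨U, V, hUV, -, hnorm⟩ :=
    hsol.exists_isFourierSolution hsym hn.reg hn.contDiff_one hn.zero
  have ht₁ : max 0 ((c + T) / 2) ∈ timeInterval (T : EReal) := by
    refine ⟨le_max_left _ _, EReal.coe_lt_coe_iff.2 (max_lt hT ?_)⟩
    linarith [Set.mem_Iio.1 hc]
  -- the limsup bounds the norm near `T`, and continuity bounds it on the remaining compact interval
  obtain ⟨M, hM⟩ := isCompact_Icc.exists_bound_of_continuousOn
    (hUV.continuousOn_U.mono (Icc_subset_timeInterval ht₁))
  obtain ⟨T', u', v', hlt, hsol', heq⟩ := hsol.exists_extension hsym hn (M := max C M.toNNReal)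
    fun t ht => by
      have htT : t < T := EReal.coe_lt_coe_iff.1 ht.2
      rcases lt_or_ge (max 0 ((c + T) / 2)) t with h1 | h1
      · have h2 : c < t := by
          have := (le_max_right 0 ((c + T) / 2)).trans_lt h1
          linarith [Set.mem_Iio.1 hc]
        have h3 : sobolevNorm s (toDist (u t)) + w t < C := hcT ⟨h2, htT⟩
        rw [ENNReal.coe_max]
        exact (le_self_add.trans h3.le).trans (le_max_left _ _)
      · rw [hnorm t ht, ENNReal.coe_max, ← ofReal_norm]
        exact (ENNReal.ofReal_le_ofReal (hM t ⟨ht.1, h1⟩)).trans (le_max_right _ _)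
  exact hmax T' u' v' hlt hsol' heq

end

end BEquation

end

theorem theorem6p5 (l b g : ℝ → ℝ) (ρ r s c₁ c₂ c₃ : ℝ)
    (hρ : 0 ≤ ρ) (hr : 0 ≤ r) (hρr : 1 ≤ ρ / 2 + r) (hs : 1 / 2 < s)
    (hc₁ : 0 < c₁) (hc₂ : 0 < c₂) (hc₃ : 0 < c₃)
    (hl_meas : Measurable l) (hb_meas : Measurable b)
    (hl_even : ∀ ξ, l (-ξ) = l ξ) (hb_even : ∀ ξ, b (-ξ) = b ξ)
    (hl : ∀ ξ, c₁ ^ 2 * (1 + ξ ^ 2) ^ (ρ / 2) ≤ l ξ ∧ l ξ ≤ c₂ ^ 2 * (1 + ξ ^ 2) ^ (ρ / 2))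
    (hb : ∀ ξ, 0 < b ξ ∧ b ξ ≤ c₃ ^ 2 * (1 + ξ ^ 2) ^ (-r / 2))
    (hg : ContDiff ℝ ((⌊s⌋₊ + 1 : ℕ) : WithTop ℕ∞) g)
    (φ : BEquation.L2) (hφ : MemSobolev s 2 (BEquation.toDist φ))
    (ψ : 𝓢'(ℝ, ℂ)) (hψ : MemSobolev (s - 1 - ρ / 2) 2 ψ)
    -- `B^{-1/2} K φ`, `B^{-1/2} Λ^{-1} ψ` and `B^{-1/2} Λ^{-1} φ` belong to `L²`
    (BKφ : BEquation.L2C)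
    (hBKφ : BEquation.IsMultiplierImage (BEquation.symbolBK l b) (BEquation.toDist φ) BKφ)
    (BΛψ : BEquation.L2C)
    (hBΛψ : BEquation.IsMultiplierImage (BEquation.symbolBΛ b) ψ BΛψ)
    (hBΛφ : ∃ BΛφ : BEquation.L2C,
      BEquation.IsMultiplierImage (BEquation.symbolBΛ b) (BEquation.toDist φ) BΛφ)
    (hGφ : Integrable (fun x => BEquation.primitive g (φ x)) volume)
    (hν : ∃ ν : ℝ, 0 < ν ∧ ∀ p : ℝ, p * g p ≤ 2 * (1 + 2 * ν) * BEquation.primitive g p)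
    (hE : ‖BΛψ‖ ^ 2 + ‖BKφ‖ ^ 2 + 2 * ∫ x, BEquation.primitive g (φ x) < 0)
    (T : EReal) (u : ℝ → BEquation.L2) (v : ℝ → 𝓢'(ℝ, ℂ))
    (hu : BEquation.IsMaximalSolution l b g ρ s φ ψ T u v) :
    ∃ Tmax : ℝ, T = (Tmax : EReal) ∧
      limsup (fun t : ℝ => BEquation.sobolevNorm s (BEquation.toDist (u t)) +
        BEquation.sobolevNorm (s - 1 - ρ / 2) (v t)) (𝓝[<] Tmax) = ⊤ := by
  have hsym : BEquation.IsSymbolPair l b ρ r :=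
    ⟨hρ, hρr, hr, hl_meas, hb_meas, hl_even, hb_even, ⟨c₁, hc₁, c₂, hc₂, hl⟩, ⟨c₃, hc₃, hb⟩⟩
  obtain ⟨ν, hν0, hν⟩ := hν
  obtain ⟨BΛφ, hBΛφ⟩ := hBΛφ
  have hg1 : ContDiff ℝ 1 g := hg.of_le (by exact_mod_cast Nat.le_add_left 1 _)
  have hn : BEquation.IsNonlinearity g s :=
    ⟨hs, hg, BEquation.eq_zero_of_le_primitive hg1 hν0 hν⟩
  induction T with
  | bot => exact absurd hu.1.pos (not_lt_bot)
  | top => exact (hu.1.false_of_neg hsym hn hBKφ hBΛψ hBΛφ hν0 hν hE).elim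
  | coe Tmax => exact ⟨Tmax, rfl, hu.limsup_eq_top hsym hn _⟩
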